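/- **Setting.** Let $\mathbb T^3=\mathbb R^3/\mathbb Z^3$; $L^2$ norms are over $\mathbb T^3$, matrices carry the operator norm, $\nabla^j$ denotes the $j$-th spatial derivative (with its norm as a multilinear form). Fix a period $P>0$, a finite set $\Lambda\subset\mathbb Q^3\setminus\{0\}$ and, for $k\in\Lambda$, smooth $P\mathbb Z^3$-periodic functions $\varphi_k$ with mean zero, $k\cdot\nabla\varphi_k=0$, and pairwise disjoint supports. Let $H_k(\xi)$ be the antisymmetric matrix with $H_kv=-(k\times\nabla\varphi_k)\times v$. Write $\langle f\rangle$ for the average in $\xi\in\mathbb R^3/P\mathbb Z^3$. Let $T,\kappa,\delta,\tau,\ell,\gamma>0$, $b>1$, $\lambda\ge 1$ with $\lambda\in P\mathbb N$; let $u:\mathbb T^3\times[0,T]\to\mathbb R^3$ be smooth and divergence free, $D_t=\partial_t+u\cdot\nabla$; let $\sigma:[0,T]\to\mathbb R$, $\eta_i,\tilde\eta_i:\mathbb T^3\times[0,T]\to[0,\infty)$ ($i$ in a finite index set), $\Phi_i:\mathbb T^3\times[0,T]\to\mathbb T^3$ (with $\Phi_i(x,t)-x$ lifting to a $\mathbb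 Z^3$-periodic function) and $a_k\circ\tilde R_i:\mathbb T^3\times[0,T]\to\mathbb R$ be smooth. Set, with $\nabla\Phi_i$ the Jacobian matrix, $$A(x,t,\xi)=\sum_i\tilde\eta_i\nabla\Phi_i^{-1}\Big(\kappa\,\mathrm{Id}+\frac{\eta_i\sigma^{1/2}}{\lambda}\sum_{k\in\Lambda}a_k(\tilde R_i)H_k(\xi)\Big)\nabla\Phi_i^{-T},$$ let $\tilde A(x,t)$ be given by the same formula with $H_k(\xi)$ replaced in the $i$-th summand by $H_k(\lambda\Phi_i(x,t))$, and set $$\chi_i(x,t,\xi)=\frac{\sigma^{1/2}}{\kappa\lambda}\nabla\Phi_i^{-1}\sum_{k\in\Lambda}a_k(\tilde R_i)\varphi_k(\xi)k,\qquad \bar A=\Big\langle A\Big(\mathrm{Id}+\sum_i\eta_i\nabla\Phi_i^T\nabla_\xi\chi_i^T\Big)\Big\rangle,\qquad \bar\kappa=\kappa\Big(1+\sum_i\frac{\sigma\eta_i^2}{\kappa^2\lambda^2}\Big).$$ **Assumptions**, for an integer $N_h\ge3$ and a constant $K\ge1$ (all suprema are over $\mathbb T^3\times[0,T]$ unless a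 smaller set is named): * $\delta^{1/2}\ell\kappa^{-1}\lambda^{-1}\le1$, $\ \tau\|\bar\kappa\|_{L^\infty}\ell^{-2}\le1$, $\ \tau\|\bar\kappa\|_{L^\infty}\lambda^{2/b}\le\lambda^{-2\gamma}$, $\ \kappa^{-1}\tau^{-1}\lambda^{-2}\le\lambda^{-4\gamma}$, $\ \lambda^2\le K(\tau\kappa\lambda^2)^{N_h}$; * $K^{-1}\delta\le\sigma\le K\delta$, $\ |\partial_t\sigma|\le K\sigma\tau^{-1}$; $\ |\nabla^{m}\nabla u|\le K\delta^{1/(2b)}\lambda^{1/b}\ell^{-m}$ for $m\le N_h$; * $\eta_i\eta_j=0$ for $i\ne j$, $\sum_i\tilde\eta_i=1$, $\tilde\eta_i\eta_i=\eta_i$, $\tilde\eta_i\eta_j=0$ for $i\neq j$, at most $K$ of the $\tilde\eta_i$ are nonzero at each point, and $|\nabla^mD_t^n\eta_i|,\ |\nabla^mD_t^n\tilde\eta_i|\le K\tau^{-n}$ for $n\in\{0,1\}$, $m\le N_h$; * on $\{\tilde\eta_i\ne0\}$: $\det\nabla\Phi_i=1$, $D_t\Phi_i=0$, $|\nabla\Phi_i-\mathrm{Id}|\le\lambda^{-2\gamma}$,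 and $|\nabla^mD_t^n\nabla\Phi_i|\le K\tau^{-n}\ell^{-m}$ for $n\in\{0,1\}$, $m\le N_h$; * on $\{\eta_i\ne0\}$: $|\nabla^mD_t^n(a_k\circ\tilde R_i)|\le K\tau^{-n}\ell^{-m}$ for $k\in\Lambda$, $n\in\{0,1\}$, $m\le N_h$; * $\tfrac12\bar\kappa|v|^2\le\bar Av\cdot v\le2\bar\kappa|v|^2$ for all $v\in\mathbb R^3$, and $|D_t\bar\kappa|\le K\tau^{-1}\bar\kappa$. **Claim.** There is a constant $C$, depending only on $N_h$, $K$ and the family $(P,\Lambda,(\varphi_k)_{k\in\Lambda})$, such that the following holds under these assumptions. Let $\rho,\bar\rho$ be smooth on $\mathbb T^3\times[0,T]$ with $$\partial_t\rho+u\cdot\nabla\rho=\operatorname{div}(\tilde A\nabla\rho),\qquad \partial_t\bar\rho+u\cdot\nabla\bar\rho=\operatorname{div}(\bar A\nabla\bar\rho),\qquad \rho|_{t=0}=\bar\rho|_{t=0}=\rho_{in},$$ and define $$\tilde\rho=\rho-\bar\rho-\frac1\lambda\sum_i\eta_i\,\chi_i(x,t,\lambda\Phi_i)\cdot\nabla\bar\rho,\qquad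 \mathcal D_{N_h}=\int_0^T\|\bar\kappa^{1/2}\nabla\bar\rho\|_{L^2}^2\,dt+\sum_{j=1}^{N_h}\tau^j\big\|\bar\kappa(\cdot,0)^{j/2}\nabla^j\rho_{in}\big\|_{L^2}^2 .$$ Then: 1. $\displaystyle\sup_{t\le T}\|\tilde\rho(t)\|_{L^2}^2+\kappa\int_0^T\|\nabla\tilde\rho\|_{L^2}^2\,dt\le\frac{C}{\lambda^2\kappa\tau}\mathcal D_{N_h}$; 2. $\displaystyle\sup_{t\le T}\|\rho(t)-\bar\rho(t)\|_{L^2}^2\le\frac{C}{\lambda^2\kappa\tau}\mathcal D_{N_h}$; 3. $\displaystyle\sup_{t\le T}\big|\|\rho(t)\|_{L^2}^2-\|\bar\rho(t)\|_{L^2}^2\big|\le C\Big(\frac1{\lambda\kappa^{1/2}\tau^{1/2}}+\lambda^{-2\gamma}\Big)\mathcal D_{N_h}$; 4. if moreover $\|\nabla^j\rho_{in}\|_{L^2}^2\le K\lambda^{2j/b}\,\kappa\int_0^T\|\nabla\rho\|_{L^2}^2\,dt$ for $1\le j\le N_h$, then $$\sup_{t\le T}\big|\|\rho(t)\|_{L^2}^2-\|\bar\rho(t)\|_{L^2}^2\big|\le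 C\lambda^{-2\gamma}\min\Big\{\int_0^T\|\bar\kappa^{1/2}\nabla\bar\rho\|_{L^2}^2\,dt,\ \kappa\int_0^T\|\nabla\rho\|_{L^2}^2\,dt\Big\}.$$ -/

import Mathlib

open scoped ContDiff

noncomputable section

namespace MikadoHom

/-- Three-dimensional Euclidean space.  The torus is the quotient of it by the integer lattice, and
functions on the torus are written as periodic functions on it. -/
abbrev E3 : Type := EuclideanSpace ℝ (Fin 3)

/-- Real three-by-three matrices, written as linear maps, with the operator norm. -/
abbrev M3 : Type := E3 →L[ℝ] E3

/-- The coordinate vectors. -/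
def basisVec (j : Fin 3) : E3 := EuclideanSpace.single j 1

/-- Periodicity with period `P` in each of the three coordinates. -/
def Periodic3 {V : Type} (P : ℝ) (f : E3 → V) : Prop :=
  ∀ (x : E3) (j : Fin 3), f (x + P • basisVec j) = f x

/-- Smooth functions of time and space (a smooth function on a closed time interval is represented
by a smooth extension of it to all times). -/
def SmoothTX {V : Type} [NormedAddCommGroup V] [NormedSpace ℝ V] (f : ℝ → E3 → V) : Prop :=
  ContDiff ℝ ∞ (fun p : ℝ × E3 => f p.1 p.2)

/-- Smooth functions of time and of a point of the unit torus. -/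
def TorusField {V : Type} [NormedAddCommGroup V] [NormedSpace ℝ V] (f : ℝ → E3 → V) : Prop :=
  SmoothTX f ∧ ∀ t, Periodic3 1 (f t)

/-- The half-open cube of side `P`, a fundamental domain of the torus of period `P`. -/
def cube (P : ℝ) : Set E3 := {x | ∀ j, x j ∈ Set.Ico 0 P}

/-- The square of the `L²` norm over the unit torus. -/
def l2sq {V : Type} [NormedAddCommGroup V] (f : E3 → V) : ℝ :=
  ∫ x in cube 1, ‖f x‖ ^ 2

/-- The advective derivative `∂ₜ f + (u · ∇) f`. -/
def matDeriv {V : Type} [NormedAddCommGroup V] [NormedSpace ℝ V]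
    (u : ℝ → E3 → E3) (f : ℝ → E3 → V) (t : ℝ) (x : E3) : V :=
  deriv (fun s => f s x) t + fderiv ℝ (f t) x (u t x)

/-- The divergence of a vector field. -/
def divergence (v : E3 → E3) (x : E3) : ℝ :=
  ∑ j, (fderiv ℝ v x (basisVec j)) j

/-- The vector product. -/
def cross (v w : E3) : E3 :=
  WithLp.toLp 2 (crossProduct (WithLp.ofLp v) (WithLp.ofLp w))

/-- The linear map `v ↦ w × v`. -/
def crossMap (w : E3) : M3 :=
  LinearMap.toContinuousLinearMap
    { toFun := fun v => cross w v
      map_add' := fun a b => by simp [cross]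
      map_smul' := fun c a => by simp [cross] }

/-- The transposed matrix. -/
def transp (A : M3) : M3 := ContinuousLinearMap.adjoint A

/-- `ρ` is a smooth solution on the torus, for times in `[0, T]`, of
`∂ₜ ρ + u · ∇ρ = div (A ∇ρ)` with `ρ(0) = ρin`. -/
structure IsSolution (T : ℝ) (u : ℝ → E3 → E3) (A : ℝ → E3 → M3) (ρin : E3 → ℝ)
    (ρ : ℝ → E3 → ℝ) : Prop where
  field : TorusField ρ
  init : ρ 0 = ρin
  eqn : ∀ t ∈ Set.Icc 0 T, ∀ x,
    matDeriv u ρ t x = divergence (fun y => A t y (gradient (ρ t) y)) x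

/-- The Mikado building blocks: a finite set `Λ` of nonzero rational vectors and, for each of them,
a smooth periodic zero-mean function `φ k` of the cell variable that is constant in the direction
`k`, these functions having pairwise disjoint supports.  `P` is the period of the cell torus. -/
structure Mikado where
  P : ℝ
  P_pos : 0 < P
  Λ : Finset E3
  φ : E3 → E3 → ℝ
  ne_zero : ∀ k ∈ Λ, k ≠ 0
  rational : ∀ k ∈ Λ, ∀ j, ∃ q : ℚ, k j = (q : ℝ)
  smooth : ∀ k ∈ Λ, ContDiff ℝ ∞ (φ k)
  periodic : ∀ k ∈ Λ, Periodic3 P (φ k)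
  invariant : ∀ k ∈ Λ, ∀ ξ, inner ℝ k (gradient (φ k) ξ) = 0
  disjoint_supp : ∀ k ∈ Λ, ∀ k' ∈ Λ, k ≠ k' → Disjoint (tsupport (φ k)) (tsupport (φ k'))
  mean_zero : ∀ k ∈ Λ, ∫ ξ in cube P, φ k ξ = 0

/-- `U_k = k × ∇φ_k`. -/
def Mikado.U (M : Mikado) (k ξ : E3) : E3 := cross k (gradient (M.φ k) ξ)

/-- The antisymmetric matrix `H_k` with `H_k v = - U_k × v`. -/
def Mikado.H (M : Mikado) (k ξ : E3) : M3 := -crossMap (M.U k ξ)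

/-- The parameters and functions that enter the equations, with `n` cutoffs.  The deformations
`Phi i` are lifts to Euclidean space of maps of the torus. -/
structure Data (n : ℕ) where
  T : ℝ
  kappa : ℝ
  lam : ℝ
  delta : ℝ
  tau : ℝ
  ell : ℝ
  b : ℝ
  gamma : ℝ
  u : ℝ → E3 → E3
  sigma : ℝ → ℝ
  eta : Fin n → ℝ → E3 → ℝ
  etat : Fin n → ℝ → E3 → ℝ
  Phi : Fin n → ℝ → E3 → E3
  a : E3 → Matrix (Fin 3) (Fin 3) ℝ → ℝ
  R : Fin n → ℝ → E3 → Matrix (Fin 3) (Fin 3) ℝ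

namespace Data

variable {n : ℕ} (d : Data n) (M : Mikado)

/-- The Jacobian matrix `∇Φ_i`, with entries `∂_l (Φ_i)_j`. -/
def gradPhi (i : Fin n) (t : ℝ) (x : E3) : M3 := fderiv ℝ (d.Phi i t) x

/-- The inverse matrix `∇Φ_i⁻¹`. -/
def invGradPhi (i : Fin n) (t : ℝ) (x : E3) : M3 := (d.gradPhi i t x).inverse

/-- `∇Φ_i⁻¹ (κ Id + (η_i σ^{1/2} / λ) ∑_k a_k(R_i) H_k(ξ)) ∇Φ_i⁻ᵀ`. -/
def block (i : Fin n) (t : ℝ) (x ξ : E3) : M3 :=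
  d.invGradPhi i t x ∘L
    (d.kappa • ContinuousLinearMap.id ℝ E3 +
      (d.eta i t x * Real.sqrt (d.sigma t) / d.lam) • ∑ k ∈ M.Λ, d.a k (d.R i t x) • M.H k ξ) ∘L
    transp (d.invGradPhi i t x)

/-- The matrix `A(x, t, ξ)` in the cell variable. -/
def cellA (t : ℝ) (x ξ : E3) : M3 := ∑ i, d.etat i t x • d.block M i t x ξ

/-- The oscillating matrix `Ã(x, t)`. -/
def Atilde (t : ℝ) (x : E3) : M3 :=
  ∑ i, d.etat i t x • d.block M i t x (d.lam • d.Phi i t x)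

/-- The corrector `χ_i(x, t, ξ)`. -/
def chi (i : Fin n) (t : ℝ) (x ξ : E3) : E3 :=
  (Real.sqrt (d.sigma t) / (d.kappa * d.lam)) •
    d.invGradPhi i t x (∑ k ∈ M.Λ, (d.a k (d.R i t x) * M.φ k ξ) • k)

/-- The homogenized matrix: the average over the cell of
`A(x, t, ξ) (Id + ∑_i η_i ∇Φ_iᵀ ∇_ξ χ_iᵀ)`. -/
def Abar (t : ℝ) (x : E3) : M3 :=
  (M.P ^ 3)⁻¹ • ∫ ξ in cube M.P,
    d.cellA M t x ξ ∘L
      (ContinuousLinearMap.id ℝ E3 +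
        ∑ i, d.eta i t x •
          (transp (d.gradPhi i t x) ∘L transp (fderiv ℝ (fun ζ => d.chi M i t x ζ) ξ)))

/-- The scalar effective diffusivity `κ̄ = κ (1 + ∑_i σ η_i² / (κ² λ²))`. -/
def kbar (t : ℝ) (x : E3) : ℝ :=
  d.kappa * (1 + ∑ i, d.sigma t * d.eta i t x ^ 2 / (d.kappa ^ 2 * d.lam ^ 2))

/-- The error of the two-scale expansion. -/
def rhoTilde (ρ ρbar : ℝ → E3 → ℝ) (t : ℝ) (x : E3) : ℝ :=
  ρ t x - ρbar t x -
    1 / d.lam * ∑ i, d.eta i t x *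
      inner ℝ (d.chi M i t x (d.lam • d.Phi i t x)) (gradient (ρbar t) x)

/-- `κ ∫₀ᵀ ‖∇f‖²`. -/
def dissip (f : ℝ → E3 → ℝ) : ℝ :=
  d.kappa * ∫ t in (0 : ℝ)..d.T, l2sq (gradient (f t))

/-- `∫₀ᵀ ‖κ̄^{1/2} ∇f‖²`. -/
def wdissip (f : ℝ → E3 → ℝ) : ℝ :=
  ∫ t in (0 : ℝ)..d.T, ∫ x in cube 1, d.kbar t x * ‖gradient (f t) x‖ ^ 2

/-- `𝒟_l = ∫₀ᵀ ‖κ̄^{1/2} ∇ρ̄‖² + ∑_{j = 1}^l τ^j ‖(κ̄^{j/2} ∇^j ρ)_in‖²`. -/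
def D (ρin : E3 → ℝ) (ρbar : ℝ → E3 → ℝ) (l : ℕ) : ℝ :=
  d.wdissip ρbar +
    ∑ j ∈ Finset.Icc 1 l,
      d.tau ^ j * ∫ x in cube 1, d.kbar 0 x ^ j * ‖iteratedFDeriv ℝ j ρin x‖ ^ 2

/-- The bounds `|∇^m f| ≤ K r^{-m}` and `|∇^m D_t f| ≤ K τ⁻¹ r^{-m}` for all `m ≤ N`, at all points
`(x, t)` with `t ∈ [0, T]` and `w(x, t) ≠ 0`. -/
def SlowOn {V : Type} [NormedAddCommGroup V] [NormedSpace ℝ V] (N : ℕ) (K r : ℝ)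
    (w : ℝ → E3 → ℝ) (f : ℝ → E3 → V) : Prop :=
  ∀ m ≤ N, ∀ t ∈ Set.Icc 0 d.T, ∀ x, w t x ≠ 0 →
    ‖iteratedFDeriv ℝ m (f t) x‖ ≤ K * r⁻¹ ^ m ∧
    ‖iteratedFDeriv ℝ m (matDeriv d.u f t) x‖ ≤ K * d.tau⁻¹ * r⁻¹ ^ m

/-- The assumptions for homogenization; `K` is the implicit constant in all of them. -/
structure Assumptions (N : ℕ) (K : ℝ) : Prop where
  T_pos : 0 < d.T
  kappa_pos : 0 < d.kappa
  delta_pos : 0 < d.delta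
  tau_pos : 0 < d.tau
  ell_pos : 0 < d.ell
  one_le_lam : 1 ≤ d.lam
  one_lt_b : 1 < d.b
  gamma_pos : 0 < d.gamma
  -- `x ↦ λ x` maps the unit torus to the cell torus
  lam_mul : ∃ q : ℕ, d.lam = M.P * q
  -- relations between the scales
  delta_ell : d.delta ^ (1 / 2 : ℝ) * d.ell * d.kappa⁻¹ * d.lam⁻¹ ≤ 1
  tau_kbar_ell : ∀ t ∈ Set.Icc 0 d.T, ∀ x, d.tau * d.kbar t x * d.ell⁻¹ ^ 2 ≤ 1
  tau_kbar_lam : ∀ t ∈ Set.Icc 0 d.T, ∀ x,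
    d.tau * d.kbar t x * d.lam ^ (2 / d.b) ≤ d.lam ^ (-(2 * d.gamma))
  kappa_tau_lam : d.kappa⁻¹ * d.tau⁻¹ * d.lam⁻¹ ^ 2 ≤ d.lam ^ (-(4 * d.gamma))
  order : d.lam ^ 2 ≤ K * (d.tau * d.kappa * d.lam ^ 2) ^ N
  -- the velocity
  u_field : TorusField d.u
  u_div : ∀ t ∈ Set.Icc 0 d.T, ∀ x, divergence (d.u t) x = 0
  u_bound : ∀ m ≤ N, ∀ t ∈ Set.Icc 0 d.T, ∀ x,
    ‖iteratedFDeriv ℝ m (fderiv ℝ (d.u t)) x‖ ≤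
      K * d.delta ^ (1 / (2 * d.b)) * d.lam ^ (1 / d.b) * d.ell⁻¹ ^ m
  -- the amplitude `σ ∼ δ`
  sigma_smooth : ContDiff ℝ ∞ d.sigma
  sigma_delta : ∀ t ∈ Set.Icc 0 d.T, K⁻¹ * d.delta ≤ d.sigma t ∧ d.sigma t ≤ K * d.delta
  sigma_deriv : ∀ t ∈ Set.Icc 0 d.T, |deriv d.sigma t| ≤ K * d.sigma t * d.tau⁻¹
  -- the cutoffs `η_i` and the partition of unity `η̃_i`
  eta_field : ∀ i, TorusField (d.eta i)
  etat_field : ∀ i, TorusField (d.etat i)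
  eta_nonneg : ∀ i, ∀ t ∈ Set.Icc 0 d.T, ∀ x, 0 ≤ d.eta i t x
  etat_nonneg : ∀ i, ∀ t ∈ Set.Icc 0 d.T, ∀ x, 0 ≤ d.etat i t x
  eta_disjoint : ∀ i j, i ≠ j → ∀ t ∈ Set.Icc 0 d.T, ∀ x, d.eta i t x * d.eta j t x = 0
  etat_sum : ∀ t ∈ Set.Icc 0 d.T, ∀ x, ∑ i, d.etat i t x = 1
  etat_eta : ∀ i, ∀ t ∈ Set.Icc 0 d.T, ∀ x, d.etat i t x * d.eta i t x = d.eta i t x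
  etat_eta_ne : ∀ i j, i ≠ j → ∀ t ∈ Set.Icc 0 d.T, ∀ x, d.etat i t x * d.eta j t x = 0
  overlap : ∀ t ∈ Set.Icc 0 d.T, ∀ x, (Set.ncard {i | d.etat i t x ≠ 0} : ℝ) ≤ K
  eta_bound : ∀ i, d.SlowOn N K 1 (fun _ _ => 1) (d.eta i)
  etat_bound : ∀ i, d.SlowOn N K 1 (fun _ _ => 1) (d.etat i)
  -- the volume-preserving deformations `Φ_i`, transported by `u`
  Phi_smooth : ∀ i, SmoothTX (d.Phi i)
  Phi_torus : ∀ i t, Periodic3 1 (fun x => d.Phi i t x - x)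
  Phi_det : ∀ i, ∀ t ∈ Set.Icc 0 d.T, ∀ x, d.etat i t x ≠ 0 → (d.gradPhi i t x).det = 1
  Phi_transport : ∀ i, ∀ t ∈ Set.Icc 0 d.T, ∀ x, d.etat i t x ≠ 0 →
    matDeriv d.u (d.Phi i) t x = 0
  Phi_near_id : ∀ i, ∀ t ∈ Set.Icc 0 d.T, ∀ x, d.etat i t x ≠ 0 →
    ‖d.gradPhi i t x - ContinuousLinearMap.id ℝ E3‖ ≤ d.lam ^ (-(2 * d.gamma))
  Phi_bound : ∀ i, d.SlowOn N K d.ell (d.etat i) (d.gradPhi i)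
  -- the coefficients `a_k ∘ R_i`
  aR_field : ∀ k ∈ M.Λ, ∀ i, TorusField (fun t x => d.a k (d.R i t x))
  aR_bound : ∀ k ∈ M.Λ, ∀ i, d.SlowOn N K d.ell (d.eta i) (fun t x => d.a k (d.R i t x))
  -- the effective diffusivity
  Abar_ellipt : ∀ t ∈ Set.Icc 0 d.T, ∀ x v : E3,
    1 / 2 * d.kbar t x * ‖v‖ ^ 2 ≤ inner ℝ (d.Abar M t x v) v ∧
    inner ℝ (d.Abar M t x v) v ≤ 2 * d.kbar t x * ‖v‖ ^ 2
  kbar_transport : ∀ t ∈ Set.Icc 0 d.T, ∀ x,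
    |matDeriv d.u d.kbar t x| ≤ K * d.tau⁻¹ * d.kbar t x

end Data

end MikadoHom

end

noncomputable section

namespace MikadoHom

open MeasureTheory Filter Topology Set

section

open scoped Pointwise

/-! ### Periodic functions and the cube -/

/-! Write `r` for the homogenized solution `ρbar`, `W r` for the corrector, and `x0 = λ (κτ)^{1/2}`,
so that the squared errors must gain `x0⁻²`. In the coordinates `Φ_i` the oscillating matrix is `κ
(Id + q ∑ a_k H_k(λΦ_i))` with `H_k = k ⊗ ∇φ_k - ∇φ_k ⊗ k`, and the leading part of the gradient of
`W r` is `∑ q a_k (k·∇r) ∇φ_k`. Since the supports are disjoint and `k·∇φ_k = 0`, the flux of `r + W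
r` minus the homogenized flux consists of three kinds of terms (`flux_algebra`, `flux_eq`): `∂φ_k`
times a slow factor and `k·∇f`; `|∇φ_k|²` minus its mean times a slow factor and `k·∇f`; and terms
in which a derivative of the corrector fell on a slow amplitude. The profiles of the first two kinds
have mean zero and are constant along `k`, so they are divergences of potentials constant along `k`
(`CF.exists_potential`). After integration by parts the second derivatives of `f` cancel because the
coordinate derivatives commute (`I_Y_dk`), and a factor `λ⁻¹` is gained at the cost of `∇f` only.

Slow quantities are measured at the local inverse length `R = (τ κ̄)^{-1/2}`, at which diffusion
acts in time `τ`. The weighted energies `(τ κ̄)^j |∇^j r|²` are bounded by `D` by induction on `j`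
(`word_bound`, `IsHom.energy_step`, `exists_energy_bound`). Amplitudes may be as large as `Q =
(κ̄/κ)^{1/2}`; this loss is compensated exactly by `Q R = ν`, where `ν = (τκ)^{-1/2}` and `λ = x0
ν`.

The advective derivative does not see the oscillation, as the `Φ_i` are transported. It acts on the
amplitude `q`, however, and the bound on `D_t κ̄` controls `D_t q` only where `q` is at least
`x0⁻¹`. The energy balance is therefore written for a regularized amplitude `qhat`
(`exists_bd_qhat`); the removed part is `O(x0⁻¹)` and is harmless in the flux. In the mean of `f D_t
Ŵ`, where `Ŵ` is the regularized corrector, the test function is not always differentiated. Each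
integration by parts then gains only `x0⁻¹`, and `N` of them suffice because `λ ≤ K x0^N`
(`exists_sum_I_Y_le`, `lam_le`).

The variance of `ρ - r - Ŵ` is then dissipated up to `x0⁻² τ⁻¹` times the energies, the Poincaré
inequality absorbing the undifferentiated test function (`exists_error_bound`). For the energies,
the antisymmetric part of the oscillating matrix drops out of the energy law of `ρ`, and testing the
flux estimate with `r + W r` itself compares the two dissipations up to `x0⁻¹`
(`exists_energy_density_bound`). In the last claim either `x0` is large and the errors are absorbed,
or `λ ≤ K x0^N` is bounded and a direct energy comparison applies (`exists_comparison`). -/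

theorem basisVec_apply (j l : Fin 3) : basisVec j l = if l = j then 1 else 0 := by
  simp [basisVec]

theorem norm_basisVec (j : Fin 3) : ‖basisVec j‖ = 1 := by
  simp [basisVec]

theorem sum_basisVec (v : E3) : v = ∑ l, v l • basisVec l := by
  ext j
  simp [basisVec_apply]

/-- The basis of the lattice of periods. -/
def periodBasis (P : ℝ) (hP : 0 < P) : Module.Basis (Fin 3) ℝ E3 :=
  (EuclideanSpace.basisFun (Fin 3) ℝ).toBasis.unitsSMul (fun _ => Units.mk0 P hP.ne')

theorem periodBasis_apply (P : ℝ) (hP : 0 < P) (j : Fin 3) :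
    periodBasis P hP j = P • basisVec j := by
  simp [periodBasis, Module.Basis.unitsSMul_apply, basisVec, Units.smul_def]

theorem cube_eq_fundamentalDomain (P : ℝ) (hP : 0 < P) :
    cube P = ZSpan.fundamentalDomain (periodBasis P hP) := by
  ext x
  simp only [cube, ZSpan.fundamentalDomain, Set.mem_ofPred_eq, periodBasis,
    Module.Basis.repr_unitsSMul, Units.smul_def, Units.val_inv_eq_inv_val, Units.val_mk0,
    Set.mem_Ico, smul_eq_mul, OrthonormalBasis.coe_toBasis_repr_apply, EuclideanSpace.basisFun_repr]
  refine forall_congr' fun j => ?_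
  rw [inv_mul_lt_iff₀ hP, mul_one]
  constructor
  · rintro ⟨h1, h2⟩; exact ⟨by positivity, h2⟩
  · rintro ⟨h1, h2⟩; exact ⟨by simpa [hP] using (mul_nonneg hP.le h1), h2⟩

theorem measurableSet_cube (P : ℝ) (hP : 0 < P) : MeasurableSet (cube P) := by
  rw [cube_eq_fundamentalDomain P hP]
  exact ZSpan.fundamentalDomain_measurableSet _

theorem Periodic3.add_lattice {V : Type} {P : ℝ} (hP : 0 < P) {f : E3 → V} (hf : Periodic3 P f)
    {v : E3} (hv : v ∈ Submodule.span ℤ (Set.range (periodBasis P hP))) (x : E3) :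
    f (x + v) = f x := by
  let S : AddSubgroup E3 :=
    { carrier := {v | ∀ x, f (x + v) = f x}
      zero_mem' := by intro x; simp
      add_mem' := by
        intro a b ha hb x
        rw [← add_assoc, hb, ha]
      neg_mem' := by
        intro a ha x
        have := ha (x + -a)
        rw [← this]; simp }
  have hS : Submodule.span ℤ (Set.range (periodBasis P hP)) ≤ AddSubgroup.toIntSubmodule S := by
    rw [Submodule.span_le]
    rintro _ ⟨j, rfl⟩
    rw [periodBasis_apply]
    exact fun x => hf x j
  exact hS hv x

/-- A translate of the cube is again a fundamental domain of the lattice of periods, and invariant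
functions have the same integral over any two fundamental domains. -/
theorem setIntegral_cube_add {V : Type} [NormedAddCommGroup V] [NormedSpace ℝ V] {P : ℝ}
    (hP : 0 < P) {f : E3 → V} (hf : Periodic3 P f) (y : E3) :
    ∫ x in cube P, f (x + y) = ∫ x in cube P, f x := by
  have h1 := ZSpan.isAddFundamentalDomain' (periodBasis P hP) (volume : Measure E3)
  have h2 := h1.vadd_of_comm y
  have : Countable (Submodule.span ℤ (Set.range (periodBasis P hP))).toAddSubgroup :=
    inferInstanceAs (Countable (Submodule.span ℤ (Set.range (periodBasis P hP))))
  have h3 := h2.setIntegral_eq h1 (f := f) (by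
    rintro ⟨g, hg⟩ x
    have := hf.add_lattice hP hg x
    rw [← this]
    simp [add_comm])
  rw [cube_eq_fundamentalDomain P hP, ← h3]
  have h4 := (measurePreserving_add_left (volume : Measure E3) y).setIntegral_image_emb
    (measurableEmbedding_addLeft y) f (ZSpan.fundamentalDomain (periodBasis P hP))
  have h5 : (fun x => y + x) '' ZSpan.fundamentalDomain (periodBasis P hP) =
      y +ᵥ ZSpan.fundamentalDomain (periodBasis P hP) := rfl
  rw [← h5, h4]
  simp [add_comm]

theorem volume_cube (P : ℝ) (hP : 0 < P) : volume.real (cube P) = P ^ 3 := by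
  have h : cube P = (WithLp.ofLp) ⁻¹' (Set.pi Set.univ fun _ : Fin 3 => Set.Ico (0:ℝ) P) := by
    ext x; simp [cube]
  rw [measureReal_def, h, (PiLp.volume_preserving_ofLp (Fin 3)).measure_preimage]
  · simp [Real.volume_pi_Ico, hP.le]
  · exact (MeasurableSet.univ_pi fun _ => measurableSet_Ico).nullMeasurableSet

theorem norm_le_of_mem_cube {P : ℝ} (hP : 0 < P) {x : E3} (hx : x ∈ cube P) : ‖x‖ ≤ 2 * P := by
  rw [EuclideanSpace.norm_eq]
  apply Real.sqrt_le_iff.2 ⟨by positivity, ?_⟩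
  have h : ∀ j, ‖x j‖ ^ 2 ≤ P ^ 2 := fun j => by
    rw [Real.norm_eq_abs, sq_abs]
    have := hx j
    simp only [Set.mem_Ico] at this
    nlinarith
  rw [Fin.sum_univ_three]
  nlinarith [h 0, h 1, h 2]

theorem cube_subset_closedBall {P : ℝ} (hP : 0 < P) :
    cube P ⊆ Metric.closedBall 0 (2 * P) := fun x hx => by
  simpa using norm_le_of_mem_cube hP hx

instance finite_restrict_cube (P : ℝ) [hP : Fact (0 < P)] :
    IsFiniteMeasure (volume.restrict (cube P) : Measure E3) :=
  ⟨by
    rw [Measure.restrict_apply_univ]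
    exact lt_of_le_of_lt (measure_mono (cube_subset_closedBall hP.out))
      (isCompact_closedBall _ _).measure_lt_top⟩

instance : Fact ((0:ℝ) < 1) := ⟨one_pos⟩

theorem integrableOn_cube_of_continuous {V : Type} [NormedAddCommGroup V] {P : ℝ}
    (hP : 0 < P) {f : E3 → V} (hf : Continuous f) : IntegrableOn f (cube P) :=
  (hf.continuousOn.integrableOn_compact (isCompact_closedBall 0 (2 * P))).mono_set
    (cube_subset_closedBall hP)

/-- Every point is a translate by a period of a point of the cube. -/
theorem exists_mem_cube {P : ℝ} (hP : 0 < P) (x : E3) :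
    ∃ v ∈ Submodule.span ℤ (Set.range (periodBasis P hP)), x + v ∈ cube P := by
  obtain ⟨v, hv, -⟩ := ZSpan.exist_unique_vadd_mem_fundamentalDomain (periodBasis P hP) x
  refine ⟨v, v.2, ?_⟩
  rw [cube_eq_fundamentalDomain P hP]
  simpa [Submodule.vadd_def, add_comm] using hv

theorem Periodic3.bounded {V : Type} [NormedAddCommGroup V] {P : ℝ} (hP : 0 < P) {f : E3 → V}
    (hf : Periodic3 P f) (hc : Continuous f) : ∃ C, 0 ≤ C ∧ ∀ x, ‖f x‖ ≤ C := by
  obtain ⟨C, hC⟩ := (isCompact_closedBall (0:E3) (2 * P)).exists_bound_of_continuousOn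
    hc.continuousOn
  refine ⟨max C 0, le_max_right _ _, fun x => ?_⟩
  obtain ⟨v, hv, hx⟩ := exists_mem_cube hP x
  rw [← hf.add_lattice hP hv x]
  exact (hC _ (cube_subset_closedBall hP hx)).trans (le_max_left _ _)

/-! ### The algebra of smooth periodic fields -/

/-- The algebra of smooth functions of time and of a point of the torus. -/
def torusAlg : Subalgebra ℝ (ℝ → E3 → ℝ) where
  carrier := {f | TorusField f}
  mul_mem' := fun ha hb => ⟨ContDiff.mul ha.1 hb.1, fun t x j => by
    have h1 := ha.2 t x j
    have h2 := hb.2 t x j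
    simp only [Pi.mul_apply, h1, h2]⟩
  add_mem' := fun ha hb => ⟨ContDiff.add ha.1 hb.1, fun t x j => by
    have h1 := ha.2 t x j
    have h2 := hb.2 t x j
    simp only [Pi.add_apply, h1, h2]⟩
  algebraMap_mem' := fun r => ⟨contDiff_const (c := r), fun t x j => rfl⟩

/-- Since the fields form a commutative ring on which space and time derivatives are derivations,
differential identities become ring computations. Smoothness and periodicity are carried by the
type. -/
abbrev PF : Type := torusAlg

instance : CoeFun PF (fun _ => ℝ → E3 → ℝ) := ⟨fun f => f.1⟩

namespace PF

theorem smooth (f : PF) : ContDiff ℝ ∞ (fun p : ℝ × E3 => f p.1 p.2) := f.2.1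
theorem periodic (f : PF) (t : ℝ) : Periodic3 1 (f t) := f.2.2 t

@[ext] theorem ext' {f g : PF} (h : ∀ t x, f t x = g t x) : f = g :=
  Subtype.ext (funext fun t => funext fun x => h t x)

@[simp] theorem mk_apply (f : ℝ → E3 → ℝ) (hf : TorusField f) (t : ℝ) (x : E3) :
    (⟨f, hf⟩ : PF) t x = f t x := rfl
@[simp] theorem add_apply (f g : PF) (t : ℝ) (x : E3) : (f + g) t x = f t x + g t x := rfl
@[simp] theorem mul_apply (f g : PF) (t : ℝ) (x : E3) : (f * g) t x = f t x * g t x := rfl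
@[simp] theorem sub_apply (f g : PF) (t : ℝ) (x : E3) : (f - g) t x = f t x - g t x := rfl
@[simp] theorem neg_apply (f : PF) (t : ℝ) (x : E3) : (-f) t x = -f t x := rfl
@[simp] theorem zero_apply (t : ℝ) (x : E3) : (0 : PF) t x = 0 := rfl
@[simp] theorem one_apply (t : ℝ) (x : E3) : (1 : PF) t x = 1 := rfl
@[simp] theorem smul_apply (c : ℝ) (f : PF) (t : ℝ) (x : E3) : (c • f) t x = c * f t x := rfl
@[simp] theorem pow_apply (f : PF) (n : ℕ) (t : ℝ) (x : E3) : (f ^ n) t x = f t x ^ n := rfl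
@[simp] theorem algebraMap_apply (c : ℝ) (t : ℝ) (x : E3) : (algebraMap ℝ PF c) t x = c := rfl

/-- Evaluation at a point. -/
def ev (t : ℝ) (x : E3) : PF →+* ℝ where
  toFun f := f t x
  map_one' := rfl
  map_mul' _ _ := rfl
  map_zero' := rfl
  map_add' _ _ := rfl

@[simp] theorem sum_apply {ι : Type*} (s : Finset ι) (f : ι → PF) (t : ℝ) (x : E3) :
    (∑ i ∈ s, f i) t x = ∑ i ∈ s, f i t x := map_sum (ev t x) f s

theorem continuous (f : PF) : Continuous (fun p : ℝ × E3 => f p.1 p.2) := f.smooth.continuous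

theorem continuous_slice (f : PF) (t : ℝ) : Continuous (f t) :=
  f.continuous.comp (Continuous.prodMk_right t)

theorem differentiable (f : PF) : Differentiable ℝ (fun p : ℝ × E3 => f p.1 p.2) :=
  f.smooth.differentiable (by simp)

theorem contDiff_slice (f : PF) (t : ℝ) : ContDiff ℝ ∞ (f t) :=
  f.smooth.comp (contDiff_const.prodMk contDiff_id)

/-- The derivative in the space-time direction `v`. -/
def dirFun (v : ℝ × E3) (f : PF) : PF :=
  ⟨fun t x => fderiv ℝ (fun p : ℝ × E3 => f p.1 p.2) (t, x) v, by
    have h : ContDiff ℝ ∞ (fderiv ℝ (fun p : ℝ × E3 => f p.1 p.2)) :=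
      f.smooth.fderiv_right (by simp)
    exact h.clm_apply contDiff_const, fun t x j => by
    have h : (fun p : ℝ × E3 => f p.1 p.2) =
        fun p => (fun p : ℝ × E3 => f p.1 p.2) (p + (0, (1:ℝ) • basisVec j)) := by
      funext p
      exact ((f.periodic p.1 p.2 j).symm.trans (by simp))
    have h2 : fderiv ℝ (fun p : ℝ × E3 => f p.1 p.2) (t, x) =
        fderiv ℝ (fun p : ℝ × E3 => f p.1 p.2) ((t, x) + (0, (1:ℝ) • basisVec j)) := by
      conv_lhs => rw [h]
      exact fderiv_comp_add_right (𝕜 := ℝ) (f := fun p : ℝ × E3 => f p.1 p.2)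
        ((0, (1:ℝ) • basisVec j) : ℝ × E3)
    show (fderiv ℝ _ (t, x + (1:ℝ) • basisVec j)) v = (fderiv ℝ _ (t, x)) v
    rw [h2]
    simp⟩

/-- The derivative in the space-time direction `v`, as a derivation. -/
def dir (v : ℝ × E3) : Derivation ℝ PF PF :=
  Derivation.mk'
    { toFun := dirFun v
      map_add' := fun f g => by
        ext t x
        show fderiv ℝ (fun p : ℝ × E3 => f p.1 p.2 + g p.1 p.2) (t, x) v = _
        rw [fderiv_fun_add (f.differentiable _) (g.differentiable _)]
        rfl
      map_smul' := fun c f => by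
        ext t x
        show fderiv ℝ (fun p : ℝ × E3 => c • f p.1 p.2) (t, x) v = _
        rw [fderiv_fun_const_smul (f.differentiable _)]
        rfl }
    (fun f g => by
      ext t x
      show fderiv ℝ (fun p : ℝ × E3 => f p.1 p.2 * g p.1 p.2) (t, x) v = _
      rw [fderiv_fun_mul (f.differentiable _) (g.differentiable _)]
      rfl)

theorem dir_apply (v : ℝ × E3) (f : PF) (t : ℝ) (x : E3) :
    dir v f t x = fderiv ℝ (fun p : ℝ × E3 => f p.1 p.2) (t, x) v := rfl

theorem dir_comm (v w : ℝ × E3) (f : PF) : dir v (dir w f) = dir w (dir v f) := by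
  ext t x
  have key : ∀ v w : ℝ × E3, dir v (dir w f) t x =
      fderiv ℝ (fderiv ℝ (fun p : ℝ × E3 => f p.1 p.2)) (t, x) v w := by
    intro v w
    have h : DifferentiableAt ℝ (fderiv ℝ (fun p : ℝ × E3 => f p.1 p.2)) (t, x) :=
      ((f.smooth.fderiv_right (m := ∞) (by simp)).differentiable (by simp)) _
    rw [dir_apply]
    show fderiv ℝ (fun p : ℝ × E3 => fderiv ℝ (fun p : ℝ × E3 => f p.1 p.2) p w) (t, x) v = _
    rw [fderiv_clm_apply h (differentiableAt_const _)]
    simp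
  rw [key, key]
  exact (f.smooth.contDiffAt.isSymmSndFDerivAt (by simpa using ENat.LEInfty.out)) v w

/-- The `l`-th spatial derivative. -/
def dx (l : Fin 3) : Derivation ℝ PF PF := dir (0, basisVec l)
/-- The time derivative. -/
def dt : Derivation ℝ PF PF := dir (1, 0)

theorem dx_comm (l m : Fin 3) (f : PF) : dx l (dx m f) = dx m (dx l f) := dir_comm _ _ _
theorem dt_dx (l : Fin 3) (f : PF) : dt (dx l f) = dx l (dt f) := dir_comm _ _ _

theorem hasFDerivAt_slice (f : PF) (t : ℝ) (x : E3) :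
    HasFDerivAt (f t) ((fderiv ℝ (fun p : ℝ × E3 => f p.1 p.2) (t, x)).comp
      (ContinuousLinearMap.inr ℝ ℝ E3)) x :=
  HasFDerivAt.comp x (f.differentiable (t, x)).hasFDerivAt (hasFDerivAt_prodMk_right t x)

theorem fderiv_slice (f : PF) (t : ℝ) (x v : E3) :
    fderiv ℝ (f t) x v = dir (0, v) f t x := by
  rw [(f.hasFDerivAt_slice t x).fderiv]
  rfl

theorem fderiv_basisVec (f : PF) (t : ℝ) (x : E3) (l : Fin 3) :
    fderiv ℝ (f t) x (basisVec l) = dx l f t x := f.fderiv_slice t x _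

theorem fderiv_eq_sum (f : PF) (t : ℝ) (x v : E3) :
    fderiv ℝ (f t) x v = ∑ l, v l * dx l f t x := by
  conv_lhs => rw [sum_basisVec v]
  simp [fderiv_basisVec]

theorem hasDerivAt_time (f : PF) (t : ℝ) (x : E3) :
    HasDerivAt (fun s => f s x) (dt f t x) t := by
  have := HasFDerivAt.comp (f := fun s : ℝ => (s, x)) t (f.differentiable (t, x)).hasFDerivAt (hasFDerivAt_prodMk_left t x)
  exact this.hasDerivAt

theorem gradient_apply (f : PF) (t : ℝ) (x : E3) (l : Fin 3) :
    gradient (f t) x l = dx l f t x := by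
  have h : inner ℝ (gradient (f t) x) (basisVec l) = fderiv ℝ (f t) x (basisVec l) := by
    exact InnerProductSpace.toDual_symm_apply
  rw [fderiv_basisVec] at h
  rw [← h, basisVec, EuclideanSpace.inner_single_right]
  simp

theorem norm_gradient_sq (f : PF) (t : ℝ) (x : E3) :
    ‖gradient (f t) x‖ ^ 2 = ∑ l, dx l f t x ^ 2 := by
  rw [EuclideanSpace.norm_sq_eq]
  simp [gradient_apply]

end PF

end

/-! ### Averages over the torus, integration by parts and the Poincaré inequality -/

theorem sq_integral_le {α : Type*} [MeasurableSpace α] {μ : Measure α} [IsProbabilityMeasure μ]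
    {g : α → ℝ} (hg : Integrable g μ) (hg2 : Integrable (fun x => g x ^ 2) μ) :
    (∫ x, g x ∂μ) ^ 2 ≤ ∫ x, g x ^ 2 ∂μ := by
  set m := ∫ x, g x ∂μ with hm
  have h : 0 ≤ ∫ x, (g x - m) ^ 2 ∂μ := integral_nonneg fun x => sq_nonneg _
  have h2 : ∫ x, (g x - m) ^ 2 ∂μ = ∫ x, (g x ^ 2 - 2 * m * g x + m ^ 2) ∂μ := by
    congr 1; funext x; ring
  have h3 : Integrable (fun x => g x ^ 2 - 2 * m * g x) μ := hg2.sub (hg.const_mul _)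
  rw [h2, integral_add h3 (integrable_const _),
    integral_sub hg2 (hg.const_mul _), integral_const_mul, ← hm] at h
  simp at h
  nlinarith

namespace PF

/-- The average over the torus at time `t`. -/
def I (t : ℝ) (f : PF) : ℝ := ∫ x in cube 1, f t x

theorem integrable (f : PF) (t : ℝ) : Integrable (f t) (volume.restrict (cube 1)) :=
  integrableOn_cube_of_continuous one_pos (f.continuous_slice t)

theorem I_add (t : ℝ) (f g : PF) : I t (f + g) = I t f + I t g :=
  integral_add (f.integrable t) (g.integrable t)

theorem I_smul (t : ℝ) (c : ℝ) (f : PF) : I t (c • f) = c * I t f :=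
  integral_const_mul _ _

/-- The average as a linear functional. -/
def Il (t : ℝ) : PF →ₗ[ℝ] ℝ where
  toFun := I t
  map_add' := I_add t
  map_smul' := I_smul t

theorem I_neg (t : ℝ) (f : PF) : I t (-f) = -I t f := map_neg (Il t) f
theorem I_sub (t : ℝ) (f g : PF) : I t (f - g) = I t f - I t g := map_sub (Il t) f g
theorem I_zero (t : ℝ) : I t 0 = 0 := map_zero (Il t)
theorem I_sum {ι : Type*} (t : ℝ) (s : Finset ι) (f : ι → PF) :
    I t (∑ i ∈ s, f i) = ∑ i ∈ s, I t (f i) := map_sum (Il t) f s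

instance : IsProbabilityMeasure (volume.restrict (cube 1) : Measure E3) :=
  ⟨by
    have h := volume_cube 1 one_pos
    rw [measureReal_def] at h
    rw [Measure.restrict_apply_univ]
    have h3 : (volume (cube 1)).toReal = 1 := by rw [h]; norm_num
    simpa using (ENNReal.toReal_eq_one_iff _).1 h3⟩

theorem I_algebraMap (t c : ℝ) : I t (algebraMap ℝ PF c) = c := by
  simp [I]

theorem I_mono {t : ℝ} {f g : PF} (h : ∀ x, f t x ≤ g t x) : I t f ≤ I t g :=
  integral_mono (f.integrable t) (g.integrable t) h

theorem I_nonneg {t : ℝ} {f : PF} (h : ∀ x, 0 ≤ f t x) : 0 ≤ I t f :=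
  integral_nonneg h

theorem I_congr {t : ℝ} {f g : PF} (h : ∀ x, f t x = g t x) : I t f = I t g :=
  integral_congr_ae (Eventually.of_forall h)

theorem hasDerivAt_I (f : PF) (t : ℝ) : HasDerivAt (fun s => I s f) (I t (dt f)) t := by
  obtain ⟨C, hC⟩ := ((isCompact_Icc (a := t - 1) (b := t + 1)).prod
    (isCompact_closedBall (0 : E3) (2 * 1))).exists_bound_of_continuousOn
      (dt f).continuous.continuousOn
  refine (hasDerivAt_integral_of_dominated_loc_of_deriv_le (s := Icc (t - 1) (t + 1))
    (F' := fun s x => dt f s x) (bound := fun _ => C)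
    (Icc_mem_nhds (by linarith) (by linarith)) ?_ (f.integrable t)
    ((dt f).integrable t).aestronglyMeasurable ?_ (integrable_const _) ?_).2
  · exact Eventually.of_forall fun s => (f.integrable s).aestronglyMeasurable
  · refine (ae_restrict_iff' (measurableSet_cube 1 one_pos)).2 (Eventually.of_forall ?_)
    intro x hx s hs
    exact hC (s, x) ⟨hs, cube_subset_closedBall one_pos hx⟩
  · exact Eventually.of_forall fun x s _ => f.hasDerivAt_time s x

theorem continuous_I (f : PF) : Continuous (fun t => I t f) :=
  continuous_iff_continuousAt.2 fun t => (f.hasDerivAt_I t).continuousAt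

/-- Translation along a spatial line, parametrized by the time variable. -/
def shift (f : PF) (t : ℝ) (v : E3) : PF :=
  ⟨fun s x => f t (x + s • v),
    f.smooth.comp (contDiff_const.prodMk (contDiff_snd.add (contDiff_fst.smul contDiff_const))),
    fun s x j => by
      show f t (x + (1:ℝ) • basisVec j + s • v) = f t (x + s • v)
      rw [add_right_comm]
      exact f.periodic t _ j⟩

theorem dt_shift (f : PF) (t : ℝ) (v : E3) (s : ℝ) (x : E3) :
    dt (f.shift t v) s x = ∑ l, v l * dx l f t (x + s • v) := by
  rw [← fderiv_eq_sum]
  have h1 : HasDerivAt (fun s : ℝ => x + s • v) v s := by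
    simpa using ((hasDerivAt_id s).smul_const v).const_add x
  have h2 := (f.hasFDerivAt_slice t (x + s • v)).comp_hasDerivAt s h1
  rw [(f.hasFDerivAt_slice t (x + s • v)).fderiv]
  exact ((f.shift t v).hasDerivAt_time s x).unique h2

theorem I_shift (f : PF) (t : ℝ) (v : E3) (s : ℝ) : I s (f.shift t v) = I t f :=
  setIntegral_cube_add one_pos (f.periodic t) _

/-- The average of a translate does not depend on the translation; its derivative in the translation
parameter is the average of the partial derivative. -/
theorem I_dx (f : PF) (t : ℝ) (l : Fin 3) : I t (dx l f) = 0 := by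
  have h1 := (f.shift t (basisVec l)).hasDerivAt_I 0
  have h2 : (fun s => I s (f.shift t (basisVec l))) = fun _ => I t f :=
    funext fun s => f.I_shift t _ s
  rw [h2] at h1
  rw [← h1.unique (hasDerivAt_const _ _)]
  exact integral_congr_ae (Eventually.of_forall fun x => by
    simp [dt_shift, basisVec_apply])

theorem I_mul_dx (f g : PF) (t : ℝ) (l : Fin 3) : I t (f * dx l g) = -I t (dx l f * g) := by
  have h := I_dx (f * g) t l
  rw [Derivation.leibniz, I_add] at h
  simp only [smul_eq_mul] at h
  rw [mul_comm (dx l f) g]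
  linarith

/-- The square of the length of the spatial gradient. -/
def Gd (f : PF) : PF := ∑ l, dx l f ^ 2

theorem Gd_apply (f : PF) (t : ℝ) (x : E3) : Gd f t x = ∑ l, dx l f t x ^ 2 := by
  simp [Gd]

theorem Gd_nonneg (f : PF) (t : ℝ) (x : E3) : 0 ≤ Gd f t x := by
  rw [Gd_apply]; positivity

theorem bounded_slice (f : PF) (t : ℝ) : ∃ C, 0 ≤ C ∧ ∀ x, ‖f t x‖ ≤ C :=
  (f.periodic t).bounded one_pos (f.continuous_slice t)

/-- The difference is the integral of the directional derivative along the segment. Jensen, Fubini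
and translation invariance give the bound, and `|y| ≤ 2` on the unit cube gives the constant `4`. -/
theorem sq_shift_sub_le (f : PF) (t : ℝ) (y : E3) (hy : y ∈ cube 1) :
    ∫ x in cube 1, (f t (x + y) - f t x) ^ 2 ≤ 4 * I t (Gd f) := by
  have hy' : ∑ l, y l ^ 2 ≤ 4 := by
    have := norm_le_of_mem_cube one_pos hy
    have h2 := EuclideanSpace.norm_sq_eq y
    simp only [Real.norm_eq_abs, sq_abs] at h2
    rw [← h2]; nlinarith [norm_nonneg y]
  have hprob : IsProbabilityMeasure (volume.restrict (Ioc (0:ℝ) 1)) :=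
    ⟨by simp⟩
  set g := f.shift t y
  have hpt : ∀ x, (f t (x + y) - f t x) ^ 2 ≤ ∫ r in Ioc (0:ℝ) 1, 4 * Gd f t (x + r • y) := by
    intro x
    have hc : Continuous fun r => dt g r x :=
      (dt g).continuous.comp (Continuous.prodMk_left x)
    have h1 : f t (x + y) - f t x = ∫ r in Ioc (0:ℝ) 1, dt g r x := by
      rw [← intervalIntegral.integral_of_le zero_le_one,
        intervalIntegral.integral_eq_sub_of_hasDerivAt (fun r _ => g.hasDerivAt_time r x)
          (hc.intervalIntegrable _ _)]
      simp [g, shift]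
    rw [h1]
    refine (sq_integral_le (hc.integrableOn_Ioc) ((hc.pow 2).integrableOn_Ioc)).trans ?_
    have hc2 : Continuous fun r : ℝ => 4 * Gd f t (x + r • y) :=
      continuous_const.mul ((Gd f).continuous_slice t |>.comp (by fun_prop))
    refine integral_mono ((hc.pow 2).integrableOn_Ioc) hc2.integrableOn_Ioc fun r => ?_
    simp only
    rw [dt_shift, Gd_apply]
    refine (Finset.sum_mul_sq_le_sq_mul_sq _ _ _).trans ?_
    exact mul_le_mul_of_nonneg_right hy' (by positivity)
  have hG : Continuous fun p : E3 × ℝ => Gd f t (p.1 + p.2 • y) :=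
    ((Gd f).continuous_slice t).comp (by fun_prop)
  obtain ⟨C, -, hC⟩ := (Gd f).bounded_slice t
  have hint : Integrable (fun p : E3 × ℝ => 4 * Gd f t (p.1 + p.2 • y))
      ((volume.restrict (cube 1)).prod (volume.restrict (Ioc (0:ℝ) 1))) :=
    (Integrable.of_bound hG.aestronglyMeasurable C
      (Eventually.of_forall fun p => hC _)).const_mul 4
  calc ∫ x in cube 1, (f t (x + y) - f t x) ^ 2
      ≤ ∫ x in cube 1, ∫ r in Ioc (0:ℝ) 1, 4 * Gd f t (x + r • y) := by
        refine integral_mono ?_ hint.integral_prod_left hpt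
        have h := f.continuous_slice t
        exact integrableOn_cube_of_continuous one_pos (by fun_prop)
    _ = ∫ r in Ioc (0:ℝ) 1, ∫ x in cube 1, 4 * Gd f t (x + r • y) :=
        integral_integral_swap hint
    _ = ∫ r in Ioc (0:ℝ) 1, 4 * I t (Gd f) := by
        congr 1; funext r
        rw [integral_const_mul]
        congr 1
        exact setIntegral_cube_add one_pos ((Gd f).periodic t) _
    _ = 4 * I t (Gd f) := by simp

/-- The Poincaré inequality on the torus. -/
theorem poincare (f : PF) (t : ℝ) :
    I t ((f - algebraMap ℝ PF (I t f)) ^ 2) ≤ 4 * I t (Gd f) := by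
  have hf := f.continuous_slice t
  obtain ⟨C, hC0, hC⟩ := f.bounded_slice t
  -- The deviation from the mean is an average of differences of `f`, so Jensen reduces the claim to
  -- `sq_shift_sub_le`.
  have hpt : ∀ x, (f t x - I t f) ^ 2 ≤ ∫ y in cube 1, (f t (x + y) - f t x) ^ 2 := by
    intro x
    have h1 : I t f - f t x = ∫ y in cube 1, (f t (x + y) - f t x) := by
      rw [integral_sub (integrableOn_cube_of_continuous one_pos (by fun_prop))
        (integrable_const _)]
      have h2 := setIntegral_cube_add one_pos (f.periodic t) x
      simp only [add_comm _ x] at h2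
      rw [h2]
      simp [I]
    have h2 : (f t x - I t f) ^ 2 = (I t f - f t x) ^ 2 := by ring
    rw [h2, h1]
    exact sq_integral_le (integrableOn_cube_of_continuous one_pos (by fun_prop))
      (integrableOn_cube_of_continuous one_pos (by fun_prop))
  have hcont : Continuous fun p : E3 × E3 => (f t (p.1 + p.2) - f t p.1) ^ 2 := by fun_prop
  have hint : Integrable (fun p : E3 × E3 => (f t (p.1 + p.2) - f t p.1) ^ 2)
      ((volume.restrict (cube 1)).prod (volume.restrict (cube 1))) := by
    refine Integrable.of_bound hcont.aestronglyMeasurable ((C + C) ^ 2)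
      (Eventually.of_forall fun p => ?_)
    rw [norm_pow]
    exact pow_le_pow_left₀ (norm_nonneg _) ((norm_sub_le _ _).trans (add_le_add (hC _) (hC _))) 2
  calc I t ((f - algebraMap ℝ PF (I t f)) ^ 2)
      ≤ ∫ x in cube 1, ∫ y in cube 1, (f t (x + y) - f t x) ^ 2 :=
        integral_mono (integrable _ t) hint.integral_prod_left hpt
    _ = ∫ y in cube 1, ∫ x in cube 1, (f t (x + y) - f t x) ^ 2 := integral_integral_swap hint
    _ ≤ ∫ y in cube 1, 4 * I t (Gd f) := by
        refine integral_mono_ae hint.integral_prod_right (integrable_const _) ?_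
        refine (ae_restrict_iff' (measurableSet_cube 1 one_pos)).2 (Eventually.of_forall ?_)
        intro y hy
        exact f.sq_shift_sub_le t y hy
    _ = 4 * I t (Gd f) := by simp

end PF

/-! ### Functions of the cell variable -/

/-- The algebra of smooth functions on the torus of period `P`. -/
def cellAlg (P : ℝ) : Subalgebra ℝ (E3 → ℝ) where
  carrier := {f | ContDiff ℝ ∞ f ∧ Periodic3 P f}
  mul_mem' := fun ha hb => ⟨ContDiff.mul ha.1 hb.1, fun x j => by
    have h1 := ha.2 x j
    have h2 := hb.2 x j
    simp only [Pi.mul_apply, h1, h2]⟩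
  add_mem' := fun ha hb => ⟨ContDiff.add ha.1 hb.1, fun x j => by
    have h1 := ha.2 x j
    have h2 := hb.2 x j
    simp only [Pi.add_apply, h1, h2]⟩
  algebraMap_mem' := fun r => ⟨contDiff_const (c := r), fun x j => rfl⟩

abbrev CF (P : ℝ) : Type := cellAlg P

instance (P : ℝ) : CoeFun (CF P) (fun _ => E3 → ℝ) := ⟨fun f => f.1⟩

namespace CF

variable {P : ℝ}

theorem smooth (f : CF P) : ContDiff ℝ ∞ f.1 := f.2.1
theorem periodic (f : CF P) : Periodic3 P f.1 := f.2.2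
theorem continuous (f : CF P) : Continuous f.1 := f.smooth.continuous
theorem differentiable (f : CF P) : Differentiable ℝ f.1 := f.smooth.differentiable (by simp)

@[ext] theorem ext' {f g : CF P} (h : ∀ x, f x = g x) : f = g := Subtype.ext (funext h)

@[simp] theorem mk_apply (f : E3 → ℝ) (hf) (x : E3) : (⟨f, hf⟩ : CF P) x = f x := rfl
@[simp] theorem add_apply (f g : CF P) (x : E3) : (f + g) x = f x + g x := rfl
@[simp] theorem mul_apply (f g : CF P) (x : E3) : (f * g) x = f x * g x := rfl
@[simp] theorem sub_apply (f g : CF P) (x : E3) : (f - g) x = f x - g x := rfl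
@[simp] theorem neg_apply (f : CF P) (x : E3) : (-f) x = -f x := rfl
@[simp] theorem zero_apply (x : E3) : (0 : CF P) x = 0 := rfl
@[simp] theorem smul_apply (c : ℝ) (f : CF P) (x : E3) : (c • f) x = c * f x := rfl
@[simp] theorem pow_apply (f : CF P) (n : ℕ) (x : E3) : (f ^ n) x = f x ^ n := rfl
@[simp] theorem algebraMap_apply (c : ℝ) (x : E3) : (algebraMap ℝ (CF P) c) x = c := rfl

/-- Evaluation at a point. -/
def ev (x : E3) : CF P →+* ℝ where
  toFun f := f x
  map_one' := rfl
  map_mul' _ _ := rfl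
  map_zero' := rfl
  map_add' _ _ := rfl

@[simp] theorem sum_apply {ι : Type*} (s : Finset ι) (f : ι → CF P) (x : E3) :
    (∑ i ∈ s, f i) x = ∑ i ∈ s, f i x := map_sum (ev x) f s

/-- The `q`-th partial derivative. -/
def pd (q : Fin 3) : Derivation ℝ (CF P) (CF P) :=
  Derivation.mk'
    { toFun := fun f => ⟨fun x => fderiv ℝ f.1 x (basisVec q), by
        have h : ContDiff ℝ ∞ (fderiv ℝ f.1) := f.smooth.fderiv_right (by simp)
        exact h.clm_apply contDiff_const, fun x j => by
        have h : f.1 = fun y => f.1 (y + P • basisVec j) :=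
          funext fun y => (f.periodic y j).symm
        have h2 : fderiv ℝ f.1 x = fderiv ℝ f.1 (x + P • basisVec j) := by
          conv_lhs => rw [h]
          exact fderiv_comp_add_right (𝕜 := ℝ) (f := f.1) (P • basisVec j)
        simp only [h2]⟩
      map_add' := fun f g => by
        ext x
        show fderiv ℝ (fun x => f x + g x) x (basisVec q) = _
        rw [fderiv_fun_add (f.differentiable _) (g.differentiable _)]
        rfl
      map_smul' := fun c f => by
        ext x
        show fderiv ℝ (fun x => c • f x) x (basisVec q) = _
        rw [fderiv_fun_const_smul (f.differentiable _)]
        rfl }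
    (fun f g => by
      ext x
      show fderiv ℝ (fun x => f x * g x) x (basisVec q) = _
      rw [fderiv_fun_mul (f.differentiable _) (g.differentiable _)]
      rfl)

theorem pd_apply (q : Fin 3) (f : CF P) (x : E3) : pd q f x = fderiv ℝ f.1 x (basisVec q) := rfl

theorem fderiv_eq_sum (f : CF P) (x v : E3) : fderiv ℝ f.1 x v = ∑ l, v l * pd l f x := by
  conv_lhs => rw [sum_basisVec v]
  simp [pd_apply]

/-- The derivative in the direction `k`. -/
def kd (k : E3) (f : CF P) : CF P := ∑ l, k l • pd l f

theorem gradient_apply (f : CF P) (x : E3) (l : Fin 3) : gradient f.1 x l = pd l f x := by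
  have h : inner ℝ (gradient f.1 x) (basisVec l) = fderiv ℝ f.1 x (basisVec l) :=
    InnerProductSpace.toDual_symm_apply
  rw [pd_apply, ← h, basisVec, EuclideanSpace.inner_single_right]
  simp

theorem bounded (hP : 0 < P) (f : CF P) : ∃ C, 0 ≤ C ∧ ∀ x, |f x| ≤ C :=
  f.periodic.bounded hP f.continuous

/-- The measure on pairs of a vector in the cube and a time in the unit interval. -/
def pairMeasure (P : ℝ) : Measure (E3 × ℝ) :=
  (volume.restrict (cube P)).prod (volume.restrict (Ioc (0 : ℝ) 1))

/-- The weighted average `∫ w(y, r) f(x + r y)`. -/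
def avFun (w : E3 → ℝ) (f : CF P) (x : E3) : ℝ :=
  ∫ z, w z.1 * f (x + z.2 • z.1) ∂pairMeasure P

theorem integrable_weight (hP : 0 < P) {w : E3 → ℝ} (hw : Continuous w) :
    Integrable (fun z : E3 × ℝ => w z.1) (pairMeasure P) := by
  have h1 : Integrable w (volume.restrict (cube P)) := integrableOn_cube_of_continuous hP hw
  exact h1.comp_fst _

theorem integrable_av (hP : 0 < P) {w : E3 → ℝ} (hw : Continuous w) (f : CF P) (x : E3) :
    Integrable (fun z : E3 × ℝ => w z.1 * f (x + z.2 • z.1)) (pairMeasure P) := by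
  obtain ⟨C, -, hC⟩ := f.bounded hP
  have hf := f.continuous
  have hc : Continuous fun z : E3 × ℝ => f (x + z.2 • z.1) := by fun_prop
  exact (integrable_weight hP hw).mul_bdd (c := C) hc.aestronglyMeasurable
    (Eventually.of_forall fun z => hC _)

theorem hasFDerivAt_avFun (hP : 0 < P) {w : E3 → ℝ} (hw : Continuous w) (f : CF P) (x : E3) :
    HasFDerivAt (avFun w f) (∑ l, avFun w (pd l f) x • (EuclideanSpace.proj l : E3 →L[ℝ] ℝ)) x := by
  have hc1 : Continuous (fderiv ℝ f.1) := f.smooth.continuous_fderiv (by simp)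
  have hc := f.continuous
  obtain ⟨C, hC0, hC⟩ : ∃ C, 0 ≤ C ∧ ∀ x, ‖fderiv ℝ f.1 x‖ ≤ C := by
    refine Periodic3.bounded hP (fun x j => ?_) hc1
    have h : f.1 = fun y => f.1 (y + P • basisVec j) :=
      funext fun y => (f.periodic y j).symm
    conv_rhs => rw [h]
    exact (fderiv_comp_add_right (𝕜 := ℝ) (f := f.1) (P • basisVec j)).symm
  have hint : Integrable (fun z : E3 × ℝ => w z.1 • fderiv ℝ f.1 (x + z.2 • z.1))
      (pairMeasure P) :=
    (integrable_weight hP hw).smul_bdd C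
      (Continuous.aestronglyMeasurable (by fun_prop)) (Eventually.of_forall fun z => hC _)
  have key : HasFDerivAt (avFun w f)
      (∫ z, w z.1 • fderiv ℝ f.1 (x + z.2 • z.1) ∂pairMeasure P) x := by
    refine hasFDerivAt_integral_of_dominated_of_fderiv_le (s := Set.univ)
      (F' := fun x (z : E3 × ℝ) => w z.1 • fderiv ℝ f.1 (x + z.2 • z.1))
      (bound := fun z : E3 × ℝ => ‖w z.1‖ * C) univ_mem ?_ (integrable_av hP hw f x) ?_ ?_ ?_ ?_
    · exact Eventually.of_forall fun y => (integrable_av hP hw f y).aestronglyMeasurable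
    · exact hint.aestronglyMeasurable
    · refine Eventually.of_forall fun z y _ => ?_
      rw [norm_smul]
      exact mul_le_mul_of_nonneg_left (hC _) (norm_nonneg _)
    · exact (integrable_weight hP hw).norm.mul_const C
    · refine Eventually.of_forall fun z y _ => ?_
      have h1 : HasFDerivAt (fun y => f.1 (y + z.2 • z.1)) (fderiv ℝ f.1 (y + z.2 • z.1)) y :=
        (hasFDerivAt_comp_add_right _).2 (f.differentiable _).hasFDerivAt
      exact h1.const_mul (w z.1)
  convert key using 1
  ext v
  rw [ContinuousLinearMap.integral_apply hint]
  simp only [_root_.smul_apply, fderiv_eq_sum, smul_eq_mul, Finset.mul_sum]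
  rw [integral_finsetSum _ fun l _ => by
    refine ((integrable_av hP hw (pd l f) x).const_mul (v l)).congr (Eventually.of_forall ?_)
    intro z
    simp only
    ring]
  simp only [_root_.sum_apply, _root_.smul_apply, smul_eq_mul]
  refine Finset.sum_congr rfl fun l _ => ?_
  rw [avFun, mul_comm, ← integral_const_mul]
  congr 1; funext z
  show v l * (_ * _) = _ * (v l * _)
  ring

/-- The derivative of a weighted average is a combination of averages of derivatives with the same
weight, so smoothness follows by induction on the order. -/
theorem contDiff_avFun (hP : 0 < P) {w : E3 → ℝ} (hw : Continuous w) (f : CF P) :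
    ContDiff ℝ ∞ (avFun w f) := by
  rw [contDiff_infty]
  intro n
  induction n generalizing f with
  | zero =>
    exact contDiff_zero.2 (continuous_iff_continuousAt.2 fun x =>
      (hasFDerivAt_avFun hP hw f x).continuousAt)
  | succ n ih =>
    refine (contDiff_succ_iff_hasFDerivAt (n := n)).2
      ⟨fun x => ∑ l, avFun w (pd l f) x • (EuclideanSpace.proj l : E3 →L[ℝ] ℝ), ?_, fun x =>
        hasFDerivAt_avFun hP hw f x⟩
    exact ContDiff.sum fun l _ => (ih (pd l f)).smul contDiff_const

/-- The weighted average as a cell function. -/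
def av (hP : 0 < P) {w : E3 → ℝ} (hw : Continuous w) (f : CF P) : CF P :=
  ⟨avFun w f, contDiff_avFun hP hw f, fun x j => by
    simp only [avFun]
    congr 1; funext z
    rw [add_right_comm, f.periodic]⟩

theorem av_apply (hP : 0 < P) {w : E3 → ℝ} (hw : Continuous w) (f : CF P) (x : E3) :
    av hP hw f x = avFun w f x := rfl

theorem pd_av (hP : 0 < P) {w : E3 → ℝ} (hw : Continuous w) (f : CF P) (q : Fin 3) :
    pd q (av hP hw f) = av hP hw (pd q f) := by
  ext x
  rw [pd_apply]
  show fderiv ℝ (avFun w f) x (basisVec q) = avFun w (pd q f) x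
  rw [(hasFDerivAt_avFun hP hw f x).fderiv]
  simp [basisVec_apply]

/-- The mean over the cell. -/
def mean (f : CF P) : ℝ := (P ^ 3)⁻¹ * ∫ x in cube P, f x

theorem mean_algebraMap (hP : 0 < P) (c : ℝ) : mean (algebraMap ℝ (CF P) c) = c := by
  have := volume_cube P hP
  simp only [mean, algebraMap_apply, integral_const, smul_eq_mul, measureReal_restrict_apply_univ,
    this]
  field_simp

theorem mean_sub (hP : 0 < P) (f g : CF P) : mean (f - g) = mean f - mean g := by
  simp only [mean, sub_apply]
  rw [integral_sub (integrableOn_cube_of_continuous hP f.continuous)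
    (integrableOn_cube_of_continuous hP g.continuous)]
  ring

/-- An explicit potential replaces the inverse Laplacian: `g_q(x) = -P⁻³ ∫ y_q ∫₀¹ f(x + r y) dr
dy`, minus its mean. Its divergence is `-P⁻³ ∫ (f(x + y) - f(x)) dy`, which is `f(x)` because `f`
has mean zero. Being an average of translates of `f`, it inherits the invariance of `f` along `k`.
-/
theorem exists_potential (hP : 0 < P) (f : CF P) (hf : mean f = 0) :
    ∃ g : Fin 3 → CF P, ∑ q, pd q (g q) = f ∧ (∀ q, mean (g q) = 0) ∧
      ∀ k : E3, kd k f = 0 → ∀ q, kd k (g q) = 0 := by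
  have hw : ∀ q : Fin 3, Continuous fun y : E3 => y q := fun q => by fun_prop
  let h : Fin 3 → CF P := fun q => -((P ^ 3)⁻¹ • av hP (hw q) f)
  refine ⟨fun q => h q - algebraMap ℝ _ (mean (h q)), ?_, ?_, ?_⟩
  · have hP3 : P ^ 3 ≠ 0 := by positivity
    simp only [map_sub, Derivation.map_algebraMap, sub_zero, h, map_neg, Derivation.map_smul, pd_av]
    ext x
    simp only [sum_apply, neg_apply, smul_apply, Finset.sum_neg_distrib, ← Finset.mul_sum]
    have hf0 : ∫ y in cube P, f y = 0 := by
      simpa [mean, hP.ne'] using hf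
    have h1 : ∑ q, av hP (hw q) (pd q f) x = - (P ^ 3) * f x := by
      simp only [av_apply, avFun]
      rw [← integral_finsetSum _ fun q _ => integrable_av hP (hw q) (pd q f) x]
      have hint := integrable_finsetSum Finset.univ fun q _ => integrable_av hP (hw q) (pd q f) x
      rw [pairMeasure, integral_prod _ hint]
      have h2 : ∀ y : E3, ∫ r in Ioc (0:ℝ) 1, ∑ q, y q * pd q f (x + r • y) = f (x + y) - f x := by
        intro y
        rw [← intervalIntegral.integral_of_le zero_le_one]
        have hd : ∀ r ∈ uIcc (0:ℝ) 1, HasDerivAt (fun r : ℝ => f (x + r • y))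
            (∑ q, y q * pd q f (x + r • y)) r := by
          intro r _
          have h1 : HasDerivAt (fun s : ℝ => x + s • y) y r := by
            simpa using ((hasDerivAt_id r).smul_const y).const_add x
          rw [← fderiv_eq_sum]
          exact (f.differentiable _).hasFDerivAt.comp_hasDerivAt r h1
        rw [intervalIntegral.integral_eq_sub_of_hasDerivAt hd]
        · simp
        · have hc := fun q => (pd q f).continuous
          exact (by fun_prop : Continuous fun r : ℝ => ∑ q, y q * pd q f (x + r • y))
            |>.intervalIntegrable _ _
      simp only [h2]
      have hc := f.continuous
      rw [integral_sub (integrableOn_cube_of_continuous hP (by fun_prop))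
        (integrableOn_cube_of_continuous hP (by fun_prop))]
      have h3 := setIntegral_cube_add hP f.periodic x
      simp only [add_comm _ x] at h3
      rw [h3, hf0]
      simp [volume_cube P hP]
    rw [h1]
    field_simp
  · intro q
    rw [mean_sub hP, mean_algebraMap hP, sub_self]
  · intro k hk q
    have h1 : kd k (h q) = -((P ^ 3)⁻¹ • av hP (hw q) (kd k f)) := by
      ext x
      simp only [h, kd, map_neg, Derivation.map_smul, pd_av, sum_apply, smul_apply, neg_apply]
      simp only [av_apply, avFun, sum_apply, smul_apply, Finset.mul_sum]
      rw [integral_finsetSum _ fun l _ => by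
        refine ((integrable_av hP (hw q) (pd l f) x).const_mul (k l)).congr
          (Eventually.of_forall ?_)
        intro z
        simp only
        ring]
      rw [Finset.mul_sum, ← Finset.sum_neg_distrib]
      refine Finset.sum_congr rfl fun l _ => ?_
      have h2 : ∫ z, z.1 q * (k l * pd l f (x + z.2 • z.1)) ∂pairMeasure P =
          k l * ∫ z, z.1 q * pd l f (x + z.2 • z.1) ∂pairMeasure P := by
        rw [← integral_const_mul]
        congr 1; funext z; ring
      rw [h2]; ring
    have h3 : av hP (hw q) (0 : CF P) = 0 := by
      ext x
      simp [av_apply, avFun]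
    rw [hk, h3] at h1
    have h4 : kd k (h q - algebraMap ℝ _ (mean (h q))) = kd k (h q) := by
      simp [kd]
    rw [h4, h1]
    simp

theorem mean_pd (hP : 0 < P) (f : CF P) (q : Fin 3) : mean (pd q f) = 0 := by
  have hc1 : Continuous (fderiv ℝ f.1) := f.smooth.continuous_fderiv (by simp)
  have h0 : ∀ s : ℝ, ∫ x in cube P, (f (x + s • basisVec q)) = ∫ x in cube P, f x := fun s =>
    setIntegral_cube_add hP f.periodic _
  obtain ⟨C, -, hC⟩ := (pd q f).bounded hP
  have hPf : Fact (0 < P) := ⟨hP⟩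
  have hf := f.continuous
  have hp := (pd q f).continuous
  have h1 := (hasDerivAt_integral_of_dominated_loc_of_deriv_le (x₀ := (0:ℝ)) (s := Set.univ)
    (μ := volume.restrict (cube P)) (F := fun s x => f (x + s • basisVec q))
    (F' := fun s x => pd q f (x + s • basisVec q)) (bound := fun _ => C) univ_mem
    (Eventually.of_forall fun s => Continuous.aestronglyMeasurable (by fun_prop))
    (integrableOn_cube_of_continuous hP (by fun_prop))
    (Continuous.aestronglyMeasurable (by fun_prop))
    (Eventually.of_forall fun x s _ => hC _) (integrable_const _)
    (Eventually.of_forall fun x s _ => by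
      have h1 : HasDerivAt (fun s : ℝ => x + s • basisVec q) (basisVec q) s := by
        simpa using ((hasDerivAt_id s).smul_const (basisVec q)).const_add x
      exact (f.differentiable _).hasFDerivAt.comp_hasDerivAt s h1)).2
  simp only [h0] at h1
  have h2 := h1.unique (hasDerivAt_const _ _)
  simp only [zero_smul, add_zero] at h2
  simp [mean, h2]

end CF

namespace PF

/-! ### Local equality -/

/-- Equality near a space-time point. -/
def EqAt (t : ℝ) (x : E3) (f g : PF) : Prop :=
  (fun y : ℝ × E3 => f y.1 y.2) =ᶠ[𝓝 (t, x)] fun y => g y.1 y.2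

section EqAt
variable {t : ℝ} {x : E3} {f g h f' g' : PF}

theorem EqAt.refl (f : PF) : EqAt t x f f := EventuallyEq.rfl
theorem EqAt.of_eq (h : f = g) : EqAt t x f g := h ▸ EqAt.refl f
theorem EqAt.symm (h : EqAt t x f g) : EqAt t x g f := EventuallyEq.symm h
theorem EqAt.trans (h1 : EqAt t x f g) (h2 : EqAt t x g h) : EqAt t x f h :=
  EventuallyEq.trans h1 h2
theorem EqAt.eq (h : EqAt t x f g) : f t x = g t x :=
  EventuallyEq.eq_of_nhds (x := (t, x)) (f := fun y : ℝ × E3 => f y.1 y.2) h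
theorem EqAt.add (h1 : EqAt t x f g) (h2 : EqAt t x f' g') : EqAt t x (f + f') (g + g') :=
  EventuallyEq.add h1 h2
theorem EqAt.sub (h1 : EqAt t x f g) (h2 : EqAt t x f' g') : EqAt t x (f - f') (g - g') :=
  EventuallyEq.sub h1 h2
theorem EqAt.mul (h1 : EqAt t x f g) (h2 : EqAt t x f' g') : EqAt t x (f * f') (g * g') :=
  EventuallyEq.mul h1 h2
theorem EqAt.smul (c : ℝ) (h1 : EqAt t x f g) : EqAt t x (c • f) (c • g) :=
  h1.mono fun _ hy => congrArg (c * ·) hy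
theorem EqAt.sum {ι : Type*} (s : Finset ι) {f g : ι → PF} (h : ∀ i ∈ s, EqAt t x (f i) (g i)) :
    EqAt t x (∑ i ∈ s, f i) (∑ i ∈ s, g i) := by
  have h2 : ∀ᶠ y in 𝓝 (t, x), ∀ i ∈ s, f i y.1 y.2 = g i y.1 y.2 :=
    (Filter.eventually_all_finset s).2 h
  refine h2.mono fun y hy => ?_
  simp only [sum_apply]
  exact Finset.sum_congr rfl hy

/-- Equality of germs survives differentiation. The properties of `Φ_i` hold only where `η̃_i` is
nonzero, so identities that are to be differentiated are kept as equalities near a point. -/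
theorem EqAt.dirD (h : EqAt t x f g) (v : ℝ × E3) : EqAt t x (dir v f) (dir v g) :=
  (EventuallyEq.fderiv (𝕜 := ℝ) h).mono fun y hy => by
    show fderiv ℝ _ y v = fderiv ℝ _ y v
    rw [hy]

theorem EqAt.dxD (h : EqAt t x f g) (l : Fin 3) : EqAt t x (dx l f) (dx l g) := h.dirD _
theorem EqAt.dtD (h : EqAt t x f g) : EqAt t x (dt f) (dt g) := h.dirD _

theorem EqAt.mul_zero_left (h : EqAt t x f 0) (g : PF) : EqAt t x (f * g) 0 :=
  (h.mul (EqAt.refl g)).trans (EqAt.of_eq (zero_mul g))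
theorem EqAt.mul_zero_right (h : EqAt t x f 0) (g : PF) : EqAt t x (g * f) 0 :=
  ((EqAt.refl g).mul h).trans (EqAt.of_eq (mul_zero g))

end EqAt

/-! ### Pointwise bounds on derivatives up to a given order -/

/-- The bounds `|∂^w f| ≤ A R ^ |w|` at a point, for all derivatives of order at most `n`. -/
def Bd (R t : ℝ) (x : E3) : ℕ → ℝ → PF → Prop
  | 0, A, f => |f t x| ≤ A
  | n + 1, A, f => |f t x| ≤ A ∧ ∀ l, Bd R t x n (A * R) (dx l f)

section Bd
variable {R t : ℝ} {x : E3} {n : ℕ} {A B : ℝ} {f g : PF}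

theorem Bd.abs_le (h : Bd R t x n A f) : |f t x| ≤ A := by
  cases n with
  | zero => exact h
  | succ n => exact h.1

theorem Bd.nonneg (h : Bd R t x n A f) : 0 ≤ A := (abs_nonneg _).trans h.abs_le

theorem Bd.step (h : Bd R t x (n + 1) A f) (l : Fin 3) : Bd R t x n (A * R) (dx l f) := h.2 l

theorem Bd.of_succ (h : Bd R t x (n + 1) A f) : Bd R t x n A f := by
  induction n generalizing A f with
  | zero => exact h.1
  | succ n ih => exact ⟨h.1, fun l => ih (h.2 l)⟩

theorem Bd.of_le {m : ℕ} (h : Bd R t x n A f) (hm : m ≤ n) : Bd R t x m A f := by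
  induction n, hm using Nat.le_induction with
  | base => exact h
  | succ n _ ih => exact ih h.of_succ

theorem Bd.mono (hR : 0 ≤ R) (h : Bd R t x n A f) (hA : A ≤ B) : Bd R t x n B f := by
  induction n generalizing A B f with
  | zero => exact le_trans h hA
  | succ n ih =>
    exact ⟨h.1.trans hA, fun l => ih (h.2 l) (mul_le_mul_of_nonneg_right hA hR)⟩

theorem Bd.mono_scale {R' : ℝ} (hR : 0 ≤ R) (hR' : R ≤ R') (h : Bd R t x n A f) :
    Bd R' t x n A f := by
  induction n generalizing A f with
  | zero => exact h
  | succ n ih =>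
    exact ⟨h.1, fun l => ih (h.2 l) |>.mono (hR.trans hR')
      (mul_le_mul_of_nonneg_left hR' h.nonneg)⟩

theorem Bd.congr (h : Bd R t x n A f) (hfg : EqAt t x f g) : Bd R t x n A g := by
  induction n generalizing A f g with
  | zero =>
    show |g t x| ≤ A
    rw [← hfg.eq]; exact h
  | succ n ih => exact ⟨by rw [← hfg.eq]; exact h.1, fun l => ih (h.2 l) (hfg.dxD l)⟩

theorem Bd.zero (hA : 0 ≤ A) (hR : 0 ≤ R) : Bd R t x n A 0 := by
  induction n generalizing A with
  | zero => simpa [Bd] using hA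
  | succ n ih => exact ⟨by simpa using hA, fun l => by
      rw [map_zero]; exact ih (mul_nonneg hA hR)⟩

theorem Bd.add (hf : Bd R t x n A f) (hg : Bd R t x n B g) : Bd R t x n (A + B) (f + g) := by
  induction n generalizing A B f g with
  | zero => exact (abs_add_le _ _).trans (add_le_add hf hg)
  | succ n ih =>
    refine ⟨(abs_add_le _ _).trans (add_le_add hf.1 hg.1), fun l => ?_⟩
    rw [map_add, add_mul]
    exact ih (hf.2 l) (hg.2 l)

theorem Bd.smul (c : ℝ) (hf : Bd R t x n A f) : Bd R t x n (|c| * A) (c • f) := by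
  induction n generalizing A f with
  | zero => exact (abs_mul _ _).trans_le (mul_le_mul_of_nonneg_left hf (abs_nonneg _))
  | succ n ih =>
    refine ⟨(abs_mul _ _).trans_le (mul_le_mul_of_nonneg_left hf.1 (abs_nonneg _)), fun l => ?_⟩
    rw [Derivation.map_smul, mul_assoc]
    exact ih (hf.2 l)

theorem Bd.neg (hf : Bd R t x n A f) : Bd R t x n A (-f) := by
  have := hf.smul (-1)
  simpa using this

theorem Bd.sub (hf : Bd R t x n A f) (hg : Bd R t x n B g) : Bd R t x n (A + B) (f - g) := by
  rw [sub_eq_add_neg]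
  exact hf.add hg.neg

/-- Leibniz rule: every differentiation doubles the number of products, hence the factor `2 ^ n`. -/
theorem Bd.mul (hf : Bd R t x n A f) (hg : Bd R t x n B g) :
    Bd R t x n (2 ^ n * (A * B)) (f * g) := by
  induction n generalizing A B f g with
  | zero =>
    simp only [Bd, mul_apply, abs_mul, pow_zero, one_mul]
    exact mul_le_mul hf hg (abs_nonneg _) (Bd.nonneg (n := 0) hf)
  | succ n ih =>
    have hA := hf.nonneg
    have hB := hg.nonneg
    refine ⟨?_, fun l => ?_⟩
    · rw [mul_apply, abs_mul]
      have h1 : |f t x| * |g t x| ≤ A * B := mul_le_mul hf.1 hg.1 (abs_nonneg _) hA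
      have h2 : (1:ℝ) ≤ 2 ^ (n + 1) := one_le_pow₀ (by norm_num)
      nlinarith [mul_nonneg hA hB]
    · rw [Derivation.leibniz, smul_eq_mul, smul_eq_mul]
      have := (ih hf.of_succ (hg.2 l)).add (ih hg.of_succ (hf.2 l))
      convert this using 1
      ring

theorem Bd.sum {ι : Type*} (s : Finset ι) {f : ι → PF} {A : ι → ℝ} (hR : 0 ≤ R)
    (h : ∀ i ∈ s, Bd R t x n (A i) (f i)) : Bd R t x n (∑ i ∈ s, A i) (∑ i ∈ s, f i) := by
  induction s using Finset.cons_induction with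
  | empty => simpa using Bd.zero le_rfl hR
  | cons a s ha ih =>
    rw [Finset.sum_cons, Finset.sum_cons]
    exact (h a (by simp)).add (ih fun i hi => h i (by simp [hi]))

theorem Bd.sum_le {ι : Type*} (s : Finset ι) {f : ι → PF} {A : ℝ} (hR : 0 ≤ R)
    (h : ∀ i ∈ s, Bd R t x n A (f i)) : Bd R t x n (s.card * A) (∑ i ∈ s, f i) := by
  have := Bd.sum s hR h
  simpa using this

theorem Bd.sum_fin {f : Fin 3 → PF} {A : ℝ} (hR : 0 ≤ R)
    (h : ∀ i, Bd R t x n A (f i)) : Bd R t x n (3 * A) (∑ i, f i) := by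
  simpa using Bd.sum_le Finset.univ hR fun i _ => h i

end Bd

/-- Bounds in terms of the norms of the iterated derivatives. -/
theorem Bd.of_iteratedFDeriv {R t : ℝ} {x : E3} {n : ℕ} {A : ℝ} {f : PF}
    (h : ∀ m ≤ n, ‖iteratedFDeriv ℝ m (f t) x‖ ≤ A * R ^ m) : Bd R t x n A f := by
  induction n generalizing A f with
  | zero => simpa [Bd] using h 0 le_rfl
  | succ n ih =>
    refine ⟨by simpa using h 0 (by simp), fun l => ih fun m hm => ?_⟩
    have h1 : (dx l f) t = fun y => (ContinuousLinearMap.apply ℝ ℝ (basisVec l)) (fderiv ℝ (f t) y) :=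
      funext fun y => (f.fderiv_basisVec t y l).symm
    have h2 : ContDiff ℝ ∞ (fderiv ℝ (f t)) := (f.contDiff_slice t).fderiv_right (by simp)
    rw [h1]
    have h3 := (ContinuousLinearMap.apply ℝ ℝ (basisVec l)).norm_iteratedFDeriv_comp_left
      (h2.contDiffAt (x := x)) (N := ∞) (n := m) (by exact_mod_cast le_top)
    have h4 : ‖ContinuousLinearMap.apply ℝ ℝ (basisVec l)‖ ≤ 1 := by
      refine ContinuousLinearMap.opNorm_le_bound _ zero_le_one fun L => ?_
      have := L.le_opNorm (basisVec l)
      rw [norm_basisVec] at this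
      simpa using this
    refine h3.trans ((mul_le_of_le_one_left (norm_nonneg _) h4).trans ?_)
    rw [norm_iteratedFDeriv_fderiv]
    refine (h (m + 1) (by omega)).trans_eq ?_
    rw [pow_succ]; ring

/-- Composition with a smooth function of one variable. -/
def comp (θ : ℝ → ℝ) (hθ : ContDiff ℝ ∞ θ) (f : PF) : PF :=
  ⟨fun t x => θ (f t x), hθ.comp f.smooth, fun t x j => by
    show θ (f t (x + (1:ℝ) • basisVec j)) = θ (f t x)
    rw [f.periodic]⟩

theorem contDiff_deriv_of_infty {θ : ℝ → ℝ} (hθ : ContDiff ℝ ∞ θ) : ContDiff ℝ ∞ (deriv θ) :=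
  ContDiff.deriv' (n := ∞) (by simpa using hθ)

theorem dir_comp (θ : ℝ → ℝ) (hθ : ContDiff ℝ ∞ θ) (f : PF) (v : ℝ × E3) :
    dir v (comp θ hθ f) = comp (deriv θ) (contDiff_deriv_of_infty hθ) f * dir v f := by
  ext t x
  have h1 : HasDerivAt θ (deriv θ (f t x)) (f t x) :=
    (hθ.differentiable (by simp) _).hasDerivAt
  have h2 := h1.comp_hasFDerivAt (t, x) (f.differentiable (t, x)).hasFDerivAt
  rw [dir_apply]
  show fderiv ℝ (θ ∘ fun p : ℝ × E3 => f p.1 p.2) (t, x) v = _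
  rw [h2.fderiv]
  rfl

/-- Iterated chain rule. Only derivatives of `f` are bounded, not `f` itself; the outer function has
bounded derivatives on the whole line. Each order costs one product, hence one factor `2 ^ n * a`.
-/
theorem Bd.compD {R t : ℝ} {x : E3} {n : ℕ} {a B : ℝ} (hR : 0 ≤ R) (ha : 1 ≤ a)
    (θ : ℝ → ℝ) (hθ : ContDiff ℝ ∞ θ) {f : PF} (hB : ∀ m ≤ n, ∀ y, |deriv^[m] θ y| ≤ B)
    (hf : ∀ m < n, ∀ l, Bd R t x m (a * R) (dx l f)) :
    Bd R t x n ((2 ^ n * a) ^ n * B) (comp θ hθ f) := by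
  have hB0 : 0 ≤ B := (abs_nonneg _).trans (hB 0 (Nat.zero_le _) 0)
  induction n generalizing θ with
  | zero => simpa [Bd, PF.comp] using hB 0 le_rfl (f t x)
  | succ n ih =>
    have h1 : (1:ℝ) ≤ 2 ^ (n + 1) * a := by
      have : (1:ℝ) ≤ 2 ^ (n + 1) := one_le_pow₀ (by norm_num)
      nlinarith
    refine ⟨?_, fun l => ?_⟩
    · refine (hB 0 (Nat.zero_le _) _).trans ?_
      exact le_mul_of_one_le_left hB0 (one_le_pow₀ h1)
    · have h2 := ih (deriv θ) (contDiff_deriv_of_infty hθ) (fun m hm y => hB (m + 1) (by omega) y)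
        (fun m hm l => hf m (by omega) l)
      have h3 := h2.mul (hf n (by omega) l)
      have h4 : dx l (PF.comp θ hθ f) = PF.comp (deriv θ) (contDiff_deriv_of_infty hθ) f * dx l f :=
        dir_comp θ hθ f _
      rw [h4]
      refine h3.mono hR ?_
      have h5 : (2 ^ n * a) ^ n ≤ (2 ^ (n + 1) * a) ^ n := by
        gcongr <;> norm_num
      have h6 : (2 ^ n * a : ℝ) ≤ 2 ^ (n + 1) * a := by gcongr <;> norm_num
      calc 2 ^ n * ((2 ^ n * a) ^ n * B * (a * R))
          = (2 ^ n * a) ^ n * (2 ^ n * a) * (B * R) := by ring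
        _ ≤ (2 ^ (n + 1) * a) ^ n * (2 ^ (n + 1) * a) * (B * R) := by gcongr
        _ = (2 ^ (n + 1) * a) ^ (n + 1) * B * R := by ring

/-! ### Iterated derivatives along words -/

/-- The iterated derivative along a word of coordinate directions. -/
def dxw : List (Fin 3) → PF → PF
  | [], f => f
  | l :: w, f => dxw w (dx l f)

theorem dxw_dir (w : List (Fin 3)) (v : ℝ × E3) (f : PF) : dxw w (dir v f) = dir v (dxw w f) := by
  induction w generalizing f with
  | nil => rfl
  | cons l w ih => simp only [dxw]; rw [dx, dir_comm, ih]

theorem dxw_dx (w : List (Fin 3)) (l : Fin 3) (f : PF) : dxw w (dx l f) = dx l (dxw w f) :=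
  dxw_dir w _ f

theorem dxw_add (w : List (Fin 3)) (f g : PF) : dxw w (f + g) = dxw w f + dxw w g := by
  induction w generalizing f g with
  | nil => rfl
  | cons l w ih => simp only [dxw, map_add, ih]

theorem dxw_sum {ι : Type*} (w : List (Fin 3)) (s : Finset ι) (f : ι → PF) :
    dxw w (∑ i ∈ s, f i) = ∑ i ∈ s, dxw w (f i) := by
  induction w generalizing f with
  | nil => rfl
  | cons l w ih => simp only [dxw, map_sum, ih]

theorem Bd.word {R t : ℝ} {x : E3} {n : ℕ} {A : ℝ} {f : PF} (w : List (Fin 3))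
    (h : Bd R t x (n + w.length) A f) : Bd R t x n (A * R ^ w.length) (dxw w f) := by
  induction w generalizing A f with
  | nil => simpa [dxw] using h
  | cons l w ih =>
    have h1 := ih (A := A * R) (f := PF.dx l f) (Bd.step (n := n + w.length) h l)
    simp only [List.length_cons, pow_succ, dxw]
    convert h1 using 1
    ring

/-- The commutator of an iterated derivative and a multiplication. -/
def comm (w : List (Fin 3)) (f g : PF) : PF := dxw w (f * g) - f * dxw w g

/-- The recursion `[∂^w ∂_l, f] g = ∂^w (∂_l f · g) + [∂^w, f] ∂_l g` shows that at least one
derivative always falls on `f`. Hence only `∇f` is bounded, and `g` is differentiated at most `|w| -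
1` times. -/
theorem abs_comm_le {R t : ℝ} {x : E3} {A B : ℝ} (hR : 0 ≤ R) (hA : 0 ≤ A) (hB : 0 ≤ B)
    (w : List (Fin 3)) (f g : PF)
    (hf : ∀ l, Bd R t x (w.length - 1) A (dx l f)) (hg : Bd R t x (w.length - 1) B g) :
    |comm w f g t x| ≤ w.length * 2 ^ w.length * (A * B * R ^ (w.length - 1)) := by
  induction w generalizing B g with
  | nil => simp [comm, dxw]
  | cons l w ih =>
    simp only [List.length_cons, Nat.add_sub_cancel] at hf hg ⊢
    have h0 : comm (l :: w) f g = dxw w (dx l f * g) + comm w f (dx l g) := by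
      simp only [comm, dxw, Derivation.leibniz, smul_eq_mul, dxw_add]
      rw [mul_comm g]; ring
    have h1 : |dxw w (dx l f * g) t x| ≤ 2 ^ w.length * (A * B) * R ^ w.length := by
      have := Bd.word (n := 0) w (by simpa using (hf l).mul hg)
      exact this
    have h2 : |comm w f (dx l g) t x| ≤ w.length * 2 ^ w.length * (A * B * R ^ w.length) := by
      rcases Nat.eq_zero_or_pos w.length with h | h
      · have : w = [] := List.length_eq_zero_iff.1 h
        subst this
        simp [comm, dxw]
      · have h3 := ih (B := B * R) (mul_nonneg hB hR) (dx l g)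
          (fun l' => (hf l').of_le (by omega))
          ((hg.of_le (m := w.length - 1 + 1) (by omega)).step l)
        refine h3.trans_eq ?_
        obtain ⟨m, hm⟩ : ∃ m, w.length = m + 1 := ⟨w.length - 1, by omega⟩
        rw [hm]
        simp only [Nat.add_sub_cancel, pow_succ]
        ring
    rw [h0, add_apply]
    have hz : 0 ≤ A * B * R ^ w.length := by positivity
    have hp : (0:ℝ) ≤ 2 ^ w.length := by positivity
    calc |dxw w (dx l f * g) t x + comm w f (dx l g) t x|
        ≤ 2 ^ w.length * (A * B) * R ^ w.length + w.length * 2 ^ w.length * (A * B * R ^ w.length) :=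
          (abs_add_le _ _).trans (add_le_add h1 h2)
      _ = (w.length + 1) * 2 ^ w.length * (A * B * R ^ w.length) := by ring
      _ ≤ (w.length + 1) * 2 ^ (w.length + 1) * (A * B * R ^ w.length) := by
          gcongr <;> norm_num
      _ = _ := by push_cast; ring

/-- The sum of the squares of all derivatives of order `j`. -/
def S : ℕ → PF → PF
  | 0, f => f ^ 2
  | j + 1, f => ∑ l, S j (dx l f)

theorem S_nonneg (j : ℕ) (f : PF) (t : ℝ) (x : E3) : 0 ≤ S j f t x := by
  induction j generalizing f with
  | zero => simp only [S, pow_apply]; positivity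
  | succ j ih =>
    simp only [S, sum_apply]
    exact Finset.sum_nonneg fun l _ => ih _

theorem Bd.of_S {R t : ℝ} {x : E3} {n : ℕ} {B : ℝ} {f : PF} (hR : 0 ≤ R) (hB : 0 ≤ B)
    (h : ∀ j ≤ n, S j f t x ≤ (B * R ^ j) ^ 2) : Bd R t x n B f := by
  have h0 : |f t x| ≤ B := by
    have := h 0 (by omega)
    simp only [S, pow_apply, pow_zero, mul_one] at this
    exact abs_le_of_sq_le_sq this hB
  induction n generalizing B f with
  | zero => exact h0
  | succ n ih =>
    refine ⟨h0, fun l => ?_⟩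
    have h1 : ∀ j ≤ n, S j (PF.dx l f) t x ≤ (B * R * R ^ j) ^ 2 := fun j hj => by
      have h2 := h (j + 1) (by omega)
      simp only [S, sum_apply] at h2
      refine (Finset.single_le_sum (f := fun l => S j (PF.dx l f) t x)
        (fun l _ => S_nonneg _ _ _ _) (Finset.mem_univ l)).trans (h2.trans_eq ?_)
      rw [pow_succ]; ring
    refine ih (mul_nonneg hB hR) h1 ?_
    have := h1 0 (by omega)
    simp only [S, pow_apply, pow_zero, mul_one] at this
    exact abs_le_of_sq_le_sq this (mul_nonneg hB hR)

/-- The words of a given length. -/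
def words : ℕ → Finset (List (Fin 3))
  | 0 => {[]}
  | j + 1 => (Finset.univ ×ˢ words j).image fun p => p.1 :: p.2

theorem cons_injective : Function.Injective fun p : Fin 3 × List (Fin 3) => p.1 :: p.2 :=
  fun p q h => by
    simp only [List.cons.injEq] at h
    exact Prod.ext h.1 h.2

theorem length_of_mem_words {j : ℕ} {w : List (Fin 3)} (h : w ∈ words j) : w.length = j := by
  induction j generalizing w with
  | zero => simp only [words, Finset.mem_singleton] at h; simp [h]
  | succ j ih =>
    simp only [words, Finset.mem_image, Finset.mem_product] at h
    obtain ⟨p, hp, rfl⟩ := h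
    simp [ih hp.2]

theorem S_eq_sum (j : ℕ) (f : PF) : S j f = ∑ w ∈ words j, dxw w f ^ 2 := by
  induction j generalizing f with
  | zero => simp [S, words, dxw]
  | succ j ih =>
    rw [words, Finset.sum_image cons_injective.injOn, Finset.sum_product]
    simp only [S, dxw, ih]

theorem card_words (j : ℕ) : (words j).card = 3 ^ j := by
  induction j with
  | zero => simp [words]
  | succ j ih => simp [words, Finset.card_image_of_injective _ cons_injective, ih, pow_succ, mul_comm]

theorem S_succ_eq (j : ℕ) (f : PF) : S (j + 1) f = ∑ w ∈ words j, Gd (dxw w f) := by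
  simp only [S, S_eq_sum, Gd]
  rw [Finset.sum_comm]
  simp only [dxw_dx]

/-- Passes from partial derivatives to the multilinear norm used for the initial datum in `D`; there
are `3 ^ j` words of length `j`. -/
theorem S_le_iteratedFDeriv (j : ℕ) (f : PF) (t : ℝ) (x : E3) :
    S j f t x ≤ 3 ^ j * ‖iteratedFDeriv ℝ j (f t) x‖ ^ 2 := by
  have key : ∀ (w : List (Fin 3)) (m : ℕ) (g : PF),
      ‖iteratedFDeriv ℝ m (dxw w g t) x‖ ≤ ‖iteratedFDeriv ℝ (m + w.length) (g t) x‖ := by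
    intro w
    induction w with
    | nil => intro m g; simp [dxw]
    | cons l w ih =>
      intro m g
      refine (ih m (dx l g)).trans ?_
      have h1 : (dx l g) t =
          fun y => (ContinuousLinearMap.apply ℝ ℝ (basisVec l)) (fderiv ℝ (g t) y) :=
        funext fun y => (g.fderiv_basisVec t y l).symm
      have h2 : ContDiff ℝ ∞ (fderiv ℝ (g t)) := (g.contDiff_slice t).fderiv_right (by simp)
      rw [h1]
      have h3 := (ContinuousLinearMap.apply ℝ ℝ (basisVec l)).norm_iteratedFDeriv_comp_left
        (h2.contDiffAt (x := x)) (N := ∞) (n := m + w.length) (by exact_mod_cast le_top)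
      have h4 : ‖ContinuousLinearMap.apply ℝ ℝ (basisVec l)‖ ≤ 1 := by
        refine ContinuousLinearMap.opNorm_le_bound _ zero_le_one fun L => ?_
        have := L.le_opNorm (basisVec l)
        rw [norm_basisVec] at this
        simpa using this
      refine h3.trans ((mul_le_of_le_one_left (norm_nonneg _) h4).trans ?_)
      rw [norm_iteratedFDeriv_fderiv]
      rfl
  rw [S_eq_sum, sum_apply]
  have h := Finset.sum_le_card_nsmul (words j) (fun w => (dxw w f ^ 2) t x)
    (‖iteratedFDeriv ℝ j (f t) x‖ ^ 2) (fun w hw => by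
      have h1 := key w 0 f
      rw [length_of_mem_words hw, zero_add] at h1
      simp only [norm_iteratedFDeriv_zero, Real.norm_eq_abs] at h1
      rw [pow_apply, ← sq_abs]
      exact pow_le_pow_left₀ (abs_nonneg _) h1 2)
  rw [card_words] at h
  simpa using h

end PF

/-! ### Auxiliary fields: square roots, functions of time, cell profiles -/

/-- A smooth function that agrees with the square root above `c`. -/
def smoothSqrt (c y : ℝ) : ℝ := Real.sqrt y * Real.smoothTransition (2 * y / c - 1)

/-- The amplitude `σ` is known to be positive only on the time interval, while fields are smooth at
all times. The root is therefore changed below a positive threshold that `σ` does not reach on the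
interval. -/
theorem smoothSqrt_eq {c y : ℝ} (hc : 0 < c) (hy : c ≤ y) : smoothSqrt c y = Real.sqrt y := by
  rw [smoothSqrt, Real.smoothTransition.one_of_one_le, mul_one]
  rw [le_sub_iff_add_le, le_div_iff₀ hc]; linarith

theorem contDiff_smoothSqrt {c : ℝ} (hc : 0 < c) : ContDiff ℝ ∞ (smoothSqrt c) := by
  rw [contDiff_iff_contDiffAt]
  intro y
  rcases lt_or_ge 0 y with hy | hy
  · refine (Real.contDiffAt_sqrt hy.ne').mul ?_
    exact (Real.smoothTransition.contDiff.comp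
      (((contDiff_const.mul contDiff_id).div_const c).sub contDiff_const)).contDiffAt
  · refine (contDiffAt_const (c := (0:ℝ))).congr_of_eventuallyEq ?_
    filter_upwards [Iio_mem_nhds (show y < c / 2 by linarith)] with z hz
    rw [smoothSqrt, Real.smoothTransition.zero_of_nonpos, mul_zero]
    rw [sub_nonpos, div_le_iff₀ hc]
    simp only [Set.mem_Iio] at hz
    linarith

theorem TorusField.clm {V : Type} [NormedAddCommGroup V] [NormedSpace ℝ V] {f : ℝ → E3 → V}
    (hf : TorusField f) (L : V →L[ℝ] ℝ) : TorusField (fun t x => L (f t x)) :=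
  ⟨L.contDiff.comp hf.1, fun t x j => congrArg L (hf.2 t x j)⟩

/-- A smooth function of time, as a field. -/
def timeField (f : ℝ → ℝ) (hf : ContDiff ℝ ∞ f) : PF :=
  ⟨fun t _ => f t, hf.comp contDiff_fst, fun _ _ _ => rfl⟩

theorem dx_timeField (f : ℝ → ℝ) (hf : ContDiff ℝ ∞ f) (l : Fin 3) :
    PF.dx l (timeField f hf) = 0 := by
  ext t x
  rw [← PF.fderiv_basisVec]
  show fderiv ℝ (fun _ : E3 => f t) x _ = 0
  simp

theorem dt_timeField (f : ℝ → ℝ) (hf : ContDiff ℝ ∞ f) (t : ℝ) (x : E3) :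
    PF.dt (timeField f hf) t x = deriv f t :=
  ((PF.hasDerivAt_time (timeField f hf) t x).deriv).symm

/-- The functions `φ k`, as cell functions. -/
def Mikado.cell (M : Mikado) (k : E3) : CF M.P := by
  classical
  exact if hk : k ∈ M.Λ then ⟨M.φ k, M.smooth k hk, M.periodic k hk⟩ else 0

theorem Mikado.cell_apply (M : Mikado) {k : E3} (hk : k ∈ M.Λ) (x : E3) :
    M.cell k x = M.φ k x := by
  simp [Mikado.cell, hk]

theorem derivation_sum_apply {ι : Type*} (s : Finset ι) (D : ι → Derivation ℝ PF PF) (f : PF) :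
    (∑ i ∈ s, D i) f = ∑ i ∈ s, D i f := by
  have h := map_sum (Derivation.coeFnAddMonoidHom (R := ℝ) (A := PF) (M := PF)) D s
  have h2 := congrFun h f
  rw [Finset.sum_apply] at h2
  exact h2

/-! ### The velocity, the cutoffs and the moving coordinates as fields -/

namespace Data.Assumptions

open PF

variable {n : ℕ} {M : Mikado} {N : ℕ} {K : ℝ} {d : Data n} (h : d.Assumptions M N K)
include h

theorem lam_pos : 0 < d.lam := lt_of_lt_of_le one_pos h.one_le_lam

/-- The components of the velocity. -/
def u (l : Fin 3) : PF := ⟨fun t x => d.u t x l, h.u_field.clm (EuclideanSpace.proj l)⟩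

/-- The advective derivative as a derivation. -/
def Dt : Derivation ℝ PF PF := dt + ∑ m, h.u m • dx m

def η (i : Fin n) : PF := ⟨d.eta i, h.eta_field i⟩
def ηt (i : Fin n) : PF := ⟨d.etat i, h.etat_field i⟩

/-- The value zero outside `Λ` spares membership proofs; every sum runs over `Λ`. -/
def a (k : E3) (i : Fin n) : PF := by
  classical
  exact if hk : k ∈ M.Λ then ⟨fun t x => d.a k (d.R i t x), h.aR_field k hk i⟩ else 0

/-- The components of `Φ_i - Id`. -/
def disp (i : Fin n) (a : Fin 3) : PF :=
  ⟨fun t x => (d.Phi i t x - x) a,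
    ((EuclideanSpace.proj a : E3 →L[ℝ] ℝ).contDiff).comp ((h.Phi_smooth i).sub contDiff_snd),
    fun t x j => congrArg (fun v : E3 => v a) (h.Phi_torus i t x j)⟩

/-- The entries of the Jacobian matrix of `Φ_i`. -/
def F (i : Fin n) : Matrix (Fin 3) (Fin 3) PF :=
  fun a l => (if a = l then 1 else 0) + dx l (h.disp i a)

/-- The adjugate of the Jacobian matrix. -/
def G (i : Fin n) : Matrix (Fin 3) (Fin 3) PF := (h.F i).adjugate

/-- The Jacobian determinant. -/
def J (i : Fin n) : PF := (h.F i).det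

/-- The components of the advective derivative of `Φ_i`. -/
def z (i : Fin n) (a : Fin 3) : PF := dt (h.disp i a) + ∑ m, h.u m * h.F i a m

/-- The derivative in the `p`-th coordinate direction of `Φ_i`. -/
def di (i : Fin n) (p : Fin 3) : Derivation ℝ PF PF := ∑ l, h.G i l p • dx l

/-- The derivative in the direction `k` of the coordinates `Φ_i`. -/
def dk (i : Fin n) (k : E3) : Derivation ℝ PF PF := ∑ p, k p • h.di i p

theorem Dt_apply (f : PF) : h.Dt f = dt f + ∑ m, h.u m * dx m f := by
  rw [Dt, Derivation.add_apply, derivation_sum_apply]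
  rfl

theorem di_apply (i : Fin n) (p : Fin 3) (f : PF) : h.di i p f = ∑ l, h.G i l p * dx l f := by
  rw [di, derivation_sum_apply]
  rfl

theorem dk_apply (i : Fin n) (k : E3) (f : PF) : h.dk i k f = ∑ p, k p • h.di i p f := by
  rw [dk, derivation_sum_apply]
  rfl

theorem exists_lam_eq : ∃ q : ℕ, d.lam = q * M.P := by
  obtain ⟨q, hq⟩ := h.lam_mul
  exact ⟨q, by rw [hq, mul_comm]⟩

theorem contDiff_lamPhi (i : Fin n) :
    ContDiff ℝ ∞ (fun p : ℝ × E3 => d.lam • d.Phi i p.1 p.2) :=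
  ContDiff.smul (f := fun _ => d.lam) (g := fun p : ℝ × E3 => d.Phi i p.1 p.2)
    contDiff_const (h.Phi_smooth i)

/-- Composition of a cell function with `λ Φ_i`. -/
def Y (i : Fin n) (f : CF M.P) : PF :=
  ⟨fun t x => f (d.lam • d.Phi i t x), f.smooth.comp (h.contDiff_lamPhi i), fun t x j => by
    obtain ⟨q, hq⟩ := h.exists_lam_eq
    have h1 : d.Phi i t (x + (1:ℝ) • basisVec j) = d.Phi i t x + basisVec j := by
      have h2 := h.Phi_torus i t x j
      simp only [one_smul] at h2 ⊢
      rw [sub_eq_sub_iff_add_eq_add] at h2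
      have h3 : d.Phi i t (x + basisVec j) + x = d.Phi i t x + basisVec j + x := by
        rw [h2]; abel
      exact add_right_cancel h3
    -- As `λ` is a natural multiple of `P`, a unit translation of the torus moves `λ Φ_i` by a
    -- period of the cell.
    have h2 : d.lam • basisVec j ∈
        Submodule.span ℤ (Set.range (periodBasis M.P M.P_pos)) := by
      have h3 := Submodule.smul_mem (Submodule.span ℤ (Set.range (periodBasis M.P M.P_pos)))
        (q : ℤ) (Submodule.subset_span ⟨j, rfl⟩)
      rw [periodBasis_apply] at h3
      convert h3 using 1
      rw [hq, mul_smul, ← Int.cast_smul_eq_zsmul ℝ]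
      simp
    show f (d.lam • d.Phi i t (x + (1:ℝ) • basisVec j)) = f (d.lam • d.Phi i t x)
    rw [h1, smul_add]
    exact f.periodic.add_lattice M.P_pos h2 _⟩

theorem Y_apply (i : Fin n) (f : CF M.P) (t : ℝ) (x : E3) :
    h.Y i f t x = f (d.lam • d.Phi i t x) := rfl

theorem Y_add (i : Fin n) (f g : CF M.P) : h.Y i (f + g) = h.Y i f + h.Y i g := rfl
theorem Y_sum {ι : Type*} (i : Fin n) (s : Finset ι) (f : ι → CF M.P) :
    h.Y i (∑ j ∈ s, f j) = ∑ j ∈ s, h.Y i (f j) := by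
  ext t x
  simp [Y_apply]
theorem Y_smul (i : Fin n) (c : ℝ) (f : CF M.P) : h.Y i (c • f) = c • h.Y i f := rfl

/-! ### The Jacobian -/

theorem dx_F (i : Fin n) (a l m : Fin 3) : dx m (h.F i a l) = dx l (h.F i a m) := by
  simp only [F, map_add]
  rw [dx_comm]
  congr 1
  split_ifs <;> simp

/-- The adjugate replaces the inverse Jacobian matrix: it is polynomial in the entries, hence a
field everywhere, and it is the inverse where the determinant is one, which is known only on the
support of `η̃_i`. -/
theorem F_mul_G (i : Fin n) (a q : Fin 3) :
    ∑ l, h.F i a l * h.G i l q = if a = q then h.J i else 0 := by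
  have h1 := congrFun (congrFun (Matrix.mul_adjugate (h.F i)) a) q
  rw [Matrix.mul_apply] at h1
  rw [G, h1, J, Matrix.smul_apply, Matrix.one_apply]
  split_ifs <;> simp

theorem G_mul_F (i : Fin n) (a q : Fin 3) :
    ∑ l, h.G i a l * h.F i l q = if a = q then h.J i else 0 := by
  have h1 := congrFun (congrFun (Matrix.adjugate_mul (h.F i)) a) q
  rw [Matrix.mul_apply] at h1
  rw [G, h1, J, Matrix.smul_apply, Matrix.one_apply]
  split_ifs <;> simp

/-- The Piola identity. -/
theorem piola (i : Fin n) (p : Fin 3) : ∑ l, dx l (h.G i l p) = 0 := by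
  have e := h.dx_F i
  simp only [G, Matrix.adjugate_fin_three, Fin.sum_univ_three]
  fin_cases p <;>
  simp [Derivation.leibniz, e _ 1 0, e _ 2 0, e _ 2 1] <;> ring

/-- By the Piola identity `di` is a divergence, so integration by parts in the moving coordinates is
exact and needs no condition on the determinant. -/
theorem I_di (i : Fin n) (p : Fin 3) (t : ℝ) (f : PF) : I t (h.di i p f) = 0 := by
  have h1 : h.di i p f = ∑ l, dx l (h.G i l p * f) := by
    simp only [Derivation.leibniz, smul_eq_mul, Finset.sum_add_distrib, ← Finset.mul_sum, h.piola,
      mul_zero, add_zero]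
    exact h.di_apply i p f
  rw [h1, I_sum]
  exact Finset.sum_eq_zero fun l _ => I_dx _ _ _

theorem I_dk (i : Fin n) (k : E3) (t : ℝ) (f : PF) : I t (h.dk i k f) = 0 := by
  rw [dk_apply, I_sum]
  exact Finset.sum_eq_zero fun p _ => by rw [I_smul, h.I_di, mul_zero]

theorem fderiv_Phi (i : Fin n) (t : ℝ) (x : E3) (a l : Fin 3) :
    (fderiv ℝ (d.Phi i t) x (basisVec l)) a = h.F i a l t x := by
  have hd : DifferentiableAt ℝ (d.Phi i t) x :=
    (((h.Phi_smooth i).comp (contDiff_const.prodMk contDiff_id)).differentiable (by simp)) x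
  have h1 : HasFDerivAt (fun y => (d.Phi i t y - y) a)
      ((EuclideanSpace.proj a : E3 →L[ℝ] ℝ).comp
        (fderiv ℝ (d.Phi i t) x - ContinuousLinearMap.id ℝ E3)) x :=
    (EuclideanSpace.proj a : E3 →L[ℝ] ℝ).hasFDerivAt.comp x
      (hd.hasFDerivAt.sub (hasFDerivAt_id x))
  have h2 := (h.disp i a).fderiv_basisVec t x l
  have h3 : fderiv ℝ (h.disp i a t) x = _ := h1.fderiv
  rw [h3] at h2
  simp only [F, add_apply, ← h2]
  show _ = _ + ((fderiv ℝ (d.Phi i t) x (basisVec l)) a - (basisVec l) a)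
  rw [basisVec_apply]
  split_ifs <;> simp

theorem hasFDerivAt_lamPhi (i : Fin n) (t : ℝ) (x : E3) :
    DifferentiableAt ℝ (fun p : ℝ × E3 => d.lam • d.Phi i p.1 p.2) (t, x) :=
  (h.contDiff_lamPhi i).differentiable (by simp) _

theorem dir_Y (i : Fin n) (f : CF M.P) (v : ℝ × E3) (t : ℝ) (x : E3) :
    dir v (h.Y i f) t x = ∑ a, (fderiv ℝ (fun p : ℝ × E3 => d.lam • d.Phi i p.1 p.2) (t, x) v) a *
      CF.pd a f (d.lam • d.Phi i t x) := by
  rw [← CF.fderiv_eq_sum, dir_apply]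
  have h1 := ((f.differentiable (d.lam • d.Phi i t x)).hasFDerivAt).comp (t, x)
    (h.hasFDerivAt_lamPhi i t x).hasFDerivAt
  have h2 : fderiv ℝ (fun p : ℝ × E3 => h.Y i f p.1 p.2) (t, x) = _ := h1.fderiv
  rw [h2]
  rfl

theorem dx_Y (i : Fin n) (f : CF M.P) (l : Fin 3) :
    dx l (h.Y i f) = d.lam • ∑ a, h.Y i (CF.pd a f) * h.F i a l := by
  ext t x
  rw [dx, h.dir_Y]
  simp only [smul_apply, sum_apply, mul_apply, Y_apply, Finset.mul_sum]
  refine Finset.sum_congr rfl fun a _ => ?_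
  have h1 := (h.hasFDerivAt_lamPhi i t x).hasFDerivAt.comp x (hasFDerivAt_prodMk_right t x)
  have hd : DifferentiableAt ℝ (d.Phi i t) x :=
    (((h.Phi_smooth i).comp (contDiff_const.prodMk contDiff_id)).differentiable (by simp)) x
  have h2 := hd.hasFDerivAt.const_smul d.lam
  have h3 := congrArg (fun L : E3 →L[ℝ] E3 => (L (basisVec l)) a) (h1.unique h2)
  simp only at h3
  have h4 : (fderiv ℝ (fun p : ℝ × E3 => d.lam • d.Phi i p.1 p.2) (t, x) (0, basisVec l)) a =
      d.lam * h.F i a l t x := by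
    rw [← h.fderiv_Phi]
    exact h3
  rw [h4]; ring

theorem deriv_Phi (i : Fin n) (t : ℝ) (x : E3) (a : Fin 3) :
    HasDerivAt (fun s => d.Phi i s x a) (dt (h.disp i a) t x) t := by
  have h1 := ((h.disp i a).hasDerivAt_time t x).add_const (x a)
  refine h1.congr_of_eventuallyEq (Eventually.of_forall fun s => ?_)
  simp [disp]

theorem hasDerivAt_Phi (i : Fin n) (t : ℝ) (x : E3) :
    DifferentiableAt ℝ (fun s => d.Phi i s x) t :=
  (((h.Phi_smooth i).comp (contDiff_id.prodMk contDiff_const)).differentiable (by simp)) t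

theorem deriv_Phi_apply (i : Fin n) (t : ℝ) (x : E3) (a : Fin 3) :
    (deriv (fun s => d.Phi i s x) t) a = dt (h.disp i a) t x := by
  have h1 := (EuclideanSpace.proj a : E3 →L[ℝ] ℝ).hasFDerivAt.comp_hasDerivAt t
    (h.hasDerivAt_Phi i t x).hasDerivAt
  exact h1.unique (h.deriv_Phi i t x a)

theorem dt_Y (i : Fin n) (f : CF M.P) :
    dt (h.Y i f) = d.lam • ∑ a, h.Y i (CF.pd a f) * dt (h.disp i a) := by
  ext t x
  rw [dt, h.dir_Y]
  simp only [smul_apply, sum_apply, mul_apply, Y_apply, Finset.mul_sum]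
  refine Finset.sum_congr rfl fun a _ => ?_
  have h1 := (h.hasFDerivAt_lamPhi i t x).hasFDerivAt.comp (f := fun s : ℝ => (s, x)) t
    (hasFDerivAt_prodMk_left t x)
  have h2 := (h.hasDerivAt_Phi i t x).hasDerivAt.const_smul d.lam
  have h3 := h1.hasDerivAt.unique h2
  have h4 : (fderiv ℝ (fun p : ℝ × E3 => d.lam • d.Phi i p.1 p.2) (t, x) (1, 0)) a =
      d.lam * dt (h.disp i a) t x := by
    rw [← h.deriv_Phi_apply]
    exact congrArg (fun v : E3 => v a) h3
  rw [h4]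
  show _ = d.lam * (_ * dt (h.disp i a) t x)
  ring

theorem Dt_Y (i : Fin n) (f : CF M.P) :
    h.Dt (h.Y i f) = d.lam • ∑ a, h.Y i (CF.pd a f) * h.z i a := by
  rw [Dt_apply, dt_Y]
  simp only [dx_Y, z, mul_add, Finset.sum_add_distrib, smul_add]
  congr 1
  simp only [mul_smul_comm, ← Finset.smul_sum]
  congr 1
  simp only [Finset.mul_sum]
  rw [Finset.sum_comm]
  refine Finset.sum_congr rfl fun a _ => Finset.sum_congr rfl fun m _ => ?_
  ring

/-- Chain rule with `F G = J`: a moving coordinate derivative sees only the cell derivative with the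
same index. -/
theorem di_Y (i : Fin n) (p : Fin 3) (f : CF M.P) :
    h.di i p (h.Y i f) = d.lam • (h.J i * h.Y i (CF.pd p f)) := by
  rw [di_apply]
  simp only [dx_Y, mul_smul_comm, ← Finset.smul_sum]
  congr 1
  simp only [Finset.mul_sum]
  rw [Finset.sum_comm]
  have h1 : ∀ a, ∑ l, h.G i l p * (h.Y i (CF.pd a f) * h.F i a l) =
      h.Y i (CF.pd a f) * ∑ l, h.F i a l * h.G i l p := fun a => by
    rw [Finset.mul_sum]
    exact Finset.sum_congr rfl fun l _ => by ring
  simp only [h1, F_mul_G]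
  simp [mul_comm]

theorem dk_Y (i : Fin n) (k : E3) (f : CF M.P) :
    h.dk i k (h.Y i f) = d.lam • (h.J i * h.Y i (CF.kd k f)) := by
  rw [dk_apply]
  simp only [di_Y, CF.kd, Y_sum, Y_smul, Finset.mul_sum, Finset.smul_sum]
  refine Finset.sum_congr rfl fun p _ => ?_
  rw [smul_comm, mul_smul_comm]

theorem dx_Dt (l : Fin 3) (f : PF) :
    h.Dt (dx l f) = dx l (h.Dt f) - ∑ m, dx l (h.u m) * dx m f := by
  simp only [Dt_apply, map_add, map_sum, Derivation.leibniz, smul_eq_mul, Finset.sum_add_distrib,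
    dt_dx]
  have h1 : ∀ m, h.u m * dx m (dx l f) = h.u m * dx l (dx m f) := fun m => by rw [dx_comm]
  have h2 : ∀ m, dx m f * dx l (h.u m) = dx l (h.u m) * dx m f := fun m => mul_comm _ _
  simp only [h1, h2]
  abel

/-- Spatial derivative of `z = D_t Φ`. Where `Φ` is transported this is the law `D_t ∇Φ = -∇Φ ∇u`,
from which both the commutation of `D_t` with `di` and the bound on `∇u` follow. -/
theorem Dt_F (i : Fin n) (a l : Fin 3) :
    h.Dt (h.F i a l) = dx l (h.z i a) - ∑ m, dx l (h.u m) * h.F i a m := by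
  have h1 : h.Dt (h.F i a l) = h.Dt (dx l (h.disp i a)) := by
    simp only [F, map_add]
    split_ifs <;> simp
  rw [h1, dx_Dt, Dt_apply]
  have h2 : h.z i a = h.Dt (h.disp i a) + h.u a := by
    rw [z, Dt_apply]
    simp only [F, mul_add, Finset.sum_add_distrib]
    simp
    abel
  rw [h2, map_add, Dt_apply]
  simp only [F, mul_add, Finset.sum_add_distrib]
  simp
  abel

/-- The coefficients of the commutator of two coordinate derivatives. -/
theorem di_di_sub (i : Fin n) (p q : Fin 3) (f : PF) :
    h.di i p (h.di i q f) - h.di i q (h.di i p f) =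
      ∑ l, (h.di i p (h.G i l q) - h.di i q (h.G i l p)) * dx l f := by
  have e : ∀ p q, h.di i p (h.di i q f) =
      ∑ l, h.di i p (h.G i l q) * dx l f + ∑ l, ∑ m, h.G i l q * h.G i m p * dx m (dx l f) := by
    intro p q
    conv_lhs => rw [h.di_apply i q f]
    simp only [map_sum, Derivation.leibniz, smul_eq_mul, Finset.sum_add_distrib]
    rw [add_comm]
    congr 1
    · exact Finset.sum_congr rfl fun l _ => mul_comm _ _
    · refine Finset.sum_congr rfl fun l _ => ?_
      rw [di_apply, Finset.mul_sum]
      exact Finset.sum_congr rfl fun m _ => by ring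
  rw [e p q, e q p]
  have e2 : ∑ l, ∑ m, h.G i l q * h.G i m p * dx m (dx l f) =
      ∑ l, ∑ m, h.G i l p * h.G i m q * dx m (dx l f) := by
    rw [Finset.sum_comm]
    refine Finset.sum_congr rfl fun m _ => Finset.sum_congr rfl fun l _ => ?_
    rw [dx_comm]; ring
  rw [e2]
  simp only [sub_mul, Finset.sum_sub_distrib]
  abel

/-- Differentiating `F G = J Id` expresses `F` applied to the bracket by derivatives of `J`, since
the second derivatives of `Φ` are symmetric and drop out. Multiplication by `G` then isolates the
bracket. So it vanishes where `J` is locally one. -/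
theorem J_mul_bracket (i : Fin n) (p q b : Fin 3) :
    h.J i * (h.di i p (h.G i b q) - h.di i q (h.G i b p)) =
      h.G i b q * h.di i p (h.J i) - h.G i b p * h.di i q (h.J i) := by
  have e : ∀ p q a, ∑ l, h.F i a l * h.di i p (h.G i l q) =
      (if a = q then h.di i p (h.J i) else 0) -
        ∑ l, ∑ m, h.G i l q * h.G i m p * dx m (h.F i a l) := by
    intro p q a
    have h1 := congrArg (h.di i p) (h.F_mul_G i a q)
    simp only [map_sum, Derivation.leibniz, smul_eq_mul, Finset.sum_add_distrib] at h1
    have h2 : h.di i p (if a = q then h.J i else 0) = if a = q then h.di i p (h.J i) else 0 := by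
      split_ifs <;> simp
    rw [h2] at h1
    rw [← h1, eq_sub_iff_add_eq]
    congr 1
    refine Finset.sum_congr rfl fun l _ => ?_
    rw [di_apply, Finset.mul_sum]
    exact Finset.sum_congr rfl fun m _ => by ring
  have e2 : ∀ a, ∑ l, ∑ m, h.G i l q * h.G i m p * dx m (h.F i a l) =
      ∑ l, ∑ m, h.G i l p * h.G i m q * dx m (h.F i a l) := fun a => by
    rw [Finset.sum_comm]
    refine Finset.sum_congr rfl fun m _ => Finset.sum_congr rfl fun l _ => ?_
    rw [h.dx_F]; ring
  have e3 : ∀ a, ∑ l, h.F i a l * (h.di i p (h.G i l q) - h.di i q (h.G i l p)) =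
      (if a = q then h.di i p (h.J i) else 0) - (if a = p then h.di i q (h.J i) else 0) := by
    intro a
    simp only [mul_sub, Finset.sum_sub_distrib]
    rw [e p q a, e q p a, e2 a]
    abel
  have e4 : ∀ c : Fin 3 → PF, ∑ a, h.G i b a * ∑ l, h.F i a l * c l = h.J i * c b := by
    intro c
    simp only [Finset.mul_sum, ← mul_assoc]
    rw [Finset.sum_comm]
    simp only [← Finset.sum_mul, G_mul_F]
    simp
  rw [← e4 fun b => h.di i p (h.G i b q) - h.di i q (h.G i b p)]
  simp only [e3]
  simp [mul_sub]

theorem Dt_di_sub (i : Fin n) (p : Fin 3) (f : PF) :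
    h.Dt (h.di i p f) - h.di i p (h.Dt f) =
      ∑ l, (h.Dt (h.G i l p) - h.di i p (h.u l)) * dx l f := by
  simp only [di_apply, map_sum, Derivation.leibniz, smul_eq_mul, dx_Dt, mul_sub,
    Finset.sum_add_distrib, Finset.sum_sub_distrib, sub_mul, Finset.sum_mul, Finset.mul_sum]
  have h1 : ∑ x, ∑ y, h.G i x p * (dx x (h.u y) * dx y f) =
      ∑ x, ∑ y, h.G i y p * dx y (h.u x) * dx x f := by
    rw [Finset.sum_comm]
    exact Finset.sum_congr rfl fun _ _ => Finset.sum_congr rfl fun _ _ => by ring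
  have h2 : ∑ x, dx x f * h.Dt (h.G i x p) = ∑ x, h.Dt (h.G i x p) * dx x f :=
    Finset.sum_congr rfl fun _ _ => mul_comm _ _
  rw [h1, h2]
  abel

/-- The same argument with the advective derivative of `F G = J Id` and the transport law `Dt_F`:
the commutator coefficients are made of derivatives of `J` and of `z`. -/
theorem J_mul_transport (i : Fin n) (p b : Fin 3) :
    h.J i * (h.Dt (h.G i b p) - h.di i p (h.u b)) =
      h.G i b p * h.Dt (h.J i) - ∑ a, h.G i b a * h.di i p (h.z i a) := by
  have e : ∀ a, ∑ l, h.F i a l * (h.Dt (h.G i l p) - h.di i p (h.u l)) =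
      (if a = p then h.Dt (h.J i) else 0) - h.di i p (h.z i a) := by
    intro a
    have h1 := congrArg h.Dt (h.F_mul_G i a p)
    simp only [map_sum, Derivation.leibniz, smul_eq_mul, Finset.sum_add_distrib] at h1
    have h2 : h.Dt (if a = p then h.J i else 0) = if a = p then h.Dt (h.J i) else 0 := by
      split_ifs <;> simp
    rw [h2] at h1
    simp only [mul_sub, Finset.sum_sub_distrib]
    rw [← h1]
    simp only [Dt_F, mul_sub, Finset.sum_sub_distrib, di_apply, Finset.mul_sum]
    have h3 : ∑ x, ∑ y, h.G i x p * (dx x (h.u y) * h.F i a y) =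
        ∑ x, ∑ y, h.F i a x * (h.G i y p * dx y (h.u x)) := by
      rw [Finset.sum_comm]
      exact Finset.sum_congr rfl fun _ _ => Finset.sum_congr rfl fun _ _ => by ring
    rw [h3]
    abel
  have e4 : ∀ c : Fin 3 → PF, ∑ a, h.G i b a * ∑ l, h.F i a l * c l = h.J i * c b := by
    intro c
    simp only [Finset.mul_sum, ← mul_assoc]
    rw [Finset.sum_comm]
    simp only [← Finset.sum_mul, G_mul_F]
    simp
  rw [← e4 fun b => h.Dt (h.G i b p) - h.di i p (h.u b)]
  simp only [e]
  simp [mul_sub]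

end Data.Assumptions

/-! ### Generic points of the cutoffs -/

namespace PF

theorem matDeriv_eq {v : ℝ → E3 → E3} (f : PF) (t : ℝ) (x : E3) :
    matDeriv v (fun t x => f t x) t x = dt f t x + ∑ l, v t x l * dx l f t x := by
  rw [matDeriv, (f.hasDerivAt_time t x).deriv, ← fderiv_eq_sum]

theorem isOpen_ne (f : PF) : IsOpen {y : ℝ × E3 | f y.1 y.2 ≠ 0} :=
  isOpen_ne_fun f.continuous continuous_const

/-- The function is nonzero at the point or vanishes near it. -/
def Dich (f : PF) (y : ℝ × E3) : Prop := f y.1 y.2 ≠ 0 ∨ EqAt y.1 y.2 f 0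

theorem isOpen_dich (f : PF) : IsOpen {y | Dich f y} := by
  have h1 : IsOpen {y : ℝ × E3 | EqAt y.1 y.2 f 0} := isOpen_setOfPred_eventually_nhds
  exact f.isOpen_ne.union h1

/-- A point outside the closure of `{f ≠ 0}` has a neighbourhood on which `f` vanishes; the
remaining points are limits of points with `f ≠ 0`. -/
theorem dense_dich (f : PF) : Dense {y | Dich f y} := by
  intro y
  by_cases h : y ∈ closure {y : ℝ × E3 | f y.1 y.2 ≠ 0}
  · exact closure_mono (fun y hy => Or.inl hy) h
  · refine subset_closure (Or.inr ?_)
    have h2 : ∀ᶠ y' in 𝓝 y, y' ∉ closure {y : ℝ × E3 | f y.1 y.2 ≠ 0} :=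
      isClosed_closure.isOpen_compl.mem_nhds h
    refine h2.mono fun y' hy' => ?_
    by_contra h3
    exact hy' (subset_closure h3)

end PF

namespace Data.Assumptions

open PF

variable {n : ℕ} {M : Mikado} {N : ℕ} {K : ℝ} {d : Data n} (h : d.Assumptions M N K)

/-- A point of space-time at which every cutoff is nonzero or vanishes in a neighbourhood. -/
structure Good (t : ℝ) (x : E3) : Prop where
  mem : t ∈ Ioo 0 d.T
  eta : ∀ i, Dich (h.η i) (t, x)
  etat : ∀ i, Dich (h.ηt i) (t, x)

include h

theorem mem_closure_good {t : ℝ} (ht : t ∈ Ioo 0 d.T) (x : E3) :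
    (t, x) ∈ closure {y : ℝ × E3 | h.Good y.1 y.2} := by
  have h1 : Dense (⋂ i, {y : ℝ × E3 | Dich (h.η i) y}) :=
    dense_iInter_of_isOpen (fun i => isOpen_dich _) fun i => dense_dich _
  have h2 : Dense (⋂ i, {y : ℝ × E3 | Dich (h.ηt i) y}) :=
    dense_iInter_of_isOpen (fun i => isOpen_dich _) fun i => dense_dich _
  have h3 := h1.inter_of_isOpen_right h2 (isOpen_iInter_of_finite fun i => isOpen_dich _)
  have h4 : IsOpen {y : ℝ × E3 | y.1 ∈ Ioo 0 d.T} := isOpen_Ioo.preimage continuous_fst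
  have h5 := h3.open_subset_closure_inter h4 (show (t, x) ∈ {y : ℝ × E3 | y.1 ∈ Ioo 0 d.T} from ht)
  refine closure_mono ?_ h5
  rintro y ⟨hy, hy1, hy2⟩
  exact ⟨hy, fun i => Set.mem_iInter.1 hy1 i, fun i => Set.mem_iInter.1 hy2 i⟩

/-- The good points are dense and fields are continuous, so pointwise inequalities need to be proved
only where each cutoff is nonzero or locally zero. The boundaries of the supports never have to be
considered. -/
theorem le_of_good {f g : PF} (hfg : ∀ t x, h.Good t x → f t x ≤ g t x) {t : ℝ}
    (ht : t ∈ Ioo 0 d.T) (x : E3) : f t x ≤ g t x := by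
  have h1 : IsClosed {y : ℝ × E3 | f y.1 y.2 ≤ g y.1 y.2} :=
    isClosed_le f.continuous g.continuous
  exact closure_minimal (fun y hy => hfg y.1 y.2 hy) h1 (h.mem_closure_good ht x)

theorem eq_of_good {f g : PF} (hfg : ∀ t x, h.Good t x → f t x = g t x) {t : ℝ}
    (ht : t ∈ Ioo 0 d.T) (x : E3) : f t x = g t x :=
  le_antisymm (h.le_of_good (fun t x hy => (hfg t x hy).le) ht x)
    (h.le_of_good (fun t x hy => (hfg t x hy).ge) ht x)

theorem I_le_of_good {f g : PF} (hfg : ∀ t x, h.Good t x → f t x ≤ g t x) {t : ℝ}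
    (ht : t ∈ Ioo 0 d.T) : I t f ≤ I t g := I_mono fun x => h.le_of_good hfg ht x

theorem I_eq_of_good {f g : PF} (hfg : ∀ t x, h.Good t x → f t x = g t x) {t : ℝ}
    (ht : t ∈ Ioo 0 d.T) : I t f = I t g := I_congr fun x => h.eq_of_good hfg ht x

theorem eventually_mem {t : ℝ} (ht : t ∈ Ioo 0 d.T) (x : E3) :
    ∀ᶠ y : ℝ × E3 in 𝓝 (t, x), y.1 ∈ Ioo 0 d.T :=
  (isOpen_Ioo.preimage continuous_fst).mem_nhds ht

theorem eqAt_of_forall {f g : PF} {t : ℝ} (ht : t ∈ Ioo 0 d.T) (x : E3)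
    (hfg : ∀ t ∈ Icc 0 d.T, ∀ x, f t x = g t x) : EqAt t x f g :=
  (h.eventually_mem ht x).mono fun y hy => hfg y.1 (Ioo_subset_Icc_self hy) y.2

theorem one_le_K : 1 ≤ K := by
  have h0 : (0:ℝ) ∈ Icc 0 d.T := ⟨le_rfl, h.T_pos.le⟩
  refine le_trans ?_ (h.overlap 0 h0 0)
  have h1 : ∃ i, d.etat i 0 0 ≠ 0 := by
    by_contra hc
    push Not at hc
    have h2 := h.etat_sum 0 h0 0
    simp [hc] at h2
  have h2 : ({i | d.etat i 0 0 ≠ 0} : Set (Fin n)).Nonempty := h1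
  have h3 := (Set.ncard_pos (Set.toFinite _)).2 h2
  exact_mod_cast h3

/-- The root of the amplitude, smoothly extended in time. -/
def s : PF :=
  timeField (fun t => smoothSqrt (d.delta / (2 * (|K| + 1))) (d.sigma t))
    ((contDiff_smoothSqrt (div_pos h.delta_pos (by positivity))).comp h.sigma_smooth)

theorem lt_sigma {t : ℝ} (ht : t ∈ Icc 0 d.T) : d.delta / (2 * (|K| + 1)) < d.sigma t := by
  have hK := h.one_le_K
  refine lt_of_lt_of_le ?_ (h.sigma_delta t ht).1
  rw [abs_of_pos (by linarith), inv_mul_eq_div]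
  exact div_lt_div_of_pos_left h.delta_pos (by linarith) (by linarith)

theorem sigma_pos {t : ℝ} (ht : t ∈ Icc 0 d.T) : 0 < d.sigma t :=
  lt_trans (div_pos h.delta_pos (by positivity)) (h.lt_sigma ht)

theorem s_eq {t : ℝ} (ht : t ∈ Icc 0 d.T) (x : E3) : h.s t x = Real.sqrt (d.sigma t) :=
  smoothSqrt_eq (div_pos h.delta_pos (by positivity)) (h.lt_sigma ht).le

theorem s_pos {t : ℝ} (ht : t ∈ Icc 0 d.T) (x : E3) : 0 < h.s t x := by
  rw [h.s_eq ht]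
  exact Real.sqrt_pos.2 (h.sigma_pos ht)

theorem s_sq {t : ℝ} (ht : t ∈ Icc 0 d.T) (x : E3) : h.s t x ^ 2 = d.sigma t := by
  rw [h.s_eq ht, Real.sq_sqrt (h.sigma_pos ht).le]

theorem dt_s {t : ℝ} (ht : t ∈ Ioo 0 d.T) (x : E3) :
    |dt h.s t x| ≤ K * h.s t x * d.tau⁻¹ := by
  have hs : EqAt t x (h.s * h.s) (timeField d.sigma h.sigma_smooth) :=
    h.eqAt_of_forall ht x fun t ht x => by
      rw [mul_apply, ← sq, h.s_sq ht]; rfl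
  have h1 := hs.dtD.eq
  rw [dt_timeField, Derivation.leibniz] at h1
  simp only [smul_eq_mul, add_apply, mul_apply] at h1
  have h2 := h.sigma_deriv t (Ioo_subset_Icc_self ht)
  rw [← h1, ← h.s_sq (Ioo_subset_Icc_self ht) x] at h2
  have hp := h.s_pos (Ioo_subset_Icc_self ht) x
  have h3 : |h.s t x * dt h.s t x + h.s t x * dt h.s t x| = 2 * h.s t x * |dt h.s t x| := by
    rw [← two_mul, abs_mul, abs_mul, abs_of_pos hp, abs_two]; ring
  rw [h3] at h2
  have hK := h.one_le_K
  have ht' := inv_pos.2 h.tau_pos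
  have h4 : h.s t x * (2 * |dt h.s t x|) ≤ h.s t x * (K * h.s t x * d.tau⁻¹) := by
    calc _ = 2 * h.s t x * |dt h.s t x| := by ring
      _ ≤ _ := h2
      _ = _ := by ring
  have h5 := le_of_mul_le_mul_left h4 hp
  nlinarith [abs_nonneg (dt h.s t x)]

theorem dx_s (l : Fin 3) : dx l h.s = 0 := dx_timeField _ _ _

/-- The normalized amplitude `η_i σ^{1/2} / (κ λ)`. -/
def q (i : Fin n) : PF := (d.kappa * d.lam)⁻¹ • (h.η i * h.s)

/-- The effective diffusivity as a field. -/
def kb : PF := d.kappa • (1 + ∑ i, h.q i ^ 2)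

theorem q_apply (i : Fin n) (t : ℝ) (x : E3) :
    h.q i t x = (d.kappa * d.lam)⁻¹ * (d.eta i t x * h.s t x) := rfl

theorem kb_apply (t : ℝ) (x : E3) : h.kb t x = d.kappa * (1 + ∑ i, h.q i t x ^ 2) := by
  simp [kb, mul_add]

theorem kb_eq {t : ℝ} (ht : t ∈ Icc 0 d.T) (x : E3) : h.kb t x = d.kbar t x := by
  rw [kb_apply, Data.kbar]
  congr 2
  refine Finset.sum_congr rfl fun i _ => ?_
  rw [q_apply, mul_pow, mul_pow, h.s_sq ht]
  field_simp [h.kappa_pos.ne', h.lam_pos.ne']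

theorem kappa_le_kb (t : ℝ) (x : E3) : d.kappa ≤ h.kb t x := by
  rw [kb_apply]
  have : 0 ≤ ∑ i, h.q i t x ^ 2 := by positivity
  nlinarith [h.kappa_pos]

theorem kb_pos (t : ℝ) (x : E3) : 0 < h.kb t x := h.kappa_pos.trans_le (h.kappa_le_kb t x)

theorem matDeriv_u (f : PF) (t : ℝ) (x : E3) :
    matDeriv d.u (fun t x => f t x) t x = h.Dt f t x := by
  rw [matDeriv_eq, Dt_apply]
  simp [u]

theorem Dt_congr {f g : PF} {t : ℝ} {x : E3} (hfg : EqAt t x f g) : EqAt t x (h.Dt f) (h.Dt g) := by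
  rw [Dt_apply, Dt_apply]
  exact hfg.dtD.add (EqAt.sum _ fun m _ => (EqAt.refl _).mul (hfg.dxD m))

theorem di_congr {f g : PF} {t : ℝ} {x : E3} (i : Fin n) (p : Fin 3) (hfg : EqAt t x f g) :
    EqAt t x (h.di i p f) (h.di i p g) := by
  rw [di_apply, di_apply]
  exact EqAt.sum _ fun m _ => (EqAt.refl _).mul (hfg.dxD m)

theorem dk_congr {f g : PF} {t : ℝ} {x : E3} (i : Fin n) (k : E3) (hfg : EqAt t x f g) :
    EqAt t x (h.dk i k f) (h.dk i k g) := by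
  rw [dk_apply, dk_apply]
  exact EqAt.sum _ fun m _ => (h.di_congr i m hfg).smul _

theorem Dt_kb {t : ℝ} (ht : t ∈ Ioo 0 d.T) (x : E3) :
    |h.Dt h.kb t x| ≤ K * d.tau⁻¹ * h.kb t x := by
  have ht' := Ioo_subset_Icc_self ht
  have h1 := h.kbar_transport t ht' x
  rw [← h.kb_eq ht'] at h1
  have h2 : matDeriv d.u d.kbar t x = matDeriv d.u (fun t x => h.kb t x) t x := by
    rw [matDeriv, matDeriv]
    congr 1
    · refine EventuallyEq.deriv_eq ?_
      filter_upwards [isOpen_Ioo.mem_nhds ht] with t' ht'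
      exact (h.kb_eq (Ioo_subset_Icc_self ht') x).symm
    · have h3 : d.kbar t = fun x => h.kb t x := funext fun x => (h.kb_eq ht' x).symm
      rw [h3]
  rwa [h2, matDeriv_u] at h1

/-! ### The scales -/

/-- The local inverse length scale. -/
def R (t : ℝ) (x : E3) : ℝ := (Real.sqrt (d.tau * h.kb t x))⁻¹

omit h in
/-- The inverse length scale of diffusion with coefficient `κ`. -/
def nu (d : Data n) : ℝ := (Real.sqrt (d.tau * d.kappa))⁻¹

theorem R_pos (t : ℝ) (x : E3) : 0 < h.R t x :=
  inv_pos.2 (Real.sqrt_pos.2 (mul_pos h.tau_pos (h.kb_pos t x)))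

theorem nu_pos : 0 < nu d := inv_pos.2 (Real.sqrt_pos.2 (mul_pos h.tau_pos h.kappa_pos))

theorem R_sq (t : ℝ) (x : E3) : h.R t x ^ 2 = (d.tau * h.kb t x)⁻¹ := by
  rw [R, inv_pow, Real.sq_sqrt (mul_pos h.tau_pos (h.kb_pos t x)).le]

theorem nu_sq : nu d ^ 2 = (d.tau * d.kappa)⁻¹ := by
  rw [nu, inv_pow, Real.sq_sqrt (mul_pos h.tau_pos h.kappa_pos).le]

/-- This is what determines `R`: diffusion with coefficient `κ̄` acts at length `R⁻¹` in time `τ`.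
-/
theorem kb_mul_R_sq (t : ℝ) (x : E3) : h.kb t x * h.R t x ^ 2 = d.tau⁻¹ := by
  rw [R_sq]
  have := (h.kb_pos t x).ne'
  have := h.tau_pos.ne'
  field_simp

theorem R_le_nu (t : ℝ) (x : E3) : h.R t x ≤ nu d := by
  rw [R, nu]
  refine inv_anti₀ (Real.sqrt_pos.2 (mul_pos h.tau_pos h.kappa_pos)) (Real.sqrt_le_sqrt ?_)
  exact mul_le_mul_of_nonneg_left (h.kappa_le_kb t x) h.tau_pos.le

theorem tau_kb_le_one {t : ℝ} (ht : t ∈ Icc 0 d.T) (x : E3) : d.tau * h.kb t x ≤ 1 := by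
  have h1 := h.tau_kbar_lam t ht x
  rw [← h.kb_eq ht] at h1
  have hb : 0 < d.b := lt_trans one_pos h.one_lt_b
  have h2 : d.lam ^ (-(2 * d.gamma)) ≤ 1 :=
    Real.rpow_le_one_of_one_le_of_nonpos h.one_le_lam (by have := h.gamma_pos; linarith)
  have h3 : 1 ≤ d.lam ^ (2 / d.b) := Real.one_le_rpow h.one_le_lam (by positivity)
  have h4 := mul_pos h.tau_pos (h.kb_pos t x)
  nlinarith

theorem one_le_R {t : ℝ} (ht : t ∈ Icc 0 d.T) (x : E3) : 1 ≤ h.R t x := by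
  rw [R, one_le_inv₀ (Real.sqrt_pos.2 (mul_pos h.tau_pos (h.kb_pos t x)))]
  exact Real.sqrt_le_one.2 (h.tau_kb_le_one ht x)

theorem inv_ell_le_R {t : ℝ} (ht : t ∈ Icc 0 d.T) (x : E3) : d.ell⁻¹ ≤ h.R t x := by
  have h1 := h.tau_kbar_ell t ht x
  rw [← h.kb_eq ht] at h1
  have h2 : d.ell⁻¹ ^ 2 ≤ h.R t x ^ 2 := by
    have h3 : d.ell⁻¹ ^ 2 ≤ 1 / (d.tau * h.kb t x) :=
      (le_div_iff₀ (mul_pos h.tau_pos (h.kb_pos t x))).2 (by linarith)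
    rw [R_sq]
    exact h3.trans (one_div _).le
  exact le_of_sq_le_sq h2 (h.R_pos t x).le

omit h in
/-- The square root of `κ τ λ²`. -/
def x0 (d : Data n) : ℝ := d.lam * Real.sqrt (d.tau * d.kappa)

theorem x0_pos : 0 < x0 d :=
  mul_pos h.lam_pos (Real.sqrt_pos.2 (mul_pos h.tau_pos h.kappa_pos))

theorem x0_sq : x0 d ^ 2 = d.tau * d.kappa * d.lam ^ 2 := by
  rw [x0, mul_pow, Real.sq_sqrt (mul_pos h.tau_pos h.kappa_pos).le]; ring

theorem x0_mul_nu : x0 d * nu d = d.lam := by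
  rw [x0, nu, mul_assoc, mul_inv_cancel₀ (Real.sqrt_pos.2 (mul_pos h.tau_pos h.kappa_pos)).ne',
    mul_one]

theorem inv_x0_sq_le : (x0 d ^ 2)⁻¹ ≤ d.lam ^ (-(4 * d.gamma)) := by
  refine le_trans (le_of_eq ?_) h.kappa_tau_lam
  rw [h.x0_sq]
  simp only [mul_inv, inv_pow]
  ring

theorem one_le_x0 : 1 ≤ x0 d := by
  have h1 := h.inv_x0_sq_le
  have h2 : d.lam ^ (-(4 * d.gamma)) ≤ 1 :=
    Real.rpow_le_one_of_one_le_of_nonpos h.one_le_lam (by have := h.gamma_pos; linarith)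
  have h3 := (inv_le_one₀ (pow_pos h.x0_pos 2)).1 (h1.trans h2)
  exact (one_le_sq_iff₀ h.x0_pos.le).1 h3

theorem order' : d.lam ^ 2 ≤ K * (x0 d ^ 2) ^ N := by
  rw [h.x0_sq]; exact h.order

theorem nu_le_lam : nu d ≤ d.lam := by
  rw [← h.x0_mul_nu]
  exact le_mul_of_one_le_left h.nu_pos.le h.one_le_x0

/-- The square root of `κ̄ / κ`. -/
def Q (t : ℝ) (x : E3) : ℝ := Real.sqrt (h.kb t x / d.kappa)

theorem Q_sq (t : ℝ) (x : E3) : d.kappa * h.Q t x ^ 2 = h.kb t x := by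
  rw [Q, Real.sq_sqrt (div_pos (h.kb_pos t x) h.kappa_pos).le]
  have := h.kappa_pos.ne'
  field_simp

theorem one_le_Q (t : ℝ) (x : E3) : 1 ≤ h.Q t x := by
  rw [Q, Real.one_le_sqrt, one_le_div h.kappa_pos]
  exact h.kappa_le_kb t x

/-- The balance used throughout: an amplitude may be as large as `Q`, but a derivative then costs
only `R = ν / Q`. -/
theorem Q_mul_R (t : ℝ) (x : E3) : h.Q t x * h.R t x = nu d := by
  have h1 : (h.Q t x * h.R t x) ^ 2 = nu d ^ 2 := by
    have h2 := h.kb_mul_R_sq t x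
    rw [← h.Q_sq] at h2
    rw [nu_sq h, mul_pow]
    have := h.kappa_pos.ne'
    have := h.tau_pos.ne'
    field_simp at h2 ⊢
    linarith
  have h3 : 0 ≤ h.Q t x * h.R t x :=
    mul_nonneg (zero_le_one.trans (h.one_le_Q t x)) (h.R_pos t x).le
  exact (pow_left_inj₀ h3 h.nu_pos.le two_ne_zero).1 h1

theorem Q_sq_eq (t : ℝ) (x : E3) : h.Q t x ^ 2 = 1 + ∑ i, h.q i t x ^ 2 := by
  have h1 := h.Q_sq t x
  rw [kb_apply] at h1
  exact mul_left_cancel₀ h.kappa_pos.ne' h1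

theorem abs_q_le (i : Fin n) (t : ℝ) (x : E3) : |h.q i t x| ≤ h.Q t x := by
  have h1 := h.Q_sq_eq t x
  have h2 : h.q i t x ^ 2 ≤ ∑ i, h.q i t x ^ 2 :=
    Finset.single_le_sum (f := fun i => h.q i t x ^ 2) (fun i _ => sq_nonneg _) (Finset.mem_univ i)
  exact abs_le_of_sq_le_sq (by linarith) (zero_le_one.trans (h.one_le_Q t x))

/-! ### The active index -/

theorem etat_eq_one {i : Fin n} {t : ℝ} {x : E3} (ht : t ∈ Icc 0 d.T) (hi : h.η i t x ≠ 0) :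
    h.ηt i t x = 1 := by
  have h1 := h.etat_eta i t ht x
  exact mul_right_cancel₀ hi (h1.trans (one_mul _).symm)

variable {h}

theorem Good.etat_ne {i : Fin n} {t : ℝ} {x : E3} (hg : h.Good t x) (hi : h.η i t x ≠ 0) :
    h.ηt i t x ≠ 0 := by
  rw [h.etat_eq_one (Ioo_subset_Icc_self hg.mem) hi]; exact one_ne_zero

/-- At a good point, vanishing at the point means vanishing nearby; disjointness of the cutoffs
becomes a statement about germs and passes to all derivatives. -/
theorem Good.eqAt_eta {i j : Fin n} {t : ℝ} {x : E3} (hg : h.Good t x) (hi : h.η i t x ≠ 0)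
    (hij : i ≠ j) : EqAt t x (h.η j) 0 := by
  refine (hg.eta j).resolve_left fun hj => ?_
  exact mul_ne_zero hi hj (h.eta_disjoint i j hij t (Ioo_subset_Icc_self hg.mem) x)

theorem Good.eqAt_etat {i j : Fin n} {t : ℝ} {x : E3} (hg : h.Good t x) (hi : h.η i t x ≠ 0)
    (hij : i ≠ j) : EqAt t x (h.ηt j) 0 := by
  refine (hg.etat j).resolve_left fun hj => ?_
  exact mul_ne_zero hj hi (h.etat_eta_ne j i hij.symm t (Ioo_subset_Icc_self hg.mem) x)

theorem Good.eqAt_q {i : Fin n} {t : ℝ} {x : E3} (hi : EqAt t x (h.η i) 0) :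
    EqAt t x (h.q i) 0 :=
  ((hi.mul_zero_left h.s).smul _).trans (EqAt.of_eq (smul_zero _))

variable (h)

theorem J_apply (i : Fin n) (t : ℝ) (x : E3) : h.J i t x = (d.gradPhi i t x).det := by
  have h1 : h.J i t x = ((ev t x).mapMatrix (h.F i)).det := by
    rw [← RingHom.map_det]; rfl
  rw [h1, RingHom.mapMatrix_apply, ContinuousLinearMap.det,
    ← LinearMap.det_toMatrix (EuclideanSpace.basisFun (Fin 3) ℝ).toBasis]
  congr 1
  ext a l
  rw [LinearMap.toMatrix_apply]
  simp only [Matrix.map_apply, OrthonormalBasis.coe_toBasis, EuclideanSpace.basisFun_apply,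
    ContinuousLinearMap.coe_coe, OrthonormalBasis.coe_toBasis_repr_apply,
    EuclideanSpace.basisFun_repr]
  exact (h.fderiv_Phi i t x a l).symm

theorem eqAt_J {i : Fin n} {t : ℝ} {x : E3} (ht : t ∈ Ioo 0 d.T) (hi : h.ηt i t x ≠ 0) :
    EqAt t x (h.J i) 1 := by
  have h1 : ∀ᶠ y : ℝ × E3 in 𝓝 (t, x), h.ηt i y.1 y.2 ≠ 0 := (h.ηt i).isOpen_ne.mem_nhds hi
  filter_upwards [h1, h.eventually_mem ht x] with y hy hy'
  rw [J_apply]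
  exact h.Phi_det i y.1 (Ioo_subset_Icc_self hy') y.2 hy

theorem matDeriv_Phi (i : Fin n) (a : Fin 3) (t : ℝ) (x : E3) :
    (matDeriv d.u (d.Phi i) t x) a = h.z i a t x := by
  rw [matDeriv, z, add_apply, sum_apply]
  simp only [PiLp.add_apply, h.deriv_Phi_apply]
  congr 1
  conv_lhs => rw [sum_basisVec (d.u t x)]
  simp only [map_sum, map_smul, WithLp.ofLp_sum, Finset.sum_apply, PiLp.smul_apply, h.fderiv_Phi]
  rfl

theorem eqAt_z {i : Fin n} {t : ℝ} {x : E3} (ht : t ∈ Ioo 0 d.T) (hi : h.ηt i t x ≠ 0)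
    (a : Fin 3) : EqAt t x (h.z i a) 0 := by
  have h1 : ∀ᶠ y : ℝ × E3 in 𝓝 (t, x), h.ηt i y.1 y.2 ≠ 0 := (h.ηt i).isOpen_ne.mem_nhds hi
  filter_upwards [h1, h.eventually_mem ht x] with y hy hy'
  rw [← h.matDeriv_Phi, h.Phi_transport i y.1 (Ioo_subset_Icc_self hy') y.2 hy]
  rfl

/-- The determinant is locally one, so `J_mul_bracket` makes the bracket vanish: the `di` behave as
commuting coordinate derivatives. `eqAt_Dt_di` is the analogue for `D_t`, where also `z = 0` is
used. -/
theorem eqAt_di_di {i : Fin n} {t : ℝ} {x : E3} (ht : t ∈ Ioo 0 d.T) (hi : h.ηt i t x ≠ 0)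
    (p q : Fin 3) (f : PF) : EqAt t x (h.di i p (h.di i q f)) (h.di i q (h.di i p f)) := by
  have hJ := h.eqAt_J ht hi
  have hd : ∀ p, EqAt t x (h.di i p (h.J i)) 0 := fun p =>
    (h.di_congr i p hJ).trans (EqAt.of_eq (Derivation.map_one_eq_zero _))
  have h1 : ∀ b, EqAt t x (h.di i p (h.G i b q) - h.di i q (h.G i b p)) 0 := fun b => by
    have h2 : EqAt t x (h.J i * (h.di i p (h.G i b q) - h.di i q (h.G i b p))) 0 := by
      rw [J_mul_bracket]
      exact (((hd p).mul_zero_right _).sub ((hd q).mul_zero_right _)).trans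
        (EqAt.of_eq (sub_zero 0))
    refine EqAt.trans ?_ h2
    exact ((EqAt.of_eq (one_mul _).symm).trans (hJ.symm.mul (EqAt.refl _)))
  have h2 : EqAt t x (h.di i p (h.di i q f) - h.di i q (h.di i p f)) 0 := by
    rw [di_di_sub]
    exact (EqAt.sum _ fun l _ => (h1 l).mul_zero_left _).trans (EqAt.of_eq (by simp))
  have h3 := h2.add (EqAt.refl (h.di i q (h.di i p f)))
  simpa using h3

theorem eqAt_Dt_di {i : Fin n} {t : ℝ} {x : E3} (ht : t ∈ Ioo 0 d.T) (hi : h.ηt i t x ≠ 0)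
    (p : Fin 3) (f : PF) : EqAt t x (h.Dt (h.di i p f)) (h.di i p (h.Dt f)) := by
  have hJ := h.eqAt_J ht hi
  have h1 : ∀ b, EqAt t x (h.Dt (h.G i b p) - h.di i p (h.u b)) 0 := fun b => by
    have h2 : EqAt t x (h.J i * (h.Dt (h.G i b p) - h.di i p (h.u b))) 0 := by
      rw [J_mul_transport]
      have e1 : EqAt t x (h.Dt (h.J i)) 0 :=
        (h.Dt_congr hJ).trans (EqAt.of_eq (Derivation.map_one_eq_zero _))
      have e2 : ∀ a, EqAt t x (h.di i p (h.z i a)) 0 := fun a =>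
        (h.di_congr i p (h.eqAt_z ht hi a)).trans (EqAt.of_eq (map_zero _))
      exact ((e1.mul_zero_right _).sub (EqAt.sum _ fun a _ => (e2 a).mul_zero_right _)).trans
        (EqAt.of_eq (by simp))
    refine EqAt.trans ?_ h2
    exact ((EqAt.of_eq (one_mul _).symm).trans (hJ.symm.mul (EqAt.refl _)))
  have h2 : EqAt t x (h.Dt (h.di i p f) - h.di i p (h.Dt f)) 0 := by
    rw [Dt_di_sub]
    exact (EqAt.sum _ fun l _ => (h1 l).mul_zero_left _).trans (EqAt.of_eq (by simp))
  have h3 := h2.add (EqAt.refl (h.di i p (h.Dt f)))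
  simpa using h3

theorem eqAt_Dt_dk {i : Fin n} {t : ℝ} {x : E3} (ht : t ∈ Ioo 0 d.T) (hi : h.ηt i t x ≠ 0)
    (k : E3) (f : PF) : EqAt t x (h.Dt (h.dk i k f)) (h.dk i k (h.Dt f)) := by
  simp only [dk_apply, map_sum, Derivation.map_smul]
  exact EqAt.sum _ fun p _ => (h.eqAt_Dt_di ht hi p f).smul _

theorem eqAt_di_dk {i : Fin n} {t : ℝ} {x : E3} (ht : t ∈ Ioo 0 d.T) (hi : h.ηt i t x ≠ 0)
    (p : Fin 3) (k : E3) (f : PF) :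
    EqAt t x (h.di i p (h.dk i k f)) (h.dk i k (h.di i p f)) := by
  simp only [dk_apply, map_sum, Derivation.map_smul]
  exact EqAt.sum _ fun q _ => (h.eqAt_di_di ht hi p q f).smul _

/-- The oscillation is carried along by the flow, so the advective derivative never produces a
factor `λ`. -/
theorem eqAt_Dt_Y {i : Fin n} {t : ℝ} {x : E3} (ht : t ∈ Ioo 0 d.T) (hi : h.ηt i t x ≠ 0)
    (f : CF M.P) : EqAt t x (h.Dt (h.Y i f)) 0 := by
  rw [Dt_Y]
  exact ((EqAt.sum _ fun a _ => (h.eqAt_z ht hi a).mul_zero_right _).smul _).trans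
    (EqAt.of_eq (by simp))

theorem eqAt_di_Y {i : Fin n} {t : ℝ} {x : E3} (ht : t ∈ Ioo 0 d.T) (hi : h.ηt i t x ≠ 0)
    (p : Fin 3) (f : CF M.P) : EqAt t x (h.di i p (h.Y i f)) (d.lam • h.Y i (CF.pd p f)) := by
  rw [di_Y]
  exact (((h.eqAt_J ht hi).mul (EqAt.refl _)).trans (EqAt.of_eq (one_mul _))).smul _

/-! ### Functions that live on one cutoff -/

/-- The function vanishes near every good point at which the cutoff vanishes. -/
def Lives (i : Fin n) (g : PF) : Prop :=
  ∀ t x, h.Good t x → EqAt t x (h.η i) 0 → EqAt t x g 0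

variable {h} in
theorem Lives.mul_left {i : Fin n} {g : PF} (hg : h.Lives i g) (f : PF) : h.Lives i (f * g) :=
  fun t x hgood hi => (hg t x hgood hi).mul_zero_right f

variable {h} in
theorem Lives.mul_right {i : Fin n} {g : PF} (hg : h.Lives i g) (f : PF) : h.Lives i (g * f) :=
  fun t x hgood hi => (hg t x hgood hi).mul_zero_left f

variable {h} in
theorem Lives.smul {i : Fin n} {g : PF} (hg : h.Lives i g) (c : ℝ) : h.Lives i (c • g) :=
  fun t x hgood hi => ((hg t x hgood hi).smul c).trans (EqAt.of_eq (smul_zero _))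

variable {h} in
theorem Lives.di {i j : Fin n} {g : PF} (hg : h.Lives i g) (p : Fin 3) : h.Lives i (h.di j p g) :=
  fun t x hgood hi => (h.di_congr j p (hg t x hgood hi)).trans (EqAt.of_eq (map_zero _))

variable {h} in
theorem Lives.dk {i j : Fin n} {g : PF} (hg : h.Lives i g) (k : E3) : h.Lives i (h.dk j k g) :=
  fun t x hgood hi => (h.dk_congr j k (hg t x hgood hi)).trans (EqAt.of_eq (map_zero _))

variable {h} in
theorem Lives.Dt {i : Fin n} {g : PF} (hg : h.Lives i g) : h.Lives i (h.Dt g) :=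
  fun t x hgood hi => (h.Dt_congr (hg t x hgood hi)).trans (EqAt.of_eq (map_zero _))

variable {h} in
theorem Lives.ne {i : Fin n} {g : PF} (hg : h.Lives i g) {t : ℝ} {x : E3} (hgood : h.Good t x) :
    h.η i t x ≠ 0 ∨ EqAt t x g 0 :=
  (hgood.eta i).imp_right (hg t x hgood)

theorem lives_q (i : Fin n) : h.Lives i (h.q i) := fun _ _ _ hi => Good.eqAt_q hi

end Data.Assumptions

/-! ### Matrix entries and the algebra of the Mikado profiles -/

theorem transp_apply (A : M3) (v : E3) (p : Fin 3) :
    transp A v p = ∑ l, A (basisVec p) l * v l := by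
  have h1 : inner ℝ (basisVec p) (transp A v) = inner ℝ (A (basisVec p)) v :=
    ContinuousLinearMap.adjoint_inner_right A _ _
  rw [basisVec, EuclideanSpace.inner_single_left, PiLp.inner_apply] at h1
  simp only [map_one, one_mul] at h1
  rw [h1]
  exact Finset.sum_congr rfl fun l _ => by simp [basisVec, mul_comm]

theorem clm_apply (A : M3) (v : E3) (l : Fin 3) :
    A v l = ∑ m, A (basisVec m) l * v m := by
  conv_lhs => rw [sum_basisVec v]
  simp only [map_sum, map_smul, WithLp.ofLp_sum, Finset.sum_apply, PiLp.smul_apply, smul_eq_mul]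
  exact Finset.sum_congr rfl fun _ _ => mul_comm _ _

theorem sum_clm_apply {ι : Type*} (s : Finset ι) (A : ι → M3) (v : E3) (l : Fin 3) :
    (∑ i ∈ s, A i) v l = ∑ i ∈ s, A i v l := by
  rw [_root_.sum_apply, WithLp.ofLp_sum, Finset.sum_apply]

namespace Mikado
variable (M : Mikado)

theorem cell_eq {k : E3} (hk : k ∈ M.Λ) : (M.cell k).1 = M.φ k := funext fun x => M.cell_apply hk x

/-- Expansion of the triple vector product: `H_k = k ⊗ ∇φ_k - ∇φ_k ⊗ k`. Only this form is used
afterwards. -/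
theorem H_apply {k : E3} (hk : k ∈ M.Λ) (ξ v : E3) (p : Fin 3) :
    M.H k ξ v p = k p * (∑ q, CF.pd q (M.cell k) ξ * v q) -
      CF.pd p (M.cell k) ξ * ∑ q, k q * v q := by
  have h1 : ∀ q, gradient (M.φ k) ξ q = CF.pd q (M.cell k) ξ := fun q => by
    rw [← M.cell_eq hk, CF.gradient_apply]
  have h2 : M.H k ξ v = -cross (cross k (gradient (M.φ k) ξ)) v := rfl
  rw [h2]
  simp only [← h1, Fin.sum_univ_three]
  fin_cases p <;> simp [cross, cross_apply] <;> ring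

theorem kd_cell {k : E3} (hk : k ∈ M.Λ) : CF.kd k (M.cell k) = 0 := by
  ext x
  have h1 := M.invariant k hk x
  rw [← M.cell_eq hk, PiLp.inner_apply] at h1
  simp only [CF.kd, CF.sum_apply, CF.smul_apply, CF.zero_apply, ← CF.gradient_apply]
  rw [← h1]
  exact Finset.sum_congr rfl fun q _ => by simp [mul_comm]

theorem mean_cell {k : E3} (hk : k ∈ M.Λ) : CF.mean (M.cell k) = 0 := by
  have h1 := M.mean_zero k hk
  rw [← M.cell_eq hk] at h1
  rw [CF.mean, h1, mul_zero]

theorem pd_cell_eq_zero {k : E3} (hk : k ∈ M.Λ) {ξ : E3} (hξ : ξ ∉ tsupport (M.φ k)) (q : Fin 3) :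
    CF.pd q (M.cell k) ξ = 0 := by
  have h1 : fderiv ℝ (M.φ k) ξ = 0 := by
    by_contra hc
    exact hξ (support_fderiv_subset ℝ hc)
  rw [CF.pd_apply, M.cell_eq hk, h1]; rfl

theorem disjoint_or {k k' : E3} (hk : k ∈ M.Λ) (hk' : k' ∈ M.Λ) (hne : k ≠ k') (ξ : E3) :
    ξ ∉ tsupport (M.φ k) ∨ ξ ∉ tsupport (M.φ k') := by
  by_contra hc
  push Not at hc
  exact Set.disjoint_left.1 (M.disjoint_supp k hk k' hk' hne) hc.1 hc.2

theorem pd_mul_pd {k k' : E3} (hk : k ∈ M.Λ) (hk' : k' ∈ M.Λ) (hne : k ≠ k') (p q : Fin 3) (ξ : E3) :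
    CF.pd p (M.cell k) ξ * CF.pd q (M.cell k') ξ = 0 := by
  rcases M.disjoint_or hk hk' hne ξ with h | h
  · rw [M.pd_cell_eq_zero hk h, zero_mul]
  · rw [M.pd_cell_eq_zero hk' h, mul_zero]

/-- The cell function `|∇φ_k|²`. -/
def gsq (k : E3) : CF M.P := ∑ q, CF.pd q (M.cell k) ^ 2

/-- The mean of `|∇φ_k|²`. -/
def cst (k : E3) : ℝ := CF.mean (M.gsq k)

theorem cst_nonneg (k : E3) : 0 ≤ M.cst k := by
  have := M.P_pos
  refine mul_nonneg (by positivity) (setIntegral_nonneg (measurableSet_cube _ M.P_pos) fun x _ => ?_)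
  simp only [gsq, CF.sum_apply, CF.pow_apply]
  positivity

end Mikado

theorem CF.mean_add {P : ℝ} (hP : 0 < P) (f g : CF P) : mean (f + g) = mean f + mean g := by
  have h1 := mean_sub hP (f + g) g
  rw [add_sub_cancel_right] at h1
  linarith

theorem CF.mean_smul {P : ℝ} (c : ℝ) (f : CF P) : mean (c • f) = c * mean f := by
  simp only [mean, smul_apply, integral_const_mul]; ring

theorem CF.mean_sum {P : ℝ} (hP : 0 < P) {ι : Type*} (s : Finset ι) (f : ι → CF P) :
    mean (∑ i ∈ s, f i) = ∑ i ∈ s, mean (f i) :=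
  map_sum ({ toFun := mean, map_add' := mean_add hP, map_zero' := by simp [mean] } : CF P →+ ℝ) f s

theorem divergence_eq {v : E3 → E3} {f : Fin 3 → PF} {t : ℝ} (hv : ∀ y j, v y j = f j t y)
    (x : E3) : divergence v x = ∑ j, PF.dx j (f j) t x := by
  have hd : DifferentiableAt ℝ v x := by
    rw [differentiableAt_euclidean]
    intro j
    have : (fun y => v y j) = f j t := funext fun y => hv y j
    rw [this]
    exact ((f j).contDiff_slice t).differentiable (by simp) x
  rw [divergence]
  refine Finset.sum_congr rfl fun j _ => ?_
  rw [← PF.fderiv_basisVec]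
  have h1 : f j t = fun y => v y j := funext fun y => (hv y j).symm
  have h2 := (EuclideanSpace.proj j : E3 →L[ℝ] ℝ).hasFDerivAt.comp x hd.hasFDerivAt
  have h3 : fderiv ℝ (f j t) x = (EuclideanSpace.proj j : E3 →L[ℝ] ℝ) ∘L fderiv ℝ v x := by
    rw [h1]; exact h2.fderiv
  rw [h3]; rfl

namespace Data.Assumptions

open PF

variable {n : ℕ} {M : Mikado} {N : ℕ} {K : ℝ} {d : Data n} (h : d.Assumptions M N K)
include h

theorem a_apply {k : E3} (hk : k ∈ M.Λ) (i : Fin n) (t : ℝ) (x : E3) :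
    h.a k i t x = d.a k (d.R i t x) := by
  simp [a, hk]

theorem J_eq_one {i : Fin n} {t : ℝ} {x : E3} (ht : t ∈ Icc 0 d.T) (hi : h.ηt i t x ≠ 0) :
    h.J i t x = 1 := by
  rw [J_apply]; exact h.Phi_det i t ht x hi

theorem gradPhi_apply (i : Fin n) (t : ℝ) (x v : E3) (a : Fin 3) :
    d.gradPhi i t x v a = ∑ l, h.F i a l t x * v l := by
  rw [clm_apply]
  exact Finset.sum_congr rfl fun l _ => by rw [Data.gradPhi, h.fderiv_Phi]

theorem invGradPhi_apply {i : Fin n} {t : ℝ} {x : E3} (ht : t ∈ Icc 0 d.T) (hi : h.ηt i t x ≠ 0)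
    (v : E3) (l : Fin 3) : d.invGradPhi i t x v l = ∑ p, h.G i l p t x * v p := by
  let L : M3 := Matrix.toEuclideanCLM (𝕜 := ℝ) (n := Fin 3) (Matrix.of fun l p => h.G i l p t x)
  have hL : ∀ v l, L v l = ∑ p, h.G i l p t x * v p := fun v l => by
    simp only [L, Matrix.ofLp_toEuclideanCLM]
    rfl
  have hJ := h.J_eq_one ht hi
  have h1 : (d.gradPhi i t x).comp L = ContinuousLinearMap.id ℝ E3 := by
    ext v a
    simp only [ContinuousLinearMap.comp_apply, h.gradPhi_apply, hL, ContinuousLinearMap.id_apply,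
      Finset.mul_sum]
    rw [Finset.sum_comm]
    simp only [← mul_assoc, ← Finset.sum_mul]
    have h2 : ∀ p, ∑ l, h.F i a l t x * h.G i l p t x = if a = p then 1 else 0 := fun p => by
      have h3 := congrArg (fun f : PF => f t x) (h.F_mul_G i a p)
      simp only [sum_apply, mul_apply] at h3
      rw [h3]
      split_ifs
      · exact hJ
      · rfl
    simp [h2]
  have h2 : L.comp (d.gradPhi i t x) = ContinuousLinearMap.id ℝ E3 := by
    ext v a
    simp only [ContinuousLinearMap.comp_apply, h.gradPhi_apply, hL, ContinuousLinearMap.id_apply,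
      Finset.mul_sum]
    rw [Finset.sum_comm]
    simp only [← mul_assoc, ← Finset.sum_mul]
    have h2 : ∀ p, ∑ l, h.G i a l t x * h.F i l p t x = if a = p then 1 else 0 := fun p => by
      have h3 := congrArg (fun f : PF => f t x) (h.G_mul_F i a p)
      simp only [sum_apply, mul_apply] at h3
      rw [h3]
      split_ifs
      · exact hJ
      · rfl
    simp [h2]
  have h3 : d.invGradPhi i t x = L := ContinuousLinearMap.inverse_eq h1 h2
  rw [h3, hL]

theorem transp_invGradPhi_apply {i : Fin n} {t : ℝ} {x : E3} (ht : t ∈ Icc 0 d.T)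
    (hi : h.ηt i t x ≠ 0) (v : E3) (p : Fin 3) :
    transp (d.invGradPhi i t x) v p = ∑ l, h.G i l p t x * v l := by
  rw [transp_apply]
  refine Finset.sum_congr rfl fun l _ => ?_
  rw [h.invGradPhi_apply ht hi]
  simp [basisVec_apply]

theorem kappa_mul_q {t : ℝ} (ht : t ∈ Icc 0 d.T) (i : Fin n) (x : E3) :
    d.eta i t x * Real.sqrt (d.sigma t) / d.lam = d.kappa * h.q i t x := by
  rw [q_apply, h.s_eq ht]
  have := h.kappa_pos.ne'
  have := h.lam_pos.ne'
  field_simp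

/-- The vector `∇Φ⁻ᵀ v` is a parameter `g`, since it is instantiated both by moving derivatives of a
field and by the corrected gradient of the cell problem. -/
theorem block_apply {i : Fin n} {t : ℝ} {x : E3} (ht : t ∈ Icc 0 d.T) (hi : h.ηt i t x ≠ 0)
    (ξ v : E3) (l : Fin 3) (g : Fin 3 → ℝ) (hg : ∀ p, g p = ∑ l, h.G i l p t x * v l) :
    d.block M i t x ξ v l = ∑ p, h.G i l p t x * (d.kappa * g p + d.kappa * h.q i t x *
      ∑ k ∈ M.Λ, h.a k i t x * (k p * (∑ q, CF.pd q (M.cell k) ξ * g q) -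
        CF.pd p (M.cell k) ξ * ∑ q, k q * g q)) := by
  rw [Data.block, ContinuousLinearMap.comp_apply, h.invGradPhi_apply ht hi]
  refine Finset.sum_congr rfl fun p _ => ?_
  have h1 : ∀ p, transp (d.invGradPhi i t x) v p = g p := fun p => by
    rw [h.transp_invGradPhi_apply ht hi, hg]
  rw [ContinuousLinearMap.comp_apply, _root_.add_apply, PiLp.add_apply, _root_.smul_apply,
    _root_.smul_apply, PiLp.smul_apply, PiLp.smul_apply, sum_clm_apply, h.kappa_mul_q ht,
    ContinuousLinearMap.id_apply, h1]
  congr 2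
  simp only [smul_eq_mul]
  congr 1
  refine Finset.sum_congr rfl fun k hk => ?_
  rw [_root_.smul_apply, PiLp.smul_apply, M.H_apply hk, h.a_apply hk]
  simp only [h1, smul_eq_mul]

/-! ### The oscillating flux -/

/-- The flux of `g` in the coordinates of `Φ_i`. -/
def oflux (i : Fin n) (p : Fin 3) (g : PF) : PF :=
  d.kappa • (h.ηt i * h.di i p g) + d.kappa • (h.q i * ∑ k ∈ M.Λ, h.a k i *
    (k p • (∑ q, h.Y i (CF.pd q (M.cell k)) * h.di i q g) -
      h.Y i (CF.pd p (M.cell k)) * h.dk i k g))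

/-- The energy form of the oscillating equation. -/
def Qt (f g : PF) : PF := ∑ i, ∑ p, h.di i p f * h.oflux i p g

theorem Atilde_apply {t : ℝ} (ht : t ∈ Icc 0 d.T) (x : E3) (g : PF) (l : Fin 3) :
    d.Atilde M t x (gradient (g t) x) l = ∑ i, ∑ p, h.G i l p t x * h.oflux i p g t x := by
  rw [Data.Atilde, sum_clm_apply]
  refine Finset.sum_congr rfl fun i _ => ?_
  rw [_root_.smul_apply, PiLp.smul_apply]
  by_cases hi : h.ηt i t x = 0
  · have h1 : h.η i t x = 0 := by
      have := h.etat_eta i t ht x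
      change h.ηt i t x * h.η i t x = h.η i t x at this
      rw [hi, zero_mul] at this
      exact this.symm
    have h2 : h.q i t x = 0 := by
      rw [q_apply]
      change _ * (h.η i t x * _) = _
      rw [h1]; simp
    have h3 : ∀ p, h.oflux i p g t x = 0 := fun p => by
      simp only [oflux, add_apply, smul_apply, mul_apply, hi, h2]; ring
    have h4 : d.etat i t x = 0 := hi
    simp [h3, h4]
  · rw [h.block_apply ht hi _ _ _ (fun p => h.di i p g t x) fun p => by
      rw [di_apply]
      simp [gradient_apply], smul_eq_mul, Finset.mul_sum]
    -- The oscillating part of `oflux` carries no factor `η̃_i`, because `η̃_i = 1` wherever `η_i`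
    -- is nonzero.
    have he : h.ηt i t x * h.q i t x = h.q i t x := by
      have := h.etat_eta i t ht x
      change h.ηt i t x * h.η i t x = h.η i t x at this
      rw [q_apply]
      change _ * (_ * (h.η i t x * _)) = _ * (h.η i t x * _)
      rw [mul_left_comm, ← mul_assoc (h.ηt i t x), this]
    refine Finset.sum_congr rfl fun p _ => ?_
    rw [mul_left_comm]
    congr 1
    simp only [oflux, add_apply, smul_apply, mul_apply, sum_apply, sub_apply, dk_apply, Y_apply]
    rw [← he]
    change h.ηt i t x * _ = _
    rw [mul_add]
    congr 1
    · ring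
    · nth_rewrite 1 [he]
      ring

theorem Dt_rho {ρin : E3 → ℝ} {ρ : ℝ → E3 → ℝ} (hρ : IsSolution d.T d.u (d.Atilde M) ρin ρ)
    {t : ℝ} (ht : t ∈ Icc 0 d.T) (x : E3) :
    h.Dt ⟨ρ, hρ.field⟩ t x = (∑ l, dx l (∑ i, ∑ p, h.G i l p * h.oflux i p ⟨ρ, hρ.field⟩)) t x := by
  rw [← matDeriv_u]
  refine (hρ.eqn t ht x).trans ?_
  rw [sum_apply]
  refine divergence_eq (fun y j => ?_) x
  refine (h.Atilde_apply ht y ⟨ρ, hρ.field⟩ j).trans ?_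
  simp

theorem weak_rho {ρin : E3 → ℝ} {ρ : ℝ → E3 → ℝ} (hρ : IsSolution d.T d.u (d.Atilde M) ρin ρ)
    {t : ℝ} (ht : t ∈ Icc 0 d.T) (f : PF) :
    I t (f * h.Dt ⟨ρ, hρ.field⟩) = -I t (h.Qt f ⟨ρ, hρ.field⟩) := by
  have h1 : I t (f * h.Dt ⟨ρ, hρ.field⟩) =
      I t (f * ∑ l, dx l (∑ i, ∑ p, h.G i l p * h.oflux i p ⟨ρ, hρ.field⟩)) :=
    I_congr fun x => by rw [mul_apply, mul_apply, h.Dt_rho hρ ht]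
  rw [h1, Finset.mul_sum, I_sum]
  simp only [I_mul_dx]
  rw [Finset.sum_neg_distrib, ← I_sum]
  congr 2
  simp only [Qt, di_apply, Finset.mul_sum, Finset.sum_mul]
  rw [Finset.sum_comm]
  refine Finset.sum_congr rfl fun i _ => ?_
  rw [Finset.sum_comm]
  refine Finset.sum_congr rfl fun p _ => Finset.sum_congr rfl fun l _ => ?_
  ring

/-! ### The homogenized flux -/

/-- The vector `∇Φ_i⁻¹ k`. -/
def Gk (i : Fin n) (k : E3) (l : Fin 3) : PF := ∑ p, k p • h.G i l p

theorem dk_eq (i : Fin n) (k : E3) (f : PF) : h.dk i k f = ∑ l, h.Gk i k l * dx l f := by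
  simp only [dk_apply, di_apply, Gk, Finset.smul_sum, Finset.sum_mul]
  rw [Finset.sum_comm]
  simp only [smul_mul_assoc]

/-- The entries of the homogenized matrix. -/
def Ab (l m : Fin 3) : PF :=
  ∑ i, (d.kappa • (h.ηt i * ∑ p, h.G i l p * h.G i m p) + d.kappa • (h.q i ^ 2 *
    ∑ k ∈ M.Λ, M.cst k • (h.a k i ^ 2 * (h.Gk i k l * h.Gk i k m))))

theorem transp_fderiv_chi {i : Fin n} {t : ℝ} {x : E3} (ht : t ∈ Icc 0 d.T)
    (hi : h.ηt i t x ≠ 0) (ξ v : E3) (g : Fin 3 → ℝ) (hg : ∀ p, g p = ∑ l, h.G i l p t x * v l)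
    (a : Fin 3) : transp (fderiv ℝ (fun ζ => d.chi M i t x ζ) ξ) v a =
      Real.sqrt (d.sigma t) / (d.kappa * d.lam) *
        ∑ k ∈ M.Λ, h.a k i t x * (CF.pd a (M.cell k) ξ * ∑ q, k q * g q) := by
  have hs : HasFDerivAt (fun ζ => ∑ k ∈ M.Λ, (d.a k (d.R i t x) * M.φ k ζ) • k)
      (∑ k ∈ M.Λ, (d.a k (d.R i t x) • fderiv ℝ (M.φ k) ξ).smulRight k) ξ := by
    refine HasFDerivAt.fun_sum fun k hk => ?_
    exact (((M.smooth k hk).differentiable (by simp) ξ).hasFDerivAt.const_mul _).smul_const k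
  have h1 := (((d.invGradPhi i t x).hasFDerivAt.comp ξ hs).const_smul
    (Real.sqrt (d.sigma t) / (d.kappa * d.lam))).fderiv
  have h2 : fderiv ℝ (fun ζ => d.chi M i t x ζ) ξ = _ := h1
  rw [h2, transp_apply]
  simp only [_root_.smul_apply, PiLp.smul_apply, smul_eq_mul, ContinuousLinearMap.comp_apply,
    h.invGradPhi_apply ht hi, mul_assoc, ← Finset.mul_sum]
  congr 1
  simp only [_root_.sum_apply, ContinuousLinearMap.smulRight_apply, WithLp.ofLp_sum,
    Finset.sum_apply, PiLp.smul_apply, smul_eq_mul, _root_.smul_apply, hg, Finset.mul_sum,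
    Finset.sum_mul]
  rw [Finset.sum_comm]
  conv_lhs => enter [2, p]; rw [Finset.sum_comm]
  rw [Finset.sum_comm]
  refine Finset.sum_congr rfl fun k hk => Finset.sum_congr rfl fun p _ =>
    Finset.sum_congr rfl fun l _ => ?_
  rw [h.a_apply hk, CF.pd_apply, M.cell_eq hk]
  ring

theorem G_transp {i : Fin n} {t : ℝ} {x : E3} (ht : t ∈ Icc 0 d.T) (hi : h.ηt i t x ≠ 0) (w : E3)
    (p : Fin 3) : ∑ l, h.G i l p t x * transp (d.gradPhi i t x) w l = w p := by
  simp only [transp_apply, h.gradPhi_apply, Finset.mul_sum]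
  rw [Finset.sum_comm]
  have h2 : ∀ a, ∑ l, h.F i a l t x * h.G i l p t x = if a = p then 1 else 0 := fun a => by
    have h3 := congrArg (fun f : PF => f t x) (h.F_mul_G i a p)
    simp only [sum_apply, mul_apply] at h3
    rw [h3]
    split_ifs
    · exact h.J_eq_one ht hi
    · rfl
  have h3 : ∀ a, ∑ l, h.G i l p t x * ((∑ l', h.F i a l' t x * basisVec l l') * w a) =
      (if a = p then 1 else 0) * w a := fun a => by
    rw [← h2, Finset.sum_mul]
    refine Finset.sum_congr rfl fun l _ => ?_
    simp only [basisVec_apply]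
    simp
    ring
  rw [Finset.sum_congr rfl fun a _ => h3 a]
  simp

end Data.Assumptions

/-- Summation by parts in the product of two sums of functions with disjoint supports. -/
theorem Mikado.pd_mul_sum (M : Mikado) {k : E3} (hk : k ∈ M.Λ) (p q : Fin 3) (ξ : E3) (c : E3 → ℝ) :
    CF.pd p (M.cell k) ξ * ∑ k' ∈ M.Λ, c k' * CF.pd q (M.cell k') ξ =
      CF.pd p (M.cell k) ξ * (c k * CF.pd q (M.cell k) ξ) := by
  rw [Finset.mul_sum]
  refine Finset.sum_eq_single k (fun k' hk' hne => ?_) fun hc => absurd hk hc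
  rw [mul_left_comm, M.pd_mul_pd hk hk' hne.symm, mul_zero]

/-- The cell gradient of the corrector is `q ∑ a_k (k·g) ∇φ_k`. Its isotropic flux cancels `-∇φ_k
(k·g)`; the part `∇φ_k ⊗ k` annihilates the corrector as `k·∇φ_k = 0`; and different `k` do not
interact, their supports being disjoint. What survives is `k (∇φ_k·g)` and `k (k·g) |∇φ_k|²`. -/
theorem Mikado.homog_identity (M : Mikado) (a : E3 → ℝ) (g : Fin 3 → ℝ) (q : ℝ) (ξ : E3) (p : Fin 3) :
    q * (∑ k ∈ M.Λ, a k * (CF.pd p (M.cell k) ξ * ∑ r, k r * g r)) +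
      q * ∑ k ∈ M.Λ, a k * (k p * (∑ r, CF.pd r (M.cell k) ξ *
          (g r + q * ∑ k' ∈ M.Λ, a k' * (CF.pd r (M.cell k') ξ * ∑ r, k' r * g r))) -
        CF.pd p (M.cell k) ξ * ∑ r, k r *
          (g r + q * ∑ k' ∈ M.Λ, a k' * (CF.pd r (M.cell k') ξ * ∑ r, k' r * g r))) =
    q * ∑ k ∈ M.Λ, a k * (k p * (∑ r, g r * CF.pd r (M.cell k) ξ) +
      k p * q * a k * (∑ r, k r * g r) * M.gsq k ξ) := by
  rw [← mul_add, ← Finset.sum_add_distrib]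
  congr 1
  refine Finset.sum_congr rfl fun k hk => ?_
  have h1 : ∀ p r, CF.pd p (M.cell k) ξ *
      (g r + q * ∑ k' ∈ M.Λ, a k' * (CF.pd r (M.cell k') ξ * ∑ r, k' r * g r)) =
      CF.pd p (M.cell k) ξ * (g r + q * (a k * (∑ r, k r * g r) * CF.pd r (M.cell k) ξ)) := by
    intro p r
    have h2 := M.pd_mul_sum hk p r ξ fun k' => a k' * ∑ r, k' r * g r
    have h3 : ∑ k' ∈ M.Λ, a k' * (CF.pd r (M.cell k') ξ * ∑ r, k' r * g r) =
        ∑ k' ∈ M.Λ, a k' * (∑ r, k' r * g r) * CF.pd r (M.cell k') ξ :=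
      Finset.sum_congr rfl fun _ _ => by ring
    rw [h3, mul_add, mul_add, mul_left_comm, h2]
    ring
  have h2 : CF.pd p (M.cell k) ξ * ∑ r, k r *
      (g r + q * ∑ k' ∈ M.Λ, a k' * (CF.pd r (M.cell k') ξ * ∑ r, k' r * g r)) =
      CF.pd p (M.cell k) ξ * ∑ r, k r * g r := by
    have h3 : ∑ r, k r * CF.pd r (M.cell k) ξ = 0 := by
      have h4 := congrArg (fun f : CF M.P => f ξ) (M.kd_cell hk)
      simpa [CF.kd] using h4
    rw [Finset.mul_sum]
    simp only [mul_left_comm _ (_ : ℝ) (g _ + _), h1]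
    calc ∑ r, k r * (CF.pd p (M.cell k) ξ *
          (g r + q * (a k * (∑ r, k r * g r) * CF.pd r (M.cell k) ξ)))
        = CF.pd p (M.cell k) ξ * ∑ r, k r * g r + CF.pd p (M.cell k) ξ * q *
            (a k * (∑ r, k r * g r)) * ∑ r, k r * CF.pd r (M.cell k) ξ := by
          simp only [Fin.sum_univ_three]
          ring
      _ = _ := by rw [h3]; ring
  rw [h2]
  simp only [h1]
  rw [Mikado.gsq, CF.sum_apply]
  simp only [CF.pow_apply, Fin.sum_univ_three]
  ring

namespace Data.Assumptions

open PF

variable {n : ℕ} {M : Mikado} {N : ℕ} {K : ℝ} {d : Data n} (h : d.Assumptions M N K)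
include h

/-- The integrand in the definition of the homogenized matrix. -/
def integrand (_ : d.Assumptions M N K) (t : ℝ) (x ξ : E3) : M3 :=
  d.cellA M t x ξ ∘L (ContinuousLinearMap.id ℝ E3 + ∑ i, d.eta i t x •
    (transp (d.gradPhi i t x) ∘L transp (fderiv ℝ (fun ζ => d.chi M i t x ζ) ξ)))

/-- The components of `∇Φ_i⁻ᵀ v`. -/
def di_val (i : Fin n) (t : ℝ) (x v : E3) (p : Fin 3) : ℝ := ∑ l, h.G i l p t x * v l

/-- The entries of the integrand, as cell functions. -/
def integrandEntry (t : ℝ) (x v : E3) (l : Fin 3) : CF M.P :=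
  ∑ i, h.ηt i t x • ∑ p, h.G i l p t x •
    (algebraMap ℝ (CF M.P) (d.kappa * h.di_val i t x v p) + (d.kappa * h.q i t x) •
      ∑ k ∈ M.Λ, h.a k i t x • (k p • (∑ r, h.di_val i t x v r • CF.pd r (M.cell k)) +
        (k p * h.q i t x * h.a k i t x * ∑ r, k r * h.di_val i t x v r) • M.gsq k))

theorem eta_eq_zero_of_etat {i j : Fin n} {t : ℝ} {x : E3} (ht : t ∈ Icc 0 d.T)
    (hi : h.ηt i t x ≠ 0) (hij : j ≠ i) : d.eta j t x = 0 := by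
  have := h.etat_eta_ne i j hij.symm t ht x
  exact (mul_eq_zero.1 this).resolve_left hi

theorem integrand_apply {t : ℝ} (ht : t ∈ Icc 0 d.T) (x ξ v : E3) (l : Fin 3) :
    h.integrand t x ξ v l = h.integrandEntry t x v l ξ := by
  rw [integrand, ContinuousLinearMap.comp_apply, Data.cellA, sum_clm_apply, integrandEntry,
    CF.sum_apply]
  refine Finset.sum_congr rfl fun i _ => ?_
  rw [_root_.smul_apply, PiLp.smul_apply, CF.smul_apply, smul_eq_mul]
  by_cases hi : h.ηt i t x = 0
  · have h4 : d.etat i t x = 0 := hi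
    rw [h4, hi, zero_mul, zero_mul]
  change h.ηt i t x * _ = _
  congr 1
  have hw : ∀ p, ∑ l, h.G i l p t x * ((ContinuousLinearMap.id ℝ E3 + ∑ i, d.eta i t x •
      (transp (d.gradPhi i t x) ∘L transp (fderiv ℝ (fun ζ => d.chi M i t x ζ) ξ))) v) l =
      h.di_val i t x v p + h.q i t x * ∑ k ∈ M.Λ, h.a k i t x *
        (CF.pd p (M.cell k) ξ * ∑ r, k r * h.di_val i t x v r) := by
    intro p
    rw [_root_.add_apply, Finset.sum_eq_single i (fun j _ hj => by
      rw [h.eta_eq_zero_of_etat ht hi hj]; exact zero_smul ℝ (_ : M3)) (fun hc => absurd (Finset.mem_univ i) hc)]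
    simp only [ContinuousLinearMap.id_apply, _root_.smul_apply, PiLp.add_apply, PiLp.smul_apply,
      ContinuousLinearMap.comp_apply, mul_add, Finset.sum_add_distrib, smul_eq_mul]
    congr 1
    simp only [mul_left_comm _ (d.eta i t x), ← Finset.mul_sum]
    rw [h.G_transp ht hi, h.transp_fderiv_chi ht hi ξ v (h.di_val i t x v) fun p => rfl, q_apply,
      h.s_eq ht]
    ring
  rw [h.block_apply ht hi _ _ _ _ fun p => (hw p).symm, CF.sum_apply]
  refine Finset.sum_congr rfl fun p _ => ?_
  rw [CF.smul_apply]
  congr 1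
  have h1 := M.homog_identity (fun k => h.a k i t x) (h.di_val i t x v) (h.q i t x) ξ p
  simp only [CF.add_apply, CF.algebraMap_apply, CF.smul_apply, CF.sum_apply]
  rw [mul_add, add_assoc, mul_assoc d.kappa (h.q i t x), mul_assoc d.kappa (h.q i t x), ← mul_add,
    h1]

theorem etat_mul_q {t : ℝ} (ht : t ∈ Icc 0 d.T) (i : Fin n) (x : E3) :
    h.ηt i t x * h.q i t x = h.q i t x := by
  have h1 : h.ηt i t x * h.η i t x = h.η i t x := h.etat_eta i t ht x
  change _ * (_ * (h.η i t x * _)) = _ * (h.η i t x * _)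
  rw [mul_left_comm, ← mul_assoc (h.ηt i t x), h1]

/-- Derivatives of profiles have mean zero, so in the average only the constant part and the mean of
`|∇φ_k|²` remain. -/
theorem mean_integrandEntry {t : ℝ} (ht : t ∈ Icc 0 d.T) (x v : E3) (l : Fin 3) :
    CF.mean (h.integrandEntry t x v l) = ∑ m, h.Ab l m t x * v m := by
  have hP := M.P_pos
  simp only [integrandEntry, CF.mean_sum hP, CF.mean_smul, CF.mean_add hP, CF.mean_algebraMap hP,
    CF.mean_pd hP, mul_zero, Finset.sum_const_zero, zero_add]
  simp only [Ab, sum_apply, Finset.sum_mul]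
  rw [Finset.sum_comm]
  refine Finset.sum_congr rfl fun i _ => ?_
  simp only [add_apply, smul_apply, mul_apply, sum_apply, pow_apply, add_mul, mul_add,
    Finset.sum_add_distrib]
  congr 1
  · simp only [di_val, Finset.mul_sum, Finset.sum_mul]
    rw [Finset.sum_comm]
    exact Finset.sum_congr rfl fun _ _ => Finset.sum_congr rfl fun _ _ => by ring
  · have hq : h.q i t x ^ 2 = h.ηt i t x * h.q i t x * h.q i t x := by
      rw [h.etat_mul_q ht, sq]
    have e1 : ∀ k : E3, ∑ r, k r * h.di_val i t x v r = ∑ m, h.Gk i k m t x * v m := fun k => by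
      simp only [di_val, Gk, sum_apply, smul_apply, Finset.mul_sum, Finset.sum_mul]
      rw [Finset.sum_comm]
      exact Finset.sum_congr rfl fun _ _ => Finset.sum_congr rfl fun _ _ => by ring
    have e2 : ∀ k : E3, h.Gk i k l t x = ∑ p, k p * h.G i l p t x := fun k => by
      simp [Gk]
    simp only [e1, e2, hq, Mikado.cst, Finset.mul_sum, Finset.sum_mul]
    rw [Finset.sum_comm]
    conv_rhs => rw [Finset.sum_comm]
    refine Finset.sum_congr rfl fun k _ => ?_
    rw [Finset.sum_comm]
    exact Finset.sum_congr rfl fun _ _ => Finset.sum_congr rfl fun _ _ => by ring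

/-- By `integrand_apply` the matrix-valued integrand is continuous in the cell variable, so its
integral may be evaluated entry by entry. -/
theorem Abar_apply {t : ℝ} (ht : t ∈ Icc 0 d.T) (x v : E3) (l : Fin 3) :
    d.Abar M t x v l = ∑ m, h.Ab l m t x * v m := by
  have hP := M.P_pos
  have hc : Continuous (h.integrand t x) := by
    refine continuous_clm_apply.2 fun w => ?_
    have hw : (fun ξ => h.integrand t x ξ w) =
        fun ξ => WithLp.toLp 2 fun l => h.integrandEntry t x w l ξ := by
      funext ξ
      ext l
      exact h.integrand_apply ht x ξ w l
    rw [hw]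
    exact (PiLp.continuous_toLp 2 _).comp
      (continuous_pi fun l => (h.integrandEntry t x w l).continuous)
  have h1 : d.Abar M t x = (M.P ^ 3)⁻¹ • ∫ ξ in cube M.P, h.integrand t x ξ := rfl
  have h2 := integrableOn_cube_of_continuous hP hc
  have h3 : (∫ ξ in cube M.P, h.integrand t x ξ) v l = ∫ ξ in cube M.P, h.integrand t x ξ v l := by
    rw [ContinuousLinearMap.integral_apply h2]
    exact ((EuclideanSpace.proj l : E3 →L[ℝ] ℝ).integral_comp_comm (h2.apply_continuousLinearMap v)).symm
  rw [h1, _root_.smul_apply, PiLp.smul_apply, h3, ← h.mean_integrandEntry ht]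
  simp only [h.integrand_apply ht]
  rfl

/-- The energy form of the homogenized equation. -/
def Qb (f g : PF) : PF := ∑ l, ∑ m, h.Ab l m * dx l f * dx m g

theorem Dt_rhobar {ρin : E3 → ℝ} {ρ : ℝ → E3 → ℝ} (hρ : IsSolution d.T d.u (d.Abar M) ρin ρ)
    {t : ℝ} (ht : t ∈ Icc 0 d.T) (x : E3) :
    h.Dt ⟨ρ, hρ.field⟩ t x = (∑ l, dx l (∑ m, h.Ab l m * dx m ⟨ρ, hρ.field⟩)) t x := by
  rw [← matDeriv_u]
  refine (hρ.eqn t ht x).trans ?_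
  rw [sum_apply]
  refine divergence_eq (fun y j => ?_) x
  rw [h.Abar_apply ht]
  simp only [sum_apply, mul_apply, ← gradient_apply]

theorem ellipt {t : ℝ} (ht : t ∈ Icc 0 d.T) (x : E3) (v : Fin 3 → ℝ) :
    1 / 2 * h.kb t x * ∑ l, v l ^ 2 ≤ ∑ l, ∑ m, h.Ab l m t x * v l * v m ∧
    ∑ l, ∑ m, h.Ab l m t x * v l * v m ≤ 2 * h.kb t x * ∑ l, v l ^ 2 := by
  have h1 := h.Abar_ellipt t ht x (WithLp.toLp 2 v)
  have h2 : inner ℝ (d.Abar M t x (WithLp.toLp 2 v)) (WithLp.toLp 2 v) =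
      ∑ l, ∑ m, h.Ab l m t x * v l * v m := by
    rw [PiLp.inner_apply]
    simp only [h.Abar_apply ht]
    refine Finset.sum_congr rfl fun l _ => ?_
    simp only [RCLike.inner_apply, conj_trivial, Finset.mul_sum]
    exact Finset.sum_congr rfl fun m _ => by ring
  have h3 : ‖(WithLp.toLp 2 v : E3)‖ ^ 2 = ∑ l, v l ^ 2 := by
    rw [EuclideanSpace.norm_sq_eq]; simp
  rw [h2, h3, ← h.kb_eq ht] at h1
  exact h1

theorem Qb_self {t : ℝ} (ht : t ∈ Icc 0 d.T) (x : E3) (f : PF) :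
    1 / 2 * (h.kb t x * Gd f t x) ≤ h.Qb f f t x ∧ h.Qb f f t x ≤ 2 * (h.kb t x * Gd f t x) := by
  have h1 := h.ellipt ht x fun l => dx l f t x
  simp only [Qb, sum_apply, mul_apply, Gd_apply]
  rw [← mul_assoc, ← mul_assoc]
  exact h1

/-- The isotropic part of the energy forms. -/
def Nf (f g : PF) : PF := ∑ i, d.kappa • (h.ηt i * ∑ p, h.di i p f * h.di i p g)

theorem Qb_eq (f g : PF) : h.Qb f g = h.Nf f g + ∑ i, d.kappa • (h.q i ^ 2 *
    ∑ k ∈ M.Λ, M.cst k • (h.a k i ^ 2 * (h.dk i k f * h.dk i k g))) := by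
  simp only [Qb, Nf, Ab, ← Finset.sum_add_distrib, Finset.sum_mul]
  simp only [dk_eq, di_apply]
  rw [Finset.sum_congr rfl fun l _ => Finset.sum_comm, Finset.sum_comm]
  refine Finset.sum_congr rfl fun i _ => ?_
  simp only [add_mul, Finset.sum_add_distrib]
  congr 1
  · simp only [Algebra.smul_def, Fin.sum_univ_three]
    ring
  · simp only [Algebra.smul_def, Finset.sum_mul, Finset.mul_sum]
    rw [Finset.sum_congr rfl fun l _ => Finset.sum_comm, Finset.sum_comm]
    refine Finset.sum_congr rfl fun k _ => ?_
    simp only [Fin.sum_univ_three]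
    ring

/-- The sum besides `Nf` is antisymmetric in `f` and `g`; it therefore disappears from the energy
law of the oscillating equation. -/
theorem Qt_eq (f g : PF) : h.Qt f g = h.Nf f g + ∑ i, d.kappa • (h.q i * ∑ k ∈ M.Λ, h.a k i *
    (h.dk i k f * ∑ q, h.Y i (CF.pd q (M.cell k)) * h.di i q g -
      (∑ q, h.Y i (CF.pd q (M.cell k)) * h.di i q f) * h.dk i k g)) := by
  simp only [Qt, Nf, oflux, mul_add, Finset.sum_add_distrib, mul_smul_comm, ← Finset.smul_sum]
  congr 1
  · congr 1
    refine Finset.sum_congr rfl fun i _ => ?_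
    rw [Finset.mul_sum]
    exact Finset.sum_congr rfl fun p _ => by ring
  · congr 1
    refine Finset.sum_congr rfl fun i _ => ?_
    simp only [Finset.mul_sum, dk_apply]
    rw [Finset.sum_comm]
    refine Finset.sum_congr rfl fun k _ => ?_
    simp only [Algebra.smul_def, Fin.sum_univ_three]
    ring

/-- The corrector. -/
def W (g : PF) : PF := d.lam⁻¹ • ∑ i, h.q i * ∑ k ∈ M.Λ, h.a k i * h.Y i (M.cell k) * h.dk i k g

theorem rhoTilde_eq {ρ ρbar : ℝ → E3 → ℝ} (hρ : TorusField ρ) (hb : TorusField ρbar) {t : ℝ}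
    (ht : t ∈ Icc 0 d.T) (x : E3) : d.rhoTilde M ρ ρbar t x =
      ((⟨ρ, hρ⟩ : PF) - (⟨ρbar, hb⟩ : PF) - h.W ⟨ρbar, hb⟩) t x := by
  simp only [sub_apply, W, smul_apply, sum_apply, mul_apply]
  rw [Data.rhoTilde, one_div]
  congr 2
  refine Finset.sum_congr rfl fun i _ => ?_
  by_cases hi : h.ηt i t x = 0
  · have h1 := h.etat_mul_q ht i x
    have h2 : h.ηt i t x * h.η i t x = h.η i t x := h.etat_eta i t ht x
    rw [hi, zero_mul] at h1 h2
    have h3 : d.eta i t x = 0 := h2.symm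
    rw [← h1, h3, zero_mul, zero_mul]
  have hg : ∀ l, gradient (ρbar t) x l = dx l (⟨ρbar, hb⟩ : PF) t x := fun l =>
    gradient_apply (⟨ρbar, hb⟩ : PF) t x l
  rw [PiLp.inner_apply]
  simp only [Data.chi, PiLp.smul_apply, h.invGradPhi_apply ht hi, hg, WithLp.ofLp_sum,
    Finset.sum_apply, smul_eq_mul, RCLike.inner_apply, conj_trivial]
  rw [q_apply, h.s_eq ht]
  simp only [dk_apply, di_apply, sum_apply, smul_apply, mul_apply, Finset.mul_sum]
  rw [Finset.sum_congr rfl fun l _ => Finset.sum_comm, Finset.sum_comm]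
  refine Finset.sum_congr rfl fun k hk => ?_
  rw [Finset.sum_comm]
  refine Finset.sum_congr rfl fun p _ => Finset.sum_congr rfl fun l _ => ?_
  rw [h.a_apply hk, Y_apply, M.cell_apply hk]
  ring

end Data.Assumptions

/-! ### Pointwise bounds on the slowly varying coefficients -/

namespace PF
variable {R t : ℝ} {x : E3} {n : ℕ} {A B : ℝ} {f g : PF}

/-- A factor that depends on time only is not differentiated, so there is no Leibniz constant. -/
theorem Bd.mul_flat {s : PF} (hs : ∀ l, dx l s = 0) (hf : Bd R t x n A f) :
    Bd R t x n (|s t x| * A) (s * f) := by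
  induction n generalizing A f with
  | zero => exact (abs_mul _ _).trans_le (mul_le_mul_of_nonneg_left hf (abs_nonneg _))
  | succ n ih =>
    refine ⟨(abs_mul _ _).trans_le (mul_le_mul_of_nonneg_left hf.1 (abs_nonneg _)), fun l => ?_⟩
    rw [Derivation.leibniz, hs, smul_zero, add_zero, smul_eq_mul, mul_assoc]
    exact ih (hf.2 l)

theorem Bd.of_abs_of_step {m : ℕ} (h0 : |f t x| ≤ A) (hm : n ≤ m + 1)
    (h1 : ∀ l, Bd R t x m (A * R) (dx l f)) : Bd R t x n A f := by
  cases n with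
  | zero => exact h0
  | succ n => exact ⟨h0, fun l => (h1 l).of_le (by omega)⟩

theorem Bd.of_clm {V : Type} [NormedAddCommGroup V] [NormedSpace ℝ V] {φ : E3 → V} {r : ℝ}
    (L : V →L[ℝ] ℝ) (hL : ‖L‖ ≤ 1) (hφ : ContDiff ℝ ∞ φ) (hf : ∀ y, f t y = L (φ y))
    (hr : 0 ≤ r⁻¹) (hrR : r⁻¹ ≤ R) (hA : 0 ≤ A)
    (hb : ∀ m ≤ n, ‖iteratedFDeriv ℝ m φ x‖ ≤ A * r⁻¹ ^ m) : Bd R t x n A f := by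
  refine Bd.of_iteratedFDeriv fun m hm => ?_
  have h1 : f t = L ∘ φ := funext hf
  rw [h1]
  have h3 := L.norm_iteratedFDeriv_comp_left (hφ.contDiffAt (x := x)) (N := ∞) (n := m)
    (by exact_mod_cast le_top)
  refine h3.trans ((mul_le_of_le_one_left (norm_nonneg _) hL).trans ((hb m hm).trans ?_))
  gcongr

end PF

section matDeriv
variable {V : Type} [NormedAddCommGroup V] [NormedSpace ℝ V] {f : ℝ → E3 → V}

theorem SmoothTX.matDeriv_eq (hf : SmoothTX f) (v : ℝ → E3 → E3) (t : ℝ) (x : E3) :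
    matDeriv v f t x = fderiv ℝ (fun p : ℝ × E3 => f p.1 p.2) (t, x) (1, v t x) := by
  have hd : DifferentiableAt ℝ (fun p : ℝ × E3 => f p.1 p.2) (t, x) :=
    hf.differentiable (by simp) _
  have h1 := (hd.hasFDerivAt.comp (f := fun s : ℝ => (s, x)) t
    (hasFDerivAt_prodMk_left t x)).hasDerivAt.deriv
  have h2 := (hd.hasFDerivAt.comp (f := fun y : E3 => (t, y)) x
    (hasFDerivAt_prodMk_right t x)).fderiv
  have h3 : deriv (fun s => f s x) t = fderiv ℝ (fun p : ℝ × E3 => f p.1 p.2) (t, x) (1, 0) := h1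
  have h4 : fderiv ℝ (f t) x (v t x) =
      fderiv ℝ (fun p : ℝ × E3 => f p.1 p.2) (t, x) (0, v t x) := by
    have h5 : fderiv ℝ (f t) x = _ := h2
    rw [h5]; rfl
  rw [matDeriv, h3, h4, ← map_add]
  simp

theorem SmoothTX.contDiff_matDeriv (hf : SmoothTX f) {v : ℝ → E3 → E3} (hv : SmoothTX v) (t : ℝ) :
    ContDiff ℝ ∞ (matDeriv v f t) := by
  have h1 : matDeriv v f t =
      fun x => fderiv ℝ (fun p : ℝ × E3 => f p.1 p.2) (t, x) (1, v t x) :=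
    funext fun x => hf.matDeriv_eq v t x
  rw [h1]
  have h2 : ContDiff ℝ ∞ (fderiv ℝ (fun p : ℝ × E3 => f p.1 p.2)) := hf.fderiv_right (by simp)
  have h3 : ContDiff ℝ ∞ fun x : E3 => (t, x) := contDiff_const.prodMk contDiff_id
  exact (h2.comp h3).clm_apply (contDiff_const.prodMk (hv.comp h3))

theorem SmoothTX.clm_matDeriv (hf : SmoothTX f) (L : V →L[ℝ] ℝ) (v : ℝ → E3 → E3) (t : ℝ) (x : E3) :
    L (matDeriv v f t x) = matDeriv v (fun t x => L (f t x)) t x := by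
  have h1 : SmoothTX (fun t x => L (f t x)) := L.contDiff.comp hf
  have hd : DifferentiableAt ℝ (fun p : ℝ × E3 => f p.1 p.2) (t, x) :=
    hf.differentiable (by simp) _
  rw [hf.matDeriv_eq, h1.matDeriv_eq]
  have h2 := (L.hasFDerivAt.comp (t, x) hd.hasFDerivAt).fderiv
  have h3 : fderiv ℝ (fun p : ℝ × E3 => L (f p.1 p.2)) (t, x) = _ := h2
  rw [h3]; rfl

theorem SmoothTX.slice (hf : SmoothTX f) (t : ℝ) : ContDiff ℝ ∞ (f t) :=
  hf.comp (contDiff_const.prodMk contDiff_id)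

end matDeriv

namespace Data.Assumptions

open PF

variable {n : ℕ} {M : Mikado} {N : ℕ} {K : ℝ} {d : Data n} (h : d.Assumptions M N K)
include h

theorem K_pos : 0 < K := one_pos.trans_le h.one_le_K

/-- The bounds on the components of a slow function. -/
theorem bd_of_slowOn {V : Type} [NormedAddCommGroup V] [NormedSpace ℝ V] {r : ℝ} (hr : 0 < r)
    {w : ℝ → E3 → ℝ} {φ : ℝ → E3 → V} (hφ : SmoothTX φ) (hs : d.SlowOn N K r w φ) {f : PF}
    (L : V →L[ℝ] ℝ) (hL : ‖L‖ ≤ 1) (hf : ∀ t x, f t x = L (φ t x)) {t : ℝ} {x : E3}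
    (ht : t ∈ Icc 0 d.T) (hw : w t x ≠ 0) {R : ℝ} (hR : r⁻¹ ≤ R) :
    Bd R t x N K f ∧ Bd R t x N (K * d.tau⁻¹) (h.Dt f) := by
  have hr' := (inv_pos.2 hr).le
  constructor
  · exact Bd.of_clm L hL (hφ.slice t) (hf t) hr' hR h.K_pos.le fun m hm => (hs m hm t ht x hw).1
  · refine Bd.of_clm L hL (hφ.contDiff_matDeriv h.u_field.1 t) (fun y => ?_) hr' hR
      (mul_nonneg h.K_pos.le (inv_pos.2 h.tau_pos).le) fun m hm => (hs m hm t ht x hw).2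
    rw [hφ.clm_matDeriv, ← matDeriv_u]
    have : (fun t x => f t x) = fun t x => L (φ t x) := funext fun t => funext fun x => hf t x
    rw [this]

theorem smoothTX_gradPhi (i : Fin n) : SmoothTX (d.gradPhi i) := by
  have h1 : ContDiff ℝ ∞ (fun q : (ℝ × E3) × E3 => d.Phi i q.1.1 q.2) :=
    (h.Phi_smooth i).comp ((contDiff_fst.comp contDiff_fst).prodMk contDiff_snd)
  exact ContDiff.fderiv (f := fun (p : ℝ × E3) (y : E3) => d.Phi i p.1 y) (m := ∞) h1 contDiff_snd
    (by simp)

theorem bd_F {i : Fin n} {t : ℝ} {x : E3} (ht : t ∈ Icc 0 d.T) (hi : h.ηt i t x ≠ 0)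
    (a l : Fin 3) : Bd (h.R t x) t x N K (h.F i a l) ∧
      Bd (h.R t x) t x N (K * d.tau⁻¹) (h.Dt (h.F i a l)) := by
  refine h.bd_of_slowOn h.ell_pos (h.smoothTX_gradPhi i) (h.Phi_bound i)
    ((EuclideanSpace.proj a : E3 →L[ℝ] ℝ).comp (ContinuousLinearMap.apply ℝ E3 (basisVec l))) ?_
    (fun t x => (h.fderiv_Phi i t x a l).symm) ht hi (h.inv_ell_le_R ht x)
  refine ContinuousLinearMap.opNorm_le_bound _ zero_le_one fun A => ?_
  rw [one_mul]
  have h1 := A.le_opNorm (basisVec l)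
  rw [norm_basisVec, mul_one] at h1
  exact (PiLp.norm_apply_le (A (basisVec l)) a).trans h1

theorem bd_η (i : Fin n) {t : ℝ} (ht : t ∈ Icc 0 d.T) (x : E3) : Bd 1 t x N K (h.η i) ∧
      Bd 1 t x N (K * d.tau⁻¹) (h.Dt (h.η i)) :=
  h.bd_of_slowOn one_pos (h.eta_field i).1 (h.eta_bound i) (ContinuousLinearMap.id ℝ ℝ)
    ContinuousLinearMap.norm_id_le (fun _ _ => rfl) ht one_ne_zero (by simp)

theorem bd_ηt (i : Fin n) {t : ℝ} (ht : t ∈ Icc 0 d.T) (x : E3) : Bd 1 t x N K (h.ηt i) :=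
  (h.bd_of_slowOn one_pos (h.etat_field i).1 (h.etat_bound i) (ContinuousLinearMap.id ℝ ℝ)
    ContinuousLinearMap.norm_id_le (fun _ _ => rfl) ht one_ne_zero (by simp)).1

theorem bd_a {i : Fin n} {t : ℝ} {x : E3} (ht : t ∈ Icc 0 d.T) (hi : h.η i t x ≠ 0) (k : E3) :
    Bd (h.R t x) t x N K (h.a k i) ∧ Bd (h.R t x) t x N (K * d.tau⁻¹) (h.Dt (h.a k i)) := by
  by_cases hk : k ∈ M.Λ
  · exact h.bd_of_slowOn h.ell_pos (h.aR_field k hk i).1 (h.aR_bound k hk i)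
      (ContinuousLinearMap.id ℝ ℝ) ContinuousLinearMap.norm_id_le (fun t x => h.a_apply hk i t x)
      ht hi (h.inv_ell_le_R ht x)
  · have h1 : h.a k i = 0 := by simp [a, hk]
    rw [h1, map_zero]
    exact ⟨Bd.zero h.K_pos.le (h.R_pos t x).le,
      Bd.zero (mul_nonneg h.K_pos.le (inv_pos.2 h.tau_pos).le) (h.R_pos t x).le⟩

theorem bd_G {i : Fin n} {t : ℝ} {x : E3} (ht : t ∈ Icc 0 d.T) (hi : h.ηt i t x ≠ 0)
    (l p : Fin 3) : Bd (h.R t x) t x N (2 ^ N * (K * K) + 2 ^ N * (K * K)) (h.G i l p) := by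
  have e := fun a l a' l' => ((h.bd_F ht hi a l).1.mul (h.bd_F ht hi a' l').1)
  have hs : ∀ a l a' l' b m b' m', Bd (h.R t x) t x N (2 ^ N * (K * K) + 2 ^ N * (K * K))
      (h.F i a l * h.F i a' l' - h.F i b m * h.F i b' m') := fun a l a' l' b m b' m' =>
    (e a l a' l').sub (e b m b' m')
  have hs' : ∀ a l a' l' b m b' m', Bd (h.R t x) t x N (2 ^ N * (K * K) + 2 ^ N * (K * K))
      (-(h.F i a l * h.F i a' l') + h.F i b m * h.F i b' m') := fun a l a' l' b m b' m' =>
    (e a l a' l').neg.add (e b m b' m')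
  rw [G, Matrix.adjugate_fin_three]
  fin_cases l <;> fin_cases p <;> first | exact hs _ _ _ _ _ _ _ _ | exact hs' _ _ _ _ _ _ _ _

theorem exists_etat_ne {t : ℝ} (ht : t ∈ Icc 0 d.T) (x : E3) : ∃ i, h.ηt i t x ≠ 0 := by
  by_contra hc
  push Not at hc
  have h1 : ∑ i, h.ηt i t x = 1 := h.etat_sum t ht x
  simp [hc] at h1

/-- The velocity gradient is recovered from a transported deformation. Near a point with `η̃_i ≠ 0`
the law `D_t F = -F ∇u` gives `∇u = -G D_t F`, and the right-hand side is of size `τ⁻¹` at scale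
`R`. -/
theorem bd_dxu {t : ℝ} {x : E3} (ht : t ∈ Ioo 0 d.T) (l b : Fin 3) :
    Bd (h.R t x) t x N (3 * (2 ^ N * ((2 ^ N * (K * K) + 2 ^ N * (K * K)) * (K * d.tau⁻¹))))
      (dx l (h.u b)) := by
  have ht' := Ioo_subset_Icc_self ht
  obtain ⟨i, hi⟩ := h.exists_etat_ne ht' x
  have h1 : Bd (h.R t x) t x N (3 * (2 ^ N * ((2 ^ N * (K * K) + 2 ^ N * (K * K)) * (K * d.tau⁻¹))))
      (-∑ a, h.G i b a * h.Dt (h.F i a l)) :=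
    (Bd.sum_fin (h.R_pos t x).le fun a => (h.bd_G ht' hi b a).mul (h.bd_F ht' hi a l).2).neg
  refine h1.congr ?_
  have h2 : ∀ a, EqAt t x (h.Dt (h.F i a l)) (0 - ∑ m, dx l (h.u m) * h.F i a m) := fun a => by
    rw [h.Dt_F]
    exact (((h.eqAt_z ht hi a).dxD l).trans (EqAt.of_eq (map_zero _))).sub (EqAt.refl _)
  have h3 : EqAt t x (∑ a, h.G i b a * h.Dt (h.F i a l))
      (∑ a, h.G i b a * (0 - ∑ m, dx l (h.u m) * h.F i a m)) :=
    EqAt.sum _ fun a _ => (EqAt.refl _).mul (h2 a)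
  have h4 : ∑ a, h.G i b a * (0 - ∑ m, dx l (h.u m) * h.F i a m) = -(h.J i * dx l (h.u b)) := by
    have h5 : ∀ (A D : Fin 3 → PF) (B : Fin 3 → Fin 3 → PF),
        ∑ a, A a * (0 - ∑ m, D m * B a m) = -∑ m, D m * ∑ a, A a * B a m := fun A D B => by
      simp only [Fin.sum_univ_three]
      ring
    rw [h5 (h.G i b) (fun m => dx l (h.u m)) (h.F i)]
    simp only [G_mul_F]
    simp [mul_comm]
  rw [h4] at h3
  have h6 : EqAt t x (-(h.J i * dx l (h.u b))) (-(1 * dx l (h.u b))) := by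
    have := ((h.eqAt_J ht hi).mul (EqAt.refl (dx l (h.u b)))).smul (-1)
    simpa using this
  have h7 := (h3.trans h6).smul (-1)
  simpa using h7

theorem s_le {t : ℝ} (ht : t ∈ Icc 0 d.T) (x : E3) : h.s t x ≤ K * Real.sqrt d.delta := by
  rw [h.s_eq ht]
  have hK := h.one_le_K
  have h1 := (h.sigma_delta t ht).2
  have h2 := h.delta_pos
  rw [Real.sqrt_le_left (by positivity), mul_pow, Real.sq_sqrt h2.le]
  nlinarith [mul_nonneg (mul_nonneg (sub_nonneg.2 hK) h.K_pos.le) h2.le]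

theorem sqrt_delta_le : (d.kappa * d.lam)⁻¹ * Real.sqrt d.delta ≤ d.ell⁻¹ := by
  have h1 := h.delta_ell
  rw [← Real.sqrt_eq_rpow] at h1
  have hk := h.kappa_pos
  have hl := h.lam_pos
  have he := h.ell_pos
  rw [← one_div d.ell, le_div_iff₀ he]
  calc _ = Real.sqrt d.delta * d.ell * d.kappa⁻¹ * d.lam⁻¹ := by rw [mul_inv]; ring
    _ ≤ 1 := h1

/-- A derivative of `q` falls on `η_i`, which varies at unit scale, and the amplitude `σ^{1/2}/(κλ)`
is at most a multiple of `ℓ⁻¹ ≤ R` by `delta_ell`. So the bound is of order `R` with no factor `Q`.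
-/
theorem bd_dxq (hN : 1 ≤ N) (i : Fin n) {t : ℝ} (ht : t ∈ Icc 0 d.T) (x : E3) (l : Fin 3) :
    Bd (h.R t x) t x (N - 1) (K * K * h.R t x) (dx l (h.q i)) := by
  have h1 : Bd 1 t x (N - 1) K (dx l (h.η i)) := by
    have := ((h.bd_η i ht x).1.of_le (m := N - 1 + 1) (by omega)).step l
    simpa using this
  have hR := h.one_le_R ht x
  have h2 := ((h1.mono_scale zero_le_one hR).mul_flat h.dx_s).smul (d.kappa * d.lam)⁻¹
  have h3 : dx l (h.q i) = (d.kappa * d.lam)⁻¹ • (h.s * dx l (h.η i)) := by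
    rw [q, Derivation.map_smul, Derivation.leibniz, h.dx_s, smul_zero, zero_add, smul_eq_mul]
  rw [h3]
  refine h2.mono (h.R_pos t x).le ?_
  have hk := inv_pos.2 (mul_pos h.kappa_pos h.lam_pos)
  rw [abs_of_pos hk, abs_of_pos (h.s_pos ht x)]
  have h4 := h.s_le ht x
  have h5 := h.sqrt_delta_le
  have h6 := h.inv_ell_le_R ht x
  have hK := h.K_pos
  calc (d.kappa * d.lam)⁻¹ * (h.s t x * K) ≤ (d.kappa * d.lam)⁻¹ * (K * Real.sqrt d.delta * K) := by
        gcongr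
    _ = K * K * ((d.kappa * d.lam)⁻¹ * Real.sqrt d.delta) := by ring
    _ ≤ K * K * h.R t x := by gcongr; exact h5.trans h6

theorem bd_q (hN : 1 ≤ N) (i : Fin n) {t : ℝ} (ht : t ∈ Icc 0 d.T) (x : E3) :
    Bd (h.R t x) t x N (K * K * h.Q t x) (h.q i) := by
  have hK := h.one_le_K
  have hQ := h.one_le_Q t x
  have hR := h.R_pos t x
  have hKK : 1 ≤ K * K := by nlinarith
  refine Bd.of_abs_of_step (m := N - 1) ((h.abs_q_le i t x).trans ?_) (by omega) fun l =>
    (h.bd_dxq hN i ht x l).mono hR.le ?_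
  · nlinarith
  · calc K * K * h.R t x ≤ K * K * h.R t x * h.Q t x := le_mul_of_one_le_right (by positivity) hQ
      _ = _ := by ring

/-- Sums over the active indices. -/
theorem bd_sum_active {f : Fin n → PF} {t : ℝ} {x : E3} (hg : h.Good t x) {m : ℕ} {A : ℝ}
    (hA : 0 ≤ A) (h0 : ∀ i, EqAt t x (h.ηt i) 0 → EqAt t x (f i) 0)
    (h1 : ∀ i, h.ηt i t x ≠ 0 → Bd (h.R t x) t x m A (f i)) :
    Bd (h.R t x) t x m (K * A) (∑ i, f i) := by
  classical
  have hR := (h.R_pos t x).le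
  have h2 : Bd (h.R t x) t x m (∑ i, if h.ηt i t x ≠ 0 then A else 0) (∑ i, f i) := by
    refine Bd.sum _ hR fun i _ => ?_
    split_ifs with hi
    · exact h1 i hi
    · exact (Bd.zero le_rfl hR).congr (h0 i ((hg.etat i).resolve_left hi)).symm
  refine h2.mono hR ?_
  rw [← Finset.sum_filter, Finset.sum_const, nsmul_eq_mul]
  refine mul_le_mul_of_nonneg_right ?_ hA
  have h3 := h.overlap t (Ioo_subset_Icc_self hg.mem) x
  have h4 : ({i | d.etat i t x ≠ 0} : Set (Fin n)) =
      ((Finset.univ.filter fun i => h.ηt i t x ≠ 0 : Finset (Fin n)) : Set (Fin n)) := by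
    ext i; simp; rfl
  rwa [h4, Set.ncard_coe_finset] at h3

/-- Sums of functions that live on the disjoint cutoffs. -/
theorem bd_sum_lives {f : Fin n → PF} {t : ℝ} {x : E3} (hg : h.Good t x) {m : ℕ} {A R : ℝ}
    (hA : 0 ≤ A) (hR : 0 ≤ R) (h0 : ∀ i, EqAt t x (h.η i) 0 → EqAt t x (f i) 0)
    (h1 : ∀ i, h.η i t x ≠ 0 → Bd R t x m A (f i)) :
    Bd R t x m A (∑ i, f i) := by
  classical
  by_cases hc : ∃ i, h.η i t x ≠ 0
  · obtain ⟨i, hi⟩ := hc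
    have h2 : EqAt t x (∑ j, if j = i then f i else 0) (∑ j, f j) := by
      refine EqAt.sum _ fun j _ => ?_
      split_ifs with hj
      · rw [hj]; exact EqAt.refl _
      · exact (h0 j (hg.eqAt_eta hi (Ne.symm hj))).symm
    rw [Finset.sum_ite_eq' Finset.univ i, if_pos (Finset.mem_univ i)] at h2
    exact (h1 i hi).congr h2
  · push Not at hc
    have h2 : EqAt t x (∑ j : Fin n, 0) (∑ j, f j) :=
      EqAt.sum _ fun j _ => (h0 j ((hg.eta j).resolve_left (not_not.2 (hc j)))).symm
    rw [Finset.sum_const_zero] at h2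
    exact (Bd.zero hA hR).congr h2

/-- The constant in the bounds on the inverse Jacobian matrices. -/
def cG (N : ℕ) (K : ℝ) : ℝ := 2 ^ N * (K * K) + 2 ^ N * (K * K)

/-- The constant in the bounds on the homogenized matrix. -/
def cA (M : Mikado) (N : ℕ) (K : ℝ) : ℝ :=
  K * (2 ^ N * (K * (3 * (2 ^ N * (cG N K * cG N K))))) +
  2 ^ N * (2 ^ N * (K * K * (K * K)) * ∑ k ∈ M.Λ, M.cst k * (2 ^ N * (2 ^ N * (K * K) *
    (2 ^ N * ((∑ p, |k p| * cG N K) * (∑ p, |k p| * cG N K))))))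

theorem bd_Gk {i : Fin n} {t : ℝ} {x : E3} (ht : t ∈ Icc 0 d.T) (hi : h.ηt i t x ≠ 0)
    (k : E3) (l : Fin 3) : Bd (h.R t x) t x N (∑ p, |k p| * cG N K) (h.Gk i k l) :=
  Bd.sum _ (h.R_pos t x).le fun p _ => (h.bd_G ht hi l p).smul _

/-- The isotropic part is of order `κ ≤ κ̄`, and overlapping `η̃_i` cost a factor `K`. The rest
lives on the disjoint cutoffs and is of order `κ q² ≤ κ Q² = κ̄`. -/
theorem bd_Ab (hN : 1 ≤ N) {t : ℝ} {x : E3} (hg : h.Good t x) (l m : Fin 3) :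
    Bd (h.R t x) t x N (cA M N K * h.kb t x) (h.Ab l m) := by
  have ht := Ioo_subset_Icc_self hg.mem
  have hR := h.R_pos t x
  have hR1 := h.one_le_R ht x
  have hK := h.K_pos
  have hκ := h.kappa_pos
  have hQ := h.one_le_Q t x
  have hcG : 0 ≤ cG N K := by rw [cG]; positivity
  have hcst := M.cst_nonneg
  simp only [Ab, Finset.sum_add_distrib]
  rw [cA, add_mul]
  refine Bd.add ?_ ?_
  · have h1 := h.bd_sum_active hg (m := N)
      (f := fun i => d.kappa • (h.ηt i * ∑ p, h.G i l p * h.G i m p))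
      (A := |d.kappa| * (2 ^ N * (K * (3 * (2 ^ N * (cG N K * cG N K)))))) (by positivity)
      (fun i hi => ((hi.mul_zero_left _).smul _).trans (EqAt.of_eq (smul_zero _)))
      (fun i hi => (((h.bd_ηt i ht x).mono_scale zero_le_one hR1).mul
        (Bd.sum_fin hR.le fun p => (h.bd_G ht hi l p).mul (h.bd_G ht hi m p))).smul _)
    refine h1.mono hR.le ?_
    rw [abs_of_pos hκ, mul_left_comm, mul_comm d.kappa]
    exact mul_le_mul_of_nonneg_left (h.kappa_le_kb t x) (by positivity)
  · have h1 := h.bd_sum_lives hg (m := N) (R := h.R t x)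
      (f := fun i => d.kappa • (h.q i ^ 2 *
        ∑ k ∈ M.Λ, M.cst k • (h.a k i ^ 2 * (h.Gk i k l * h.Gk i k m))))
      (A := |d.kappa| * (2 ^ N * (2 ^ N * (K * K * h.Q t x * (K * K * h.Q t x)) *
        ∑ k ∈ M.Λ, |M.cst k| * (2 ^ N * (2 ^ N * (K * K) *
        (2 ^ N * ((∑ p, |k p| * cG N K) * (∑ p, |k p| * cG N K)))))))) (by positivity) hR.le
      (fun i hi => (((by
        rw [sq]; exact (Good.eqAt_q hi).mul_zero_left _ : EqAt t x (h.q i ^ 2) 0).mul_zero_left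
          _).smul _).trans (EqAt.of_eq (smul_zero _)))
      (fun i hi => by
        have hi' := hg.etat_ne hi
        simp only [sq]
        exact (((h.bd_q hN i ht x).mul (h.bd_q hN i ht x)).mul (Bd.sum _ hR.le fun k _ =>
          (((h.bd_a ht hi k).1.mul (h.bd_a ht hi k).1).mul
            ((h.bd_Gk ht hi' k l).mul (h.bd_Gk ht hi' k m))).smul _)).smul _)
    refine h1.mono hR.le (le_of_eq ?_)
    simp only [abs_of_pos hκ, abs_of_nonneg (hcst _)]
    rw [← h.Q_sq]
    ring

theorem abs_dx_kb (hN : 1 ≤ N) {t : ℝ} {x : E3} (hg : h.Good t x) (l : Fin 3) :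
    |dx l h.kb t x| ≤ 2 * (K * K) * (h.R t x * h.kb t x) := by
  have ht := Ioo_subset_Icc_self hg.mem
  have hR := h.R_pos t x
  have hK := h.K_pos
  have hκ := h.kappa_pos
  have hQ := h.one_le_Q t x
  have h2 : Bd (h.R t x) t x 0 (2 * (h.Q t x * (K * K * h.R t x)))
      (∑ i, (2:ℝ) • (h.q i * dx l (h.q i))) := by
    refine h.bd_sum_lives hg (by positivity) hR.le (fun i hi => ?_) fun i hi => ?_
    · exact (((Good.eqAt_q hi).mul_zero_left _).smul _).trans (EqAt.of_eq (smul_zero _))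
    · have h3 : Bd (h.R t x) t x 0 (h.Q t x) (h.q i) := h.abs_q_le i t x
      have := ((h3.mul ((h.bd_dxq hN i ht x l).of_le (Nat.zero_le _))).smul 2)
      simpa using this
  have h1 : dx l h.kb = d.kappa • ∑ i, (2:ℝ) • (h.q i * dx l (h.q i)) := by
    rw [kb, Derivation.map_smul, map_add, Derivation.map_one_eq_zero, zero_add, map_sum]
    congr 1
    refine Finset.sum_congr rfl fun i _ => ?_
    rw [sq, Derivation.leibniz, smul_eq_mul, two_smul]
  rw [h1, smul_apply, abs_mul, abs_of_pos hκ, ← h.Q_sq]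
  calc _ ≤ d.kappa * (2 * (h.Q t x * (K * K * h.R t x))) :=
        mul_le_mul_of_nonneg_left h2.abs_le hκ.le
    _ = 2 * (K * K) * (h.R t x * (d.kappa * h.Q t x)) := by ring
    _ ≤ 2 * (K * K) * (h.R t x * (d.kappa * h.Q t x ^ 2)) := by
      gcongr
      nlinarith

end Data.Assumptions

/-! ### Regularization of the amplitudes -/

theorem sq_deriv_le_of_nonneg {g g' g'' : ℝ → ℝ} {K : ℝ} (hK : 0 < K)
    (h1 : ∀ r, HasDerivAt g (g' r) r) (h2 : ∀ r, HasDerivAt g' (g'' r) r)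
    (hb : ∀ r, g'' r ≤ K) (hg : ∀ r, 0 ≤ g r) : g' 0 ^ 2 ≤ 2 * K * g 0 := by
  have hm : Monotone fun r => K * r - g' r := by
    refine monotone_of_hasDerivAt_nonneg (f' := fun r => K - g'' r)
      (fun r => ?_) fun r => sub_nonneg.2 (hb r)
    have := ((hasDerivAt_id r).const_mul K).sub (h2 r)
    rw [mul_one] at this
    exact this
  have hd : ∀ r, HasDerivAt (fun r => g' 0 * r + K / 2 * r ^ 2 - g r)
      (g' 0 + K * r - g' r) r := fun r => by
    have := (((hasDerivAt_id r).const_mul (g' 0)).add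
      ((hasDerivAt_pow 2 r).const_mul (K / 2))).sub (h1 r)
    refine this.congr_deriv ?_
    simp only [Nat.cast_ofNat, Nat.add_one_sub_one, pow_one]
    ring
  have hc : Continuous fun r => g' 0 * r + K / 2 * r ^ 2 - g r :=
    continuous_iff_continuousAt.2 fun r => (hd r).continuousAt
  have key : ∀ r, g r ≤ g 0 + g' 0 * r + K / 2 * r ^ 2 := by
    intro r
    rcases lt_trichotomy r 0 with hr | hr | hr
    · obtain ⟨c, hc1, hc2⟩ := exists_hasDerivAt_eq_slope _ _ hr hc.continuousOn fun x _ => hd x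
      have h3 := hm hc1.2.le
      simp only [mul_zero] at h3
      rw [eq_div_iff (by linarith)] at hc2
      nlinarith
    · subst hr; simp
    · obtain ⟨c, hc1, hc2⟩ := exists_hasDerivAt_eq_slope _ _ hr hc.continuousOn fun x _ => hd x
      have h3 := hm hc1.1.le
      simp only [mul_zero] at h3
      rw [eq_div_iff (by linarith)] at hc2
      nlinarith
  -- The function is nonnegative and lies below the parabola of `key`, so the minimum of the
  -- parabola, attained at `-g'(0)/K`, is nonnegative.
  have h3 := (hg _).trans (key (-g' 0 / K))
  have h4 : g 0 + g' 0 * (-g' 0 / K) + K / 2 * (-g' 0 / K) ^ 2 = g 0 - g' 0 ^ 2 / (2 * K) := by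
    field_simp; ring
  rw [h4, sub_nonneg, div_le_iff₀ (by positivity)] at h3
  linarith

/-- A function that is constant below `1` and above `2`. -/
def Steplike (θ : ℝ → ℝ) : Prop := ∃ a b : ℝ, (∀ y < 1, θ y = a) ∧ ∀ y > 2, θ y = b

theorem Steplike.deriv {θ : ℝ → ℝ} (h : Steplike θ) : Steplike (deriv θ) := by
  obtain ⟨a, b, ha, hb⟩ := h
  refine ⟨0, 0, fun y hy => ?_, fun y hy => ?_⟩
  · have : θ =ᶠ[𝓝 y] fun _ => a := by
      filter_upwards [Iio_mem_nhds hy] with z hz using ha z hz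
    rw [this.deriv_eq, deriv_const]
  · have : θ =ᶠ[𝓝 y] fun _ => b := by
      filter_upwards [Ioi_mem_nhds hy] with z hz using hb z hz
    rw [this.deriv_eq, deriv_const]

theorem Steplike.bounded {θ : ℝ → ℝ} (h : Steplike θ) (hc : Continuous θ) :
    ∃ B, ∀ y, |θ y| ≤ B := by
  obtain ⟨a, b, ha, hb⟩ := h
  obtain ⟨C, hC⟩ := isCompact_Icc.exists_bound_of_continuousOn (s := Icc (1:ℝ) 2) hc.continuousOn
  refine ⟨max C (max |a| |b|), fun y => ?_⟩
  rcases lt_or_ge y 1 with h1 | h1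
  · rw [ha y h1]; simp
  rcases lt_or_ge 2 y with h2 | h2
  · rw [hb y h2]; simp
  · exact (hC y ⟨h1, h2⟩).trans (le_max_left _ _)

theorem Steplike.bounded_deriv {θ : ℝ → ℝ} (h : Steplike θ) (hc : ContDiff ℝ ∞ θ) (n : ℕ) :
    ∃ B, 1 ≤ B ∧ ∀ m ≤ n, ∀ y, |_root_.deriv^[m] θ y| ≤ B := by
  induction n generalizing θ with
  | zero =>
    obtain ⟨B, hB⟩ := h.bounded hc.continuous
    refine ⟨max 1 B, le_max_left _ _, fun m hm y => ?_⟩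
    obtain rfl : m = 0 := by omega
    exact (hB y).trans (le_max_right _ _)
  | succ n ih =>
    obtain ⟨B, hB⟩ := h.bounded hc.continuous
    obtain ⟨B', hB1, hB'⟩ := ih h.deriv (PF.contDiff_deriv_of_infty hc)
    refine ⟨max B' B, hB1.trans (le_max_left _ _), fun m hm y => ?_⟩
    cases m with
    | zero => exact (hB y).trans (le_max_right _ _)
    | succ m => exact (hB' m (by omega) y).trans (le_max_left _ _)

/-- A smooth step from `0` below `1` to `1` above `2`. -/
def step (y : ℝ) : ℝ := Real.smoothTransition (y - 1)

theorem contDiff_step : ContDiff ℝ ∞ step :=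
  Real.smoothTransition.contDiff.comp (contDiff_id.sub contDiff_const)

theorem step_eq_zero {y : ℝ} (hy : y ≤ 1) : step y = 0 :=
  Real.smoothTransition.zero_of_nonpos (by linarith)

theorem step_eq_one {y : ℝ} (hy : 2 ≤ y) : step y = 1 :=
  Real.smoothTransition.one_of_one_le (by linarith)

/-- A smooth truncation of the identity. -/
def trunc (y : ℝ) : ℝ := y * step y

theorem contDiff_trunc : ContDiff ℝ ∞ trunc := contDiff_id.mul contDiff_step

theorem steplike_step : Steplike step :=
  ⟨0, 1, fun _ hy => step_eq_zero hy.le, fun _ hy => step_eq_one (le_of_lt hy)⟩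

theorem steplike_deriv_trunc : Steplike (deriv trunc) := by
  refine ⟨0, 1, fun y hy => ?_, fun y hy => ?_⟩
  · have : trunc =ᶠ[𝓝 y] fun _ => 0 := by
      filter_upwards [Iio_mem_nhds hy] with z hz
      rw [trunc, step_eq_zero (le_of_lt hz), mul_zero]
    rw [this.deriv_eq, deriv_const]
  · have : trunc =ᶠ[𝓝 y] id := by
      filter_upwards [Ioi_mem_nhds hy] with z hz
      rw [trunc, step_eq_one (le_of_lt hz), mul_one]; rfl
    rw [this.deriv_eq, deriv_id]

theorem abs_trunc_sub_le {y : ℝ} (hy : 0 ≤ y) : |y - trunc y| ≤ 2 := by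
  rcases lt_or_ge y 2 with h | h
  · have h0 := Real.smoothTransition.nonneg (y - 1)
    have h1 := Real.smoothTransition.le_one (y - 1)
    have : y - trunc y = y * (1 - step y) := by rw [trunc]; ring
    have h2 : (0:ℝ) ≤ step y := h0
    have h3 : step y ≤ 1 := h1
    rw [this, abs_of_nonneg (mul_nonneg hy (sub_nonneg.2 h3))]
    nlinarith
  · rw [trunc, step_eq_one h]; simp

namespace Data.Assumptions

open PF

variable {n : ℕ} {M : Mikado} {N : ℕ} {K : ℝ} {d : Data n} (h : d.Assumptions M N K)
include h

/-- Nonnegativity makes the gradient of a cutoff small where the cutoff is small; this controls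
derivatives of `x0 q` in the transition zone of the truncation. -/
theorem sq_dx_eta_le (hN : 2 ≤ N) (i : Fin n) {t : ℝ} (ht : t ∈ Icc 0 d.T) (x : E3) (l : Fin 3) :
    dx l (h.η i) t x ^ 2 ≤ 2 * K * h.η i t x := by
  have hl : ∀ r : ℝ, HasDerivAt (fun s : ℝ => x + s • basisVec l) (basisVec l) r := fun r => by
    simpa using ((hasDerivAt_id r).smul_const (basisVec l)).const_add x
  have hd : ∀ (f : PF) (r : ℝ), HasDerivAt (fun s : ℝ => f t (x + s • basisVec l))
      (dx l f t (x + r • basisVec l)) r := fun f r => by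
    rw [← fderiv_basisVec]
    exact ((f.contDiff_slice t).differentiable (by simp) _).hasFDerivAt.comp_hasDerivAt r (hl r)
  have h1 := sq_deriv_le_of_nonneg h.K_pos (hd (h.η i)) (hd (dx l (h.η i))) (fun r => by
    have h2 := ((((h.bd_η i ht (x + r • basisVec l)).1.of_le hN).step l).step l).abs_le
    simp only [mul_one] at h2
    exact (le_abs_self _).trans h2) fun r => h.eta_nonneg i t ht _
  simpa using h1

theorem Dt_comp (θ : ℝ → ℝ) (hθ : ContDiff ℝ ∞ θ) (f : PF) :
    h.Dt (comp θ hθ f) = comp (deriv θ) (contDiff_deriv_of_infty hθ) f * h.Dt f := by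
  simp only [Dt_apply, dt, dx, dir_comp, mul_add, Finset.mul_sum]
  congr 1
  exact Finset.sum_congr rfl fun l _ => by ring

/-- The amplitude `σ^{1/2} / (κ λ)`. -/
def amp : PF := (d.kappa * d.lam)⁻¹ • h.s

omit h in
/-- The constant comparable to the amplitude. -/
def L0 (d : Data n) : ℝ := (d.kappa * d.lam)⁻¹ * Real.sqrt d.delta

theorem q_eq (i : Fin n) : h.q i = h.amp * h.η i := by
  rw [q, amp, smul_mul_assoc, mul_comm (h.η i)]

theorem dx_amp (l : Fin 3) : dx l h.amp = 0 := by
  rw [amp, Derivation.map_smul, dx_s, smul_zero]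

theorem amp_pos {t : ℝ} (ht : t ∈ Icc 0 d.T) (x : E3) : 0 < h.amp t x :=
  mul_pos (inv_pos.2 (mul_pos h.kappa_pos h.lam_pos)) (h.s_pos ht x)

theorem L0_pos : 0 < L0 d :=
  mul_pos (inv_pos.2 (mul_pos h.kappa_pos h.lam_pos)) (Real.sqrt_pos.2 h.delta_pos)

theorem amp_le {t : ℝ} (ht : t ∈ Icc 0 d.T) (x : E3) : h.amp t x ≤ K * L0 d := by
  have h1 := h.s_le ht x
  have h2 := inv_pos.2 (mul_pos h.kappa_pos h.lam_pos)
  calc (d.kappa * d.lam)⁻¹ * h.s t x ≤ (d.kappa * d.lam)⁻¹ * (K * Real.sqrt d.delta) := by gcongr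
    _ = _ := by rw [L0]; ring

theorem L0_le_R {t : ℝ} (ht : t ∈ Icc 0 d.T) (x : E3) : L0 d ≤ h.R t x :=
  h.sqrt_delta_le.trans (h.inv_ell_le_R ht x)

theorem Dt_amp : h.Dt h.amp = (d.kappa * d.lam)⁻¹ • dt h.s := by
  rw [Dt_apply]
  simp only [dx_amp, mul_zero, Finset.sum_const_zero, add_zero]
  rw [amp, Derivation.map_smul]

theorem dx_Dt_amp (l : Fin 3) : dx l (h.Dt h.amp) = 0 := by
  rw [Dt_amp, Derivation.map_smul, ← dt_dx, dx_s, map_zero, smul_zero]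

theorem abs_Dt_amp_le {t : ℝ} (ht : t ∈ Ioo 0 d.T) (x : E3) :
    |h.Dt h.amp t x| ≤ K * d.tau⁻¹ * h.amp t x := by
  have h2 := inv_pos.2 (mul_pos h.kappa_pos h.lam_pos)
  rw [Dt_amp, smul_apply, abs_mul, abs_of_pos h2]
  calc _ ≤ (d.kappa * d.lam)⁻¹ * (K * h.s t x * d.tau⁻¹) :=
        mul_le_mul_of_nonneg_left (h.dt_s ht x) h2.le
    _ = K * d.tau⁻¹ * ((d.kappa * d.lam)⁻¹ * h.s t x) := by ring

theorem Dt_q (i : Fin n) : h.Dt (h.q i) = h.amp * h.Dt (h.η i) + h.Dt h.amp * h.η i := by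
  rw [q_eq, Derivation.leibniz, smul_eq_mul, smul_eq_mul, mul_comm (h.η i)]

theorem bd_Dt_q_flat (i : Fin n) {t : ℝ} (ht : t ∈ Ioo 0 d.T) (x : E3) :
    Bd 1 t x N (2 * (K * K * K) * d.tau⁻¹ * L0 d) (h.Dt (h.q i)) := by
  have ht' := Ioo_subset_Icc_self ht
  have hK := h.one_le_K
  have hL := h.L0_pos
  have hτ := inv_pos.2 h.tau_pos
  have h0 := h.amp_pos ht' x
  have ha := h.amp_le ht' x
  rw [Dt_q]
  have h1 := ((h.bd_η i ht' x).2.mul_flat h.dx_amp).add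
    ((h.bd_η i ht' x).1.mul_flat h.dx_Dt_amp)
  refine h1.mono zero_le_one ?_
  rw [abs_of_pos h0]
  have h2 := h.abs_Dt_amp_le ht x
  calc h.amp t x * (K * d.tau⁻¹) + |h.Dt h.amp t x| * K
      ≤ K * L0 d * (K * d.tau⁻¹) + K * d.tau⁻¹ * (K * L0 d) * K := by gcongr; exact h2.trans (by gcongr)
    _ = (K * K + K * K * K) * d.tau⁻¹ * L0 d := by ring
    _ ≤ _ := by
      have : K * K + K * K * K ≤ 2 * (K * K * K) := by nlinarith [mul_nonneg (mul_nonneg h.K_pos.le h.K_pos.le) (sub_nonneg.2 hK)]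
      gcongr

/-- The regularized amplitude. -/
def qhat (i : Fin n) : PF := by
  classical
  -- The bound on `D_t κ̄` controls `q D_t q`, hence `D_t q` only where `q` is at least about
  -- `x0⁻¹`. Smaller values are cut off. If `L0 ≤ x0`, the plain bound of order `L0 τ⁻¹` on `D_t q`
  -- is already sufficient and nothing is removed.
  exact if L0 d ≤ x0 d then h.q i else (x0 d)⁻¹ • comp trunc contDiff_trunc (x0 d • h.q i)

theorem qhat_of_le (hL : L0 d ≤ x0 d) (i : Fin n) : h.qhat i = h.q i := by simp [qhat, hL]

theorem qhat_of_lt (hL : x0 d < L0 d) (i : Fin n) :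
    h.qhat i = (x0 d)⁻¹ • comp trunc contDiff_trunc (x0 d • h.q i) := by simp [qhat, hL]

theorem qhat_of_lt_apply (hL : x0 d < L0 d) (i : Fin n) (t : ℝ) (x : E3) :
    h.qhat i t x = (x0 d)⁻¹ * trunc (x0 d * h.q i t x) := by
  rw [h.qhat_of_lt hL]; rfl

theorem lives_qhat (i : Fin n) : h.Lives i (h.qhat i) := by
  intro t x hg hi
  rcases le_or_gt (L0 d) (x0 d) with hL | hL
  · rw [h.qhat_of_le hL]; exact Good.eqAt_q hi
  · refine (Good.eqAt_q hi).mono fun y hy => ?_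
    simp only at hy ⊢
    rw [h.qhat_of_lt_apply hL, hy]
    simp [trunc]

theorem q_nonneg (i : Fin n) {t : ℝ} (ht : t ∈ Icc 0 d.T) (x : E3) : 0 ≤ h.q i t x := by
  rw [q_eq, mul_apply]
  exact mul_nonneg (h.amp_pos ht x).le (h.eta_nonneg i t ht x)

theorem abs_q_sub_qhat_le (i : Fin n) {t : ℝ} (ht : t ∈ Icc 0 d.T) (x : E3) :
    |h.q i t x - h.qhat i t x| ≤ 2 * (x0 d)⁻¹ := by
  have hx := h.x0_pos
  rcases le_or_gt (L0 d) (x0 d) with hL | hL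
  · rw [h.qhat_of_le hL, sub_self, abs_zero]; positivity
  · rw [h.qhat_of_lt_apply hL]
    have h1 := abs_trunc_sub_le (mul_nonneg hx.le (h.q_nonneg i ht x))
    have h2 : h.q i t x - (x0 d)⁻¹ * trunc (x0 d * h.q i t x) =
        (x0 d)⁻¹ * (x0 d * h.q i t x - trunc (x0 d * h.q i t x)) := by
      field_simp
    rw [h2, abs_mul, abs_of_pos (inv_pos.2 hx), mul_comm]
    gcongr

/-- Here `x0 < L0 ≤ R`, so `x0` times the amplitude is at most `K R²` and pays for two derivatives
of `η_i`. A single derivative is bounded by `sq_dx_eta_le` and `x0 q ≤ 2`, which give a square of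
order `R²`. -/
theorem bd_dx_x0_q (hN : 2 ≤ N) (hL : x0 d < L0 d) {i : Fin n} {t : ℝ} {x : E3}
    (ht : t ∈ Icc 0 d.T) (hq : x0 d * h.q i t x ≤ 2) {m : ℕ} (hm : m < N) (l : Fin 3) :
    Bd (h.R t x) t x m (3 * (K * K) * h.R t x) (dx l (x0 d • h.q i)) := by
  have hK := h.one_le_K
  have hx := h.x0_pos
  have hR := h.R_pos t x
  have hL0 := h.L0_pos
  have ha := h.amp_pos ht x
  have h1 : ∀ f : PF, dx l (x0 d • (h.amp * f)) = x0 d • (h.amp * dx l f) := fun f => by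
    rw [Derivation.map_smul, Derivation.leibniz, dx_amp, smul_zero, add_zero, smul_eq_mul]
  have h3 : x0 d * h.amp t x ≤ K * (h.R t x * h.R t x) := by
    have := h.amp_le ht x
    have hLR := h.L0_le_R ht x
    calc x0 d * h.amp t x ≤ L0 d * (K * L0 d) := by gcongr
      _ = K * (L0 d * L0 d) := by ring
      _ ≤ _ := by have := h.K_pos; gcongr
  rw [q_eq, h1]
  refine Bd.of_abs_of_step (m := N - 2) ?_ (by omega) fun l' => ?_
  · have h2 := h.sq_dx_eta_le hN i ht x l
    rw [q_eq, mul_apply] at hq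
    refine (abs_le_of_sq_le_sq (b := 2 * K * h.R t x) ?_ (by positivity)).trans ?_
    · simp only [smul_apply, mul_apply]
      calc (x0 d * (h.amp t x * dx l (h.η i) t x)) ^ 2
          = (x0 d * h.amp t x) ^ 2 * dx l (h.η i) t x ^ 2 := by ring
        _ ≤ (x0 d * h.amp t x) ^ 2 * (2 * K * h.η i t x) := by gcongr
        _ = 2 * K * (x0 d * h.amp t x) * (x0 d * (h.amp t x * h.η i t x)) := by ring
        _ ≤ 2 * K * (K * (h.R t x * h.R t x)) * 2 := by
          have := h.K_pos
          have h0 := h.eta_nonneg i t ht x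
          have : 0 ≤ h.η i t x := h0
          gcongr
        _ = (2 * K * h.R t x) ^ 2 := by ring
    · have : 2 * K ≤ 3 * (K * K) := by nlinarith
      exact mul_le_mul_of_nonneg_right this hR.le
  · have h2 := ((((h.bd_η i ht x).1.of_le (m := N - 2 + 1 + 1) (by omega)).step l).step l')
    have h4 := ((h2.mul_flat h.dx_amp).smul (x0 d)).mono_scale zero_le_one (h.one_le_R ht x)
    have h5 : dx l' (x0 d • (h.amp * dx l (h.η i))) = x0 d • (h.amp * dx l' (dx l (h.η i))) := by
      rw [Derivation.map_smul, Derivation.leibniz, dx_amp, smul_zero, add_zero, smul_eq_mul]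
    rw [h5]
    refine h4.mono hR.le ?_
    rw [abs_of_pos hx, abs_of_pos ha]
    calc x0 d * (h.amp t x * (K * 1 * 1)) = x0 d * h.amp t x * K := by ring
      _ ≤ K * (h.R t x * h.R t x) * K := by gcongr
      _ ≤ _ := by nlinarith [mul_pos hR hR, mul_pos (mul_pos hR hR) (mul_pos h.K_pos h.K_pos)]

/-- Where `q_i` is nonzero no other amplitude is present, so the hypothesis on `κ̄` reads `2 q |D_t
q| ≤ K τ⁻¹ (1 + q²)`. Division by `2 q` with `x0 q ≥ 1` and `q ≤ Q` gives the claim. -/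
theorem abs_Dt_q_le {i : Fin n} {t : ℝ} {x : E3} (hg : h.Good t x) (hq : 1 ≤ x0 d * h.q i t x) :
    |h.Dt (h.q i) t x| ≤ K * (x0 d * h.Q t x) * d.tau⁻¹ := by
  have ht := Ioo_subset_Icc_self hg.mem
  have hx := h.x0_pos
  have hQ := h.one_le_Q t x
  have hx1 := h.one_le_x0
  have hq0 : 0 < h.q i t x := by
    by_contra hc
    nlinarith [mul_nonpos_of_nonneg_of_nonpos hx.le (not_lt.1 hc)]
  have hi : h.η i t x ≠ 0 := fun hc => by
    rw [q_eq, mul_apply, hc, mul_zero] at hq0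
    exact lt_irrefl _ hq0
  have h0 : ∀ j ≠ i, EqAt t x (h.q j) 0 := fun j hj => Good.eqAt_q (hg.eqAt_eta hi (Ne.symm hj))
  have h1 : h.Dt h.kb t x = d.kappa * (2 * (h.q i t x * h.Dt (h.q i) t x)) := by
    have e : h.Dt h.kb = d.kappa • ∑ i, (2:ℝ) • (h.q i * h.Dt (h.q i)) := by
      rw [kb, Derivation.map_smul, map_add, Derivation.map_one_eq_zero, zero_add, map_sum]
      congr 1
      refine Finset.sum_congr rfl fun i _ => ?_
      rw [sq, Derivation.leibniz, smul_eq_mul, two_smul]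
    rw [e, smul_apply, sum_apply, Finset.sum_eq_single i (fun j _ hj => by
      simp [(h0 j hj).eq]) fun hc => absurd (Finset.mem_univ i) hc]
    rfl
  have h2 : h.kb t x = d.kappa * (1 + h.q i t x ^ 2) := by
    rw [kb_apply, Finset.sum_eq_single i (fun j _ hj => by
      simp [(h0 j hj).eq]) fun hc => absurd (Finset.mem_univ i) hc]
  have h3 := h.Dt_kb hg.mem x
  rw [h1, h2, abs_mul, abs_of_pos h.kappa_pos, abs_mul, abs_two, abs_mul, abs_of_pos hq0] at h3
  have h4 : 2 * (h.q i t x * |h.Dt (h.q i) t x|) ≤ K * d.tau⁻¹ * (1 + h.q i t x ^ 2) := by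
    refine le_of_mul_le_mul_left ?_ h.kappa_pos
    calc _ ≤ _ := h3
      _ = _ := by ring
  have h5 := h.abs_q_le i t x
  rw [abs_of_pos hq0] at h5
  have hτ := inv_pos.2 h.tau_pos
  have h6 : 1 + h.q i t x ^ 2 ≤ h.q i t x * (2 * (x0 d * h.Q t x)) := by
    have : h.q i t x ≤ x0 d * h.Q t x := by nlinarith
    have : 1 ≤ h.q i t x * (x0 d * h.Q t x) := by
      calc 1 ≤ x0 d * h.q i t x := hq
        _ ≤ (x0 d * h.q i t x) * h.Q t x := le_mul_of_one_le_right (by positivity) hQ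
        _ = _ := by ring
    nlinarith
  refine le_of_mul_le_mul_left ?_ (mul_pos two_pos hq0)
  calc 2 * h.q i t x * |h.Dt (h.q i) t x| ≤ K * d.tau⁻¹ * (1 + h.q i t x ^ 2) := by linarith
    _ ≤ K * d.tau⁻¹ * (h.q i t x * (2 * (x0 d * h.Q t x))) := by
      have := h.K_pos; gcongr
    _ = _ := by ring

/-- Only the order zero needs `abs_Dt_q_le`. From the first derivative on, the bound at unit scale
with amplitude `L0 ≤ R` is enough. -/
theorem bd_Dt_q (hN : 1 ≤ N) {i : Fin n} {t : ℝ} {x : E3} (hg : h.Good t x)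
    (hq : 1 ≤ x0 d * h.q i t x) : Bd (h.R t x) t x N
      (2 * (K * K * K) * (x0 d * h.Q t x * d.tau⁻¹)) (h.Dt (h.q i)) := by
  have ht := Ioo_subset_Icc_self hg.mem
  have hK := h.one_le_K
  have hx := h.x0_pos
  have hx1 := h.one_le_x0
  have hQ := h.one_le_Q t x
  have hR := h.R_pos t x
  have hτ := inv_pos.2 h.tau_pos
  have hKK : 1 ≤ K * K := by nlinarith
  refine Bd.of_abs_of_step (m := N - 1) ((h.abs_Dt_q_le hg hq).trans ?_) (by omega) fun l => ?_
  · calc K * (x0 d * h.Q t x) * d.tau⁻¹ = K * (x0 d * h.Q t x * d.tau⁻¹) := by ring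
      _ ≤ _ := by
        refine mul_le_mul_of_nonneg_right ?_ (by positivity)
        nlinarith [h.K_pos]
  · have h1 := (((h.bd_Dt_q_flat i hg.mem x).of_le (m := N - 1 + 1) (by omega)).step l).mono_scale
      zero_le_one (h.one_le_R ht x)
    refine h1.mono hR.le ?_
    have h2 := h.L0_le_R ht x
    have h3 : 1 ≤ x0 d * h.Q t x := by nlinarith
    have h4 : h.R t x ≤ h.R t x * (x0 d * h.Q t x) := le_mul_of_one_le_right hR.le h3
    have := h.K_pos
    calc 2 * (K * K * K) * d.tau⁻¹ * L0 d * 1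
        ≤ 2 * (K * K * K) * d.tau⁻¹ * (h.R t x * (x0 d * h.Q t x)) * 1 := by
          gcongr; exact h2.trans h4
      _ = _ := by ring

omit h in
variable (M) in
-- When `x0 < L0` there are three zones. For `x0 q < 1` the regularized amplitude vanishes nearby;
-- for `x0 q > 2` it coincides with `q`, and `bd_Dt_q` applies; in between, the chain rule is
-- combined with `bd_dx_x0_q`. The bound on `D_t qhat` loses a factor `x0` compared with `τ⁻¹ Q`,
-- which the prefactor `λ⁻¹` of the corrector can pay.
theorem exists_bd_qhat (hN : 2 ≤ N) (hK : 1 ≤ K) : ∃ c, 1 ≤ c ∧ ∀ (n : ℕ) (d : Data n)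
    (h : d.Assumptions M N K) (i : Fin n) (t : ℝ) (x : E3), h.Good t x →
    Bd (h.R t x) t x N (c * h.Q t x) (h.qhat i) ∧
    Bd (h.R t x) t x N (c * (x0 d * h.Q t x * d.tau⁻¹)) (h.Dt (h.qhat i)) := by
  obtain ⟨B1, hB1, hB1'⟩ := steplike_step.bounded_deriv contDiff_step N
  obtain ⟨B2, hB2, hB2'⟩ := steplike_deriv_trunc.bounded_deriv
    (contDiff_deriv_of_infty contDiff_trunc) N
  have hKK : 1 ≤ K * K := by nlinarith
  have hK0 : 0 < K := by linarith
  have hp : (1:ℝ) ≤ 2 ^ N := one_le_pow₀ (by norm_num)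
  have ha : (1:ℝ) ≤ 3 * (K * K) := by linarith
  let C1 := (2 ^ N * (3 * (K * K))) ^ N * (B1 + B2)
  have hC1 : 1 ≤ C1 := by
    have h1 : 1 ≤ (2 ^ N * (3 * (K * K))) ^ N := one_le_pow₀ (by nlinarith)
    nlinarith
  have hcc : 2 * (K * K * K) ≤ 2 ^ N * (C1 * (2 * (K * K * K))) := by
    have h1 : 1 ≤ 2 ^ N * C1 := by nlinarith
    calc 2 * (K * K * K) ≤ 2 ^ N * C1 * (2 * (K * K * K)) := le_mul_of_one_le_left (by positivity) h1
      _ = _ := by ring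
  have hcK : K * K ≤ 2 * (K * K * K) := by nlinarith
  refine ⟨2 ^ N * (C1 * (2 * (K * K * K))), by linarith, fun n d h i t x hg => ?_⟩
  have ht := Ioo_subset_Icc_self hg.mem
  have hQ := h.one_le_Q t x
  have hQ0 : 0 < h.Q t x := by linarith
  have hR := h.R_pos t x
  have hx1 := h.one_le_x0
  have hx := h.x0_pos
  have hτ := inv_pos.2 h.tau_pos
  have hq1 : Bd (h.R t x) t x N (2 ^ N * (C1 * (2 * (K * K * K))) * h.Q t x) (h.q i) :=
    (h.bd_q (by omega) i ht x).mono hR.le (mul_le_mul_of_nonneg_right (hcK.trans hcc) hQ0.le)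
  rcases le_or_gt (L0 d) (x0 d) with hL | hL
  · rw [h.qhat_of_le hL]
    refine ⟨hq1, ((h.bd_Dt_q_flat i hg.mem x).mono_scale zero_le_one (h.one_le_R ht x)).mono hR.le ?_⟩
    calc 2 * (K * K * K) * d.tau⁻¹ * L0 d ≤ 2 * (K * K * K) * d.tau⁻¹ * (x0 d * h.Q t x) := by
          gcongr; exact hL.trans (le_mul_of_one_le_right hx.le hQ)
      _ = 2 * (K * K * K) * (x0 d * h.Q t x * d.tau⁻¹) := by ring
      _ ≤ _ := by gcongr
  have hc : Continuous fun y : ℝ × E3 => x0 d * h.q i y.1 y.2 := continuous_const.mul (h.q i).continuous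
  rcases lt_or_ge (x0 d * h.q i t x) 1 with hy | hy
  · have h0 : EqAt t x 0 (h.qhat i) := by
      filter_upwards [(isOpen_lt hc continuous_const).mem_nhds hy] with y hy
      rw [h.qhat_of_lt_apply hL, trunc, step_eq_zero (le_of_lt hy)]
      simp
    refine ⟨(Bd.zero (by positivity) hR.le).congr h0, ?_⟩
    exact (Bd.zero (by positivity) hR.le).congr
      ((EqAt.of_eq (map_zero h.Dt).symm).trans (h.Dt_congr h0))
  have hD := h.bd_Dt_q (by omega) hg hy
  rcases lt_or_ge 2 (x0 d * h.q i t x) with hy2 | hy2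
  · have h0 : EqAt t x (h.q i) (h.qhat i) := by
      filter_upwards [(isOpen_lt continuous_const hc).mem_nhds hy2] with y hy
      rw [h.qhat_of_lt_apply hL, trunc, step_eq_one (le_of_lt hy)]
      field_simp
    refine ⟨hq1.congr h0, (hD.congr (h.Dt_congr h0)).mono hR.le ?_⟩
    gcongr
  -- Only the transition zone `1 ≤ x0 q ≤ 2` is left.
  have hz := fun m (hm : m < N) l => h.bd_dx_x0_q hN hL ht hy2 hm l
  constructor
  · have e : h.qhat i = h.q i * comp step contDiff_step (x0 d • h.q i) := by
      ext t x
      rw [h.qhat_of_lt_apply hL, mul_apply]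
      show _ = h.q i t x * step (x0 d * h.q i t x)
      rw [trunc]; field_simp
    rw [e]
    refine ((h.bd_q (by omega) i ht x).mul (Bd.compD hR.le ha step contDiff_step
      (B := B1 + B2) (fun m hm y => (hB1' m hm y).trans (by linarith)) hz)).mono hR.le ?_
    show 2 ^ N * (K * K * h.Q t x * C1) ≤ _
    calc 2 ^ N * (K * K * h.Q t x * C1) = 2 ^ N * (C1 * (K * K)) * h.Q t x := by ring
      _ ≤ _ := by gcongr
  · have e : h.Dt (h.qhat i) =
        comp (deriv trunc) (contDiff_deriv_of_infty contDiff_trunc) (x0 d • h.q i) * h.Dt (h.q i) := by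
      rw [h.qhat_of_lt hL, Derivation.map_smul, Dt_comp, Derivation.map_smul, mul_smul_comm,
        smul_smul, inv_mul_cancel₀ hx.ne', one_smul]
    rw [e]
    refine ((Bd.compD hR.le ha (deriv trunc) (contDiff_deriv_of_infty contDiff_trunc)
      (B := B1 + B2) (fun m hm y => (hB2' m hm y).trans (by linarith)) hz).mul hD).mono hR.le ?_
    show 2 ^ N * (C1 * (2 * (K * K * K) * (x0 d * h.Q t x * d.tau⁻¹))) ≤ _
    refine le_of_eq ?_
    ring

/-- Good times are interior; the end points of the interval follow by continuity in time. -/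
theorem I_le_of_good' {f g : PF} (hfg : ∀ t x, h.Good t x → f t x ≤ g t x) {t : ℝ}
    (ht : t ∈ Icc 0 d.T) : I t f ≤ I t g := by
  have h1 : IsClosed {t : ℝ | I t f ≤ I t g} := isClosed_le (continuous_I f) (continuous_I g)
  have h2 : closure (Ioo 0 d.T) ⊆ {t : ℝ | I t f ≤ I t g} :=
    closure_minimal (fun t ht => h.I_le_of_good hfg ht) h1
  rw [closure_Ioo h.T_pos.ne] at h2
  exact h2 ht

/-- The gradient is recovered from the moving derivatives through `F G = Id`. With the partition of
unity this makes `Nf` comparable to `κ |∇f|²`. -/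
theorem Gd_le_di {i : Fin n} {t : ℝ} {x : E3} (ht : t ∈ Icc 0 d.T) (hi : h.ηt i t x ≠ 0) (f : PF) :
    Gd f t x ≤ 9 * (K * K) * ∑ p, h.di i p f t x ^ 2 := by
  have h1 : ∀ l, dx l f t x = ∑ a, h.F i a l t x * h.di i a f t x := by
    intro l
    have e : ∑ a, h.F i a l * h.di i a f = h.J i * dx l f := by
      simp only [di_apply, Finset.mul_sum]
      rw [Finset.sum_comm]
      have e1 : ∀ m, ∑ a, h.F i a l * (h.G i m a * dx m f) =
          (if m = l then h.J i else 0) * dx m f := fun m => by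
        rw [← h.G_mul_F, Finset.sum_mul]
        exact Finset.sum_congr rfl fun a _ => by ring
      simp only [e1]
      simp
    have e2 := congrArg (fun g : PF => g t x) e
    simp only [sum_apply, mul_apply, h.J_eq_one ht hi, one_mul] at e2
    exact e2.symm
  have h2 : ∀ l, dx l f t x ^ 2 ≤ 3 * (K * K) * ∑ p, h.di i p f t x ^ 2 := by
    intro l
    rw [h1]
    refine (Finset.sum_mul_sq_le_sq_mul_sq _ _ _).trans ?_
    refine mul_le_mul_of_nonneg_right ?_ (by positivity)
    have h3 : ∀ a ∈ Finset.univ, h.F i a l t x ^ 2 ≤ K * K := fun a _ => by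
      have := (h.bd_F ht hi a l).1.abs_le
      have hK := h.K_pos.le
      rw [← sq_abs, sq]
      gcongr
    simpa using Finset.sum_le_card_nsmul Finset.univ _ _ h3
  rw [Gd_apply]
  have := Finset.sum_le_card_nsmul Finset.univ _ _ fun l _ => h2 l
  simp only [Finset.card_univ, Fintype.card_fin, nsmul_eq_mul] at this
  push_cast at this
  linarith

theorem cG_nonneg : 0 ≤ cG N K := by
  have := h.K_pos
  rw [cG]; positivity

theorem di_sq_le {i : Fin n} {t : ℝ} {x : E3} (ht : t ∈ Icc 0 d.T) (hi : h.ηt i t x ≠ 0)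
    (p : Fin 3) (f : PF) : h.di i p f t x ^ 2 ≤ 3 * (cG N K) ^ 2 * Gd f t x := by
  rw [di_apply, sum_apply]
  simp only [mul_apply, Gd_apply]
  refine (Finset.sum_mul_sq_le_sq_mul_sq _ _ _).trans ?_
  refine mul_le_mul_of_nonneg_right ?_ (by positivity)
  have h3 : ∀ a ∈ Finset.univ, h.G i a p t x ^ 2 ≤ cG N K ^ 2 := fun a _ => by
    rw [← sq_abs]
    have h4 : |h.G i a p t x| ≤ cG N K := (h.bd_G ht hi a p).abs_le
    gcongr
  simpa using Finset.sum_le_card_nsmul Finset.univ _ _ h3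

theorem Nf_apply (f : PF) (t : ℝ) (x : E3) :
    h.Nf f f t x = d.kappa * ∑ i, h.ηt i t x * ∑ p, h.di i p f t x ^ 2 := by
  simp only [Nf, sum_apply, smul_apply, mul_apply, Finset.mul_sum, sq]

theorem kappa_Gd_le_Nf {t : ℝ} (ht : t ∈ Icc 0 d.T) (x : E3) (f : PF) :
    d.kappa * Gd f t x ≤ 9 * (K * K) * h.Nf f f t x := by
  rw [Nf_apply]
  have h1 : Gd f t x ≤ 9 * (K * K) * ∑ i, h.ηt i t x * ∑ p, h.di i p f t x ^ 2 := by
    have h2 : ∑ i, h.ηt i t x = 1 := h.etat_sum t ht x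
    calc Gd f t x = ∑ i, h.ηt i t x * Gd f t x := by rw [← Finset.sum_mul, h2, one_mul]
      _ ≤ ∑ i, h.ηt i t x * (9 * (K * K) * ∑ p, h.di i p f t x ^ 2) := by
        refine Finset.sum_le_sum fun i _ => ?_
        by_cases hi : h.ηt i t x = 0
        · rw [hi]; simp
        · have h0 : 0 ≤ h.ηt i t x := h.etat_nonneg i t ht x
          exact mul_le_mul_of_nonneg_left (h.Gd_le_di ht hi f) h0
      _ = _ := by
        rw [Finset.mul_sum]
        exact Finset.sum_congr rfl fun i _ => by ring
  calc d.kappa * Gd f t x ≤ d.kappa * (9 * (K * K) * ∑ i, h.ηt i t x * ∑ p, h.di i p f t x ^ 2) :=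
        mul_le_mul_of_nonneg_left h1 h.kappa_pos.le
    _ = _ := by ring

theorem Nf_le {t : ℝ} (ht : t ∈ Icc 0 d.T) (x : E3) (f : PF) :
    h.Nf f f t x ≤ 9 * cG N K ^ 2 * (d.kappa * Gd f t x) := by
  rw [Nf_apply]
  have h2 : ∑ i, h.ηt i t x = 1 := h.etat_sum t ht x
  have h1 : ∑ i, h.ηt i t x * ∑ p, h.di i p f t x ^ 2 ≤ 9 * cG N K ^ 2 * Gd f t x := by
    calc _ ≤ ∑ i, h.ηt i t x * (9 * cG N K ^ 2 * Gd f t x) := by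
          refine Finset.sum_le_sum fun i _ => ?_
          by_cases hi : h.ηt i t x = 0
          · rw [hi]; simp
          · have h0 : 0 ≤ h.ηt i t x := h.etat_nonneg i t ht x
            refine mul_le_mul_of_nonneg_left ?_ h0
            have := Finset.sum_le_card_nsmul Finset.univ _ _ fun p _ => h.di_sq_le ht hi p f
            simp only [Finset.card_univ, Fintype.card_fin, nsmul_eq_mul] at this
            push_cast at this
            linarith
      _ = _ := by rw [← Finset.sum_mul, h2, one_mul]
  calc _ ≤ d.kappa * (9 * cG N K ^ 2 * Gd f t x) := mul_le_mul_of_nonneg_left h1 h.kappa_pos.le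
    _ = _ := by ring

end Data.Assumptions

/-! ### Weighted energy estimates for the homogenized equation -/

theorem PF.EqAt.word {t : ℝ} {x : E3} {f g : PF} (hfg : PF.EqAt t x f g) (w : List (Fin 3)) :
    PF.EqAt t x (PF.dxw w f) (PF.dxw w g) := by
  induction w generalizing f g with
  | nil => exact hfg
  | cons l w ih => exact ih (hfg.dxD l)

/-- The mixed terms are completed to the square of `β - 18 A (P + C) α Z`, at the cost of half of
the dissipation `k β²`. The factor `18 = 2·3·3` comes from the two index sums in dimension three. -/
theorem quad_absorb {k β α Z A P C : ℝ} (hk : 0 ≤ k) :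
    -(k * β ^ 2) + 18 * k * A * (P * α * β * Z + C * α * β * Z + C * P * α ^ 2 * Z ^ 2) ≤
      -(1 / 2 * (k * β ^ 2)) + k * Z ^ 2 * α ^ 2 * (1 / 2 * (18 * A * (P + C)) ^ 2 + 18 * A * C * P) := by
  have h1 : 0 ≤ k * (β - 18 * A * (P + C) * α * Z) ^ 2 := mul_nonneg hk (sq_nonneg _)
  nlinarith

theorem abs_sum_fin_le {f : Fin 3 → ℝ} {B : ℝ} (hf : ∀ l, |f l| ≤ B) : |∑ l, f l| ≤ 3 * B := by
  refine (Finset.abs_sum_le_sum_abs _ _).trans ?_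
  have := Finset.sum_le_card_nsmul Finset.univ (fun l => |f l|) B fun l _ => hf l
  simpa using this

namespace Data.Assumptions

open PF

variable {n : ℕ} {M : Mikado} {N : ℕ} {K : ℝ} {d : Data n} (h : d.Assumptions M N K)
include h

theorem div_u {t : ℝ} (ht : t ∈ Icc 0 d.T) (x : E3) : ∑ l, dx l (h.u l) t x = 0 := by
  rw [← h.u_div t ht x]
  exact (divergence_eq (f := h.u) (fun y j => rfl) x).symm

theorem I_Dt {t : ℝ} (ht : t ∈ Icc 0 d.T) (f : PF) : I t (h.Dt f) = I t (dt f) := by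
  rw [Dt_apply, I_add, I_sum]
  simp only [I_mul_dx, Finset.sum_neg_distrib]
  rw [← I_sum, ← Finset.sum_mul]
  have h1 : I t ((∑ m, dx m (h.u m)) * f) = I t 0 :=
    I_congr fun x => by rw [mul_apply, sum_apply, h.div_u ht, zero_mul]; rfl
  rw [h1, I_zero, neg_zero, add_zero]

theorem Dt_dxw (w : List (Fin 3)) (f : PF) :
    h.Dt (dxw w f) = dxw w (h.Dt f) - ∑ m, PF.comm w (h.u m) (dx m f) := by
  simp only [Dt_apply, dxw_add, dxw_sum, PF.comm, Finset.sum_sub_distrib, dxw_dx]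
  rw [dt, dxw_dir]
  abel

/-- The energy density of order `j` in local units. -/
def En (r : PF) (j : ℕ) : PF := (d.tau • h.kb) ^ j * S j r

/-- The integrand of the time derivative of the energy of order `j`. -/
def En' (r : PF) (j : ℕ) : PF :=
  (j : ℝ) • ((d.tau • h.kb) ^ (j - 1) * (d.tau • h.Dt h.kb) * S j r) +
    ∑ w ∈ words j, ((2 : ℝ) • ((d.tau • h.kb) ^ j * dxw w r *
        -∑ m, PF.comm w (h.u m) (dx m r)) -
      (2 : ℝ) • ∑ l, dx l ((d.tau • h.kb) ^ j * dxw w r) * dxw w (∑ m, h.Ab l m * dx m r))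

/-- The equation with the homogenized matrix. -/
def IsHom (r : PF) : Prop :=
  ∀ t ∈ Icc 0 d.T, ∀ x, h.Dt r t x = (∑ l, dx l (∑ m, h.Ab l m * dx m r)) t x

variable {h} in
-- The divergence-free velocity lets `∂_t` be replaced by `D_t` under the average. The commutator of
-- a word with `D_t` involves only `∇u`, and the diffusion is integrated by parts once.
theorem IsHom.deriv_energy {r : PF} (hr : h.IsHom r) (j : ℕ) {t : ℝ} (ht : t ∈ Ioo 0 d.T) :
    I t (dt (h.En r j)) = I t (h.En' r j) := by
  have ht' := Ioo_subset_Icc_self ht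
  have h1 : h.Dt (h.En r j) = (j : ℝ) • ((d.tau • h.kb) ^ (j - 1) * (d.tau • h.Dt h.kb) * S j r) +
      ∑ w ∈ words j, ((2 : ℝ) • ((d.tau • h.kb) ^ j * dxw w r *
        -∑ m, PF.comm w (h.u m) (dx m r)) + (2 : ℝ) • ((d.tau • h.kb) ^ j * dxw w r *
          dxw w (h.Dt r))) := by
    rw [En, Derivation.leibniz, smul_eq_mul, smul_eq_mul, Derivation.leibniz_pow,
      Derivation.map_smul, S_eq_sum, map_sum, add_comm]
    congr 1
    · rw [← Nat.cast_smul_eq_nsmul ℝ, smul_eq_mul, mul_smul_comm]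
      congr 1; ring
    · rw [Finset.mul_sum]
      refine Finset.sum_congr rfl fun w _ => ?_
      rw [sq, Derivation.leibniz, Dt_dxw, smul_eq_mul, ← two_smul ℝ, mul_smul_comm, ← smul_add]
      congr 1; ring
  rw [← h.I_Dt ht', h1, En', I_add, I_add, I_sum, I_sum]
  congr 1
  refine Finset.sum_congr rfl fun w _ => ?_
  rw [I_add, I_sub, sub_eq_add_neg, I_smul _ _ (∑ l, _), I_smul _ _ ((d.tau • h.kb) ^ j * dxw w r *
          dxw w (h.Dt r)), ← mul_neg]
  congr 2
  have h2 : I t ((d.tau • h.kb) ^ j * dxw w r * dxw w (h.Dt r)) =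
      I t ((d.tau • h.kb) ^ j * dxw w r * ∑ l, dx l (dxw w (∑ m, h.Ab l m * dx m r))) := by
    refine I_congr fun x => ?_
    rw [mul_apply, mul_apply _ (∑ l, _)]
    congr 1
    have h3 := ((h.eqAt_of_forall ht x hr).word w).eq
    rw [h3, dxw_sum]
    simp only [dxw_dx]
  rw [h2, Finset.mul_sum, I_sum]
  simp only [I_mul_dx]
  rw [Finset.sum_neg_distrib, ← I_sum]

theorem tau_kb_mul_R_sq (t : ℝ) (x : E3) : d.tau * h.kb t x * h.R t x ^ 2 = 1 := by
  rw [mul_assoc, kb_mul_R_sq, mul_inv_cancel₀ h.tau_pos.ne']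

theorem En_apply (r : PF) (j : ℕ) (t : ℝ) (x : E3) :
    h.En r j t x = (d.tau * h.kb t x) ^ j * S j r t x := rfl

theorem En_nonneg (r : PF) (j : ℕ) (t : ℝ) (x : E3) : 0 ≤ h.En r j t x := by
  rw [En_apply]
  have := h.kb_pos t x
  have := h.tau_pos
  have := S_nonneg j r t x
  positivity

theorem S_eq_En (r : PF) (j : ℕ) (t : ℝ) (x : E3) :
    S j r t x = h.En r j t x * (h.R t x ^ j) ^ 2 := by
  have h1 : (d.tau * h.kb t x) ^ j * (h.R t x ^ j) ^ 2 = 1 := by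
    rw [← pow_mul, mul_comm j, pow_mul, ← mul_pow, tau_kb_mul_R_sq, one_pow]
  rw [En_apply, mul_right_comm, h1, one_mul]

/-- The sum of the energy densities of orders from `1` to `j`. -/
def esum (r : PF) (j : ℕ) : PF := ∑ i ∈ Finset.Icc 1 j, h.En r i

theorem esum_apply (r : PF) (j : ℕ) (t : ℝ) (x : E3) :
    h.esum r j t x = ∑ i ∈ Finset.Icc 1 j, h.En r i t x := by simp [esum]

theorem esum_nonneg (r : PF) (j : ℕ) (t : ℝ) (x : E3) : 0 ≤ h.esum r j t x := by
  rw [esum_apply]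
  exact Finset.sum_nonneg fun i _ => h.En_nonneg r i t x

theorem En_le_esum (r : PF) {i j : ℕ} (h1 : 1 ≤ i) (h2 : i ≤ j) (t : ℝ) (x : E3) :
    h.En r i t x ≤ h.esum r j t x := by
  rw [esum_apply]
  exact Finset.single_le_sum (f := fun i => h.En r i t x) (fun i _ => h.En_nonneg r i t x)
    (Finset.mem_Icc.2 ⟨h1, h2⟩)

/-- The derivatives of the solution are bounded in terms of the energy densities. -/
theorem bd_dx_sol (r : PF) (j : ℕ) (m : Fin 3) (t : ℝ) (x : E3) :
    Bd (h.R t x) t x j (Real.sqrt (h.esum r (j + 1) t x) * h.R t x) (dx m r) := by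
  have hR := h.R_pos t x
  refine Bd.of_S hR.le (by positivity) fun i hi => ?_
  have h1 : S i (dx m r) t x ≤ S (i + 1) r t x := by
    simp only [S, sum_apply]
    exact Finset.single_le_sum (f := fun l => S i (dx l r) t x) (fun l _ => S_nonneg _ _ _ _)
      (Finset.mem_univ m)
  refine h1.trans ?_
  rw [h.S_eq_En, mul_pow, mul_pow, Real.sq_sqrt (h.esum_nonneg _ _ _ _)]
  have h2 := h.En_le_esum r (show 1 ≤ i + 1 by omega) (show i + 1 ≤ j + 1 by omega) t x
  calc _ ≤ h.esum r (j + 1) t x * (h.R t x ^ (i + 1)) ^ 2 := by gcongr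
    _ = _ := by ring

/-- The constant in the bounds on the velocity gradient. -/
def cU (N : ℕ) (K : ℝ) : ℝ := 3 * (2 ^ N * (cG N K * K))

theorem bd_dxu' {t : ℝ} {x : E3} (ht : t ∈ Ioo 0 d.T) (l b : Fin 3) :
    Bd (h.R t x) t x N (cU N K * d.tau⁻¹) (dx l (h.u b)) :=
  (h.bd_dxu ht l b).mono (h.R_pos t x).le (le_of_eq (by rw [cU, cG]; ring))

/-- The constant in the energy inequalities. -/
def cE (M : Mikado) (N : ℕ) (K : ℝ) : ℝ :=
  3 ^ N * (6 * (N * 2 ^ N) * cU N K + (1 / 2 * (18 * cA M N K * (N * 2 ^ N + 2 * N * (K * K))) ^ 2 +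
    18 * cA M N K * (2 * N * (K * K)) * (N * 2 ^ N))) + N * K

theorem cA_nonneg : 0 ≤ cA M N K := by
  have := h.K_pos
  have := h.cG_nonneg
  have h1 : 0 ≤ ∑ k ∈ M.Λ, M.cst k * (2 ^ N * (2 ^ N * (K * K) *
      (2 ^ N * ((∑ p, |k p| * cG N K) * (∑ p, |k p| * cG N K))))) :=
    Finset.sum_nonneg fun k _ => mul_nonneg (M.cst_nonneg k) (by positivity)
  rw [cA]; positivity

theorem cU_nonneg : 0 ≤ cU N K := by
  have := h.K_pos
  have := h.cG_nonneg
  rw [cU]; positivity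

/-- Ellipticity produces the dissipation `θ κ̄ |∇ ∂^w r|²` with weight `θ = (τ κ̄)^j`. The
commutators with `Ab` and the derivative of the weight are products of this top-order gradient with
derivatives of order at most `j`, or quadratic in the latter, and half of the dissipation absorbs
them. The commutator with `u` is of size `τ⁻¹`. Hence only energies up to order `j` occur on the
right. -/
theorem word_bound (hN : 1 ≤ N) {t : ℝ} {x : E3} (hg : h.Good t x) (r : PF) {j : ℕ} (hj : 1 ≤ j)
    (hjN : j ≤ N) {w : List (Fin 3)} (hw : w ∈ words j) :
    ((2 : ℝ) • ((d.tau • h.kb) ^ j * dxw w r * -∑ m, PF.comm w (h.u m) (dx m r)) -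
      (2 : ℝ) • ∑ l, dx l ((d.tau • h.kb) ^ j * dxw w r) * dxw w (∑ m, h.Ab l m * dx m r)) t x ≤
    -(1 / 2 * ((d.tau * h.kb t x) ^ j * h.kb t x * Gd (dxw w r) t x)) +
      d.tau⁻¹ * h.esum r j t x * (6 * (N * 2 ^ N) * cU N K +
        (1 / 2 * (18 * cA M N K * (N * 2 ^ N + 2 * N * (K * K))) ^ 2 +
          18 * cA M N K * (2 * N * (K * K)) * (N * 2 ^ N))) := by
  have ht := Ioo_subset_Icc_self hg.mem
  have hwl := length_of_mem_words hw
  have hR := h.R_pos t x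
  have hkb := h.kb_pos t x
  have hτ := h.tau_pos
  have hK := h.K_pos
  have hA := h.cA_nonneg
  have hU := h.cU_nonneg
  have hτi := inv_pos.2 hτ
  obtain ⟨j', rfl⟩ : ∃ j', j = j' + 1 := ⟨j - 1, by omega⟩
  set j := j' + 1 with hjdef
  set e := h.esum r j t x with he
  have he0 : 0 ≤ e := h.esum_nonneg r j t x
  set α := Real.sqrt e with hα
  have hα0 : 0 ≤ α := Real.sqrt_nonneg _
  have hα2 : α ^ 2 = e := Real.sq_sqrt he0
  set θ := (d.tau * h.kb t x) ^ j with hθ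
  have hθ0 : 0 < θ := by positivity
  have hθR : θ * (h.R t x ^ j) ^ 2 = 1 := by
    rw [hθ, ← pow_mul, mul_comm j 2, pow_mul, ← mul_pow, tau_kb_mul_R_sq, one_pow]
  set P : ℝ := N * 2 ^ N with hP
  have hP0 : 0 ≤ P := by positivity
  have hlen : (w.length * 2 ^ w.length : ℝ) ≤ P := by
    rw [hwl, hP]
    have : (j : ℝ) ≤ N := by exact_mod_cast hjN
    gcongr; norm_num
  set C4 : ℝ := 2 * N * (K * K) with hC4
  have hC40 : 0 ≤ C4 := by positivity
  set p := dxw w r t x with hp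
  set g : Fin 3 → ℝ := fun l => dx l (dxw w r) t x with hgdef
  set β := Real.sqrt (Gd (dxw w r) t x) with hβ
  have hβ0 : 0 ≤ β := Real.sqrt_nonneg _
  have hβ2 : β ^ 2 = Gd (dxw w r) t x := Real.sq_sqrt (Gd_nonneg _ _ _)
  have hgβ : ∀ l, |g l| ≤ β := fun l => by
    refine Real.abs_le_sqrt ?_
    rw [Gd_apply]
    exact Finset.single_le_sum (f := fun l => dx l (dxw w r) t x ^ 2) (fun l _ => sq_nonneg _)
      (Finset.mem_univ l)
  have hpα : |p| ≤ α * h.R t x ^ j := by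
    refine abs_le_of_sq_le_sq ?_ (by positivity)
    have h1 : p ^ 2 ≤ S j r t x := by
      rw [S_eq_sum, PF.sum_apply]
      exact Finset.single_le_sum (f := fun w => (dxw w r ^ 2) t x)
        (fun w _ => by rw [pow_apply]; positivity) hw
    rw [mul_pow, hα2]
    refine h1.trans ?_
    rw [h.S_eq_En]
    have := h.En_le_esum r hj le_rfl t x
    gcongr
  have hsol := fun m => h.bd_dx_sol r j' m t x
  have hcu : ∀ m, |PF.comm w (h.u m) (dx m r) t x| ≤ P * (cU N K * d.tau⁻¹ * α * h.R t x ^ j) := by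
    intro m
    refine (abs_comm_le hR.le (mul_nonneg hU hτi.le) (by positivity) w (h.u m) (dx m r)
      (fun l => (h.bd_dxu' hg.mem l m).of_le (by omega))
      ((hsol m).of_le (by omega))).trans ?_
    have e1 : cU N K * d.tau⁻¹ * (Real.sqrt (h.esum r (j' + 1) t x) * h.R t x) *
        h.R t x ^ (w.length - 1) = cU N K * d.tau⁻¹ * α * h.R t x ^ j := by
      rw [hwl, hjdef, Nat.add_sub_cancel, pow_succ]; ring
    rw [e1]
    gcongr
  have hca : ∀ l m, |PF.comm w (h.Ab l m) (dx m r) t x| ≤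
      P * (cA M N K * h.kb t x * α * (h.R t x ^ j * h.R t x)) := by
    intro l m
    have hb := h.bd_Ab hN hg l m
    refine (abs_comm_le hR.le (A := cA M N K * h.kb t x * h.R t x) (by positivity) (by positivity) w
      (h.Ab l m) (dx m r)
      (fun l' => ((hb.of_le (m := w.length - 1 + 1) (by omega)).step l'))
      ((hsol m).of_le (by omega))).trans ?_
    have e1 : cA M N K * h.kb t x * h.R t x * (Real.sqrt (h.esum r (j' + 1) t x) * h.R t x) *
        h.R t x ^ (w.length - 1) = cA M N K * h.kb t x * α * (h.R t x ^ j * h.R t x) := by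
      rw [hwl, hjdef, Nat.add_sub_cancel, pow_succ]; ring
    rw [e1]
    gcongr
  have hdθ : ∀ l, |dx l ((d.tau • h.kb) ^ j) t x| ≤ C4 * (θ * h.R t x) := by
    intro l
    rw [Derivation.leibniz_pow, ← Nat.cast_smul_eq_nsmul ℝ, Derivation.map_smul]
    simp only [PF.smul_apply, pow_apply, smul_eq_mul, mul_apply]
    have h1 := h.abs_dx_kb hN hg l
    have h2 : (j : ℝ) ≤ N := by exact_mod_cast hjN
    rw [abs_mul, abs_mul, abs_mul, abs_of_pos hτ, Nat.abs_cast, abs_of_pos (by positivity)]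
    calc (j : ℝ) * ((d.tau * h.kb t x) ^ (j - 1) * (d.tau * |dx l h.kb t x|))
        ≤ N * ((d.tau * h.kb t x) ^ (j - 1) * (d.tau * (2 * (K * K) * (h.R t x * h.kb t x)))) := by
          gcongr
      _ = 2 * N * (K * K) * (((d.tau * h.kb t x) ^ (j - 1) * (d.tau * h.kb t x)) * h.R t x) := by ring
      _ = _ := by rw [← pow_succ, hjdef, Nat.add_sub_cancel]
  set Z := h.R t x ^ j * h.R t x with hZ
  have hZ0 : 0 < Z := by positivity
  -- This normalization turns every remainder into a constant times `τ⁻¹ e`.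
  have hkZ : θ * h.kb t x * Z ^ 2 = d.tau⁻¹ := by
    rw [hZ, mul_pow, ← h.kb_mul_R_sq t x]
    calc θ * h.kb t x * ((h.R t x ^ j) ^ 2 * h.R t x ^ 2)
        = θ * (h.R t x ^ j) ^ 2 * (h.kb t x * h.R t x ^ 2) := by ring
      _ = _ := by rw [hθR, one_mul]
  -- the flux and its commutator part
  let ca : Fin 3 → ℝ := fun l => ∑ m, PF.comm w (h.Ab l m) (dx m r) t x
  let ag : Fin 3 → ℝ := fun l => ∑ m, h.Ab l m t x * g m
  have hfl : ∀ l, dxw w (∑ m, h.Ab l m * dx m r) t x = ag l + ca l := fun l => by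
    rw [dxw_sum, PF.sum_apply]
    simp only [ag, ca, ← Finset.sum_add_distrib]
    refine Finset.sum_congr rfl fun m _ => ?_
    simp only [PF.comm, sub_apply, mul_apply, dxw_dx, g]
    ring
  have hcal : ∀ l, |ca l| ≤ 3 * (P * (cA M N K * h.kb t x * α * Z)) := fun l =>
    abs_sum_fin_le fun m => hca l m
  have hagl : ∀ l, |ag l| ≤ 3 * (cA M N K * h.kb t x * β) := fun l =>
    abs_sum_fin_le fun m => by
      rw [abs_mul]
      exact mul_le_mul (h.bd_Ab hN hg l m).abs_le (hgβ m) (abs_nonneg _) (by positivity)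
  have hdp : ∀ l, dx l ((d.tau • h.kb) ^ j * dxw w r) t x =
      θ * g l + dx l ((d.tau • h.kb) ^ j) t x * p := fun l => by
    rw [Derivation.leibniz]
    simp only [smul_eq_mul, add_apply, mul_apply]
    rw [mul_comm p]
    rfl
  have hell := (h.ellipt ht x g).1
  have hell' : ∑ l, g l * ag l = ∑ l, ∑ m, h.Ab l m t x * g l * g m := by
    simp only [ag, Finset.mul_sum]
    exact Finset.sum_congr rfl fun l _ => Finset.sum_congr rfl fun m _ => by ring
  rw [← hell'] at hell
  have hgs : ∑ l, g l ^ 2 = β ^ 2 := by rw [hβ2, Gd_apply]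
  rw [hgs] at hell
  have hX1 : |∑ l, θ * g l * ca l| ≤ 3 * (θ * β * (3 * (P * (cA M N K * h.kb t x * α * Z)))) :=
    abs_sum_fin_le fun l => by
      rw [abs_mul, abs_mul, abs_of_pos hθ0]
      exact mul_le_mul (mul_le_mul_of_nonneg_left (hgβ l) hθ0.le) (hcal l) (abs_nonneg _)
        (by positivity)
  have hX2 : |∑ l, dx l ((d.tau • h.kb) ^ j) t x * p * (ag l + ca l)| ≤
      3 * (C4 * (θ * h.R t x) * (α * h.R t x ^ j) * (3 * (cA M N K * h.kb t x * β) +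
        3 * (P * (cA M N K * h.kb t x * α * Z)))) :=
    abs_sum_fin_le fun l => by
      rw [abs_mul, abs_mul]
      refine mul_le_mul (mul_le_mul (hdθ l) hpα (abs_nonneg _) (by positivity))
        ((abs_add_le _ _).trans (add_le_add (hagl l) (hcal l))) (abs_nonneg _) (by positivity)
  have hX3 : |p * ∑ m, PF.comm w (h.u m) (dx m r) t x| ≤
      α * h.R t x ^ j * (3 * (P * (cU N K * d.tau⁻¹ * α * h.R t x ^ j))) := by
    rw [abs_mul]
    exact mul_le_mul hpα (abs_sum_fin_le hcu) (abs_nonneg _) (by positivity)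
  have hL : ((2 : ℝ) • ((d.tau • h.kb) ^ j * dxw w r * -∑ m, PF.comm w (h.u m) (dx m r)) -
      (2 : ℝ) • ∑ l, dx l ((d.tau • h.kb) ^ j * dxw w r) * dxw w (∑ m, h.Ab l m * dx m r)) t x =
      -(2 * θ * (p * ∑ m, PF.comm w (h.u m) (dx m r) t x)) - 2 * (θ * ∑ l, g l * ag l +
        ∑ l, θ * g l * ca l + ∑ l, dx l ((d.tau • h.kb) ^ j) t x * p * (ag l + ca l)) := by
    simp only [sub_apply, PF.smul_apply, mul_apply, neg_apply, PF.sum_apply, hdp, hfl, pow_apply]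
    rw [Finset.mul_sum Finset.univ _ θ, ← Finset.sum_add_distrib, ← Finset.sum_add_distrib]
    congr 1
    · ring
    · congr 1
      exact Finset.sum_congr rfl fun l _ => by ring
  rw [hL, ← hβ2]
  have hq := quad_absorb (k := θ * h.kb t x) (β := β) (α := α) (Z := Z) (A := cA M N K) (P := P)
    (C := C4) (by positivity)
  have hb1 : 2 * θ * (α * h.R t x ^ j * (3 * (P * (cU N K * d.tau⁻¹ * α * h.R t x ^ j)))) =
      d.tau⁻¹ * e * (6 * P * cU N K) := by
    calc _ = (θ * (h.R t x ^ j) ^ 2) * (α ^ 2) * (d.tau⁻¹ * (6 * P * cU N K)) := by ring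
      _ = _ := by rw [hθR, hα2]; ring
  have hb2 : 2 * (3 * (θ * β * (3 * (P * (cA M N K * h.kb t x * α * Z))))) +
      2 * (3 * (C4 * (θ * h.R t x) * (α * h.R t x ^ j) * (3 * (cA M N K * h.kb t x * β) +
        3 * (P * (cA M N K * h.kb t x * α * Z))))) =
      18 * (θ * h.kb t x) * cA M N K *
        (P * α * β * Z + C4 * α * β * Z + C4 * P * α ^ 2 * Z ^ 2) := by
    rw [hZ]; ring
  have hb3 : θ * h.kb t x * Z ^ 2 * α ^ 2 = d.tau⁻¹ * e := by rw [hkZ, hα2]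
  rw [hb3] at hq
  have a1 := neg_abs_le (p * ∑ m, PF.comm w (h.u m) (dx m r) t x)
  have a2 := neg_abs_le (∑ l, θ * g l * ca l)
  have a3 := neg_abs_le (∑ l, dx l ((d.tau • h.kb) ^ j) t x * p * (ag l + ca l))
  have a4 : -(2 * θ * (p * ∑ m, PF.comm w (h.u m) (dx m r) t x)) ≤ d.tau⁻¹ * e * (6 * P * cU N K) := by
    rw [← hb1, ← mul_neg]
    refine mul_le_mul_of_nonneg_left ?_ (by positivity)
    linarith
  have a5 : θ * (1 / 2 * h.kb t x * β ^ 2) ≤ θ * ∑ l, g l * ag l :=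
    mul_le_mul_of_nonneg_left hell hθ0.le
  linarith

/-- Summed over the words of length `j`, the dissipation is `τ⁻¹` times the energy density of order
`j + 1`: each step of the hierarchy controls the time integral of the next energy. -/
theorem En'_le (hN : 1 ≤ N) {t : ℝ} {x : E3} (hg : h.Good t x) (r : PF) {j : ℕ} (hj : 1 ≤ j)
    (hjN : j ≤ N) : h.En' r j t x ≤
      -(1 / 2 * (d.tau⁻¹ * h.En r (j + 1) t x)) + cE M N K * (d.tau⁻¹ * h.esum r j t x) := by
  have hK := h.K_pos
  have hτ := h.tau_pos
  have hτi := inv_pos.2 hτ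
  have hkb := h.kb_pos t x
  have hA := h.cA_nonneg
  have hU := h.cU_nonneg
  have he0 := h.esum_nonneg r j t x
  rw [En', add_apply, PF.sum_apply]
  have h1 := Finset.sum_le_sum fun w hw => h.word_bound hN hg r hj hjN (w := w) hw
  have h2 : ((j : ℝ) • ((d.tau • h.kb) ^ (j - 1) * (d.tau • h.Dt h.kb) * S j r)) t x ≤
      N * K * (d.tau⁻¹ * h.esum r j t x) := by
    have h3 := (le_abs_self _).trans (h.Dt_kb hg.mem x)
    have h4 : (j : ℝ) ≤ N := by exact_mod_cast hjN
    have h5 := S_nonneg j r t x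
    have h6 := h.En_le_esum r hj le_rfl t x
    have h7 := h.En_nonneg r j t x
    simp only [PF.smul_apply, mul_apply, pow_apply]
    calc _ ≤ (j : ℝ) * ((d.tau * h.kb t x) ^ (j - 1) * (d.tau * (K * d.tau⁻¹ * h.kb t x)) * S j r t x) := by
          gcongr
      _ = j * K * (d.tau⁻¹ * ((d.tau * h.kb t x) ^ (j - 1) * (d.tau * h.kb t x) * S j r t x)) := by ring
      _ = j * K * (d.tau⁻¹ * h.En r j t x) := by
        rw [← pow_succ, Nat.sub_add_cancel hj, En_apply]
      _ ≤ _ := by gcongr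
  have h3 : ∑ w ∈ words j, -(1 / 2 * ((d.tau * h.kb t x) ^ j * h.kb t x * Gd (dxw w r) t x)) =
      -(1 / 2 * (d.tau⁻¹ * h.En r (j + 1) t x)) := by
    rw [Finset.sum_neg_distrib, ← Finset.mul_sum, ← Finset.mul_sum, En_apply, S_succ_eq, PF.sum_apply,
      pow_succ]
    congr 2
    field_simp
  rw [Finset.sum_add_distrib, h3, Finset.sum_const, card_words, nsmul_eq_mul] at h1
  refine (add_le_add h2 h1).trans ?_
  rw [cE]
  set c5 := 6 * (N * 2 ^ N) * cU N K +
        (1 / 2 * (18 * cA M N K * (N * 2 ^ N + 2 * N * (K * K))) ^ 2 +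
          18 * cA M N K * (2 * N * (K * K)) * (N * 2 ^ N))
  have hc5 : 0 ≤ c5 := by positivity
  have h4 : ((3 ^ j : ℕ) : ℝ) ≤ 3 ^ N := by
    push_cast
    exact pow_le_pow_right₀ (by norm_num) hjN
  have h5 : ((3 ^ j : ℕ) : ℝ) * (d.tau⁻¹ * h.esum r j t x * c5) ≤
      3 ^ N * (d.tau⁻¹ * h.esum r j t x * c5) := by gcongr
  linarith

end Data.Assumptions

namespace PF

theorem I_sub_le_integral {T : ℝ} {f : PF} {φ : ℝ → ℝ} (hφ : Continuous φ)
    (hd : ∀ t ∈ Ioo 0 T, I t (dt f) ≤ φ t) {t : ℝ} (ht : t ∈ Icc 0 T) :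
    I t f - I 0 f ≤ ∫ s in (0:ℝ)..t, φ s :=
  intervalIntegral.sub_le_integral_of_hasDeriv_right_of_le ht.1 (continuous_I f).continuousOn
    (fun s _ => (hasDerivAt_I f s).hasDerivWithinAt) (hφ.integrableOn_Icc)
    fun s hs => hd s ⟨hs.1, hs.2.trans_le ht.2⟩

end PF

theorem intervalIntegral_mono_right {φ : ℝ → ℝ} (hφ : Continuous φ) {t T : ℝ} (ht : t ∈ Icc 0 T)
    (h0 : ∀ s ∈ Icc 0 T, 0 ≤ φ s) : ∫ s in (0:ℝ)..t, φ s ≤ ∫ s in (0:ℝ)..T, φ s := by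
  rw [← intervalIntegral.integral_add_adjacent_intervals (hφ.intervalIntegrable 0 t)
    (hφ.intervalIntegrable t T)]
  have := intervalIntegral.integral_nonneg (μ := volume) (f := φ) ht.2
    fun s hs => h0 s ⟨ht.1.trans hs.1, hs.2⟩
  linarith

theorem intervalIntegral_lin {A B : ℝ → ℝ} (hA : Continuous A) (hB : Continuous B) {a b t : ℝ} :
    ∫ s in (0:ℝ)..t, (-(a * A s) + b * B s) =
      -a * (∫ s in (0:ℝ)..t, A s) + b * ∫ s in (0:ℝ)..t, B s := by
  have e : ∀ s, -(a * A s) + b * B s = (-a) * A s + b * B s := fun s => by ring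
  simp only [e]
  rw [intervalIntegral.integral_add (f := fun s => -a * A s) (g := fun s => b * B s)
      ((continuous_const.mul hA).intervalIntegrable _ _)
      ((continuous_const.mul hB).intervalIntegrable _ _),
    intervalIntegral.integral_const_mul, intervalIntegral.integral_const_mul]

namespace Data.Assumptions

open PF

variable {n : ℕ} {M : Mikado} {N : ℕ} {K : ℝ} {d : Data n} (h : d.Assumptions M N K)
include h

theorem isHom {ρin : E3 → ℝ} {ρ : ℝ → E3 → ℝ} (hρ : IsSolution d.T d.u (d.Abar M) ρin ρ) :
    h.IsHom ⟨ρ, hρ.field⟩ := fun _ ht x => h.Dt_rhobar hρ ht x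

theorem wdissip_eq (r : PF) : d.wdissip (fun t x => r t x) = ∫ t in (0:ℝ)..d.T, I t (h.kb * Gd r) := by
  refine intervalIntegral.integral_congr fun t ht => ?_
  rw [uIcc_of_le h.T_pos.le] at ht
  refine setIntegral_congr_fun (measurableSet_cube 1 one_pos) fun x _ => ?_
  show d.kbar t x * ‖gradient (fun x => r t x) x‖ ^ 2 = h.kb t x * Gd r t x
  rw [← h.kb_eq ht, Gd_apply]
  congr 1
  exact norm_gradient_sq r t x

/-- The lowest member of the hierarchy is the weighted dissipation itself, which starts the
induction. -/
theorem tau_inv_En_one (r : PF) (t : ℝ) : d.tau⁻¹ * I t (h.En r 1) = I t (h.kb * Gd r) := by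
  rw [← I_smul]
  refine I_congr fun x => ?_
  have := h.tau_pos.ne'
  rw [PF.smul_apply, En_apply, mul_apply]
  show _ * ((d.tau * h.kb t x) ^ 1 * Gd r t x) = _
  field_simp

/-- The initial part of the norm of the homogenized solution. -/
theorem initial_term_nonneg (ρin : E3 → ℝ) (j : ℕ) :
    0 ≤ d.tau ^ j * ∫ x in cube 1, d.kbar 0 x ^ j * ‖iteratedFDeriv ℝ j ρin x‖ ^ 2 := by
  have h0 : (0:ℝ) ∈ Icc 0 d.T := ⟨le_rfl, h.T_pos.le⟩
  refine mul_nonneg (pow_nonneg h.tau_pos.le _) (integral_nonneg fun x => ?_)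
  rw [← h.kb_eq h0]
  have := h.kb_pos 0 x
  positivity

theorem wdissip_nonneg (r : PF) : 0 ≤ d.wdissip (fun t x => r t x) := by
  rw [wdissip_eq h]
  refine intervalIntegral.integral_nonneg h.T_pos.le fun t _ => I_nonneg fun x => ?_
  exact mul_nonneg (h.kb_pos t x).le (Gd_nonneg _ _ _)

theorem wdissip_le_D (ρin : E3 → ℝ) (r : PF) :
    d.wdissip (fun t x => r t x) ≤ d.D ρin (fun t x => r t x) N :=
  le_add_of_nonneg_right (Finset.sum_nonneg fun j _ => h.initial_term_nonneg ρin j)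

theorem D_nonneg (ρin : E3 → ℝ) (r : PF) : 0 ≤ d.D ρin (fun t x => r t x) N :=
  (h.wdissip_nonneg r).trans (h.wdissip_le_D ρin r)

theorem I_zero_En_le (ρin : E3 → ℝ) (r : PF) (hr : r 0 = ρin) {j : ℕ} (hj : 1 ≤ j) (hjN : j ≤ N) :
    I 0 (h.En r j) ≤ 3 ^ N * d.D ρin (fun t x => r t x) N := by
  have h0 : (0:ℝ) ∈ Icc 0 d.T := ⟨le_rfl, h.T_pos.le⟩
  have hτ := h.tau_pos
  have hc : Continuous fun x => d.kbar 0 x ^ j * ‖iteratedFDeriv ℝ j ρin x‖ ^ 2 := by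
    have h1 : d.kbar 0 = fun x => h.kb 0 x := funext fun x => (h.kb_eq h0 x).symm
    have h2 : Continuous (iteratedFDeriv ℝ j ρin) := by
      rw [← hr]
      exact (r.contDiff_slice 0).continuous_iteratedFDeriv (by exact_mod_cast le_top)
    have h3 := (h.kb).continuous_slice 0
    rw [h1]
    fun_prop
  have h1 : I 0 (h.En r j) ≤ ∫ x in cube 1, 3 ^ j * d.tau ^ j *
      (d.kbar 0 x ^ j * ‖iteratedFDeriv ℝ j ρin x‖ ^ 2) := by
    refine integral_mono (integrable _ 0)
      ((integrableOn_cube_of_continuous one_pos hc).const_mul _) fun x => ?_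
    have hk := h.kb_pos 0 x
    have h2 := S_le_iteratedFDeriv j r 0 x
    rw [hr] at h2
    show h.En r j 0 x ≤ _
    rw [En_apply, ← h.kb_eq h0]
    calc _ ≤ (d.tau * h.kb 0 x) ^ j * (3 ^ j * ‖iteratedFDeriv ℝ j ρin x‖ ^ 2) := by gcongr
      _ = _ := by rw [mul_pow]; ring
  rw [integral_const_mul, mul_assoc] at h1
  refine h1.trans ?_
  have h2 : d.tau ^ j * ∫ x in cube 1, d.kbar 0 x ^ j * ‖iteratedFDeriv ℝ j ρin x‖ ^ 2 ≤
      d.D ρin (fun t x => r t x) N := by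
    refine le_trans ?_ (le_add_of_nonneg_left (h.wdissip_nonneg r))
    exact Finset.single_le_sum (f := fun j => d.tau ^ j *
      ∫ x in cube 1, d.kbar 0 x ^ j * ‖iteratedFDeriv ℝ j ρin x‖ ^ 2)
      (fun i _ => h.initial_term_nonneg ρin i) (Finset.mem_Icc.2 ⟨hj, hjN⟩)
  have h3 := h.initial_term_nonneg ρin j
  have h4 : (3:ℝ) ^ j ≤ 3 ^ N := pow_le_pow_right₀ (by norm_num) hjN
  calc _ ≤ (3:ℝ) ^ N * (d.tau ^ j * ∫ x in cube 1, d.kbar 0 x ^ j * ‖iteratedFDeriv ℝ j ρin x‖ ^ 2) := by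
        gcongr
    _ ≤ _ := by gcongr

theorem cE_nonneg : 0 ≤ cE M N K := by
  have := h.K_pos
  have := h.cA_nonneg
  have := h.cU_nonneg
  rw [cE]; positivity

variable {h} in
-- The lower energies enter only through their time integrals, already bounded at earlier stages. No
-- Grönwall argument is needed, and the constant does not depend on `T / τ`.
theorem IsHom.energy_step (hN : 1 ≤ N) {r : PF} (hr : h.IsHom r) {j : ℕ} (hj : 1 ≤ j) (hjN : j ≤ N)
    {B : ℝ} (hB : ∀ i ∈ Finset.Icc 1 j, ∫ t in (0:ℝ)..d.T, d.tau⁻¹ * I t (h.En r i) ≤ B)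
    {t : ℝ} (ht : t ∈ Icc 0 d.T) :
    I t (h.En r j) + 1 / 2 * ∫ s in (0:ℝ)..t, d.tau⁻¹ * I s (h.En r (j + 1)) ≤
      I 0 (h.En r j) + cE M N K * (j * B) := by
  have hc : ∀ i, Continuous fun s => d.tau⁻¹ * I s (h.En r i) := fun i =>
    continuous_const.mul (continuous_I _)
  have hτi := inv_pos.2 h.tau_pos
  have hcE := h.cE_nonneg
  have h1 := I_sub_le_integral (T := d.T) (f := h.En r j)
    (φ := fun s => -(1 / 2 * (d.tau⁻¹ * I s (h.En r (j + 1)))) +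
      cE M N K * ∑ i ∈ Finset.Icc 1 j, d.tau⁻¹ * I s (h.En r i))
    (by
      have h1 := hc (j + 1)
      have h2 : Continuous fun s => ∑ i ∈ Finset.Icc 1 j, d.tau⁻¹ * I s (h.En r i) :=
        continuous_finsetSum _ fun i _ => hc i
      fun_prop) (fun s hs => by
      rw [hr.deriv_energy j hs]
      refine (h.I_le_of_good (g := -((1 / 2 : ℝ) • (d.tau⁻¹ • h.En r (j + 1))) +
        cE M N K • ∑ i ∈ Finset.Icc 1 j, d.tau⁻¹ • h.En r i) (fun t x hg => ?_) hs).trans_eq ?_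
      · refine (h.En'_le hN hg r hj hjN).trans_eq ?_
        simp only [add_apply, neg_apply, PF.smul_apply, PF.sum_apply, esum_apply, Finset.mul_sum]
      · simp only [I_add, I_neg, I_smul, I_sum]) ht
  have h2 : ∫ s in (0:ℝ)..t, (-(1 / 2 * (d.tau⁻¹ * I s (h.En r (j + 1)))) +
      cE M N K * ∑ i ∈ Finset.Icc 1 j, d.tau⁻¹ * I s (h.En r i)) =
      -(1 / 2 * ∫ s in (0:ℝ)..t, d.tau⁻¹ * I s (h.En r (j + 1))) +
      cE M N K * ∑ i ∈ Finset.Icc 1 j, ∫ s in (0:ℝ)..t, d.tau⁻¹ * I s (h.En r i) := by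
    have hs : Continuous fun s => ∑ i ∈ Finset.Icc 1 j, d.tau⁻¹ * I s (h.En r i) :=
      continuous_finsetSum _ fun i _ => hc i
    rw [intervalIntegral_lin (hc (j + 1)) hs,
      intervalIntegral.integral_finsetSum fun i _ => (hc i).intervalIntegrable _ _]
    ring
  rw [h2] at h1
  have h3 : ∑ i ∈ Finset.Icc 1 j, ∫ s in (0:ℝ)..t, d.tau⁻¹ * I s (h.En r i) ≤ j * B := by
    have := Finset.sum_le_card_nsmul (Finset.Icc 1 j)
      (fun i => ∫ s in (0:ℝ)..t, d.tau⁻¹ * I s (h.En r i)) B fun i hi =>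
      (intervalIntegral_mono_right (hc i) ht fun s _ =>
        mul_nonneg hτi.le (I_nonneg fun x => h.En_nonneg _ _ _ _)).trans (hB i hi)
    simpa using this
  have := mul_le_mul_of_nonneg_left h3 hcE
  linarith

omit h in
/-- The energy estimates for the homogenized equation. -/
theorem exists_energy_bound (M : Mikado) (hN : 1 ≤ N) (K : ℝ) : ∃ C, 1 ≤ C ∧
    ∀ (n : ℕ) (d : Data n) (h : d.Assumptions M N K) (ρin : E3 → ℝ) (r : PF), h.IsHom r →
      r 0 = ρin →
      (∀ j, 1 ≤ j → j ≤ N + 1 → ∫ t in (0:ℝ)..d.T, d.tau⁻¹ * I t (h.En r j) ≤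
        C * d.D ρin (fun t x => r t x) N) ∧
      ∀ j, 1 ≤ j → j ≤ N → ∀ t ∈ Icc 0 d.T, I t (h.En r j) ≤ C * d.D ρin (fun t x => r t x) N := by
  have key : ∀ J ≤ N, ∃ C, 1 ≤ C ∧
    ∀ (n : ℕ) (d : Data n) (h : d.Assumptions M N K) (ρin : E3 → ℝ) (r : PF), h.IsHom r →
      r 0 = ρin →
      (∀ j, 1 ≤ j → j ≤ J + 1 → ∫ t in (0:ℝ)..d.T, d.tau⁻¹ * I t (h.En r j) ≤
        C * d.D ρin (fun t x => r t x) N) ∧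
      ∀ j, 1 ≤ j → j ≤ J → ∀ t ∈ Icc 0 d.T, I t (h.En r j) ≤ C * d.D ρin (fun t x => r t x) N := by
    intro J
    induction J with
    | zero =>
      -- At stage zero only `j = 1` occurs, and its time integral is `wdissip`, a part of `D`.
      refine fun _ => ⟨1, le_rfl, fun n d h ρin r hr hr0 => ⟨fun j h1 h2 => ?_, fun j h1 h2 => ?_⟩⟩
      · obtain rfl : j = 1 := by omega
        simp only [h.tau_inv_En_one, one_mul]
        rw [← h.wdissip_eq]
        exact h.wdissip_le_D ρin r
      · omega
    | succ J ih =>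
      intro hJ
      obtain ⟨C, hC, ih⟩ := ih (by omega)
      refine ⟨C + 2 * (3 ^ N + |cE M N K| * (N * C)), by
        have : 0 ≤ 2 * (3 ^ N + |cE M N K| * (N * C)) := by positivity
        linarith, fun n d h ρin r hr hr0 => ?_⟩
      obtain ⟨ih1, ih2⟩ := ih n d h ρin r hr hr0
      have hD := h.D_nonneg ρin r
      set D := d.D ρin (fun t x => r t x) N with hDdef
      have hτi := inv_pos.2 h.tau_pos
      have hcE := h.cE_nonneg
      have hst : ∀ t ∈ Icc 0 d.T, I t (h.En r (J + 1)) +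
          1 / 2 * ∫ s in (0:ℝ)..t, d.tau⁻¹ * I s (h.En r (J + 1 + 1)) ≤
          (3 ^ N + |cE M N K| * (N * C)) * D := fun t ht => by
        have h1 := hr.energy_step hN (j := J + 1) (by omega) hJ (B := C * D)
          (fun i hi => ih1 i (Finset.mem_Icc.1 hi).1 (Finset.mem_Icc.1 hi).2) ht
        have h2 := h.I_zero_En_le ρin r hr0 (j := J + 1) (by omega) hJ
        have h3 : ((J + 1 : ℕ) : ℝ) ≤ N := by exact_mod_cast hJ
        have h4 : cE M N K * (((J + 1 : ℕ) : ℝ) * (C * D)) ≤ |cE M N K| * (N * (C * D)) := by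
          rw [abs_of_nonneg hcE]
          gcongr
        calc _ ≤ _ := h1
          _ ≤ 3 ^ N * D + |cE M N K| * (N * (C * D)) := add_le_add h2 h4
          _ = _ := by ring
      have hp : 0 ≤ (3 ^ N + |cE M N K| * (N * C)) * D := by positivity
      have hCD : 0 ≤ C * D := by positivity
      have hi0 : ∀ j t, 0 ≤ I t (h.En r j) := fun j t => I_nonneg fun x => h.En_nonneg _ _ _ _
      refine ⟨fun j h1 h2 => ?_, fun j h1 h2 t ht => ?_⟩
      · rw [add_mul]
        rcases Nat.lt_or_ge j (J + 2) with hj | hj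
        · have := ih1 j h1 (by omega)
          linarith
        · obtain rfl : j = J + 1 + 1 := by omega
          have h3 := hst d.T ⟨h.T_pos.le, le_rfl⟩
          have h4 := hi0 (J + 1) d.T
          linarith
      · rw [add_mul]
        rcases Nat.lt_or_ge j (J + 1) with hj | hj
        · have := ih2 j h1 (by omega) t ht
          linarith
        · obtain rfl : j = J + 1 := by omega
          have h3 := hst t ht
          have h4 : 0 ≤ ∫ s in (0:ℝ)..t, d.tau⁻¹ * I s (h.En r (J + 1 + 1)) :=
            intervalIntegral.integral_nonneg ht.1 fun s _ => mul_nonneg hτi.le (hi0 _ _)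
          linarith
  exact key N le_rfl

end Data.Assumptions

/-! ### Pairings with a test function and the gain from oscillation -/

theorem nonpos_of_forall_le_mul {X B : ℝ} (hB : 0 ≤ B) (hX : ∀ s : ℝ, 0 < s → X ≤ s * B) : X ≤ 0 := by
  by_contra hc
  push Not at hc
  have h1 := hX (X / (2 * (B + 1))) (by positivity)
  have h2 : X / (2 * (B + 1)) * B < X := by
    rw [div_mul_eq_mul_div, div_lt_iff₀ (by positivity)]
    nlinarith
  linarith

/-- Young's inequality with every weight gives the product of roots, at weight `√B / √A`; if `A` or
`B` is zero, the weight is sent to infinity or to zero. -/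
theorem le_mul_sqrt_mul_sqrt {X c A B : ℝ} (hc : 0 ≤ c) (hA : 0 ≤ A) (hB : 0 ≤ B)
    (hX : ∀ s : ℝ, 0 < s → X ≤ c * (1 / 2 * (s * A + s⁻¹ * B))) :
    X ≤ c * (Real.sqrt A * Real.sqrt B) := by
  rcases hA.eq_or_lt with rfl | hA
  · rw [Real.sqrt_zero, zero_mul, mul_zero]
    refine nonpos_of_forall_le_mul (B := c * B) (by positivity) fun s hs => ?_
    have h1 := hX s⁻¹ (by positivity)
    rw [inv_inv] at h1
    have : 0 ≤ s * (c * B) := by positivity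
    linarith
  rcases hB.eq_or_lt with rfl | hB
  · rw [Real.sqrt_zero, mul_zero, mul_zero]
    refine nonpos_of_forall_le_mul (B := c * A) (by positivity) fun s hs => ?_
    have h1 := hX s hs
    have : 0 ≤ s * (c * A) := by positivity
    linarith
  have p1 := Real.sqrt_pos.2 hA
  have p2 := Real.sqrt_pos.2 hB
  refine (hX (Real.sqrt B / Real.sqrt A) (by positivity)).trans_eq ?_
  have e1 := Real.sq_sqrt hA.le
  have e2 := Real.sq_sqrt hB.le
  generalize Real.sqrt A = a at *
  generalize Real.sqrt B = b at *
  subst e1 e2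
  field_simp
  ring

theorem mul_sqrt_le_half {s A B : ℝ} (hs : 0 < s) (hA : 0 ≤ A) (hB : 0 ≤ B) :
    Real.sqrt A * Real.sqrt B ≤ 1 / 2 * (s * A + s⁻¹ * B) := by
  have e1 := Real.sq_sqrt hA
  have e2 := Real.sq_sqrt hB
  generalize Real.sqrt A = a at *
  generalize Real.sqrt B = b at *
  subst e1 e2
  have : 1 / 2 * (s * a ^ 2 + s⁻¹ * b ^ 2) - a * b = 1 / 2 * (s⁻¹ * (s * a - b) ^ 2) := by
    field_simp; ring
  have h2 : 0 ≤ 1 / 2 * (s⁻¹ * (s * a - b) ^ 2) := by positivity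
  linarith

namespace PF

theorem abs_dx_le_sqrt (f : PF) (l : Fin 3) (t : ℝ) (x : E3) :
    |dx l f t x| ≤ Real.sqrt (Gd f t x) := by
  refine Real.abs_le_sqrt ?_
  rw [Gd_apply]
  exact Finset.single_le_sum (f := fun l => dx l f t x ^ 2) (fun _ _ => sq_nonneg _)
    (Finset.mem_univ l)

/-- The square of the norm of a function in the Sobolev space of order one, as a density. -/
def Sob (f : PF) : PF := Gd f + f ^ 2

theorem Sob_apply (f : PF) (t : ℝ) (x : E3) : Sob f t x = Gd f t x + f t x ^ 2 := rfl

theorem Sob_nonneg (f : PF) (t : ℝ) (x : E3) : 0 ≤ Sob f t x :=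
  add_nonneg (Gd_nonneg _ _ _) (sq_nonneg _)

theorem abs_le_sqrt_Sob (f : PF) (t : ℝ) (x : E3) : |f t x| ≤ Real.sqrt (Sob f t x) :=
  Real.abs_le_sqrt (by rw [Sob_apply]; have := Gd_nonneg f t x; linarith)

theorem sqrt_Gd_le (f : PF) (t : ℝ) (x : E3) : Real.sqrt (Gd f t x) ≤ Real.sqrt (Sob f t x) :=
  Real.sqrt_le_sqrt (by rw [Sob_apply]; have := sq_nonneg (f t x); linarith)

/-- The product of the norms of `f` in the Sobolev space and of `√e` in the Lebesgue space. -/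
def pair (f e : PF) (t : ℝ) : ℝ := Real.sqrt (I t (Sob f)) * Real.sqrt (I t e)

theorem pair_nonneg (f e : PF) (t : ℝ) : 0 ≤ pair f e t := by
  unfold pair; positivity

end PF

namespace Data.Assumptions

open PF

variable {n : ℕ} {M : Mikado} {N : ℕ} {K : ℝ} {d : Data n} (h : d.Assumptions M N K)
include h

/-- Cauchy–Schwarz by way of Young's inequality: the roots need not be smooth, but for each weight
the quadratic majorant is a field, so the pointwise bound extends from the good points. -/
theorem abs_I_le_of_good {F f e : PF} {c : ℝ} (hc : 0 ≤ c) (he : ∀ t x, 0 ≤ e t x)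
    (hF : ∀ t x, h.Good t x → |F t x| ≤ c * (Real.sqrt (Sob f t x) * Real.sqrt (e t x))) {t : ℝ}
    (ht : t ∈ Icc 0 d.T) : |I t F| ≤ c * pair f e t := by
  have key : ∀ F : PF,
      (∀ t x, h.Good t x → |F t x| ≤ c * (Real.sqrt (Sob f t x) * Real.sqrt (e t x))) →
      I t F ≤ c * pair f e t := by
    intro F hF
    refine le_mul_sqrt_mul_sqrt hc (I_nonneg fun x => Sob_nonneg _ _ _) (I_nonneg fun x => he _ _)
      fun s hs => ?_
    rw [← I_smul, ← I_smul, ← I_add, ← I_smul, ← I_smul]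
    refine h.I_le_of_good' (fun t x hg => ?_) ht
    refine (le_abs_self _).trans ((hF t x hg).trans ?_)
    exact mul_le_mul_of_nonneg_left (mul_sqrt_le_half hs (Sob_nonneg _ _ _) (he _ _)) hc
  refine abs_le.2 ⟨?_, key F hF⟩
  have := key (-F) fun t x hg => by rw [neg_apply, abs_neg]; exact hF t x hg
  rw [I_neg] at this
  linarith

theorem abs_di_le {i : Fin n} {t : ℝ} {x : E3} (ht : t ∈ Icc 0 d.T) (hi : h.ηt i t x ≠ 0)
    {f : PF} {B : ℝ} (hB : ∀ l, |dx l f t x| ≤ B) (p : Fin 3) : |h.di i p f t x| ≤ 3 * (cG N K * B) := by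
  rw [di_apply, sum_apply]
  refine abs_sum_fin_le fun l => ?_
  rw [mul_apply, abs_mul]
  have h4 : |h.G i l p t x| ≤ cG N K := (h.bd_G ht hi l p).abs_le
  exact mul_le_mul h4 (hB l) (abs_nonneg _) h.cG_nonneg

theorem abs_dk_le {i : Fin n} {t : ℝ} {x : E3} (ht : t ∈ Icc 0 d.T) (hi : h.ηt i t x ≠ 0)
    {f : PF} {B : ℝ} (hB : ∀ l, |dx l f t x| ≤ B) (k : E3) :
    |h.dk i k f t x| ≤ (∑ p, |k p|) * (3 * (cG N K * B)) := by
  rw [dk_apply, sum_apply, Finset.sum_mul]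
  refine (Finset.abs_sum_le_sum_abs _ _).trans (Finset.sum_le_sum fun p _ => ?_)
  rw [PF.smul_apply, abs_mul]
  exact mul_le_mul_of_nonneg_left (h.abs_di_le ht hi hB p) (abs_nonneg _)

theorem abs_sum_lives_le {f : Fin n → PF} {t : ℝ} {x : E3} (hg : h.Good t x) {A : ℝ}
    (hA : 0 ≤ A) (h0 : ∀ i, h.Lives i (f i)) (h1 : ∀ i, h.η i t x ≠ 0 → |f i t x| ≤ A) :
    |(∑ i, f i) t x| ≤ A :=
  h.bd_sum_lives (m := 0) (R := 1) hg hA zero_le_one (fun i hi => h0 i t x hg hi) h1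

variable {h} in
theorem Lives.sum {ι : Type*} {s : Finset ι} {i : Fin n} {g : ι → PF} (hg : ∀ j ∈ s, h.Lives i (g j)) :
    h.Lives i (∑ j ∈ s, g j) := fun t x hgood hi =>
  (EqAt.sum _ fun j hj => hg j hj t x hgood hi).trans (EqAt.of_eq (by simp))

variable {h} in
theorem Lives.sub {i : Fin n} {f g : PF} (hf : h.Lives i f) (hg : h.Lives i g) : h.Lives i (f - g) :=
  fun t x hgood hi => ((hf t x hgood hi).sub (hg t x hgood hi)).trans (EqAt.of_eq (sub_zero _))

variable {h} in
theorem Lives.add {i : Fin n} {f g : PF} (hf : h.Lives i f) (hg : h.Lives i g) : h.Lives i (f + g) :=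
  fun t x hgood hi => ((hf t x hgood hi).add (hg t x hgood hi)).trans (EqAt.of_eq (add_zero _))

/-- Integration by parts for products with an oscillating factor. -/
theorem I_Y_dk (i : Fin n) {k : E3} {g : Fin 3 → CF M.P} (hg : ∀ q, CF.kd k (g q) = 0) {b : PF}
    (hb : h.Lives i b) (f : PF) {t : ℝ} (ht : t ∈ Ioo 0 d.T) :
    I t (h.Y i (∑ q, CF.pd q (g q)) * b * h.dk i k f) =
      I t (d.lam⁻¹ • ∑ q, h.Y i (g q) * (h.dk i k b * h.di i q f - h.di i q b * h.dk i k f)) := by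
  have hl := h.lam_pos.ne'
  have e0 : ∀ q, h.dk i k (h.Y i (g q)) = 0 := fun q => by
    rw [dk_Y, hg]
    have : h.Y i (0 : CF M.P) = 0 := rfl
    rw [this, mul_zero, smul_zero]
  -- Both terms are exact derivatives with average zero. In their difference the second derivatives
  -- of `f` cancel since `di` and `dk` commute, and `dk` does not act on the potential, which is
  -- constant along `k`.
  have e1 : I t (d.lam⁻¹ • ∑ q, (h.di i q (h.Y i (g q) * b * h.dk i k f) -
      h.dk i k (h.Y i (g q) * b * h.di i q f))) = 0 := by
    rw [I_smul, I_sum]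
    simp only [I_sub, I_di, I_dk, sub_self, Finset.sum_const_zero, mul_zero]
  rw [← add_zero (I t (d.lam⁻¹ • ∑ q, h.Y i (g q) * _)), ← e1, ← I_add]
  refine h.I_eq_of_good (fun t x hgood => ?_) ht
  simp only [Derivation.leibniz, smul_eq_mul, e0, mul_zero, add_zero]
  rcases hb.ne hgood with hi | hi
  · have hi' := hgood.etat_ne hi
    have e2 : ∀ q, h.di i q (h.Y i (g q)) t x = d.lam * h.Y i (CF.pd q (g q)) t x := fun q =>
      (h.eqAt_di_Y hgood.mem hi' q (g q)).eq
    have e3 : ∀ q, h.di i q (h.dk i k f) t x = h.dk i k (h.di i q f) t x := fun q =>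
      (h.eqAt_di_dk hgood.mem hi' q k f).eq
    simp only [PF.add_apply, PF.smul_apply, mul_apply, PF.sub_apply, e2, e3, Y_add,
      Fin.sum_univ_three]
    field_simp
    ring
  · have e2 := hi.eq
    have e3 := (h.dk_congr i k hi).eq
    have e4 := fun q => (h.di_congr i q hi).eq
    rw [map_zero] at e3
    simp only [map_zero] at e4
    simp only [PF.add_apply, PF.smul_apply, PF.sum_apply, mul_apply, PF.sub_apply, e2, e3, e4, PF.zero_apply]
    simp

/-- Oscillating transport terms gain one power of the frequency. -/
theorem abs_sum_I_Y_dk_le {k : E3} {g : Fin 3 → CF M.P} (hg : ∀ q, CF.kd k (g q) = 0) {c : ℝ}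
    (hc : 0 ≤ c) (hgc : ∀ q ξ, |g q ξ| ≤ c) {b : Fin n → PF} (hb : ∀ i, h.Lives i (b i)) {e : PF}
    {β : ℝ} (hβ : 0 ≤ β) (he : ∀ t x, 0 ≤ e t x)
    (hbe : ∀ t x, h.Good t x → ∀ i, h.η i t x ≠ 0 → ∀ l, |dx l (b i) t x| ≤ β * Real.sqrt (e t x))
    (f : PF) {t : ℝ} (ht : t ∈ Ioo 0 d.T) :
    |I t (∑ i, h.Y i (∑ q, CF.pd q (g q)) * b i * h.dk i k f)| ≤
      54 * (c * (∑ p, |k p|) * cG N K ^ 2) * (d.lam⁻¹ * β) * pair f e t := by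
  have hG := h.cG_nonneg
  have hl := inv_pos.2 h.lam_pos
  have hk : 0 ≤ ∑ p, |k p| := by positivity
  rw [I_sum, Finset.sum_congr rfl fun i _ => h.I_Y_dk i hg (hb i) f ht, ← I_sum]
  refine h.abs_I_le_of_good (by positivity) he (fun t x hgood => ?_) (Ioo_subset_Icc_self ht)
  refine h.abs_sum_lives_le hgood (by positivity) (fun i => Lives.smul (Lives.sum fun q _ =>
    ((hb i).dk k |>.mul_right _ |>.sub ((hb i).di q |>.mul_right _)).mul_left _) _) fun i hi => ?_
  have hi' := hgood.etat_ne hi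
  have ht' := Ioo_subset_Icc_self hgood.mem
  have b1 := h.abs_dk_le ht' hi' (hbe t x hgood i hi) k
  have b2 := h.abs_di_le ht' hi' (hbe t x hgood i hi)
  have b3 := h.abs_dk_le ht' hi' (fun l => (abs_dx_le_sqrt f l t x).trans (sqrt_Gd_le f t x)) k
  have b4 := h.abs_di_le ht' hi' (fun l => (abs_dx_le_sqrt f l t x).trans (sqrt_Gd_le f t x))
  rw [PF.smul_apply, abs_mul, abs_of_pos hl, PF.sum_apply]
  have hq : ∀ q, |(h.Y i (g q) * (h.dk i k (b i) * h.di i q f - h.di i q (b i) * h.dk i k f)) t x| ≤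
      c * ((∑ p, |k p|) * (3 * (cG N K * (β * √(e t x)))) * (3 * (cG N K * √(Sob f t x))) +
        3 * (cG N K * (β * √(e t x))) * ((∑ p, |k p|) * (3 * (cG N K * √(Sob f t x))))) := by
    intro q
    simp only [mul_apply, sub_apply, abs_mul]
    refine mul_le_mul (hgc q _) ((abs_sub _ _).trans ?_) (abs_nonneg _) hc
    rw [abs_mul, abs_mul]
    exact add_le_add (mul_le_mul b1 (b4 q) (abs_nonneg _) (by positivity))
      (mul_le_mul (b2 q) b3 (abs_nonneg _) (by positivity))
  -- The constant is `54 = 3 (9 + 9)`: three indices `q`, and two products with a factor `3` from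
  -- each of the two moving derivatives.
  calc _ ≤ d.lam⁻¹ * (3 * _) := mul_le_mul_of_nonneg_left (abs_sum_fin_le hq) hl.le
    _ = _ := by ring

/-- One integration by parts against an oscillating factor. -/
theorem I_mul_Y (i : Fin n) (g : Fin 3 → CF M.P) {b : PF} (hb : h.Lives i b) (f : PF) {t : ℝ}
    (ht : t ∈ Ioo 0 d.T) :
    I t (f * h.Y i (∑ q, CF.pd q (g q)) * b) =
      -I t (∑ q, d.lam⁻¹ • (h.di i q f * h.Y i (g q) * b)) -
        ∑ q, I t (f * h.Y i (g q) * (d.lam⁻¹ • h.di i q b)) := by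
  have hl := h.lam_pos.ne'
  have e1 : I t (d.lam⁻¹ • ∑ q, h.di i q (f * h.Y i (g q) * b)) = 0 := by
    rw [I_smul, I_sum]
    simp only [I_di, Finset.sum_const_zero, mul_zero]
  rw [← zero_sub, ← e1, ← I_sum, ← I_sub, ← I_sub]
  refine h.I_eq_of_good (fun t x hgood => ?_) ht
  simp only [Derivation.leibniz, smul_eq_mul]
  rcases hb.ne hgood with hi | hi
  · have hi' := hgood.etat_ne hi
    have e2 : ∀ q, h.di i q (h.Y i (g q)) t x = d.lam * h.Y i (CF.pd q (g q)) t x := fun q =>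
      (h.eqAt_di_Y hgood.mem hi' q (g q)).eq
    simp only [PF.add_apply, PF.smul_apply, mul_apply, PF.sub_apply, e2, Y_add,
      Fin.sum_univ_three]
    field_simp
    ring
  · have e2 := hi.eq
    have e4 := fun q => (h.di_congr i q hi).eq
    simp only [map_zero] at e4
    simp only [PF.add_apply, PF.smul_apply, PF.sum_apply, mul_apply, PF.sub_apply, e2, e4, PF.zero_apply]
    simp

omit h in
/-- Oscillating terms gain a power of the frequency or of the number of integrations by parts. -/
theorem exists_sum_I_Y_le (M : Mikado) (N : ℕ) {K : ℝ} (hK : 0 ≤ K) {m : ℕ} (hm : m ≤ N)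
    (φ : CF M.P) (hφ : CF.mean φ = 0) :
    ∃ C, 0 ≤ C ∧ ∀ (n : ℕ) (d : Data n) (h : d.Assumptions M N K) (b : Fin n → PF) (e : PF) (β : ℝ),
      (∀ i, h.Lives i (b i)) → 0 ≤ β → (∀ t x, 0 ≤ e t x) →
      (∀ t x, h.Good t x → ∀ i, h.η i t x ≠ 0 → Bd (nu d) t x m (β * Real.sqrt (e t x)) (b i)) →
      ∀ (f : PF) (t : ℝ), t ∈ Ioo 0 d.T → |I t (∑ i, f * h.Y i φ * b i)| ≤
        C * ((d.lam⁻¹ + (x0 d)⁻¹ ^ m) * β) * pair f e t := by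
  induction m generalizing φ with
  | zero =>
    obtain ⟨c, hc, hφc⟩ := φ.bounded M.P_pos
    refine ⟨c, hc, fun n d h b e β hb hβ he hbe f t ht => ?_⟩
    have hl := inv_pos.2 h.lam_pos
    refine h.abs_I_le_of_good (by positivity) he (fun t x hgood => ?_) (Ioo_subset_Icc_self ht)
    refine h.abs_sum_lives_le hgood (by positivity) (fun i => (hb i).mul_left _) fun i hi => ?_
    rw [mul_apply, mul_apply, abs_mul, abs_mul]
    have b1 := (hbe t x hgood i hi).abs_le
    have b2 := abs_le_sqrt_Sob f t x
    have b3 : |h.Y i φ t x| ≤ c := hφc _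
    calc _ ≤ √(Sob f t x) * c * (β * √(e t x)) := by gcongr
      _ = c * (1 * β) * (√(Sob f t x) * √(e t x)) := by ring
      _ ≤ c * ((d.lam⁻¹ + (x0 d)⁻¹ ^ 0) * β) * (√(Sob f t x) * √(e t x)) := by
        gcongr
        rw [pow_zero]; linarith
  | succ m ih =>
    -- One integration by parts. The term with the derivative on `f` already has the factor `λ⁻¹`
    -- and is kept; the term with the derivative on `b` is handed to the induction hypothesis.
    obtain ⟨g, hg, hg0, -⟩ := CF.exists_potential M.P_pos φ hφ
    choose C hC hCb using fun q => ih (by omega) (g q) (hg0 q)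
    choose c hc hgc using fun q => (g q).bounded M.P_pos
    refine ⟨3 * (cG N K * ∑ q, c q) + ∑ q, C q * (3 * (2 ^ m * cG N K)), ?_,
      fun n d h b e β hb hβ he hbe f t ht => ?_⟩
    · have : 0 ≤ cG N K := by rw [cG]; positivity
      have h1 : 0 ≤ ∑ q, c q := Finset.sum_nonneg fun q _ => hc q
      have h2 : 0 ≤ ∑ q, C q * (3 * (2 ^ m * cG N K)) :=
        Finset.sum_nonneg fun q _ => mul_nonneg (hC q) (by positivity)
      positivity
    have hl := inv_pos.2 h.lam_pos
    have hG := h.cG_nonneg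
    have hx := inv_pos.2 h.x0_pos
    have hν := h.nu_pos
    have hcs : 0 ≤ ∑ q, c q := Finset.sum_nonneg fun q _ => hc q
    have hp := pair_nonneg f e t
    rw [← hg, I_sum, Finset.sum_congr rfl fun i _ => h.I_mul_Y i g (hb i) f ht,
      Finset.sum_sub_distrib, Finset.sum_neg_distrib, ← I_sum,
      Finset.sum_comm (f := fun i q => I t (f * h.Y i (g q) * (d.lam⁻¹ • h.di i q (b i))))]
    have b1 : |I t (∑ i, ∑ q, d.lam⁻¹ • (h.di i q f * h.Y i (g q) * b i))| ≤
        3 * (cG N K * ∑ q, c q) * (d.lam⁻¹ * β) * pair f e t := by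
      refine h.abs_I_le_of_good (by positivity) he (fun t x hgood => ?_) (Ioo_subset_Icc_self ht)
      refine h.abs_sum_lives_le hgood (by positivity)
        (fun i => Lives.sum fun q _ => ((hb i).mul_left _).smul _) fun i hi => ?_
      rw [PF.sum_apply]
      refine (Finset.abs_sum_le_sum_abs _ _).trans ?_
      calc _ ≤ ∑ q, 3 * cG N K * c q * (d.lam⁻¹ * β) * (√(Sob f t x) * √(e t x)) := ?_
        _ = _ := by simp only [← Finset.sum_mul, ← Finset.mul_sum]; ring
      refine Finset.sum_le_sum fun q _ => ?_
      have hi' := hgood.etat_ne hi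
      have b4 := h.abs_di_le (Ioo_subset_Icc_self hgood.mem) hi'
        (fun l => (abs_dx_le_sqrt f l t x).trans (sqrt_Gd_le f t x)) q
      rw [PF.smul_apply, mul_apply, mul_apply, abs_mul, abs_mul, abs_mul, abs_of_pos hl]
      have b1 := (hbe t x hgood i hi).abs_le
      have b3 : |h.Y i (g q) t x| ≤ c q := hgc q _
      have := hc q
      calc _ ≤ d.lam⁻¹ * (3 * (cG N K * √(Sob f t x)) * c q * (β * √(e t x))) := by gcongr
        _ = _ := by ring
    -- A derivative of `b` costs `ν` and comes with `λ⁻¹`; since `λ = x0 ν`, the amplitude `β` is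
    -- replaced by a multiple of `x0⁻¹ β`.
    have b2 : ∀ q, |∑ i, I t (f * h.Y i (g q) * (d.lam⁻¹ • h.di i q (b i)))| ≤
        C q * ((d.lam⁻¹ + (x0 d)⁻¹ ^ m) * (3 * (2 ^ m * cG N K) * ((x0 d)⁻¹ * β))) * pair f e t := by
      intro q
      rw [← I_sum]
      refine hCb q n d h _ e _ (fun i => ((hb i).di q).smul _) (by positivity) he
        (fun t x hgood i hi => ?_) f t ht
      have hi' := hgood.etat_ne hi
      have hB := hbe t x hgood i hi
      have hGb : ∀ l, Bd (nu d) t x m (cG N K) (h.G i l q) := fun l =>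
        ((h.bd_G (Ioo_subset_Icc_self hgood.mem) hi' l q).of_le (by omega)).mono_scale
          (h.R_pos t x).le (h.R_le_nu t x)
      rw [di_apply]
      refine ((Bd.sum_fin hν.le fun l => (hGb l).mul (hB.step l)).smul _).mono hν.le (le_of_eq ?_)
      have hlam := h.x0_mul_nu
      rw [abs_of_pos hl, ← hlam]
      have := h.x0_pos.ne'
      field_simp
    have hx1 : (x0 d)⁻¹ ≤ 1 := inv_le_one_of_one_le₀ h.one_le_x0
    have b3 : (d.lam⁻¹ + (x0 d)⁻¹ ^ m) * (x0 d)⁻¹ ≤ d.lam⁻¹ + (x0 d)⁻¹ ^ (m + 1) := by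
      rw [add_mul, pow_succ]
      have := mul_le_of_le_one_right hl.le hx1
      linarith
    have b4 : ∑ q, |∑ i, I t (f * h.Y i (g q) * (d.lam⁻¹ • h.di i q (b i)))| ≤
        ∑ q, C q * (3 * (2 ^ m * cG N K)) * ((d.lam⁻¹ + (x0 d)⁻¹ ^ (m + 1)) * β) * pair f e t := by
      refine Finset.sum_le_sum fun q _ => (b2 q).trans ?_
      have := hC q
      calc _ = C q * (3 * (2 ^ m * cG N K)) * (((d.lam⁻¹ + (x0 d)⁻¹ ^ m) * (x0 d)⁻¹) * β) *
            pair f e t := by ring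
        _ ≤ _ := by gcongr
    have b5 : d.lam⁻¹ * β ≤ (d.lam⁻¹ + (x0 d)⁻¹ ^ (m + 1)) * β := by
      have : 0 ≤ (x0 d)⁻¹ ^ (m + 1) := by positivity
      gcongr; linarith
    calc _ ≤ |I t (∑ i, ∑ q, d.lam⁻¹ • (h.di i q f * h.Y i (g q) * b i))| +
          ∑ q, |∑ i, I t (f * h.Y i (g q) * (d.lam⁻¹ • h.di i q (b i)))| := by
          refine (abs_sub _ _).trans ?_
          rw [abs_neg]
          exact add_le_add le_rfl (Finset.abs_sum_le_sum_abs _ _)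
      _ ≤ 3 * (cG N K * ∑ q, c q) * ((d.lam⁻¹ + (x0 d)⁻¹ ^ (m + 1)) * β) * pair f e t + _ := by
          refine add_le_add (b1.trans ?_) b4
          gcongr
      _ = _ := by simp only [← Finset.sum_mul]; ring

end Data.Assumptions

/-! ### The corrector and the flux of the two-scale expansion -/

/-- The algebra behind the cancellations in the flux of the two-scale expansion. -/
theorem flux_algebra (Λ : Finset E3) (φ : E3 → Fin 3 → ℝ) (D R E : Fin 3 → ℝ) (a c : E3 → ℝ) (q : ℝ)
    (hd : ∀ k ∈ Λ, ∀ k' ∈ Λ, k ≠ k' → ∀ p p', φ k p * φ k' p' = 0)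
    (hk0 : ∀ k ∈ Λ, ∑ p, k p * φ k p = 0) (S : Fin 3 → ℝ)
    (hS : ∀ p, S p = ∑ k ∈ Λ, q * a k * (∑ p, k p * R p) * φ k p) :
    (∑ p, D p * (S p + E p)) + q * ∑ k ∈ Λ, a k * ((∑ p, k p * D p) *
        ∑ p, φ k p * (R p + (S p + E p)) - (∑ p, φ k p * D p) * ∑ p, k p * (R p + (S p + E p))) -
      q ^ 2 * ∑ k ∈ Λ, c k * (a k ^ 2 * ((∑ p, k p * D p) * ∑ p, k p * R p)) =
    (∑ k ∈ Λ, ∑ p, φ k p * (q * a k * R p) * ∑ p, k p * D p) +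
      (∑ k ∈ Λ, ((∑ p, φ k p ^ 2) - c k) * (q ^ 2 * a k ^ 2 * ∑ p, k p * R p) * ∑ p, k p * D p) +
      ((∑ p, D p * E p) + q * ∑ k ∈ Λ, a k * ((∑ p, k p * D p) * (∑ p, φ k p * E p) -
        (∑ p, φ k p * D p) * ∑ p, k p * E p)) := by
  -- Disjoint supports: multiplied by the gradient of one profile, the corrector gradient reduces to
  -- its term with the same `k`.
  have h1 : ∀ k ∈ Λ, ∀ p p', φ k p * S p' = q * a k * (∑ p, k p * R p) * φ k p * φ k p' := by
    intro k hk p p'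
    rw [hS, Finset.mul_sum, Finset.sum_eq_single_of_mem k hk fun k' hk' hne => ?_]
    · ring
    · have := hd k hk k' hk' hne.symm p p'
      linear_combination (q * a k' * ∑ p, k' p * R p) * this
  have h2 : ∑ p, D p * (S p + E p) =
      (∑ k ∈ Λ, q * a k * (∑ p, k p * R p) * ∑ p, D p * φ k p) + ∑ p, D p * E p := by
    simp only [mul_add, Finset.sum_add_distrib, hS, Finset.mul_sum]
    rw [Finset.sum_comm]
    congr 1
    exact Finset.sum_congr rfl fun k _ => Finset.sum_congr rfl fun p _ => by
      simp only [Finset.sum_mul, Finset.mul_sum]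
      exact Finset.sum_congr rfl fun p' _ => by ring
  rw [h2]
  suffices h3 : (∑ k ∈ Λ, q * a k * (∑ p, k p * R p) * ∑ p, D p * φ k p) +
      q * (∑ k ∈ Λ, a k * ((∑ p, k p * D p) *
        ∑ p, φ k p * (R p + (S p + E p)) - (∑ p, φ k p * D p) * ∑ p, k p * (R p + (S p + E p)))) -
      q ^ 2 * (∑ k ∈ Λ, c k * (a k ^ 2 * ((∑ p, k p * D p) * ∑ p, k p * R p))) =
    (∑ k ∈ Λ, ∑ p, φ k p * (q * a k * R p) * ∑ p, k p * D p) +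
      (∑ k ∈ Λ, ((∑ p, φ k p ^ 2) - c k) * (q ^ 2 * a k ^ 2 * ∑ p, k p * R p) * ∑ p, k p * D p) +
      (q * ∑ k ∈ Λ, a k * ((∑ p, k p * D p) * (∑ p, φ k p * E p) -
        (∑ p, φ k p * D p) * ∑ p, k p * E p)) by linarith
  rw [Finset.mul_sum, Finset.mul_sum, Finset.mul_sum, ← Finset.sum_add_distrib,
    ← Finset.sum_sub_distrib, ← Finset.sum_add_distrib, ← Finset.sum_add_distrib]
  refine Finset.sum_congr rfl fun k hk => ?_
  have h4 := h1 k hk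
  have h5 := hk0 k hk
  simp only [Fin.sum_univ_three] at h4 h5 ⊢
  have e := fun p p' => h4 p p'
  -- The first two groups substitute `h1` in the antisymmetric form. The last one uses `k·∇φ_k = 0`
  -- to discard the action of `∇φ_k ⊗ k` on the corrector.
  linear_combination q * a k * (k 0 * D 0 + k 1 * D 1 + k 2 * D 2) * (e 0 0 + e 1 1 + e 2 2) -
    q * a k * (D 0 * (k 0 * e 0 0 + k 1 * e 0 1 + k 2 * e 0 2) +
      D 1 * (k 0 * e 1 0 + k 1 * e 1 1 + k 2 * e 1 2) +
      D 2 * (k 0 * e 2 0 + k 1 * e 2 1 + k 2 * e 2 2)) -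
    q * a k * (q * a k * (k 0 * R 0 + k 1 * R 1 + k 2 * R 2)) *
      (φ k 0 * D 0 + φ k 1 * D 1 + φ k 2 * D 2) * h5

namespace Data.Assumptions

open PF

variable {n : ℕ} {M : Mikado} {N : ℕ} {K : ℝ} {d : Data n} (h : d.Assumptions M N K)
include h

/-- The amplitudes of the corrector with coefficients `c`. -/
def am (c : Fin n → PF) (r : PF) (i : Fin n) (k : E3) : PF := c i * h.a k i * h.dk i k r

/-- The corrector with coefficients `c`. -/
def Wc (c : Fin n → PF) (r : PF) : PF :=
  d.lam⁻¹ • ∑ i, ∑ k ∈ M.Λ, h.Y i (M.cell k) * h.am c r i k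

theorem W_eq (r : PF) : h.W r = h.Wc h.q r := by
  simp only [W, Wc, am, Finset.mul_sum]
  congr 1
  exact Finset.sum_congr rfl fun i _ => Finset.sum_congr rfl fun k _ => by ring

/-- The lower order part of the gradient of the corrector. -/
def lowC (r : PF) (c : Fin n → PF) (i : Fin n) (p : Fin 3) : PF :=
  d.lam⁻¹ • ∑ k ∈ M.Λ, h.Y i (M.cell k) * h.di i p (h.am c r i k)

variable {c : Fin n → PF} (hc : ∀ i, h.Lives i (c i)) (r : PF)
include hc

theorem lives_am (i : Fin n) (k : E3) : h.Lives i (h.am c r i k) :=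
  ((hc i).mul_right _).mul_right _

theorem eqAt_Wc {t : ℝ} {x : E3} (hg : h.Good t x) {j : Fin n} (hj : h.η j t x ≠ 0) :
    EqAt t x (h.Wc c r) (d.lam⁻¹ • ∑ k ∈ M.Λ, h.Y j (M.cell k) * h.am c r j k) := by
  classical
  refine EqAt.smul _ ?_
  have h2 : EqAt t x (∑ i, ∑ k ∈ M.Λ, h.Y i (M.cell k) * h.am c r i k)
      (∑ i, if i = j then ∑ k ∈ M.Λ, h.Y j (M.cell k) * h.am c r j k else 0) := by
    refine EqAt.sum _ fun i _ => ?_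
    split_ifs with hi
    · rw [hi]; exact EqAt.refl _
    · exact Lives.sum (fun k _ => (h.lives_am hc r i k).mul_left _) t x hg
        (hg.eqAt_eta hj (Ne.symm hi))
  rwa [Finset.sum_ite_eq' Finset.univ j, if_pos (Finset.mem_univ j)] at h2

theorem eqAt_Wc_zero {t : ℝ} {x : E3} (hg : h.Good t x) (hz : ∀ j, EqAt t x (h.η j) 0) :
    EqAt t x (h.Wc c r) 0 :=
  ((EqAt.sum _ fun i _ => Lives.sum (fun k _ => (h.lives_am hc r i k).mul_left _) t x hg
    (hz i)).smul _).trans (EqAt.of_eq (by simp))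

/-- A derivative of the profile gains `λ` and cancels the prefactor of the corrector; everything
else is the lower order part `lowC`. -/
theorem di_Wc {t : ℝ} {x : E3} (hg : h.Good t x) {j : Fin n} (hj : h.η j t x ≠ 0) (p : Fin 3) :
    h.di j p (h.Wc c r) t x =
      (∑ k ∈ M.Λ, h.am c r j k t x * h.Y j (CF.pd p (M.cell k)) t x) +
      h.lowC r c j p t x := by
  have hl := h.lam_pos.ne'
  rw [lowC, (h.di_congr j p (h.eqAt_Wc hc r hg hj)).eq, Derivation.map_smul, map_sum]
  simp only [Derivation.leibniz, smul_eq_mul, PF.smul_apply, PF.sum_apply, PF.add_apply, mul_apply,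
    Finset.sum_add_distrib, mul_add]
  rw [add_comm]
  congr 1
  rw [Finset.mul_sum]
  refine Finset.sum_congr rfl fun k _ => ?_
  rw [(h.eqAt_di_Y hg.mem (hg.etat_ne hj) p (M.cell k)).eq, PF.smul_apply]
  field_simp

/-- The profiles are transported, so only the slow amplitudes are differentiated. -/
theorem Dt_Wc {t : ℝ} {x : E3} (hg : h.Good t x) {j : Fin n} (hj : h.η j t x ≠ 0) :
    h.Dt (h.Wc c r) t x = (d.lam⁻¹ • ∑ k ∈ M.Λ, h.Y j (M.cell k) * h.Dt (h.am c r j k)) t x := by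
  rw [(h.Dt_congr (h.eqAt_Wc hc r hg hj)).eq, Derivation.map_smul, map_sum]
  simp only [Derivation.leibniz, smul_eq_mul, PF.smul_apply, PF.sum_apply, PF.add_apply, mul_apply]
  congr 1
  refine Finset.sum_congr rfl fun k _ => ?_
  rw [(h.eqAt_Dt_Y hg.mem (hg.etat_ne hj) (M.cell k)).eq, PF.zero_apply, mul_zero, add_zero]

omit hc

/-- The lower order part of the gradient of the corrector of the two-scale expansion. -/
abbrev lowW (i : Fin n) (p : Fin 3) : PF := h.lowC r h.q i p

theorem lives_lowW (i : Fin n) (p : Fin 3) : h.Lives i (h.lowW r i p) :=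
  Lives.smul (Lives.sum fun k _ => ((h.lives_am h.lives_q r i k).di p).mul_left _) _

variable (f : PF)

/-- The part of the flux that is transported by an oscillating gradient. -/
def fluxGrad (k : E3) (p : Fin 3) : PF :=
  ∑ i, h.Y i (CF.pd p (M.cell k)) * (d.kappa • (h.q i * h.a k i * h.di i p r)) * h.dk i k f

/-- The part of the flux that is transported by the fluctuation of `|∇φ_k|²`. -/
def fluxSq (k : E3) : PF :=
  ∑ i, h.Y i (M.gsq k - algebraMap ℝ (CF M.P) (M.cst k)) *
    (d.kappa • (h.q i ^ 2 * h.a k i ^ 2 * h.dk i k r)) * h.dk i k f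

/-- The part of the flux that comes from the lower order part of the corrector. -/
def fluxLow : PF :=
  ∑ i, d.kappa • ((∑ p, h.di i p f * h.lowW r i p) + h.q i * ∑ k ∈ M.Λ, h.a k i *
    (h.dk i k f * (∑ p, h.Y i (CF.pd p (M.cell k)) * h.lowW r i p) -
      (∑ p, h.Y i (CF.pd p (M.cell k)) * h.di i p f) * ∑ p, k p • h.lowW r i p))

/-- The isotropic form of `f` and `r` is common to both fluxes and cancels. For each index the rest
is `flux_algebra` where `η_j` is nonzero, and every term vanishes where `η_j` is locally zero. -/
theorem flux_eq {t : ℝ} {x : E3} (hg : h.Good t x) :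
    (h.Qt f (r + h.W r) - h.Qb f r) t x =
      ((∑ k ∈ M.Λ, ∑ p, h.fluxGrad r f k p) + (∑ k ∈ M.Λ, h.fluxSq r f k) + h.fluxLow r f) t x := by
  have ht := Ioo_subset_Icc_self hg.mem
  have e1 : ∀ j, h.ηt j t x * (∑ p, h.di j p f t x * h.di j p (h.W r) t x) +
      h.q j t x * (∑ k ∈ M.Λ, h.a k j t x *
        (h.dk j k f t x * (∑ p, h.Y j (CF.pd p (M.cell k)) t x * (h.di j p r t x + h.di j p (h.W r) t x)) -
        (∑ p, h.Y j (CF.pd p (M.cell k)) t x * h.di j p f t x) *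
          (h.dk j k r t x + h.dk j k (h.W r) t x))) -
      h.q j t x ^ 2 * (∑ k ∈ M.Λ, M.cst k * (h.a k j t x ^ 2 * (h.dk j k f t x * h.dk j k r t x))) =
      (∑ k ∈ M.Λ, ∑ p, h.Y j (CF.pd p (M.cell k)) t x * (h.q j t x * h.a k j t x * h.di j p r t x) *
        h.dk j k f t x) +
      (∑ k ∈ M.Λ, ((∑ p, h.Y j (CF.pd p (M.cell k)) t x ^ 2) - M.cst k) *
        (h.q j t x ^ 2 * h.a k j t x ^ 2 * h.dk j k r t x) * h.dk j k f t x) +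
      ((∑ p, h.di j p f t x * h.lowW r j p t x) + h.q j t x * ∑ k ∈ M.Λ, h.a k j t x *
        (h.dk j k f t x * (∑ p, h.Y j (CF.pd p (M.cell k)) t x * h.lowW r j p t x) -
        (∑ p, h.Y j (CF.pd p (M.cell k)) t x * h.di j p f t x) * ∑ p, k p * h.lowW r j p t x)) := by
    intro j
    rcases hg.eta j with hj | hj
    · have h1 := h.di_Wc h.lives_q r hg hj
      rw [← W_eq] at h1
      rw [h.etat_eq_one ht hj, one_mul]
      have h2 := flux_algebra M.Λ (fun k p => h.Y j (CF.pd p (M.cell k)) t x)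
        (fun p => h.di j p f t x) (fun p => h.di j p r t x) (fun p => h.lowW r j p t x)
        (fun k => h.a k j t x) M.cst (h.q j t x)
        (fun k hk k' hk' hne p p' => M.pd_mul_pd hk hk' hne p p' _) (fun k hk => by
          have := congrArg (fun g : CF M.P => g (d.lam • d.Phi j t x)) (M.kd_cell hk)
          simp only [CF.kd, CF.sum_apply, CF.smul_apply, CF.zero_apply] at this
          exact this) _ (fun p => rfl)
      have h3 : ∀ g k, h.dk j k g t x = ∑ p, k p * h.di j p g t x := fun g k => by
        rw [dk_apply, PF.sum_apply]; rfl
      have h4 : ∀ p, h.di j p (h.W r) t x = (∑ k ∈ M.Λ, h.q j t x * h.a k j t x *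
          (∑ p, k p * h.di j p r t x) * h.Y j (CF.pd p (M.cell k)) t x) + h.lowW r j p t x :=
        fun p => by
          rw [h1]
          simp only [am, mul_apply, h3]
      simp only [← h4] at h2
      simp only [h3]
      simp only [mul_add, Finset.sum_add_distrib] at h2 ⊢
      exact h2
    · have h1 : h.q j t x = 0 := (h.lives_q j t x hg hj).eq
      have h2 : ∀ p, h.lowW r j p t x = 0 := fun p => (h.lives_lowW r j p t x hg hj).eq
      -- Here `η̃_j` may be nonzero although `η_j` vanishes. Then no other `η_i` is active, as `η̃_j
      -- η_i = 0`, and the corrector vanishes nearby.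
      have h3 : h.ηt j t x * (∑ p, h.di j p f t x * h.di j p (h.W r) t x) = 0 := by
        by_cases hz : h.ηt j t x = 0
        · rw [hz, zero_mul]
        · have h4 : ∀ i, EqAt t x (h.η i) 0 := fun i => by
            refine (hg.eta i).resolve_left fun hi => hz ?_
            have hij : i ≠ j := by rintro rfl; exact hi hj.eq
            exact (hg.eqAt_etat hi hij).eq
          have h5 : ∀ p, h.di j p (h.W r) t x = 0 := fun p => by
            rw [W_eq, (h.di_congr j p (h.eqAt_Wc_zero h.lives_q r hg h4)).eq, map_zero]; rfl
          simp [h5]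
      rw [h3, h1]
      simp [h2]
  have eL : (h.Qt f (r + h.W r) - h.Qb f r) t x = ∑ j, d.kappa *
      (h.ηt j t x * (∑ p, h.di j p f t x * h.di j p (h.W r) t x) +
      h.q j t x * (∑ k ∈ M.Λ, h.a k j t x *
        (h.dk j k f t x * (∑ p, h.Y j (CF.pd p (M.cell k)) t x * (h.di j p r t x + h.di j p (h.W r) t x)) -
        (∑ p, h.Y j (CF.pd p (M.cell k)) t x * h.di j p f t x) *
          (h.dk j k r t x + h.dk j k (h.W r) t x))) -
      h.q j t x ^ 2 * (∑ k ∈ M.Λ, M.cst k * (h.a k j t x ^ 2 * (h.dk j k f t x * h.dk j k r t x)))) := by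
    simp only [Qt_eq, Qb_eq, Nf, PF.sum_apply, PF.add_apply, PF.sub_apply, PF.smul_apply, mul_apply,
      pow_apply, map_add]
    rw [← Finset.sum_add_distrib, ← Finset.sum_add_distrib, ← Finset.sum_sub_distrib]
    refine Finset.sum_congr rfl fun j _ => ?_
    have e3 : ∑ p, h.di j p f t x * (h.di j p r t x + h.di j p (h.W r) t x) =
      (∑ p, h.di j p f t x * h.di j p r t x) + ∑ p, h.di j p f t x * h.di j p (h.W r) t x := by
      rw [← Finset.sum_add_distrib]
      exact Finset.sum_congr rfl fun p _ => mul_add _ _ _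
    rw [e3]
    ring
  have eR : ((∑ k ∈ M.Λ, ∑ p, h.fluxGrad r f k p) + (∑ k ∈ M.Λ, h.fluxSq r f k) + h.fluxLow r f) t x =
      ∑ j, d.kappa * ((∑ k ∈ M.Λ, ∑ p, h.Y j (CF.pd p (M.cell k)) t x *
        (h.q j t x * h.a k j t x * h.di j p r t x) * h.dk j k f t x) +
      (∑ k ∈ M.Λ, ((∑ p, h.Y j (CF.pd p (M.cell k)) t x ^ 2) - M.cst k) *
        (h.q j t x ^ 2 * h.a k j t x ^ 2 * h.dk j k r t x) * h.dk j k f t x) +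
      ((∑ p, h.di j p f t x * h.lowW r j p t x) + h.q j t x * ∑ k ∈ M.Λ, h.a k j t x *
        (h.dk j k f t x * (∑ p, h.Y j (CF.pd p (M.cell k)) t x * h.lowW r j p t x) -
        (∑ p, h.Y j (CF.pd p (M.cell k)) t x * h.di j p f t x) * ∑ p, k p * h.lowW r j p t x))) := by
    have e4 : ∀ k j, h.Y j (M.gsq k - algebraMap ℝ (CF M.P) (M.cst k)) t x =
        (∑ p, h.Y j (CF.pd p (M.cell k)) t x ^ 2) - M.cst k := fun k j => by
      rw [Y_apply, Mikado.gsq, CF.sub_apply, CF.sum_apply]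
      rfl
    simp only [fluxGrad, fluxSq, fluxLow, PF.sum_apply, PF.add_apply, PF.sub_apply, PF.smul_apply,
      mul_apply, pow_apply, e4]
    rw [Finset.sum_congr rfl fun k _ => Finset.sum_comm, Finset.sum_comm,
      Finset.sum_comm (s := M.Λ), ← Finset.sum_add_distrib, ← Finset.sum_add_distrib]
    refine Finset.sum_congr rfl fun j _ => ?_
    have e5 : ∀ a b c : ℝ, d.kappa * (a + b + c) = d.kappa * a + d.kappa * b + d.kappa * c :=
      fun a b c => by ring
    rw [e5]
    congr 2
    · simp only [Finset.mul_sum]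
      exact Finset.sum_congr rfl fun k _ => Finset.sum_congr rfl fun p _ => by ring
    · rw [Finset.mul_sum]
      exact Finset.sum_congr rfl fun k _ => by ring
  rw [eL, eR]
  exact Finset.sum_congr rfl fun j _ => congrArg _ (e1 j)

end Data.Assumptions

theorem PF.Bd.abs_dx_le {R t : ℝ} {x : E3} {m : ℕ} {A : ℝ} {f : PF} (h : Bd R t x m A f) (hm : 1 ≤ m)
    (l : Fin 3) : |dx l f t x| ≤ A * R := by
  obtain ⟨m, rfl⟩ : ∃ m', m = m' + 1 := ⟨m - 1, by omega⟩
  exact (h.step l).abs_le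

theorem CF.pd_comm {P : ℝ} (p q : Fin 3) (f : CF P) : pd p (pd q f) = pd q (pd p f) := by
  ext x
  have h1 : ∀ v w : E3, fderiv ℝ (fun y => fderiv ℝ f.1 y v) x w = fderiv ℝ (fderiv ℝ f.1) x w v :=
    fun v w => by
      have h : DifferentiableAt ℝ (fderiv ℝ f.1) x :=
        (f.smooth.fderiv_right (m := ∞) (by simp)).differentiable (by simp) x
      rw [fderiv_clm_apply h (differentiableAt_const _)]
      simp
  have h2 : IsSymmSndFDerivAt ℝ f.1 x := f.smooth.contDiffAt.isSymmSndFDerivAt (by simpa using ENat.LEInfty.out)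
  exact (h1 _ _).trans ((h2 _ _).trans (h1 _ _).symm)

theorem CF.kd_pd {P : ℝ} (k : E3) (q : Fin 3) (f : CF P) : kd k (pd q f) = pd q (kd k f) := by
  simp only [kd, map_sum, Derivation.map_smul, pd_comm q]

/-- The derivative along `k` commutes with the partial derivatives, so the components of `∇φ_k`, and
with them `|∇φ_k|²`, are constant along `k`. -/
theorem CF.kd_gsq {M : Mikado} {k : E3} (hk : k ∈ M.Λ) :
    kd k (M.gsq k - algebraMap ℝ (CF M.P) (M.cst k)) = 0 := by
  have h1 : ∀ q, kd k (pd q (M.cell k)) = 0 := fun q => by rw [kd_pd, M.kd_cell hk, map_zero]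
  have h2 : ∀ q, kd k (pd q (M.cell k) ^ 2) = 0 := fun q => by
    have : kd k (pd q (M.cell k) ^ 2) = 2 * pd q (M.cell k) * kd k (pd q (M.cell k)) := by
      simp only [kd, sq, Derivation.leibniz, smul_eq_mul, Algebra.smul_def, Finset.mul_sum]
      exact Finset.sum_congr rfl fun l _ => by ring
    rw [this, h1, mul_zero]
  have h3 : kd k (M.gsq k - algebraMap ℝ (CF M.P) (M.cst k)) = ∑ q, kd k (pd q (M.cell k) ^ 2) := by
    simp only [kd, Mikado.gsq, map_sub, map_sum, Derivation.map_algebraMap, sub_zero, Finset.smul_sum]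
    rw [Finset.sum_comm]
  rw [h3]
  exact Finset.sum_eq_zero fun q _ => h2 q

theorem CF.mean_gsq (M : Mikado) (k : E3) :
    mean (M.gsq k - algebraMap ℝ (CF M.P) (M.cst k)) = 0 := by
  rw [mean_sub M.P_pos, mean_algebraMap M.P_pos]
  exact sub_self _

theorem Mikado.exists_bound (M : Mikado) : ∃ B, 0 ≤ B ∧ ∀ k ∈ M.Λ,
    (∀ ξ, |M.cell k ξ| ≤ B) ∧ (∀ p ξ, |CF.pd p (M.cell k) ξ| ≤ B) ∧ ∑ p, |k p| ≤ B := by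
  choose b hb hb' using fun k => (M.cell k).bounded M.P_pos
  choose b1 hb1 hb1' using fun k p => (CF.pd p (M.cell k)).bounded M.P_pos
  have h0 : ∀ k, 0 ≤ b k + (∑ p, b1 k p) + ∑ p, |k p| := fun k => by
    have := hb k
    have := Finset.sum_nonneg fun p (_ : p ∈ Finset.univ) => hb1 k p
    positivity
  refine ⟨∑ k ∈ M.Λ, (b k + (∑ p, b1 k p) + ∑ p, |k p|), Finset.sum_nonneg fun k _ => h0 k, ?_⟩
  intro k hk
  have h1 := Finset.single_le_sum (fun k _ => h0 k) hk
  have h2 := hb k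
  have h3 : 0 ≤ ∑ p, b1 k p := Finset.sum_nonneg fun p (_ : p ∈ Finset.univ) => hb1 k p
  have h4 : 0 ≤ ∑ p, |k p| := by positivity
  refine ⟨fun ξ => (hb' k ξ).trans (by linarith), fun p ξ => (hb1' k p ξ).trans ?_, by linarith⟩
  have h5 := Finset.single_le_sum (fun p _ => hb1 k p) (Finset.mem_univ p)
  linarith

/-! ### Terms that are negligible in the energy balance of the error -/

namespace Data.Assumptions

open PF

/-- Quantities that are small compared with the energies of the homogenized solution. -/
def Negl (M : Mikado) (N : ℕ) (K : ℝ)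
    (X : ∀ {n : ℕ} {d : Data n}, d.Assumptions M N K → PF → PF → ℝ → ℝ) : Prop :=
  ∃ C, 0 ≤ C ∧ ∀ (n : ℕ) (d : Data n) (h : d.Assumptions M N K) (r f : PF) (t : ℝ), h.IsHom r →
    -- The size `κ ν / x0` is adapted to Young's inequality: besides a small multiple of `κ |∇f|²`
    -- it leaves `κ ν² x0⁻² e = x0⁻² τ⁻¹ e`, whose time integral is at most a multiple of `x0⁻² D`.
    t ∈ Ioo 0 d.T → |X h r f t| ≤ C * (d.kappa * nu d * (x0 d)⁻¹) * pair f (h.esum r (N + 1)) t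

section Negl

variable {M : Mikado} {N : ℕ} {K : ℝ}
  {X Y : ∀ {n : ℕ} {d : Data n}, d.Assumptions M N K → PF → PF → ℝ → ℝ}

theorem Negl.add (hX : Negl M N K X) (hY : Negl M N K Y) :
    Negl M N K fun h r f t => X h r f t + Y h r f t := by
  obtain ⟨C, hC, hX⟩ := hX
  obtain ⟨C', hC', hY⟩ := hY
  refine ⟨C + C', by positivity, fun n d h r f t hr ht => (abs_add_le _ _).trans ?_⟩
  rw [add_mul, add_mul]
  exact add_le_add (hX n d h r f t hr ht) (hY n d h r f t hr ht)

theorem Negl.neg (hX : Negl M N K X) : Negl M N K fun h r f t => -X h r f t := by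
  obtain ⟨C, hC, hX⟩ := hX
  exact ⟨C, hC, fun n d h r f t hr ht => (abs_neg _).trans_le (hX n d h r f t hr ht)⟩

theorem Negl.sum {ι : Type*} (s : Finset ι)
    {X : ι → ∀ {n : ℕ} {d : Data n}, d.Assumptions M N K → PF → PF → ℝ → ℝ}
    (hX : ∀ j ∈ s, Negl M N K (X j)) : Negl M N K fun h r f t => ∑ j ∈ s, X j h r f t := by
  classical
  induction s using Finset.induction_on with
  | empty =>
    refine ⟨0, le_rfl, fun n d h r f t _ _ => by simp⟩
  | insert j s hj ih =>
    simp only [Finset.sum_insert hj]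
    exact (hX j (Finset.mem_insert_self _ _)).add
      (ih fun i hi => hX i (Finset.mem_insert_of_mem hi))

theorem Negl.congr (hX : Negl M N K X)
    (hXY : ∀ (n : ℕ) (d : Data n) (h : d.Assumptions M N K) (r f : PF) (t : ℝ), h.IsHom r →
      t ∈ Ioo 0 d.T → Y h r f t = X h r f t) : Negl M N K Y := by
  obtain ⟨C, hC, hX⟩ := hX
  exact ⟨C, hC, fun n d h r f t hr ht => (congrArg _ (hXY n d h r f t hr ht)).trans_le
    (hX n d h r f t hr ht)⟩

theorem negl_of_good {F : ∀ {n : ℕ} {d : Data n}, d.Assumptions M N K → PF → PF → PF} {C : ℝ}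
    (hC : 0 ≤ C) (hF : ∀ (n : ℕ) (d : Data n) (h : d.Assumptions M N K) (r f : PF), h.IsHom r →
      ∀ t x, h.Good t x → |F h r f t x| ≤ C * (d.kappa * nu d * (x0 d)⁻¹) *
        (Real.sqrt (Sob f t x) * Real.sqrt (h.esum r (N + 1) t x))) :
    Negl M N K fun h r f t => I t (F h r f) := by
  refine ⟨C, hC, fun n d h r f t hr ht => ?_⟩
  have := h.kappa_pos
  have := h.nu_pos
  have := h.x0_pos
  exact h.abs_I_le_of_good (by positivity) (h.esum_nonneg r _) (fun t x hg => hF n d h r f hr t x hg)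
    (Ioo_subset_Icc_self ht)

/-- One integration by parts suffices when the test function is differentiated along `k`: `λ⁻¹ κ ν²
= κ ν / x0`. -/
theorem negl_transport (k : E3) (φ : CF M.P) (hφ : CF.mean φ = 0) (hk : CF.kd k φ = 0)
    {b : ∀ {n : ℕ} {d : Data n}, d.Assumptions M N K → PF → Fin n → PF} {c : ℝ} (hc : 0 ≤ c)
    (hb : ∀ (n : ℕ) (d : Data n) (h : d.Assumptions M N K) (r : PF) (i : Fin n), h.Lives i (b h r i))
    (hbe : ∀ (n : ℕ) (d : Data n) (h : d.Assumptions M N K) (r : PF), h.IsHom r →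
      ∀ t x, h.Good t x → ∀ i, h.η i t x ≠ 0 → ∀ l,
        |dx l (b h r i) t x| ≤ c * (d.kappa * nu d ^ 2) * Real.sqrt (h.esum r (N + 1) t x)) :
    Negl M N K fun {_} {_} h r f t => I t (∑ i, h.Y i φ * b h r i * h.dk i k f) := by
  obtain ⟨g, hg, -, hgk⟩ := CF.exists_potential M.P_pos φ hφ
  choose c1 hc1 hgc using fun q => (g q).bounded M.P_pos
  have hc0 : 0 ≤ ∑ q, c1 q := Finset.sum_nonneg fun q _ => hc1 q
  have hk0 : 0 ≤ ∑ p, |k p| := by positivity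
  refine ⟨54 * ((∑ q, c1 q) * (∑ p, |k p|) * cG N K ^ 2) * c, by positivity,
    fun n d h r f t hr ht => ?_⟩
  have hκ := h.kappa_pos
  have hν := h.nu_pos
  rw [← hg]
  refine (h.abs_sum_I_Y_dk_le (hgk k hk) hc0 (fun q ξ => (hgc q ξ).trans
    (Finset.single_le_sum (fun q _ => hc1 q) (Finset.mem_univ q))) (hb n d h r)
    (β := c * (d.kappa * nu d ^ 2)) (by positivity) (h.esum_nonneg r (N + 1)) (hbe n d h r hr) f
    ht).trans_eq ?_
  have := h.x0_pos.ne'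
  have hν' := hν.ne'
  rw [← h.x0_mul_nu]
  field_simp

/-- For terms in which the test function is not differentiated, smallness comes from `m`
integrations by parts, each gaining `x0⁻¹`; the amplitudes then need `m` derivatives at scale `ν`.
-/
theorem negl_osc (hK : 0 ≤ K) {m : ℕ} (hm : m ≤ N) (φ : CF M.P) (hφ : CF.mean φ = 0)
    {b : ∀ {n : ℕ} {d : Data n}, d.Assumptions M N K → PF → Fin n → PF}
    {β : ∀ {n : ℕ}, Data n → ℝ} {c : ℝ} (hc : 0 ≤ c)
    (hb : ∀ (n : ℕ) (d : Data n) (h : d.Assumptions M N K) (r : PF) (i : Fin n), h.Lives i (b h r i))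
    (hβ : ∀ (n : ℕ) (d : Data n), d.Assumptions M N K → 0 ≤ β d ∧
      (d.lam⁻¹ + (x0 d)⁻¹ ^ m) * β d ≤ c * (d.kappa * nu d * (x0 d)⁻¹))
    (hbe : ∀ (n : ℕ) (d : Data n) (h : d.Assumptions M N K) (r : PF), h.IsHom r →
      ∀ t x, h.Good t x → ∀ i, h.η i t x ≠ 0 →
        Bd (nu d) t x m (β d * Real.sqrt (h.esum r (N + 1) t x)) (b h r i)) :
    Negl M N K fun {_} {_} h r f t => I t (∑ i, f * h.Y i φ * b h r i) := by
  obtain ⟨C, hC, hCb⟩ := exists_sum_I_Y_le M N hK hm φ hφ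
  refine ⟨C * c, by positivity, fun n d h r f t hr ht => ?_⟩
  refine (hCb n d h (b h r) (h.esum r (N + 1)) (β d) (hb n d h r) (hβ n d h).1
    (h.esum_nonneg r (N + 1)) (hbe n d h r hr) f t ht).trans ?_
  rw [mul_assoc C c]
  exact mul_le_mul_of_nonneg_right (mul_le_mul_of_nonneg_left (hβ n d h).2 hC) (pair_nonneg _ _ _)

end Negl

variable {n : ℕ} {M : Mikado} {N : ℕ} {K : ℝ} {d : Data n} (h : d.Assumptions M N K)
include h

omit h in
/-- The constant in the bounds on the derivatives of the solution in the moving coordinates. -/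
def cD (N : ℕ) (K : ℝ) : ℝ := 3 * (2 ^ N * cG N K)

theorem bd_di {i : Fin n} {t : ℝ} {x : E3} (ht : t ∈ Icc 0 d.T) (hi : h.ηt i t x ≠ 0) {m : ℕ}
    (hm : m ≤ N) {g : PF} {A : ℝ} (hg : ∀ l, Bd (h.R t x) t x m A (dx l g)) (p : Fin 3) :
    Bd (h.R t x) t x m (cD N K * A) (h.di i p g) := by
  have hR := (h.R_pos t x).le
  have hG := h.cG_nonneg
  have hA := (hg 0).nonneg
  rw [di_apply]
  refine (Bd.sum_fin hR fun l => ((h.bd_G ht hi l p).of_le hm).mul (hg l)).mono hR ?_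
  have : (2:ℝ) ^ m ≤ 2 ^ N := pow_le_pow_right₀ (by norm_num) hm
  calc _ = 3 * (2 ^ m * (cG N K * A)) := rfl
    _ ≤ 3 * (2 ^ N * (cG N K * A)) := by gcongr
    _ = _ := by rw [cD]; ring

theorem bd_dk {i : Fin n} {t : ℝ} {x : E3} (ht : t ∈ Icc 0 d.T) (hi : h.ηt i t x ≠ 0) {m : ℕ}
    (hm : m ≤ N) {g : PF} {A : ℝ} (hg : ∀ l, Bd (h.R t x) t x m A (dx l g)) {k : E3} {B : ℝ}
    (hk : ∑ p, |k p| ≤ B) : Bd (h.R t x) t x m (B * (cD N K * A)) (h.dk i k g) := by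
  have hR := (h.R_pos t x).le
  have hb := h.bd_di ht hi hm hg
  rw [dk_apply]
  refine (Bd.sum _ hR fun p _ => (hb p).smul (k p)).mono hR ?_
  rw [← Finset.sum_mul]
  exact mul_le_mul_of_nonneg_right hk (hb 0).nonneg

/-- The amplitude brings a factor `Q` and the gradient of the solution a factor `R`; their product
is `ν`. -/
theorem bd_am {c : Fin n → PF} {r : PF} {i : Fin n} {t : ℝ} {x : E3} (hg : h.Good t x)
    (hi : h.η i t x ≠ 0) {C : ℝ} (hc : Bd (h.R t x) t x N (C * h.Q t x) (c i)) {k : E3} {B : ℝ}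
    (hk : ∑ p, |k p| ≤ B) : Bd (h.R t x) t x N
      (2 ^ N * (2 ^ N * (C * K) * (B * cD N K)) * (nu d * Real.sqrt (h.esum r (N + 1) t x)))
      (h.am c r i k) := by
  have ht := Ioo_subset_Icc_self hg.mem
  have hb := (hc.mul (h.bd_a ht hi k).1).mul
    (h.bd_dk ht (hg.etat_ne hi) le_rfl (fun l => h.bd_dx_sol r N l t x) hk)
  rw [am]
  refine hb.mono (h.R_pos t x).le (le_of_eq ?_)
  rw [← h.Q_mul_R t x]
  ring

theorem abs_lowC_le (hN : 1 ≤ N) {c : Fin n → PF} {r : PF} {i : Fin n} {t : ℝ} {x : E3}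
    (hg : h.Good t x) (hi : h.η i t x ≠ 0) {C : ℝ} (hc : Bd (h.R t x) t x N (C * h.Q t x) (c i))
    {B : ℝ} (hB0 : 0 ≤ B) (hB : ∀ k ∈ M.Λ,
      (∀ ξ, |M.cell k ξ| ≤ B) ∧ (∀ p ξ, |CF.pd p (M.cell k) ξ| ≤ B) ∧ ∑ p, |k p| ≤ B) (p : Fin 3) :
    |h.lowC r c i p t x| ≤ M.Λ.card * (B * (3 * (cG N K * (2 ^ N * (2 ^ N * (C * K) *
      (B * cD N K)))))) * (d.lam⁻¹ * (nu d * (h.R t x * Real.sqrt (h.esum r (N + 1) t x)))) := by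
  have hl := inv_pos.2 h.lam_pos
  rw [lowC, PF.smul_apply, abs_mul, abs_of_pos hl, PF.sum_apply]
  have h1 : ∀ k ∈ M.Λ, |(h.Y i (M.cell k) * h.di i p (h.am c r i k)) t x| ≤ B * (3 * (cG N K *
      (2 ^ N * (2 ^ N * (C * K) * (B * cD N K)) * (nu d * Real.sqrt (h.esum r (N + 1) t x)) *
        h.R t x))) := by
    intro k hk
    obtain ⟨b1, b2, b3⟩ := hB k hk
    rw [mul_apply, abs_mul]
    exact mul_le_mul (b1 _) (h.abs_di_le (Ioo_subset_Icc_self hg.mem) (hg.etat_ne hi)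
      (fun l => (h.bd_am hg hi hc b3).abs_dx_le hN l) p) (abs_nonneg _) hB0
  have h2 := (Finset.abs_sum_le_sum_abs _ _).trans (Finset.sum_le_card_nsmul _ _ _ h1)
  rw [nsmul_eq_mul] at h2
  calc _ ≤ d.lam⁻¹ * _ := mul_le_mul_of_nonneg_left h2 hl.le
    _ = _ := by ring

theorem kappa_mul_nu_sq : d.kappa * nu d ^ 2 = d.tau⁻¹ := by
  rw [h.nu_sq]
  have := h.kappa_pos.ne'
  have := h.tau_pos.ne'
  field_simp

theorem lam_inv_mul_nu : d.lam⁻¹ * nu d = (x0 d)⁻¹ := by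
  have := h.nu_pos.ne'
  have := h.x0_pos.ne'
  rw [← h.x0_mul_nu]
  field_simp

/-- This form of `order` turns `N` gains of `x0⁻¹` into a full factor `λ⁻¹`; it also bounds `λ`
whenever `x0` is bounded. -/
theorem lam_le : d.lam ≤ K * x0 d ^ N := by
  have h1 := h.order'
  have hK := h.one_le_K
  have hx := h.x0_pos
  have h2 : d.lam ^ 2 ≤ (K * x0 d ^ N) ^ 2 := by
    refine h1.trans ?_
    rw [mul_pow, ← pow_mul, ← pow_mul, mul_comm 2 N]
    have : K ≤ K ^ 2 := by nlinarith
    gcongr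
  exact (le_abs_self _).trans (abs_le_of_sq_le_sq h2 (by positivity))

theorem abs_bilinear_le {i : Fin n} {t : ℝ} {x : E3} (hg : h.Good t x) (hi : h.η i t x ≠ 0) {B : ℝ}
    (hB0 : 0 ≤ B) (hB : ∀ k ∈ M.Λ,
      (∀ ξ, |M.cell k ξ| ≤ B) ∧ (∀ p ξ, |CF.pd p (M.cell k) ξ| ≤ B) ∧ ∑ p, |k p| ≤ B) {f : PF} {S : ℝ}
    (hf : ∀ l, |dx l f t x| ≤ S) {L : Fin 3 → ℝ} {L0 : ℝ} (hL : ∀ p, |L p| ≤ L0) :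
    |d.kappa * ((∑ p, h.di i p f t x * L p) + h.q i t x * ∑ k ∈ M.Λ, h.a k i t x *
        (h.dk i k f t x * (∑ p, h.Y i (CF.pd p (M.cell k)) t x * L p) -
          (∑ p, h.Y i (CF.pd p (M.cell k)) t x * h.di i p f t x) * ∑ p, k p * L p))| ≤
      (9 * cG N K + M.Λ.card * (K * (18 * B ^ 2 * cG N K))) * (d.kappa * h.Q t x * (S * L0)) := by
  have ht := Ioo_subset_Icc_self hg.mem
  have hi' := hg.etat_ne hi
  have hκ := h.kappa_pos
  have hG := h.cG_nonneg
  have hK := h.K_pos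
  have hQ := h.one_le_Q t x
  have hL00 : 0 ≤ L0 := (abs_nonneg _).trans (hL 0)
  have hS : 0 ≤ S := (abs_nonneg _).trans (hf 0)
  have b1 : |∑ p, h.di i p f t x * L p| ≤ 3 * (3 * (cG N K * S) * L0) :=
    abs_sum_fin_le fun p => by
      rw [abs_mul]
      exact mul_le_mul (h.abs_di_le ht hi' hf p) (hL p) (abs_nonneg _) (by positivity)
  have b2 : ∀ k ∈ M.Λ, |h.a k i t x *
        (h.dk i k f t x * (∑ p, h.Y i (CF.pd p (M.cell k)) t x * L p) -
          (∑ p, h.Y i (CF.pd p (M.cell k)) t x * h.di i p f t x) * ∑ p, k p * L p)| ≤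
      K * (B * (3 * (cG N K * S)) * (3 * (B * L0)) + 3 * (B * (3 * (cG N K * S))) * (B * L0)) := by
    intro k hk
    obtain ⟨c1, c2, c3⟩ := hB k hk
    have c2' : ∀ p, |h.Y i (CF.pd p (M.cell k)) t x| ≤ B := fun p => c2 p _
    rw [abs_mul]
    have d1 : |h.dk i k f t x| ≤ B * (3 * (cG N K * S)) := (h.abs_dk_le ht hi' hf k).trans (by gcongr)
    have d2 : |∑ p, h.Y i (CF.pd p (M.cell k)) t x * L p| ≤ 3 * (B * L0) := abs_sum_fin_le fun p => by
      rw [abs_mul]; exact mul_le_mul (c2' p) (hL p) (abs_nonneg _) hB0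
    have d3 : |∑ p, h.Y i (CF.pd p (M.cell k)) t x * h.di i p f t x| ≤ 3 * (B * (3 * (cG N K * S))) :=
      abs_sum_fin_le fun p => by
        rw [abs_mul]; exact mul_le_mul (c2' p) (h.abs_di_le ht hi' hf p) (abs_nonneg _) hB0
    have d4 : |∑ p, k p * L p| ≤ B * L0 := by
      refine (Finset.abs_sum_le_sum_abs _ _).trans ?_
      refine le_trans ?_ (mul_le_mul_of_nonneg_right c3 hL00)
      rw [Finset.sum_mul]
      refine Finset.sum_le_sum fun p _ => ?_
      rw [abs_mul]
      exact mul_le_mul_of_nonneg_left (hL p) (abs_nonneg _)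
    refine mul_le_mul (h.bd_a ht hi k).1.abs_le ((abs_sub _ _).trans ?_) (abs_nonneg _) hK.le
    rw [abs_mul, abs_mul]
    exact add_le_add (mul_le_mul d1 d2 (abs_nonneg _) (by positivity))
      (mul_le_mul d3 d4 (abs_nonneg _) (by positivity))
  have b3 := (Finset.abs_sum_le_sum_abs _ _).trans (Finset.sum_le_card_nsmul _ _ _ b2)
  rw [nsmul_eq_mul] at b3
  have b4 := h.abs_q_le i t x
  rw [abs_mul, abs_of_pos hκ]
  calc _ ≤ d.kappa * (3 * (3 * (cG N K * S) * L0) + h.Q t x * (M.Λ.card * (K * (B * (3 * (cG N K * S)) *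
        (3 * (B * L0)) + 3 * (B * (3 * (cG N K * S))) * (B * L0))))) := by
        refine mul_le_mul_of_nonneg_left ((abs_add_le _ _).trans (add_le_add b1 ?_)) hκ.le
        rw [abs_mul]
        exact mul_le_mul b4 b3 (abs_nonneg _) (by linarith)
    _ ≤ d.kappa * (h.Q t x * (3 * (3 * (cG N K * S) * L0)) + h.Q t x * (M.Λ.card * (K * (B *
        (3 * (cG N K * S)) * (3 * (B * L0)) + 3 * (B * (3 * (cG N K * S))) * (B * L0))))) := by
        refine mul_le_mul_of_nonneg_left (add_le_add (le_mul_of_one_le_left (by positivity) hQ) le_rfl)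
          hκ.le
    _ = _ := by ring

/-- The form costs `κ Q`, since `q ≤ Q`, and the factor `R` in the bound on `L` turns this into `κ
ν`. -/
theorem abs_quadratic_le {i : Fin n} {t : ℝ} {x : E3} (hg : h.Good t x) (hi : h.η i t x ≠ 0) {B : ℝ}
    (hB0 : 0 ≤ B) (hB : ∀ k ∈ M.Λ,
      (∀ ξ, |M.cell k ξ| ≤ B) ∧ (∀ p ξ, |CF.pd p (M.cell k) ξ| ≤ B) ∧ ∑ p, |k p| ≤ B) (f : PF) {r : PF} {m : ℕ}
    {L : Fin 3 → ℝ} {A : ℝ} (hL : ∀ p, |L p| ≤ A * ((x0 d)⁻¹ * (h.R t x * Real.sqrt (h.esum r m t x)))) :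
    |d.kappa * ((∑ p, h.di i p f t x * L p) + h.q i t x * ∑ k ∈ M.Λ, h.a k i t x *
        (h.dk i k f t x * (∑ p, h.Y i (CF.pd p (M.cell k)) t x * L p) -
          (∑ p, h.Y i (CF.pd p (M.cell k)) t x * h.di i p f t x) * ∑ p, k p * L p))| ≤
      (9 * cG N K + M.Λ.card * (K * (18 * B ^ 2 * cG N K))) * A * (d.kappa * nu d * (x0 d)⁻¹) *
        (Real.sqrt (Sob f t x) * Real.sqrt (h.esum r m t x)) := by
  refine (h.abs_bilinear_le hg hi hB0 hB
    (fun l => (abs_dx_le_sqrt f l t x).trans (sqrt_Gd_le f t x)) hL).trans_eq ?_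
  rw [← h.Q_mul_R t x]; ring

omit h in
theorem negl_fluxLow (hN : 1 ≤ N) (hK : 0 ≤ K) :
    Negl M N K fun {_} {_} h r f t => I t (h.fluxLow r f) := by
  obtain ⟨B, hB0, hB⟩ := M.exists_bound
  have hG : 0 ≤ cG N K := by rw [cG]; positivity
  have hD : 0 ≤ cD N K := by rw [cD, cG]; positivity
  refine negl_of_good (C := (9 * cG N K + M.Λ.card * (K * (18 * B ^ 2 * cG N K))) *
    (M.Λ.card * (B * (3 * (cG N K * (2 ^ N * (2 ^ N * (K * K * K) * (B * cD N K)))))))) (by positivity)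
    fun n d h r f _ t x hg => ?_
  have hκ := h.kappa_pos
  have hν := h.nu_pos
  have hx := h.x0_pos
  refine h.abs_sum_lives_le hg (by positivity) (fun i => ?_) fun i hi => ?_
  · have h1 := h.lives_lowW r i
    exact Lives.smul (Lives.add (Lives.sum fun p _ => (h1 p).mul_left _)
      ((h.lives_q i).mul_right _)) _
  · have hL := h.abs_lowC_le hN (r := r) hg hi (h.bd_q hN i (Ioo_subset_Icc_self hg.mem) x) hB0 hB
    rw [← mul_assoc d.lam⁻¹, h.lam_inv_mul_nu] at hL
    have := h.abs_quadratic_le hg hi hB0 hB f hL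
    simpa only [PF.smul_apply, PF.add_apply, PF.sum_apply, mul_apply, PF.sub_apply] using this

omit h in
-- Only one amplitude `q` occurs here. Of the two factors `R`, from the gradient of the solution and
-- from one more derivative, one compensates `Q` and the other is bounded by `ν`.
theorem negl_fluxGrad (hN : 1 ≤ N) (hK : 0 ≤ K) {k : E3} (hk : k ∈ M.Λ) (p : Fin 3) :
    Negl M N K fun {_} {_} h r f t => I t (h.fluxGrad r f k p) := by
  have hD : 0 ≤ cD N K := by rw [cD, cG]; positivity
  refine negl_transport k (CF.pd p (M.cell k)) (CF.mean_pd M.P_pos _ _)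
    (by rw [CF.kd_pd, M.kd_cell hk, map_zero])
    (b := fun {_} {d} h r i => d.kappa • (h.q i * h.a k i * h.di i p r))
    (c := 2 ^ N * (2 ^ N * (K * K * K) * cD N K)) (by positivity) (fun n d h r i =>
    (((h.lives_q i).mul_right _).mul_right _).smul _) fun n d h r _ t x hg i hi l => ?_
  have ht := Ioo_subset_Icc_self hg.mem
  have hκ := h.kappa_pos
  have hν := h.nu_pos
  have hb := ((((h.bd_q hN i ht x).mul (h.bd_a ht hi k).1).mul
    (h.bd_di ht (hg.etat_ne hi) le_rfl (fun l => h.bd_dx_sol r N l t x) p)).smul d.kappa).abs_dx_le hN l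
  refine hb.trans ?_
  rw [abs_of_pos hκ]
  calc _ = 2 ^ N * (2 ^ N * (K * K * K) * cD N K) * (d.kappa * (h.Q t x * h.R t x) * h.R t x) *
        √(h.esum r (N + 1) t x) := by ring
    _ ≤ 2 ^ N * (2 ^ N * (K * K * K) * cD N K) * (d.kappa * (h.Q t x * h.R t x) * nu d) *
        √(h.esum r (N + 1) t x) := by
        have h1 := h.R_le_nu t x
        rw [h.Q_mul_R]
        gcongr
    _ = _ := by rw [h.Q_mul_R]; ring

omit h in
-- Two amplitudes give `Q²`, and the gradient of the solution and the additional derivative give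
-- `R²`, so that `κ Q² R² = κ ν²` exactly.
theorem negl_fluxSq (hN : 1 ≤ N) (hK : 0 ≤ K) {k : E3} (hk : k ∈ M.Λ) :
    Negl M N K fun {_} {_} h r f t => I t (h.fluxSq r f k) := by
  have hD : 0 ≤ cD N K := by rw [cD, cG]; positivity
  have hk0 : 0 ≤ ∑ p, |k p| := by positivity
  refine negl_transport k (M.gsq k - algebraMap ℝ (CF M.P) (M.cst k)) (CF.mean_gsq M k) (CF.kd_gsq hk)
    (b := fun {_} {d} h r i => d.kappa • (h.q i ^ 2 * h.a k i ^ 2 * h.dk i k r))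
    (c := 2 ^ N * (2 ^ N * (2 ^ N * (K * K * (K * K)) * (2 ^ N * (K * K))) * ((∑ p, |k p|) * cD N K)))
    (by positivity) (fun n d h r i => by
      rw [sq (h.q i)]
      exact ((((h.lives_q i).mul_right _).mul_right _).mul_right _).smul _)
      fun n d h r _ t x hg i hi l => ?_
  have ht := Ioo_subset_Icc_self hg.mem
  have hκ := h.kappa_pos
  have hq := h.bd_q hN i ht x
  have ha := (h.bd_a ht hi k).1
  have hb := ((((hq.mul hq).mul (ha.mul ha)).mul
    (h.bd_dk ht (hg.etat_ne hi) le_rfl (fun l => h.bd_dx_sol r N l t x) (k := k) le_rfl)).smul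
      d.kappa).abs_dx_le hN l
  rw [← sq, ← sq] at hb
  refine hb.trans (le_of_eq ?_)
  rw [abs_of_pos hκ, ← h.Q_mul_R t x]
  ring

omit h in
/-- The flux of the two-scale expansion is close to the homogenized flux. -/
theorem negl_flux (hN : 1 ≤ N) (hK : 0 ≤ K) :
    Negl M N K fun {_} {_} h r f t => I t (h.Qt f (r + h.W r) - h.Qb f r) := by
  refine ((((Negl.sum M.Λ fun k hk => Negl.sum Finset.univ fun p _ => negl_fluxGrad hN hK hk p).add
    (Negl.sum M.Λ fun k hk => negl_fluxSq hN hK hk)).add (negl_fluxLow hN hK))).congr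
    fun n d h r f t hr ht => ?_
  rw [h.I_eq_of_good (fun t x hg => h.flux_eq r f hg) ht]
  simp only [I_add, I_sum]

/-- The part of the amplitude that the regularization removes. -/
def qrem (i : Fin n) : PF := h.q i - h.qhat i

theorem lives_qrem (i : Fin n) : h.Lives i (h.qrem i) := (h.lives_q i).sub (h.lives_qhat i)

theorem Qt_apply_of_ne {t : ℝ} {x : E3} (hg : h.Good t x) {i : Fin n} (hi : h.η i t x ≠ 0) (f g : PF) :
    h.Qt f g t x = d.kappa * ((∑ p, h.di i p f t x * h.di i p g t x) + h.q i t x * ∑ k ∈ M.Λ,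
      h.a k i t x * (h.dk i k f t x * (∑ p, h.Y i (CF.pd p (M.cell k)) t x * h.di i p g t x) -
        (∑ p, h.Y i (CF.pd p (M.cell k)) t x * h.di i p f t x) * ∑ p, k p * h.di i p g t x)) := by
  have ht := Ioo_subset_Icc_self hg.mem
  have h3 : ∀ g k, h.dk i k g t x = ∑ p, k p * h.di i p g t x := fun g k => by
    rw [dk_apply, PF.sum_apply]; rfl
  rw [Qt_eq, PF.add_apply, Nf, PF.sum_apply, PF.sum_apply,
    Finset.sum_eq_single_of_mem i (Finset.mem_univ i) fun j _ hj => by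
      rw [PF.smul_apply, mul_apply, (hg.eqAt_etat hi hj.symm).eq]; simp,
    Finset.sum_eq_single_of_mem i (Finset.mem_univ i) fun j _ hj => by
      rw [PF.smul_apply, mul_apply, (h.lives_q j t x hg (hg.eqAt_eta hi hj.symm)).eq]; simp]
  simp only [PF.smul_apply, mul_apply, PF.sum_apply, PF.sub_apply, h.etat_eq_one ht hi, one_mul, h3]
  ring

theorem Qt_eq_zero {t : ℝ} {x : E3} (f : PF) {g : PF} (hz : EqAt t x g 0) : h.Qt f g t x = 0 := by
  have e1 : ∀ i p, h.di i p g t x = 0 := fun i p => by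
    rw [(h.di_congr i p hz).eq, map_zero]; rfl
  have e2 : ∀ i k, h.dk i k g t x = 0 := fun i k => by
    rw [(h.dk_congr i k hz).eq, map_zero]; rfl
  simp only [Qt_eq, Nf, PF.add_apply, PF.sum_apply, PF.smul_apply, mul_apply, PF.sub_apply, e1, e2]
  simp

/-- The pointwise size `β` of the coefficient is separated from the bound on its derivatives: it
governs the leading part, while the lower order part gains `x0⁻¹` in any case. For `qrem` one has `β
= 2 x0⁻¹`, so the whole gradient is small. -/
theorem abs_di_Wc_le (hN : 1 ≤ N) {c : Fin n → PF} (hcl : ∀ i, h.Lives i (c i)) (r : PF) {i : Fin n}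
    {t : ℝ} {x : E3} (hg : h.Good t x) (hi : h.η i t x ≠ 0) {C β : ℝ}
    (hc : Bd (h.R t x) t x N (C * h.Q t x) (c i)) (hβ : |c i t x| ≤ β) {B : ℝ} (hB0 : 0 ≤ B)
    (hB : ∀ k ∈ M.Λ,
      (∀ ξ, |M.cell k ξ| ≤ B) ∧ (∀ p ξ, |CF.pd p (M.cell k) ξ| ≤ B) ∧ ∑ p, |k p| ≤ B) (p : Fin 3) :
    |h.di i p (h.Wc c r) t x| ≤ (M.Λ.card * (K * (B * (3 * cG N K)) * B) * β +
      M.Λ.card * (B * (3 * (cG N K * (2 ^ N * (2 ^ N * (C * K) * (B * cD N K)))))) * (x0 d)⁻¹) *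
        (h.R t x * Real.sqrt (h.esum r (N + 1) t x)) := by
  have ht := Ioo_subset_Icc_self hg.mem
  have hG := h.cG_nonneg
  have hK := h.K_pos
  have b1 := h.abs_lowC_le hN (r := r) hg hi hc hB0 hB p
  rw [← mul_assoc d.lam⁻¹, h.lam_inv_mul_nu] at b1
  rw [h.di_Wc hcl r hg hi p, add_mul]
  refine (abs_add_le _ _).trans (add_le_add ?_ (b1.trans_eq (by ring)))
  have hβ0 : 0 ≤ β := (abs_nonneg _).trans hβ
  have hR := h.R_pos t x
  have b2 : ∀ k ∈ M.Λ, |h.am c r i k t x * h.Y i (CF.pd p (M.cell k)) t x| ≤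
      β * K * (B * (3 * (cG N K * (√(h.esum r (N + 1) t x) * h.R t x)))) * B := by
    intro k hk
    obtain ⟨c1, c2, c3⟩ := hB k hk
    have hd := h.abs_dk_le ht (hg.etat_ne hi) (fun l => (h.bd_dx_sol r N l t x).abs_le) k
    have ha := (h.bd_a ht hi k).1.abs_le
    have hY : |h.Y i (CF.pd p (M.cell k)) t x| ≤ B := c2 p _
    rw [am, mul_apply, mul_apply, abs_mul, abs_mul, abs_mul]
    gcongr
    exact hd.trans (by gcongr)
  have b3 := (Finset.abs_sum_le_sum_abs _ _).trans (Finset.sum_le_card_nsmul _ _ _ b2)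
  rw [nsmul_eq_mul] at b3
  exact b3.trans (le_of_eq (by ring))

omit h in
theorem exists_di_qrem_le (M : Mikado) (hN : 2 ≤ N) (hK : 1 ≤ K) :
    ∃ A, 0 ≤ A ∧ ∀ (n : ℕ) (d : Data n) (h : d.Assumptions M N K) (r : PF) (i : Fin n) (t : ℝ) (x : E3),
      h.Good t x → h.η i t x ≠ 0 → ∀ p, |h.di i p (h.Wc h.qrem r) t x| ≤
        A * ((x0 d)⁻¹ * (h.R t x * Real.sqrt (h.esum r (N + 1) t x))) := by
  obtain ⟨B, hB0, hB⟩ := M.exists_bound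
  obtain ⟨c, hc, hcq⟩ := exists_bd_qhat M hN hK
  have hK0 : 0 ≤ K := by linarith
  have hG : 0 ≤ cG N K := by rw [cG]; positivity
  have hD : 0 ≤ cD N K := by rw [cD]; positivity
  refine ⟨M.Λ.card * (K * (B * (3 * cG N K)) * B) * 2 + M.Λ.card * (B * (3 * (cG N K * (2 ^ N *
    (2 ^ N * ((K * K + c) * K) * (B * cD N K)))))), by positivity, fun n d h r i t x hg hi p => ?_⟩
  have hqr : Bd (h.R t x) t x N ((K * K + c) * h.Q t x) (h.qrem i) :=
    ((h.bd_q (by omega) i (Ioo_subset_Icc_self hg.mem) x).sub (hcq n d h i t x hg).1).mono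
      (h.R_pos t x).le (le_of_eq (by ring))
  exact (h.abs_di_Wc_le (by omega) h.lives_qrem r hg hi hqr
    (h.abs_q_sub_qhat_le i (Ioo_subset_Icc_self hg.mem) x) hB0 hB p).trans_eq (by ring)

omit h in
/-- The regularization of the amplitudes changes the flux by a small amount. -/
theorem negl_flux_qrem (hN : 2 ≤ N) (hK : 1 ≤ K) :
    Negl M N K fun {_} {_} h r f t => I t (h.Qt f (h.Wc h.qrem r)) := by
  obtain ⟨B, hB0, hB⟩ := M.exists_bound
  obtain ⟨A, hA, hAb⟩ := exists_di_qrem_le M hN hK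
  have hK0 : 0 ≤ K := by linarith
  have hG : 0 ≤ cG N K := by rw [cG]; positivity
  refine negl_of_good (C := (9 * cG N K + M.Λ.card * (K * (18 * B ^ 2 * cG N K))) * A)
    (by positivity) fun n d h r f _ t x hg => ?_
  have hκ := h.kappa_pos
  have hν := h.nu_pos
  have hx := h.x0_pos
  by_cases hi : ∃ i, h.η i t x ≠ 0
  · obtain ⟨i, hi⟩ := hi
    rw [h.Qt_apply_of_ne hg hi]
    exact h.abs_quadratic_le hg hi hB0 hB f (hAb n d h r i t x hg hi)
  · push Not at hi
    rw [h.Qt_eq_zero f (h.eqAt_Wc_zero h.lives_qrem r hg fun j => (hg.eta j).resolve_left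
      (not_not.2 (hi j))), abs_zero]
    positivity

/-! ### The advective derivative of the regularized corrector -/

omit h in
/-- The constant in the bounds on the advective derivative of the solution. -/
def cH (M : Mikado) (N : ℕ) (K : ℝ) : ℝ := 3 * (3 * (2 ^ N * cA M N K))

theorem cH_nonneg : 0 ≤ cH M N K := by
  have := h.cA_nonneg
  rw [cH]; positivity

variable {h} in
theorem IsHom.bd_Dt (hN : 1 ≤ N) {r : PF} (hr : h.IsHom r) {t : ℝ} {x : E3} (hg : h.Good t x) :
    Bd (h.R t x) t x (N - 1) (cH M N K * (d.tau⁻¹ * Real.sqrt (h.esum r (N + 1) t x))) (h.Dt r) := by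
  have hR := (h.R_pos t x).le
  refine Bd.congr ?_ (h.eqAt_of_forall hg.mem x hr).symm
  have h1 : ∀ l, Bd (h.R t x) t x N (3 * (2 ^ N * (cA M N K * h.kb t x *
      (√(h.esum r (N + 1) t x) * h.R t x)))) (∑ m, h.Ab l m * dx m r) := fun l =>
    Bd.sum_fin hR fun m => (h.bd_Ab hN hg l m).mul (h.bd_dx_sol r N m t x)
  obtain ⟨N', rfl⟩ : ∃ N', N = N' + 1 := ⟨N - 1, by omega⟩
  refine (Bd.sum_fin hR fun l => (h1 l).step l).mono hR (le_of_eq ?_)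
  rw [← h.kb_mul_R_sq t x, cH]
  ring

/-- The coefficients of the regularized corrector. -/
def cw (k : E3) (i : Fin n) : PF := d.lam⁻¹ • (h.qhat i * h.a k i)

theorem lives_cw (k : E3) (i : Fin n) : h.Lives i (h.cw k i) := ((h.lives_qhat i).mul_right _).smul _

/-- `D_t` commutes with `dk` and does not see the profiles. The term with `dk (D_t r)` would have
too many derivatives of `r`; `dk` is moved away by parts, at no cost in `λ` because `φ_k` is
constant along `k`. It lands on the coefficient or on the test function. -/
theorem I_mul_Dt_Wc (r f : PF) {t : ℝ} (ht : t ∈ Ioo 0 d.T) :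
    I t (f * h.Dt (h.Wc h.qhat r)) = ∑ k ∈ M.Λ, (I t (∑ i, f * h.Y i (M.cell k) *
      (h.Dt (h.cw k i) * h.dk i k r)) + (-I t (∑ i, f * h.Y i (M.cell k) *
        (h.dk i k (h.cw k i) * h.Dt r)) +
      -I t (∑ i, h.Y i (M.cell k) * (h.cw k i * h.Dt r) * h.dk i k f))) := by
  have e0 : I t (∑ k ∈ M.Λ, ∑ i, h.dk i k (f * h.Y i (M.cell k) * (h.cw k i * h.Dt r))) = 0 := by
    simp only [I_sum, I_dk, Finset.sum_const_zero]
  have e1 : ∀ k ∈ M.Λ, ∀ i, h.dk i k (h.Y i (M.cell k)) = 0 := fun k hk i => by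
    rw [dk_Y, M.kd_cell hk]
    have : h.Y i (0 : CF M.P) = 0 := rfl
    rw [this, mul_zero, smul_zero]
  have e2 : I t (f * h.Dt (h.Wc h.qhat r)) = I t (∑ k ∈ M.Λ, ∑ i, f * h.Y i (M.cell k) *
      (h.Dt (h.cw k i) * h.dk i k r + h.cw k i * h.dk i k (h.Dt r))) := by
    refine h.I_eq_of_good (fun t x hg => ?_) ht
    rw [Finset.sum_comm]
    by_cases hi : ∃ i, h.η i t x ≠ 0
    · obtain ⟨i, hi⟩ := hi
      rw [PF.sum_apply, Finset.sum_eq_single_of_mem i (Finset.mem_univ i) fun j _ hj => ?_]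
      · rw [mul_apply, h.Dt_Wc h.lives_qhat r hg hi]
        simp only [PF.smul_apply, PF.sum_apply, mul_apply, Finset.mul_sum, am, cw,
          Derivation.leibniz, Derivation.map_smul, smul_eq_mul, PF.add_apply]
        refine Finset.sum_congr rfl fun k _ => ?_
        rw [(h.eqAt_Dt_dk hg.mem (hg.etat_ne hi) k r).eq]
        ring
      · have hz := hg.eqAt_eta hi hj.symm
        rw [PF.sum_apply]
        refine Finset.sum_eq_zero fun k _ => ?_
        simp only [mul_apply, PF.add_apply, ((h.lives_cw k j).Dt t x hg hz).eq,
          (h.lives_cw k j t x hg hz).eq, PF.zero_apply]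
        ring
    · push Not at hi
      have hz : ∀ j, EqAt t x (h.η j) 0 := fun j => (hg.eta j).resolve_left (not_not.2 (hi j))
      rw [mul_apply, (h.Dt_congr (h.eqAt_Wc_zero h.lives_qhat r hg hz)).eq, map_zero, PF.sum_apply,
        Finset.sum_eq_zero fun j _ => ?_]
      · simp
      · rw [PF.sum_apply]
        refine Finset.sum_eq_zero fun k _ => ?_
        simp only [mul_apply, PF.add_apply, ((h.lives_cw k j).Dt t x hg (hz j)).eq,
          (h.lives_cw k j t x hg (hz j)).eq, PF.zero_apply]
        ring
  rw [e2, ← sub_zero (I t _), ← e0, ← I_sub, ← Finset.sum_sub_distrib, I_sum]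
  refine Finset.sum_congr rfl fun k hk => ?_
  rw [← I_neg, ← I_neg, ← I_add, ← I_add, ← Finset.sum_sub_distrib, ← Finset.sum_neg_distrib,
    ← Finset.sum_neg_distrib, ← Finset.sum_add_distrib, ← Finset.sum_add_distrib]
  congr 1
  refine Finset.sum_congr rfl fun i _ => ?_
  simp only [Derivation.leibniz, smul_eq_mul, e1 k hk i]
  ring

theorem bd_Dt_cw {c : ℝ} (hc : 0 ≤ c) {i : Fin n} {t : ℝ} {x : E3} (hg : h.Good t x) (hi : h.η i t x ≠ 0)
    (h1 : Bd (h.R t x) t x N (c * h.Q t x) (h.qhat i))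
    (h2 : Bd (h.R t x) t x N (c * (x0 d * h.Q t x * d.tau⁻¹)) (h.Dt (h.qhat i))) (k : E3) :
    Bd (h.R t x) t x N (2 * 2 ^ N * c * K * (d.lam⁻¹ * x0 d * h.Q t x * d.tau⁻¹)) (h.Dt (h.cw k i)) := by
  have ht := Ioo_subset_Icc_self hg.mem
  have hR := (h.R_pos t x).le
  have hl := inv_pos.2 h.lam_pos
  have hτ := inv_pos.2 h.tau_pos
  have hx := h.one_le_x0
  have hK := h.K_pos
  have hQ := h.one_le_Q t x
  obtain ⟨a1, a2⟩ := h.bd_a ht hi k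
  have e : h.Dt (h.cw k i) = d.lam⁻¹ • (h.qhat i * h.Dt (h.a k i) + h.a k i * h.Dt (h.qhat i)) := by
    rw [cw, Derivation.map_smul, Derivation.leibniz]; rfl
  rw [e]
  refine (((h1.mul a2).add (a1.mul h2)).smul _).mono hR ?_
  rw [abs_of_pos hl]
  calc _ = d.lam⁻¹ * (2 ^ N * (c * h.Q t x * (K * d.tau⁻¹)) * 1 +
        2 ^ N * (K * (c * (x0 d * h.Q t x * d.tau⁻¹)))) := by ring
    _ ≤ d.lam⁻¹ * (2 ^ N * (c * h.Q t x * (K * d.tau⁻¹)) * x0 d +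
        2 ^ N * (K * (c * (x0 d * h.Q t x * d.tau⁻¹)))) := by gcongr
    _ = _ := by ring

theorem bd_cw {c : ℝ} {i : Fin n} {t : ℝ} {x : E3} (hg : h.Good t x) (hi : h.η i t x ≠ 0)
    (h1 : Bd (h.R t x) t x N (c * h.Q t x) (h.qhat i)) (k : E3) :
    Bd (h.R t x) t x N (2 ^ N * c * K * (d.lam⁻¹ * h.Q t x)) (h.cw k i) := by
  have hl := inv_pos.2 h.lam_pos
  refine ((h1.mul (h.bd_a (Ioo_subset_Icc_self hg.mem) hi k).1).smul _).mono (h.R_pos t x).le ?_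
  rw [abs_of_pos hl]
  exact le_of_eq (by ring)

/-- The factor `λ⁻¹` alone gives `λ⁻¹ κ ν² = κ ν / x0`. The factor `x0^{-m}` is as good as `λ⁻¹` up
to a constant, which for `m = N` is the content of `lam_le`. -/
theorem osc_factor_le {m : ℕ} (hm : (x0 d)⁻¹ ^ m * d.lam ≤ K) :
    (d.lam⁻¹ + (x0 d)⁻¹ ^ m) * d.tau⁻¹ ≤ (1 + K) * (d.kappa * nu d * (x0 d)⁻¹) * 1 := by
  have hκ := h.kappa_pos
  have hν := h.nu_pos
  have hx := h.x0_pos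
  rw [← h.kappa_mul_nu_sq, mul_one]
  calc _ = d.kappa * nu d * (d.lam⁻¹ * nu d) + d.kappa * nu d * ((x0 d)⁻¹ ^ m * (nu d)) := by ring
    _ = d.kappa * nu d * (x0 d)⁻¹ + d.kappa * nu d * ((x0 d)⁻¹ * ((x0 d)⁻¹ ^ m * d.lam)) := by
        rw [h.lam_inv_mul_nu, ← h.x0_mul_nu]
        field_simp
    _ ≤ d.kappa * nu d * (x0 d)⁻¹ + d.kappa * nu d * ((x0 d)⁻¹ * K) := by gcongr
    _ = _ := by ring

theorem inv_x0_pow_mul_lam : (x0 d)⁻¹ ^ N * d.lam ≤ K := by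
  have hx := h.x0_pos
  rw [inv_pow, inv_mul_le_iff₀ (by positivity), mul_comm]
  exact h.lam_le

omit h in
/-- The advective derivative of the regularized corrector is negligible. -/
theorem negl_Dt_Wc (hN : 2 ≤ N) (hK : 1 ≤ K) :
    Negl M N K fun {_} {_} h r f t => I t (f * h.Dt (h.Wc h.qhat r)) := by
  obtain ⟨c, hc, hcq⟩ := exists_bd_qhat M hN hK
  have hK0 : 0 ≤ K := by linarith
  have hc0 : 0 ≤ c := by linarith
  have hD : 0 ≤ cD N K := by rw [cD, cG]; positivity
  -- The sign of `cH` is derived from an instance of the assumptions; without any instance the claim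
  -- is void.
  by_cases hne : ∃ (n : ℕ) (d : Data n), d.Assumptions M N K
  swap
  · exact ⟨0, le_rfl, fun n d h => (hne ⟨n, d, h⟩).elim⟩
  obtain ⟨n', d', h'⟩ := hne
  have hH : 0 ≤ cH M N K := h'.cH_nonneg
  refine (Negl.sum M.Λ (X := fun k {_} {_} h r f t => I t (∑ i, f * h.Y i (M.cell k) *
      (h.Dt (h.cw k i) * h.dk i k r)) + (-I t (∑ i, f * h.Y i (M.cell k) *
        (h.dk i k (h.cw k i) * h.Dt r)) +
      -I t (∑ i, h.Y i (M.cell k) * (h.cw k i * h.Dt r) * h.dk i k f))) fun k hk => ?_).congr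
    fun n d h r f t _ ht => h.I_mul_Dt_Wc r f ht
  have hk0 : 0 ≤ ∑ p, |k p| := by positivity
  refine Negl.add ?_ (Negl.add (Negl.neg ?_) (Negl.neg ?_))
  -- Derivative on the coefficient in time. The loss `x0` in `D_t qhat` uses up the prefactor, as
  -- `λ⁻¹ x0 Q R = 1`, so all `N` integrations by parts are needed.
  · set A : ℝ := 2 ^ N * (2 * 2 ^ N * c * K * ((∑ p, |k p|) * cD N K)) with hA
    have hA0 : 0 ≤ A := by positivity
    refine negl_osc hK0 le_rfl (M.cell k) (M.mean_cell hk)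
      (b := fun {_} {_} h r i => h.Dt (h.cw k i) * h.dk i k r) (β := fun d => A * d.tau⁻¹)
      (c := A * (1 + K)) (by positivity) (fun n d h r i => (h.lives_cw k i).Dt.mul_right _)
      (fun n d h => ?_) fun n d h r hr t x hg i hi => ?_
    · have := h.tau_pos
      refine ⟨by positivity, ?_⟩
      have := mul_le_mul_of_nonneg_left (h.osc_factor_le h.inv_x0_pow_mul_lam) hA0
      linarith
    · obtain ⟨b1, b2⟩ := hcq n d h i t x hg
      have b3 := (h.bd_Dt_cw hc0 hg hi b1 b2 k).mul (h.bd_dk (Ioo_subset_Icc_self hg.mem)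
        (hg.etat_ne hi) le_rfl (fun l => h.bd_dx_sol r N l t x) (k := k) le_rfl)
      refine (b3.mono_scale (h.R_pos t x).le (h.R_le_nu t x)).mono h.nu_pos.le (le_of_eq ?_)
      have e : d.lam⁻¹ * x0 d * (h.Q t x * h.R t x) = 1 := by
        rw [h.Q_mul_R, mul_assoc, h.x0_mul_nu]
        exact inv_mul_cancel₀ h.lam_pos.ne'
      calc _ = A * d.tau⁻¹ * √(h.esum r (N + 1) t x) * (d.lam⁻¹ * x0 d * (h.Q t x * h.R t x)) := by
            rw [hA]; ring
        _ = _ := by rw [e, mul_one]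
  -- Here `D_t r` and `dk` of the coefficient are bounded only up to order `N - 1`. The missing
  -- integration by parts is replaced by the factor `x0⁻¹ = λ⁻¹ Q R` in the amplitude.
  · set A : ℝ := 2 ^ (N - 1) * ((∑ p, |k p|) * (cD N K * (2 ^ N * c * K)) * cH M N K) with hA
    have hA0 : 0 ≤ A := by positivity
    refine negl_osc hK0 (Nat.sub_le N 1) (M.cell k) (M.mean_cell hk)
      (b := fun {_} {_} h r i => h.dk i k (h.cw k i) * h.Dt r)
      (β := fun d => A * ((x0 d)⁻¹ * d.tau⁻¹))
      (c := A * (1 + K)) (by positivity) (fun n d h r i => ((h.lives_cw k i).dk k).mul_right _)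
      (fun n d h => ?_) fun n d h r hr t x hg i hi => ?_
    · have hτ := h.tau_pos
      have hx := h.x0_pos
      have hl := inv_pos.2 h.lam_pos
      refine ⟨by positivity, ?_⟩
      have h1 := mul_le_mul_of_nonneg_left (h.osc_factor_le h.inv_x0_pow_mul_lam) hA0
      have h2 : (d.lam⁻¹ + (x0 d)⁻¹ ^ (N - 1)) * (x0 d)⁻¹ ≤ d.lam⁻¹ + (x0 d)⁻¹ ^ N := by
        have e : (x0 d)⁻¹ ^ N = (x0 d)⁻¹ ^ (N - 1) * (x0 d)⁻¹ := by
          rw [← pow_succ]; congr 1; omega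
        rw [add_mul, ← e]
        have := mul_le_of_le_one_right hl.le (inv_le_one_of_one_le₀ h.one_le_x0)
        linarith
      calc _ = A * ((d.lam⁻¹ + (x0 d)⁻¹ ^ (N - 1)) * (x0 d)⁻¹ * d.tau⁻¹) := by ring
        _ ≤ A * ((d.lam⁻¹ + (x0 d)⁻¹ ^ N) * d.tau⁻¹) := by gcongr
        _ ≤ _ := by linarith
    · obtain ⟨b1, b2⟩ := hcq n d h i t x hg
      have b4 := h.bd_dk (Ioo_subset_Icc_self hg.mem) (hg.etat_ne hi) (m := N - 1) (by omega)
        (fun l => ((h.bd_cw hg hi b1 k).of_le (m := N - 1 + 1) (by omega)).step l) (k := k) le_rfl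
      have b3 := b4.mul (hr.bd_Dt (by omega) hg)
      refine (b3.mono_scale (h.R_pos t x).le (h.R_le_nu t x)).mono h.nu_pos.le (le_of_eq ?_)
      rw [← h.lam_inv_mul_nu, ← h.Q_mul_R t x, hA]
      ring
  -- The test function is differentiated along `k`, so a single integration by parts suffices.
  · set A : ℝ := 2 ^ (N - 1) * (2 ^ N * c * K * cH M N K) with hA
    have hA0 : 0 ≤ A := by positivity
    refine negl_transport k (M.cell k) (M.mean_cell hk) (M.kd_cell hk)
      (b := fun {_} {_} h r i => h.cw k i * h.Dt r) (c := A) hA0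
      (fun n d h r i => (h.lives_cw k i).mul_right _) fun n d h r hr t x hg i hi l => ?_
    obtain ⟨b1, b2⟩ := hcq n d h i t x hg
    have hτ := h.tau_pos
    have b3 := (((h.bd_cw hg hi b1 k).of_le (m := N - 1) (by omega)).mul
      (hr.bd_Dt (by omega) hg)).abs_dx_le (by omega) l
    refine b3.trans ?_
    rw [h.kappa_mul_nu_sq]
    calc _ = A * (d.lam⁻¹ * (h.Q t x * h.R t x) * d.tau⁻¹) * √(h.esum r (N + 1) t x) := by
          rw [hA]; ring
      _ ≤ A * (1 * d.tau⁻¹) * √(h.esum r (N + 1) t x) := by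
          rw [h.Q_mul_R, h.lam_inv_mul_nu]
          have := inv_le_one_of_one_le₀ h.one_le_x0
          gcongr
      _ = _ := by rw [one_mul]

end Data.Assumptions

/-! ### Variance and energy balance of the two-scale error -/

namespace PF

theorem sq_I_le (f : PF) (t : ℝ) : I t f ^ 2 ≤ I t (f ^ 2) := by
  have h1 : 0 ≤ I t ((f - algebraMap ℝ PF (I t f)) ^ 2) := I_nonneg fun x => sq_nonneg _
  have h2 : (f - algebraMap ℝ PF (I t f)) ^ 2 =
      f ^ 2 - (2 * I t f) • f + algebraMap ℝ PF (I t f ^ 2) := by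
    rw [Algebra.smul_def, map_mul, map_pow]
    simp only [map_ofNat]
    ring
  rw [h2, I_add, I_sub, I_smul, I_algebraMap] at h1
  linarith

theorem Gd_sub_algebraMap (f : PF) (c : ℝ) : Gd (f - algebraMap ℝ PF c) = Gd f := by
  simp only [Gd, map_sub, Derivation.map_algebraMap, sub_zero]

/-- The constant is `5 = 1 + 4`, with `4` from the Poincaré inequality. -/
theorem I_Sob_centered_le (f : PF) (t : ℝ) :
    I t (Sob (f - algebraMap ℝ PF (I t f))) ≤ 5 * I t (Gd f) := by
  rw [Sob, I_add, Gd_sub_algebraMap]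
  have := poincare f t
  linarith

theorem Gd_add_le (f g : PF) (t : ℝ) (x : E3) : Gd (f + g) t x ≤ 2 * Gd f t x + 2 * Gd g t x := by
  simp only [Gd_apply, map_add, PF.add_apply, Finset.mul_sum, ← Finset.sum_add_distrib]
  exact Finset.sum_le_sum fun l _ => by nlinarith [sq_nonneg (dx l f t x - dx l g t x)]

theorem Gd_neg (f : PF) : Gd (-f) = Gd f := by
  simp only [Gd, map_neg]
  exact Finset.sum_congr rfl fun l _ => by ring

end PF

theorem sub_le_integral_of_hasDerivAt {T : ℝ} {V V' φ : ℝ → ℝ} (hφ : Continuous φ)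
    (hV : ∀ s, HasDerivAt V (V' s) s) (hd : ∀ t ∈ Ioo 0 T, V' t ≤ φ t) {t : ℝ} (ht : t ∈ Icc 0 T) :
    V t - V 0 ≤ ∫ s in (0:ℝ)..t, φ s :=
  intervalIntegral.sub_le_integral_of_hasDeriv_right_of_le ht.1
    (fun s _ => (hV s).continuousAt.continuousWithinAt)
    (fun s _ => (hV s).hasDerivWithinAt) (hφ.integrableOn_Icc)
    fun s hs => hd s ⟨hs.1, hs.2.trans_le ht.2⟩

namespace Data.Assumptions

open PF

variable {n : ℕ} {M : Mikado} {N : ℕ} {K : ℝ} {d : Data n} (h : d.Assumptions M N K)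
include h

/-- The weak form of the equation with the oscillating matrix. -/
def IsOsc (ρ : PF) : Prop := ∀ t ∈ Icc 0 d.T, ∀ f, I t (f * h.Dt ρ) = -I t (h.Qt f ρ)

variable {h} in
theorem IsHom.weak {r : PF} (hr : h.IsHom r) {t : ℝ} (ht : t ∈ Icc 0 d.T) (f : PF) :
    I t (f * h.Dt r) = -I t (h.Qb f r) := by
  have h1 : I t (f * h.Dt r) = I t (f * ∑ l, dx l (∑ m, h.Ab l m * dx m r)) :=
    I_congr fun x => by rw [mul_apply, mul_apply, hr t ht]
  rw [h1, Finset.mul_sum, I_sum]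
  simp only [I_mul_dx]
  rw [Finset.sum_neg_distrib, ← I_sum]
  congr 2
  simp only [Qb, Finset.mul_sum]
  exact Finset.sum_congr rfl fun l _ => Finset.sum_congr rfl fun m _ => by ring

theorem Qt_add_right (f g g' : PF) : h.Qt f (g + g') = h.Qt f g + h.Qt f g' := by
  simp only [Qt_eq, Nf, map_add, mul_add, Finset.sum_add_distrib, smul_add, mul_sub,
    Finset.sum_sub_distrib, smul_sub]
  abel

theorem Qt_sub_right (f g g' : PF) : h.Qt f (g - g') = h.Qt f g - h.Qt f g' := by
  rw [eq_sub_iff_add_eq, ← Qt_add_right, sub_add_cancel]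

theorem Qt_algebraMap_right (f : PF) (c : ℝ) : h.Qt f (algebraMap ℝ PF c) = 0 := by
  simp [Qt_eq, Nf]

theorem Qt_sub_algebraMap_left (f g : PF) (c : ℝ) : h.Qt (f - algebraMap ℝ PF c) g = h.Qt f g := by
  simp only [Qt_eq, Nf, map_sub, Derivation.map_algebraMap, sub_zero]

theorem Qb_sub_algebraMap_left (f g : PF) (c : ℝ) : h.Qb (f - algebraMap ℝ PF c) g = h.Qb f g := by
  simp only [Qb, map_sub, Derivation.map_algebraMap, sub_zero]

/-- The oscillating part of the matrix is antisymmetric and contributes no energy. -/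
theorem Qt_self (f : PF) : h.Qt f f = h.Nf f f := by
  rw [Qt_eq, add_eq_left]
  refine Finset.sum_eq_zero fun i _ => ?_
  rw [Finset.sum_eq_zero fun k _ => ?_, mul_zero, smul_zero]
  rw [mul_comm (h.dk i k f), sub_self, mul_zero]

theorem Wc_sub (c c' : Fin n → PF) (r : PF) :
    h.Wc (fun i => c i - c' i) r = h.Wc c r - h.Wc c' r := by
  simp only [Wc, am, sub_mul, mul_sub, Finset.sum_sub_distrib, smul_sub]

theorem I_mul_Dt {t : ℝ} (ht : t ∈ Icc 0 d.T) (f : PF) : I t (f * dt f) = I t (f * h.Dt f) := by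
  have h1 := h.I_Dt ht (f ^ 2)
  have e : ∀ D : Derivation ℝ PF PF, D (f ^ 2) = (2:ℝ) • (f * D f) := fun D => by
    rw [sq, Derivation.leibniz, smul_eq_mul, two_smul]
  rw [e, e, I_smul, I_smul] at h1
  linarith

/-- The balance of the variance of the regularized error. -/
theorem I_mul_Dt_error {ρ r : PF} (hρ : h.IsOsc ρ) (hr : h.IsHom r) {t : ℝ} (ht : t ∈ Icc 0 d.T)
    {f : PF} {c : ℝ} (hf : f = ρ - r - h.Wc h.qhat r - algebraMap ℝ PF c) :
    I t (f * h.Dt f) = -I t (h.Nf f f) + (-I t (h.Qt f (r + h.W r) - h.Qb f r) +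
      (I t (h.Qt f (h.Wc h.qrem r)) + -I t (f * h.Dt (h.Wc h.qhat r)))) := by
  have h1 : h.Dt f = h.Dt ρ - h.Dt r - h.Dt (h.Wc h.qhat r) := by
    rw [hf, map_sub, map_sub, map_sub, Derivation.map_algebraMap, sub_zero]
  -- The error `f` contains the regularized corrector, whose advective derivative is controlled, but
  -- the flux must be that of the full corrector to match the homogenized one; `qrem` accounts for
  -- the difference.
  have h2 : ρ = f + algebraMap ℝ PF c + (r + h.W r) - h.Wc h.qrem r := by
    have : h.Wc h.qrem r = h.W r - h.Wc h.qhat r := by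
      rw [W_eq, ← Wc_sub]; rfl
    rw [this, hf]; ring
  have h3 : h.Qt f ρ = h.Nf f f + h.Qt f (r + h.W r) - h.Qt f (h.Wc h.qrem r) := by
    conv_lhs => rw [h2]
    rw [Qt_sub_right, Qt_add_right, Qt_add_right, Qt_algebraMap_right, add_zero, Qt_self]
  rw [h1, mul_sub, mul_sub, I_sub, I_sub, hρ t ht, hr.weak ht, h3, I_sub, I_sub, I_add]
  ring

omit h in
theorem hasDerivAt_variance (g : PF) (t : ℝ) :
    HasDerivAt (fun s => I s (g ^ 2) - I s g ^ 2)
      (I t (dt (g ^ 2)) - 2 * I t g * I t (dt g)) t := by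
  have h1 := hasDerivAt_I (g ^ 2) t
  have h2 := (hasDerivAt_I g t).pow 2
  refine (h1.sub h2).congr_deriv ?_
  push_cast
  rw [pow_one]

/-- The variance is used in place of the norm because the negligible terms are paired with a full
Sobolev norm, and only for the centred error does the Poincaré inequality bound that norm by the
gradient. -/
theorem deriv_variance (g : PF) {t : ℝ} (ht : t ∈ Icc 0 d.T) :
    I t (dt (g ^ 2)) - 2 * I t g * I t (dt g) =
      2 * I t ((g - algebraMap ℝ PF (I t g)) * h.Dt (g - algebraMap ℝ PF (I t g))) := by
  rw [← h.I_mul_Dt ht]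
  have h1 : dt (g - algebraMap ℝ PF (I t g)) = dt g := by
    rw [map_sub, Derivation.map_algebraMap, sub_zero]
  have h2 : dt (g ^ 2) = (2:ℝ) • (g * dt g) := by
    rw [sq, Derivation.leibniz, smul_eq_mul, two_smul]
  rw [h1, h2, sub_mul, I_sub, I_smul, ← Algebra.smul_def, I_smul]
  ring

omit h in
-- Completion of the square `(g - a C b √5 z)²`, with `g` and `z` the roots of `G` and `e`; half of
-- the dissipation `2 k G / a` survives.
theorem absorb {k G a b e C : ℝ} (ha : 0 < a) (hk : 0 ≤ k) (hG : 0 ≤ G) (he : 0 ≤ e) :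
    2 * (-(k * G / a) + C * (k * b) * (Real.sqrt (5 * G) * Real.sqrt e)) ≤
      -(a⁻¹ * (k * G)) + 5 * a * C ^ 2 * ((k * b ^ 2) * e) := by
  have e1 := Real.sq_sqrt hG
  have e2 := Real.sq_sqrt he
  have e3 : Real.sqrt 5 ^ 2 = 5 := Real.sq_sqrt (by norm_num)
  rw [Real.sqrt_mul (by norm_num)]
  generalize Real.sqrt G = g at *
  generalize Real.sqrt e = z at *
  generalize Real.sqrt 5 = w at *
  subst e1 e2
  have h1 : 0 ≤ k * a⁻¹ * (g - a * C * b * w * z) ^ 2 := by positivity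
  have h2 : k * a⁻¹ * (g - a * C * b * w * z) ^ 2 = k * g ^ 2 / a - 2 * (C * (k * b) * (w * g * z)) +
      w ^ 2 * a * C ^ 2 * (k * b ^ 2 * z ^ 2) := by
    field_simp
    ring
  rw [e3] at h2
  rw [h2] at h1
  have h3 : a⁻¹ * (k * g ^ 2) = k * g ^ 2 / a := by field_simp
  rw [h3]
  linarith

/-- The corrector is of size `λ⁻¹ Q R = x0⁻¹` in the units of the first energy density. At this
point only the value of the amplitude matters, not its derivatives. -/
theorem abs_Wc_le {c : Fin n → PF} (hcl : ∀ i, h.Lives i (c i)) (r : PF) {t : ℝ} {x : E3}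
    (hg : h.Good t x) {C : ℝ} (hC : 0 ≤ C) (hc : ∀ i, h.η i t x ≠ 0 → |c i t x| ≤ C * h.Q t x) {B : ℝ}
    (hB0 : 0 ≤ B) (hB : ∀ k ∈ M.Λ,
      (∀ ξ, |M.cell k ξ| ≤ B) ∧ (∀ p ξ, |CF.pd p (M.cell k) ξ| ≤ B) ∧ ∑ p, |k p| ≤ B) :
    |h.Wc c r t x| ≤ M.Λ.card * (B * (C * K * (B * (3 * cG N K)))) *
      ((x0 d)⁻¹ * Real.sqrt (h.En r 1 t x)) := by
  have ht := Ioo_subset_Icc_self hg.mem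
  have hl := inv_pos.2 h.lam_pos
  have hK := h.K_pos
  have hG := h.cG_nonneg
  have hx := h.x0_pos
  have hQ := h.one_le_Q t x
  have hR := h.R_pos t x
  by_cases hi : ∃ i, h.η i t x ≠ 0
  · obtain ⟨i, hi⟩ := hi
    have b2 : ∀ k ∈ M.Λ, |(h.Y i (M.cell k) * h.am c r i k) t x| ≤
        B * (C * h.Q t x * K * (B * (3 * (cG N K * (√(h.En r 1 t x) * h.R t x))))) := by
      intro k hk
      obtain ⟨c1, c2, c3⟩ := hB k hk
      have he : h.esum r (0 + 1) t x = h.En r 1 t x := by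
        rw [esum_apply, zero_add, Finset.Icc_self, Finset.sum_singleton]
      have hd := h.abs_dk_le ht (hg.etat_ne hi) (fun l => (h.bd_dx_sol r 0 l t x).abs_le) k
      rw [he] at hd
      have ha := (h.bd_a ht hi k).1.abs_le
      have hq := hc i hi
      have hY : |h.Y i (M.cell k) t x| ≤ B := c1 _
      rw [am, mul_apply, mul_apply, mul_apply, abs_mul, abs_mul, abs_mul]
      gcongr
      exact hd.trans (by gcongr)
    have b3 := (Finset.abs_sum_le_sum_abs _ _).trans (Finset.sum_le_card_nsmul _ _ _ b2)
    rw [nsmul_eq_mul] at b3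
    rw [(h.eqAt_Wc hcl r hg hi).eq, PF.smul_apply, PF.sum_apply, abs_mul, abs_of_pos hl]
    refine (mul_le_mul_of_nonneg_left b3 hl.le).trans (le_of_eq ?_)
    rw [← h.lam_inv_mul_nu, ← h.Q_mul_R t x]
    ring
  · push Not at hi
    rw [(h.eqAt_Wc_zero hcl r hg fun j => (hg.eta j).resolve_left (not_not.2 (hi j))).eq,
      PF.zero_apply, abs_zero]
    positivity

theorem I_Wc_sq_le {c : Fin n → PF} {r : PF} {A : ℝ}
    (hc : ∀ t x, h.Good t x → |h.Wc c r t x| ≤ A * ((x0 d)⁻¹ * Real.sqrt (h.En r 1 t x))) {t : ℝ}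
    (ht : t ∈ Icc 0 d.T) : I t (h.Wc c r ^ 2) ≤ A ^ 2 * ((x0 d ^ 2)⁻¹ * I t (h.En r 1)) := by
  rw [← I_smul, ← I_smul]
  refine h.I_le_of_good' (fun t x hg => ?_) ht
  have h1 := hc t x hg
  rw [pow_apply, ← sq_abs, PF.smul_apply, PF.smul_apply]
  calc |h.Wc c r t x| ^ 2 ≤ (A * ((x0 d)⁻¹ * Real.sqrt (h.En r 1 t x))) ^ 2 := by gcongr
    _ = _ := by
      rw [mul_pow, mul_pow, Real.sq_sqrt (h.En_nonneg _ _ _ _), inv_pow]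

end Data.Assumptions

namespace PF

theorem I_sq_add_le (f g : PF) (t : ℝ) : I t ((f + g) ^ 2) ≤ 2 * I t (f ^ 2) + 2 * I t (g ^ 2) := by
  rw [← I_smul, ← I_smul, ← I_add]
  refine I_mono fun x => ?_
  simp only [PF.add_apply, pow_apply, PF.smul_apply]
  nlinarith [sq_nonneg (f t x - g t x)]

theorem I_Gd_add_le (f g : PF) (t : ℝ) : I t (Gd (f + g)) ≤ 2 * I t (Gd f) + 2 * I t (Gd g) := by
  rw [← I_smul, ← I_smul, ← I_add]
  refine I_mono fun x => ?_
  simp only [PF.add_apply, PF.smul_apply]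
  exact Gd_add_le f g t x

theorem I_sq_nonneg (f : PF) (t : ℝ) : 0 ≤ I t (f ^ 2) :=
  I_nonneg fun x => by rw [pow_apply]; positivity

theorem I_Gd_nonneg (f : PF) (t : ℝ) : 0 ≤ I t (Gd f) := I_nonneg fun _ => Gd_nonneg _ _ _

end PF

namespace Data.Assumptions

open PF

variable {n : ℕ} {M : Mikado} {N : ℕ} {K : ℝ} {d : Data n} (h : d.Assumptions M N K)
include h

theorem I_esum_nonneg (r : PF) (j : ℕ) (t : ℝ) : 0 ≤ I t (h.esum r j) :=
  I_nonneg fun _ => h.esum_nonneg _ _ _ _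

theorem continuous_tau_inv_I (f : PF) : Continuous fun t => d.tau⁻¹ * I t f :=
  continuous_const.mul (continuous_I f)

omit h in
theorem exists_energy_bounds (M : Mikado) (hN : 1 ≤ N) (K : ℝ) : ∃ C, 0 ≤ C ∧
    ∀ (n : ℕ) (d : Data n) (h : d.Assumptions M N K) (ρin : E3 → ℝ) (r : PF), h.IsHom r →
      r 0 = ρin →
      (∫ t in (0:ℝ)..d.T, d.tau⁻¹ * I t (h.esum r (N + 1))) ≤ C * d.D ρin (fun t x => r t x) N ∧
      ∀ t ∈ Icc 0 d.T, I t (h.En r 1) ≤ C * d.D ρin (fun t x => r t x) N := by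
  obtain ⟨C, hC, H⟩ := exists_energy_bound M hN K
  refine ⟨(N + 1 : ℕ) * C, by positivity, fun n d h ρin r hr h0 => ⟨?_, fun t ht => ?_⟩⟩
  · have e : ∀ t, d.tau⁻¹ * I t (h.esum r (N + 1)) =
        ∑ j ∈ Finset.Icc 1 (N + 1), d.tau⁻¹ * I t (h.En r j) := fun t => by
      rw [esum, I_sum, Finset.mul_sum]
    simp only [e]
    rw [intervalIntegral.integral_finsetSum
      fun i _ => (h.continuous_tau_inv_I (h.En r i)).intervalIntegrable _ _]
    refine (Finset.sum_le_card_nsmul _ _ _ fun j hj =>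
      (H n d h ρin r hr h0).1 j (Finset.mem_Icc.1 hj).1 (Finset.mem_Icc.1 hj).2).trans_eq ?_
    rw [Nat.card_Icc, nsmul_eq_mul, mul_assoc]
    simp
  · have h1 := (H n d h ρin r hr h0).2 1 le_rfl hN t ht
    have h2 : 0 ≤ C * d.D ρin (fun t x => r t x) N :=
      mul_nonneg (by linarith) (h.D_nonneg ρin r)
    have h3 : (1:ℝ) ≤ (N + 1 : ℕ) := by exact_mod_cast Nat.le_add_left 1 N
    rw [mul_assoc]
    nlinarith

variable {h} in
-- Both equations conserve the mean: the weak forms vanish on the test function one.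
theorem IsOsc.I_sub_eq_zero {ρ r : PF} (hρ : h.IsOsc ρ) (hr : h.IsHom r) (h0 : ρ 0 = r 0) {t : ℝ}
    (ht : t ∈ Icc 0 d.T) : I t (ρ - r) = 0 := by
  have hd : ∀ s ∈ Ioo 0 d.T, I s (dt (ρ - r)) = 0 := fun s hs => by
    have hs' := Ioo_subset_Icc_self hs
    have h1 := hρ s hs' 1
    have h2 := hr.weak hs' 1
    have e1 : h.Qt 1 ρ = 0 := by simp [Qt_eq, Nf]
    have e2 : h.Qb 1 r = 0 := by simp [Qb]
    rw [one_mul, e1, I_zero, neg_zero] at h1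
    rw [one_mul, e2, I_zero, neg_zero] at h2
    rw [← h.I_Dt hs', map_sub, I_sub, h1, h2, sub_zero]
  have hz : I 0 (ρ - r) = 0 := by
    rw [I_sub, sub_eq_zero]
    show ∫ x in cube 1, ρ 0 x = ∫ x in cube 1, r 0 x
    rw [h0]
  have h1 := I_sub_le_integral (f := ρ - r) (φ := fun _ => 0) continuous_const
    (fun s hs => (hd s hs).le) ht
  have h2 := I_sub_le_integral (f := -(ρ - r)) (φ := fun _ => 0) continuous_const
    (fun s hs => by rw [map_neg, I_neg, hd s hs, neg_zero]) ht
  simp only [I_neg, hz, intervalIntegral.integral_zero] at h1 h2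
  linarith

omit h in
theorem exists_abs_Wc_le (M : Mikado) (hN : 2 ≤ N) (hK : 1 ≤ K) :
    ∃ A, 0 ≤ A ∧ ∀ (n : ℕ) (d : Data n) (h : d.Assumptions M N K) (r : PF) (t : ℝ) (x : E3),
      h.Good t x → |h.Wc h.qhat r t x| ≤ A * ((x0 d)⁻¹ * Real.sqrt (h.En r 1 t x)) ∧
      |h.W r t x| ≤ A * ((x0 d)⁻¹ * Real.sqrt (h.En r 1 t x)) := by
  obtain ⟨B, hB0, hB⟩ := M.exists_bound
  obtain ⟨c, hc, hcq⟩ := exists_bd_qhat M hN hK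
  have hK0 : 0 ≤ K := by linarith
  have hG : 0 ≤ cG N K := by rw [cG]; positivity
  refine ⟨M.Λ.card * (B * (c * K * (B * (3 * cG N K)))), by positivity, fun n d h r t x hg => ⟨?_, ?_⟩⟩
  · exact h.abs_Wc_le h.lives_qhat r hg (by linarith) (fun i _ => (hcq n d h i t x hg).1.abs_le) hB0 hB
  · rw [W_eq]
    have hQ := h.one_le_Q t x
    exact h.abs_Wc_le h.lives_q r hg (by linarith)
      (fun i _ => (h.abs_q_le i t x).trans (by nlinarith)) hB0 hB

theorem kappa_I_Gd_Wc_le {c : Fin n → PF} (hcl : ∀ i, h.Lives i (c i)) {r : PF} {β : ℝ}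
    (hβ : ∀ i t x, h.Good t x → h.η i t x ≠ 0 → ∀ p,
      |h.di i p (h.Wc c r) t x| ≤ β * (nu d * Real.sqrt (h.esum r (N + 1) t x))) {t : ℝ}
    (ht : t ∈ Icc 0 d.T) :
    d.kappa * I t (Gd (h.Wc c r)) ≤ 27 * (K * K) * β ^ 2 * (d.tau⁻¹ * I t (h.esum r (N + 1))) := by
  rw [← I_smul, ← I_smul, ← I_smul]
  refine h.I_le_of_good' (fun t x hg => ?_) ht
  have he := h.esum_nonneg r (N + 1) t x
  have hκ := h.kappa_pos
  have hK := h.K_pos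
  have hτ := h.tau_pos
  simp only [PF.smul_apply]
  by_cases hi : ∃ i, h.η i t x ≠ 0
  · obtain ⟨i, hi⟩ := hi
    have h1 := h.Gd_le_di (Ioo_subset_Icc_self hg.mem) (hg.etat_ne hi) (h.Wc c r)
    have h2 : ∑ p, h.di i p (h.Wc c r) t x ^ 2 ≤
        3 * (β ^ 2 * (nu d ^ 2 * h.esum r (N + 1) t x)) := by
      refine (Finset.sum_le_card_nsmul _ _ (β ^ 2 * (nu d ^ 2 * h.esum r (N + 1) t x))
        fun p _ => ?_).trans_eq (by simp)
      have h3 := hβ i t x hg hi p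
      calc _ = |h.di i p (h.Wc c r) t x| ^ 2 := (sq_abs _).symm
        _ ≤ (β * (nu d * Real.sqrt (h.esum r (N + 1) t x))) ^ 2 := by gcongr
        _ = _ := by rw [mul_pow, mul_pow, Real.sq_sqrt he]
    calc _ ≤ d.kappa * (9 * (K * K) * (3 * (β ^ 2 * (nu d ^ 2 * h.esum r (N + 1) t x)))) := by
          gcongr
          exact h1.trans (by gcongr)
      _ = _ := by rw [← h.kappa_mul_nu_sq]; ring
  · push Not at hi
    have hz := h.eqAt_Wc_zero hcl r hg fun j => (hg.eta j).resolve_left (not_not.2 (hi j))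
    have : Gd (h.Wc c r) t x = 0 := by
      rw [Gd_apply]
      refine Finset.sum_eq_zero fun l _ => ?_
      rw [(hz.dxD l).eq, map_zero, PF.zero_apply]
      norm_num
    rw [this, mul_zero]
    positivity

omit h in
theorem exists_kappa_I_Gd_le (M : Mikado) (hN : 2 ≤ N) (hK : 1 ≤ K) :
    ∃ A, 0 ≤ A ∧ ∀ (n : ℕ) (d : Data n) (h : d.Assumptions M N K) (r : PF) (t : ℝ), t ∈ Icc 0 d.T →
      d.kappa * I t (Gd (h.Wc h.qrem r)) ≤
        A * ((x0 d ^ 2)⁻¹ * (d.tau⁻¹ * I t (h.esum r (N + 1)))) ∧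
      d.kappa * I t (Gd (h.W r)) ≤ A * (d.tau⁻¹ * I t (h.esum r (N + 1))) := by
  obtain ⟨B, hB0, hB⟩ := M.exists_bound
  obtain ⟨A, hA, H⟩ := exists_di_qrem_le M hN hK
  have hK0 : 0 ≤ K := by linarith
  have hG : 0 ≤ cG N K := by rw [cG]; positivity
  have hD : 0 ≤ cD N K := by rw [cD]; positivity
  set A' := M.Λ.card * (K * (B * (3 * cG N K)) * B) + M.Λ.card * (B * (3 * (cG N K * (2 ^ N *
    (2 ^ N * (K * K * K) * (B * cD N K))))))
  have hA' : 0 ≤ A' := by positivity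
  refine ⟨27 * (K * K) * (A + A') ^ 2, by positivity, fun n d h r t ht => ⟨?_, ?_⟩⟩
  · have he := h.I_esum_nonneg r (N + 1) t
    have hτ := h.tau_pos
    refine (h.kappa_I_Gd_Wc_le h.lives_qrem (β := A * (x0 d)⁻¹) (fun i t x hg hi p =>
      (H n d h r i t x hg hi p).trans ?_) ht).trans ?_
    · rw [mul_assoc]
      have := h.R_le_nu t x
      have := h.x0_pos
      gcongr
    · rw [mul_pow, inv_pow, mul_assoc (27 * (K * K)), mul_assoc (27 * (K * K)), mul_assoc (A ^ 2)]
      have := h.x0_pos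
      gcongr
      linarith
  · have he := h.I_esum_nonneg r (N + 1) t
    have hτ := h.tau_pos
    rw [W_eq]
    refine (h.kappa_I_Gd_Wc_le h.lives_q (β := A') (fun i t x hg hi p =>
      (h.abs_di_Wc_le (by omega) h.lives_q r hg hi (h.bd_q (by omega) i (Ioo_subset_Icc_self hg.mem) x)
      (h.abs_q_le i t x) hB0 hB p).trans ?_) ht).trans ?_
    · have hR := h.R_pos t x
      rw [← h.Q_mul_R t x, show A' * (h.Q t x * h.R t x * √(h.esum r (N + 1) t x)) =
        A' * h.Q t x * (h.R t x * √(h.esum r (N + 1) t x)) by ring]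
      refine mul_le_mul_of_nonneg_right ?_ (by positivity)
      rw [add_mul]
      gcongr
      exact (inv_le_one_of_one_le₀ h.one_le_x0).trans (h.one_le_Q t x)
    · gcongr
      linarith

end Data.Assumptions

theorem intervalIntegral_le_lin {F A B : ℝ → ℝ} (hF : Continuous F) (hA : Continuous A)
    (hB : Continuous B) {a b T : ℝ} (hT : 0 ≤ T) (hle : ∀ t ∈ Ioo 0 T, F t ≤ a * A t + b * B t) :
    ∫ t in (0:ℝ)..T, F t ≤ a * (∫ t in (0:ℝ)..T, A t) + b * ∫ t in (0:ℝ)..T, B t := by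
  have h1 := intervalIntegral.integral_mono_on_of_le_Ioo (μ := volume) (f := F)
    (g := fun t => -(-a * A t) + b * B t) hT (hF.intervalIntegrable _ _)
    ((by fun_prop : Continuous _).intervalIntegrable _ _) fun t ht => by
      rw [neg_mul, neg_neg]; exact hle t ht
  rwa [intervalIntegral_lin hA hB, neg_neg] at h1

namespace Data.Assumptions

open PF

variable {n : ℕ} {M : Mikado} {N : ℕ} {K : ℝ} {d : Data n} (h : d.Assumptions M N K)
include h

theorem I_Nf_ge {t : ℝ} (ht : t ∈ Icc 0 d.T) (f : PF) :
    d.kappa * I t (Gd f) / (9 * (K * K)) ≤ I t (h.Nf f f) := by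
  have hK := h.K_pos
  rw [div_le_iff₀ (by positivity), mul_comm (I t _), ← I_smul, ← I_smul]
  exact I_mono fun x => h.kappa_Gd_le_Nf ht x f

omit h in
theorem pair_centered_le (g e : PF) (t : ℝ) :
    pair (g - algebraMap ℝ PF (I t g)) e t ≤ Real.sqrt (5 * I t (Gd g)) * Real.sqrt (I t e) :=
  mul_le_mul_of_nonneg_right (Real.sqrt_le_sqrt (I_Sob_centered_le g t)) (Real.sqrt_nonneg _)

omit h in
-- In the derivative of the variance the form `Nf` is coercive and the three other terms are
-- negligible, so `absorb` leaves a source `x0⁻² τ⁻¹ e`, whose time integral is bounded by `D`. The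
-- mean of the error is estimated separately at the end.
theorem exists_error_bound (M : Mikado) (hN : 2 ≤ N) (hK : 1 ≤ K) : ∃ C, 0 ≤ C ∧
    ∀ (n : ℕ) (d : Data n) (h : d.Assumptions M N K) (ρin : E3 → ℝ) (ρ r : PF), h.IsOsc ρ →
      h.IsHom r → ρ 0 = ρin → r 0 = ρin →
      (∀ t ∈ Icc 0 d.T, I t ((ρ - r - h.Wc h.qhat r) ^ 2) ≤
        C * ((x0 d ^ 2)⁻¹ * d.D ρin (fun t x => r t x) N)) ∧
      d.kappa * (∫ t in (0:ℝ)..d.T, I t (Gd (ρ - r - h.Wc h.qhat r))) ≤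
        C * ((x0 d ^ 2)⁻¹ * d.D ρin (fun t x => r t x) N) := by
  obtain ⟨C1, hC1, H1⟩ := (negl_flux (M := M) (N := N) (K := K) (by omega) (by linarith)).neg.add
    ((negl_flux_qrem hN hK).add (negl_Dt_Wc hN hK).neg)
  obtain ⟨CE, hCE, HE⟩ := exists_energy_bounds M (N := N) (by omega) K
  obtain ⟨A, hA, HA⟩ := exists_abs_Wc_le M hN hK
  have hK0 : 0 < K := by linarith
  set a := 9 * (K * K) with ha_def
  have ha : 0 < a := by positivity
  refine ⟨(1 + a) * (A ^ 2 * CE + 5 * a * C1 ^ 2 * CE) + A ^ 2 * CE, by positivity,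
    fun n d h ρin ρ r hρ hr hρ0 hr0 => ?_⟩
  obtain ⟨E1, E2⟩ := HE n d h ρin r hr hr0
  have hD0 := h.D_nonneg ρin r
  set D := d.D ρin (fun t x => r t x) N
  set w := h.Wc h.qhat r with hw
  set g := ρ - r - w with hg
  have hx := h.x0_pos
  have hκ := h.kappa_pos
  have hτ := h.tau_pos
  set X := (x0 d ^ 2)⁻¹ with hX
  have hX0 : 0 ≤ X := by positivity
  have hWsq : ∀ t ∈ Icc 0 d.T, I t (w ^ 2) ≤ A ^ 2 * CE * (X * D) := fun t ht => by
    refine (h.I_Wc_sq_le (fun t x hg => (HA n d h r t x hg).1) ht).trans ?_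
    calc _ ≤ A ^ 2 * (X * (CE * D)) := by gcongr; exact E2 t ht
      _ = _ := by ring
  have h00 : (0:ℝ) ∈ Icc 0 d.T := ⟨le_rfl, h.T_pos.le⟩
  set V : ℝ → ℝ := fun s => I s (g ^ 2) - I s g ^ 2 with hV
  have hVpos : ∀ t, 0 ≤ V t := fun t => sub_nonneg.2 (sq_I_le g t)
  -- The solutions agree initially, so the initial error is minus the corrector.
  have hV0 : V 0 ≤ A ^ 2 * CE * (X * D) := by
    refine le_trans ?_ (hWsq 0 h00)
    have : I 0 (g ^ 2) = I 0 (w ^ 2) := I_congr fun x => by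
      rw [pow_apply, pow_apply, hg, PF.sub_apply, PF.sub_apply, hρ0, hr0, sub_self, zero_sub, neg_sq]
    simp only [hV]
    rw [this]
    linarith [sq_nonneg (I 0 g)]
  have hcG := continuous_I (Gd g)
  have hce := h.continuous_tau_inv_I (h.esum r (N + 1))
  have key : ∀ t ∈ Icc 0 d.T, V t - V 0 ≤ ∫ s in (0:ℝ)..t,
      (-(a⁻¹ * (d.kappa * I s (Gd g))) +
        5 * a * C1 ^ 2 * X * (d.tau⁻¹ * I s (h.esum r (N + 1)))) := by
    refine fun t ht => sub_le_integral_of_hasDerivAt (by fun_prop) (hasDerivAt_variance g)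
      (fun s hs => ?_) ht
    have hs' := Ioo_subset_Icc_self hs
    rw [h.deriv_variance g hs', h.I_mul_Dt_error hρ hr hs' (c := I s g) rfl]
    have b1 := H1 n d h r (g - algebraMap ℝ PF (I s g)) s hr hs
    have b2 := h.I_Nf_ge hs' (g - algebraMap ℝ PF (I s g))
    rw [Gd_sub_algebraMap] at b2
    have b3 := pair_centered_le g (h.esum r (N + 1)) s
    have hν := h.nu_pos
    have b4 := absorb (b := nu d * (x0 d)⁻¹) (C := C1) ha hκ.le (I_Gd_nonneg g s)
      (h.I_esum_nonneg r (N + 1) s)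
    have b5 : C1 * (d.kappa * nu d * (x0 d)⁻¹) *
        pair (g - algebraMap ℝ PF (I s g)) (h.esum r (N + 1)) s ≤
        C1 * (d.kappa * (nu d * (x0 d)⁻¹)) *
          (Real.sqrt (5 * I s (Gd g)) * Real.sqrt (I s (h.esum r (N + 1)))) := by
      rw [mul_assoc d.kappa]
      gcongr
    have b6 : d.kappa * (nu d * (x0 d)⁻¹) ^ 2 = X * d.tau⁻¹ := by
      rw [mul_pow, ← mul_assoc, h.kappa_mul_nu_sq, inv_pow, mul_comm]
    have b7 := (abs_le.1 b1).2
    rw [b6] at b4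
    refine le_trans ?_ (b4.trans_eq (by ring))
    linarith
  have hint : ∀ t, ∫ s in (0:ℝ)..t, (-(a⁻¹ * (d.kappa * I s (Gd g))) +
        5 * a * C1 ^ 2 * X * (d.tau⁻¹ * I s (h.esum r (N + 1)))) =
      -a⁻¹ * (d.kappa * ∫ s in (0:ℝ)..t, I s (Gd g)) +
        5 * a * C1 ^ 2 * X * ∫ s in (0:ℝ)..t, d.tau⁻¹ * I s (h.esum r (N + 1)) := fun t => by
    rw [intervalIntegral_lin (A := fun s => d.kappa * I s (Gd g)) (continuous_const.mul hcG) hce,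
      intervalIntegral.integral_const_mul]
  have hmain : ∀ t ∈ Icc 0 d.T, V t + a⁻¹ * (d.kappa * ∫ s in (0:ℝ)..t, I s (Gd g)) ≤
      (A ^ 2 * CE + 5 * a * C1 ^ 2 * CE) * (X * D) := fun t ht => by
    have h1 := key t ht
    rw [hint] at h1
    have h2 := (intervalIntegral_mono_right hce ht fun s _ =>
      mul_nonneg (inv_pos.2 hτ).le (h.I_esum_nonneg r (N + 1) s)).trans E1
    have h3 : 5 * a * C1 ^ 2 * X * (∫ s in (0:ℝ)..t, d.tau⁻¹ * I s (h.esum r (N + 1))) ≤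
      5 * a * C1 ^ 2 * X * (CE * D) := by gcongr
    linarith
  have hP : 0 ≤ X * D := by positivity
  have hB : 0 ≤ (A ^ 2 * CE + 5 * a * C1 ^ 2 * CE) * (X * D) := by positivity
  have hA2 : 0 ≤ A ^ 2 * CE * (X * D) := by positivity
  constructor
  · intro t ht
    have h1 := hmain t ht
    have h2 : 0 ≤ a⁻¹ * (d.kappa * ∫ s in (0:ℝ)..t, I s (Gd g)) :=
      mul_nonneg (inv_pos.2 ha).le (mul_nonneg hκ.le
        (intervalIntegral.integral_nonneg ht.1 fun s _ => I_Gd_nonneg g s))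
    -- The mean of `ρ - r` is zero, so the mean of the error is minus that of the corrector.
    have h3 : I t g ^ 2 ≤ A ^ 2 * CE * (X * D) := by
      rw [hg, I_sub, hρ.I_sub_eq_zero hr (hρ0.trans hr0.symm) ht, zero_sub, neg_sq]
      exact (sq_I_le w t).trans (hWsq t ht)
    have h4 : I t (g ^ 2) = V t + I t g ^ 2 := by simp only [hV]; ring
    rw [h4, add_mul, mul_assoc (1 + a)]
    have h5 := mul_nonneg ha.le hB
    linarith
  · have h1 := hmain d.T ⟨h.T_pos.le, le_rfl⟩
    have h2 := hVpos d.T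
    have h3 : a⁻¹ * (d.kappa * ∫ s in (0:ℝ)..d.T, I s (Gd g)) ≤
      (A ^ 2 * CE + 5 * a * C1 ^ 2 * CE) * (X * D) := by linarith
    rw [inv_mul_le_iff₀ ha] at h3
    rw [add_mul, mul_assoc (1 + a)]
    linarith

omit h in
/-- The estimates for the two-scale expansion and for the difference of the solutions. -/
theorem exists_expansion_bound (M : Mikado) (hN : 2 ≤ N) (hK : 1 ≤ K) : ∃ C, 0 ≤ C ∧
    ∀ (n : ℕ) (d : Data n) (h : d.Assumptions M N K) (ρin : E3 → ℝ) (ρ r : PF), h.IsOsc ρ →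
      h.IsHom r → ρ 0 = ρin → r 0 = ρin →
      (∀ t ∈ Icc 0 d.T, I t ((ρ - r) ^ 2) ≤ C * ((x0 d ^ 2)⁻¹ * d.D ρin (fun t x => r t x) N)) ∧
      (∀ t ∈ Icc 0 d.T, I t ((ρ - r - h.W r) ^ 2) ≤
        C * ((x0 d ^ 2)⁻¹ * d.D ρin (fun t x => r t x) N)) ∧
      d.kappa * (∫ t in (0:ℝ)..d.T, I t (Gd (ρ - r - h.W r))) ≤
        C * ((x0 d ^ 2)⁻¹ * d.D ρin (fun t x => r t x) N) := by
  obtain ⟨C1, hC1, H1⟩ := exists_error_bound M hN hK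
  obtain ⟨CE, hCE, HE⟩ := exists_energy_bounds M (N := N) (by omega) K
  obtain ⟨A, hA, HA⟩ := exists_abs_Wc_le M hN hK
  obtain ⟨A', hA', HA'⟩ := exists_kappa_I_Gd_le M hN hK
  refine ⟨2 * (2 * C1 + 2 * (A ^ 2 * CE)) + 2 * (A ^ 2 * CE) + (2 * C1 + 2 * (A' * CE)), by positivity,
    fun n d h ρin ρ r hρ hr hρ0 hr0 => ?_⟩
  obtain ⟨E1, E2⟩ := HE n d h ρin r hr hr0
  obtain ⟨G1, G2⟩ := H1 n d h ρin ρ r hρ hr hρ0 hr0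
  have hD0 := h.D_nonneg ρin r
  set D := d.D ρin (fun t x => r t x) N
  have hx := h.x0_pos
  have hκ := h.kappa_pos
  set X := (x0 d ^ 2)⁻¹
  have hP : 0 ≤ X * D := by positivity
  have p1 : 0 ≤ C1 * (X * D) := by positivity
  have p2 : 0 ≤ A ^ 2 * CE * (X * D) := by positivity
  have p3 : 0 ≤ A' * CE * (X * D) := by positivity
  have hWsq : ∀ c, (∀ t x, h.Good t x → |h.Wc c r t x| ≤ A * ((x0 d)⁻¹ * Real.sqrt (h.En r 1 t x))) →
      ∀ t ∈ Icc 0 d.T, I t (h.Wc c r ^ 2) ≤ A ^ 2 * CE * (X * D) := fun c hc t ht => by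
    refine (h.I_Wc_sq_le hc ht).trans ?_
    calc _ ≤ A ^ 2 * (X * (CE * D)) := by gcongr; exact E2 t ht
      _ = _ := by ring
  have hsub : ∀ t ∈ Icc 0 d.T, I t ((ρ - r) ^ 2) ≤ 2 * (C1 * (X * D)) + 2 * (A ^ 2 * CE * (X * D)) :=
    fun t ht => by
      have h1 := I_sq_add_le (ρ - r - h.Wc h.qhat r) (h.Wc h.qhat r) t
      rw [sub_add_cancel] at h1
      have h2 := hWsq h.qhat (fun t x hg => (HA n d h r t x hg).1) t ht
      have h3 := G1 t ht
      linarith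
  refine ⟨fun t ht => ?_, fun t ht => ?_, ?_⟩
  · have := hsub t ht
    linarith
  · have h1 := I_sq_add_le (ρ - r) (-h.W r) t
    rw [← sub_eq_add_neg, show (-h.W r) ^ 2 = h.W r ^ 2 by ring] at h1
    have h2 := hWsq h.q (fun t x hg => by rw [← W_eq]; exact (HA n d h r t x hg).2) t ht
    have h3 := hsub t ht
    rw [← W_eq] at h2
    linarith
  · have e : ρ - r - h.W r = ρ - r - h.Wc h.qhat r + -h.Wc h.qrem r := by
      have : h.Wc h.qrem r = h.W r - h.Wc h.qhat r := by
        rw [W_eq, ← Wc_sub]; rfl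
      rw [this]; ring
    have h1 : ∀ t ∈ Icc 0 d.T, d.kappa * I t (Gd (ρ - r - h.W r)) ≤
        2 * (d.kappa * I t (Gd (ρ - r - h.Wc h.qhat r))) +
          2 * A' * X * (d.tau⁻¹ * I t (h.esum r (N + 1))) := fun t ht => by
      have h2 := I_Gd_add_le (ρ - r - h.Wc h.qhat r) (-h.Wc h.qrem r) t
      rw [Gd_neg, ← e] at h2
      have h3 := (HA' n d h r t ht).1
      have h4 := mul_le_mul_of_nonneg_left h2 hκ.le
      linarith
    have c2 : Continuous fun t => d.kappa * I t (Gd (ρ - r - h.Wc h.qhat r)) :=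
      continuous_const.mul (continuous_I _)
    have c1 : Continuous fun t => d.kappa * I t (Gd (ρ - r - h.W r)) :=
      continuous_const.mul (continuous_I _)
    have h2 := intervalIntegral_le_lin c1 c2
      (h.continuous_tau_inv_I (h.esum r (N + 1))) h.T_pos.le fun t ht =>
        h1 t (Ioo_subset_Icc_self ht)
    rw [intervalIntegral.integral_const_mul, intervalIntegral.integral_const_mul] at h2
    have h3 : 2 * A' * X * (∫ t in (0:ℝ)..d.T, d.tau⁻¹ * I t (h.esum r (N + 1))) ≤
        2 * A' * X * (CE * D) := by gcongr
    linarith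

theorem Qb_add_left (f f' g : PF) : h.Qb (f + f') g = h.Qb f g + h.Qb f' g := by
  simp only [Qb, map_add, mul_add, add_mul, Finset.sum_add_distrib]

/-- Young's inequality with a free weight `s`, since the two arguments will have very different
sizes. -/
theorem abs_Nf_add_sub_le {t : ℝ} (ht : t ∈ Icc 0 d.T) (x : E3) (v z : PF) {s : ℝ} (hs : 0 < s) :
    |h.Nf (v + z) (v + z) t x - h.Nf v v t x| ≤ s * h.Nf v v t x + (s⁻¹ + 1) * h.Nf z z t x := by
  have hw : ∀ i, 0 ≤ d.kappa * h.ηt i t x := fun i =>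
    mul_nonneg h.kappa_pos.le (h.etat_nonneg i t ht x)
  have key : ∀ a b : ℝ, |(a + b) ^ 2 - a ^ 2| ≤ s * a ^ 2 + (s⁻¹ + 1) * b ^ 2 := fun a b => by
    have e1 : s * a ^ 2 + s⁻¹ * b ^ 2 - 2 * (a * b) = s⁻¹ * (s * a - b) ^ 2 := by field_simp; ring
    have e2 : s * a ^ 2 + s⁻¹ * b ^ 2 + 2 * (a * b) = s⁻¹ * (s * a + b) ^ 2 := by field_simp; ring
    have p1 : 0 ≤ s⁻¹ * (s * a - b) ^ 2 := by positivity
    have p2 : 0 ≤ s⁻¹ * (s * a + b) ^ 2 := by positivity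
    rw [abs_le]
    constructor <;> nlinarith [sq_nonneg b]
  simp only [Nf_apply, map_add, PF.add_apply, Finset.mul_sum, ← Finset.sum_sub_distrib,
    ← Finset.sum_add_distrib]
  refine (Finset.abs_sum_le_sum_abs _ _).trans (Finset.sum_le_sum fun i _ =>
    (Finset.abs_sum_le_sum_abs _ _).trans (Finset.sum_le_sum fun p _ => ?_))
  have h1 := mul_le_mul_of_nonneg_left (key (h.di i p v t x) (h.di i p z t x)) (hw i)
  rw [← mul_assoc, ← mul_assoc, ← mul_sub, abs_mul, abs_of_nonneg (hw i)]
  linarith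

theorem kappa_I_Gd_le_I_esum (r : PF) (t : ℝ) :
    d.kappa * I t (Gd r) ≤ d.tau⁻¹ * I t (h.esum r (N + 1)) := by
  have hτ := h.tau_pos
  have h1 : d.kappa * I t (Gd r) ≤ d.tau⁻¹ * I t (h.En r 1) := by
    rw [h.tau_inv_En_one, ← I_smul]
    exact I_mono fun x => mul_le_mul_of_nonneg_right (h.kappa_le_kb t x) (Gd_nonneg _ _ _)
  refine h1.trans ?_
  gcongr
  exact I_mono fun x => h.En_le_esum r le_rfl (by omega) t x

omit h in
-- The flux estimate is tested with `v = r + W r`, centred. By antisymmetry `Qt v v = Nf v v`,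
-- whereas `Qb v r = Qb r r + Qb (W r) r`. The average of the last term is that of `-W r · D_t r`,
-- of order `x0⁻¹` because the corrector is.
theorem exists_energy_density_bound (M : Mikado) (hN : 2 ≤ N) (hK : 1 ≤ K) : ∃ C, 0 ≤ C ∧
    ∀ (n : ℕ) (d : Data n) (h : d.Assumptions M N K) (r : PF), h.IsHom r → ∀ t ∈ Ioo 0 d.T,
      I t (h.Nf (r + h.W r) (r + h.W r)) ≤ C * (d.tau⁻¹ * I t (h.esum r (N + 1))) ∧
      |I t (h.Nf (r + h.W r) (r + h.W r)) - I t (h.Qb r r)| ≤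
        C * ((x0 d)⁻¹ * (d.tau⁻¹ * I t (h.esum r (N + 1)))) := by
  obtain ⟨C1, hC1, H1⟩ := negl_flux (M := M) (N := N) (K := K) (by omega) (by linarith)
  obtain ⟨A, hA, HA⟩ := exists_abs_Wc_le M hN hK
  obtain ⟨A', hA', HA'⟩ := exists_kappa_I_Gd_le M hN hK
  have hK0 : 0 ≤ K := by linarith
  have hG : 0 ≤ cG N K := by rw [cG]; positivity
  refine ⟨9 * cG N K ^ 2 * (2 + 2 * A') + C1 * (5 * (2 + 2 * A') + 1) + A * |cH M N K|, by positivity,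
    fun n d h r hr t ht => ?_⟩
  have ht' := Ioo_subset_Icc_self ht
  have hx := h.x0_pos
  have hκ := h.kappa_pos
  have hτ := h.tau_pos
  have hν := h.nu_pos
  have hH := h.cH_nonneg
  rw [abs_of_nonneg hH]
  have hE0 := h.I_esum_nonneg r (N + 1) t
  set E := d.tau⁻¹ * I t (h.esum r (N + 1)) with hE
  have hEp : 0 ≤ E := by positivity
  set v := r + h.W r with hv
  have hGv : d.kappa * I t (Gd v) ≤ (2 + 2 * A') * E := by
    have h1 := mul_le_mul_of_nonneg_left (I_Gd_add_le r (h.W r) t) hκ.le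
    have h2 := h.kappa_I_Gd_le_I_esum r t
    have h3 := (HA' n d h r t ht').2
    linarith
  have p1 : 0 ≤ 9 * cG N K ^ 2 * (2 + 2 * A') * E := by positivity
  constructor
  · have h1 : I t (h.Nf v v) ≤ 9 * cG N K ^ 2 * (d.kappa * I t (Gd v)) := by
      rw [← I_smul, ← I_smul]
      exact I_mono fun x => h.Nf_le ht' x v
    have h2 : 0 ≤ (C1 * (5 * (2 + 2 * A') + 1) + A * cH M N K) * E := by positivity
    have h3 := mul_le_mul_of_nonneg_left hGv (by positivity : 0 ≤ 9 * cG N K ^ 2)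
    linarith
  · have e : I t (h.Nf v v) - I t (h.Qb r r) =
        I t (h.Qt (v - algebraMap ℝ PF (I t v)) v - h.Qb (v - algebraMap ℝ PF (I t v)) r) -
          I t (h.W r * h.Dt r) := by
      rw [Qt_sub_algebraMap_left, Qb_sub_algebraMap_left, hr.weak ht', I_sub, Qt_self, hv,
        Qb_add_left, I_add]
      ring
    have b1 : |I t (h.Qt (v - algebraMap ℝ PF (I t v)) v - h.Qb (v - algebraMap ℝ PF (I t v)) r)| ≤
        C1 * (5 * (2 + 2 * A') + 1) * ((x0 d)⁻¹ * E) := by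
      refine (H1 n d h r (v - algebraMap ℝ PF (I t v)) t hr ht).trans ?_
      have c1 := (pair_centered_le v (h.esum r (N + 1)) t).trans
        (mul_sqrt_le_half (inv_pos.2 hν) (mul_nonneg (by norm_num) (I_Gd_nonneg v t)) hE0)
      rw [inv_inv] at c1
      have c2 : d.kappa * nu d * pair (v - algebraMap ℝ PF (I t v)) (h.esum r (N + 1)) t ≤
          (5 * (2 + 2 * A') + 1) * E := by
        refine (mul_le_mul_of_nonneg_left c1 (by positivity)).trans ?_
        have c3 : d.kappa * nu d * (1 / 2 * ((nu d)⁻¹ * (5 * I t (Gd v)) +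
            nu d * I t (h.esum r (N + 1)))) = 5 / 2 * (d.kappa * I t (Gd v)) + 1 / 2 * E := by
          rw [hE, ← h.kappa_mul_nu_sq]
          field_simp
        rw [c3]
        have := mul_nonneg hA' hEp
        nlinarith
      calc _ = C1 * ((x0 d)⁻¹ * (d.kappa * nu d *
            pair (v - algebraMap ℝ PF (I t v)) (h.esum r (N + 1)) t)) := by ring
        _ ≤ C1 * ((x0 d)⁻¹ * ((5 * (2 + 2 * A') + 1) * E)) := by gcongr
        _ = _ := by ring
    have b2 : |I t (h.W r * h.Dt r)| ≤ A * cH M N K * ((x0 d)⁻¹ * E) := by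
      have c : ∀ f : PF, (∀ t x, h.Good t x →
          f t x ≤ A * cH M N K * ((x0 d)⁻¹ * (d.tau⁻¹ * h.esum r (N + 1) t x))) →
          I t f ≤ A * cH M N K * ((x0 d)⁻¹ * E) := fun f hf => by
        rw [hE, ← I_smul, ← I_smul, ← I_smul]
        exact h.I_le_of_good hf ht
      have c1 : ∀ t x, h.Good t x → |(h.W r * h.Dt r) t x| ≤
          A * cH M N K * ((x0 d)⁻¹ * (d.tau⁻¹ * h.esum r (N + 1) t x)) := fun t x hg => by
        have d1 := (HA n d h r t x hg).2
        have d2 := (hr.bd_Dt (by omega) hg).abs_le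
        have d3 := h.En_le_esum r le_rfl (by omega : 1 ≤ N + 1) t x
        have d4 := Real.mul_self_sqrt (h.esum_nonneg r (N + 1) t x)
        rw [mul_apply, abs_mul]
        calc _ ≤ A * ((x0 d)⁻¹ * Real.sqrt (h.esum r (N + 1) t x)) *
            (cH M N K * (d.tau⁻¹ * Real.sqrt (h.esum r (N + 1) t x))) :=
              mul_le_mul (d1.trans (by gcongr)) d2 (abs_nonneg _) (by positivity)
          _ = A * cH M N K * ((x0 d)⁻¹ * (d.tau⁻¹ *
            (Real.sqrt (h.esum r (N + 1) t x) * Real.sqrt (h.esum r (N + 1) t x)))) := by ring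
          _ = _ := by rw [d4]
      rw [abs_le]
      constructor
      · have := c (-(h.W r * h.Dt r)) fun t x hg => by
          rw [PF.neg_apply]; exact (neg_le_abs _).trans (c1 t x hg)
        rw [I_neg] at this
        linarith
      · exact c _ fun t x hg => (le_abs_self _).trans (c1 t x hg)
    rw [e]
    refine (abs_sub _ _).trans ?_
    have : 0 ≤ 9 * cG N K ^ 2 * (2 + 2 * A') * ((x0 d)⁻¹ * E) := by positivity
    linarith

theorem I_dt_sq {t : ℝ} (ht : t ∈ Icc 0 d.T) (f : PF) : I t (dt (f ^ 2)) = 2 * I t (f * h.Dt f) := by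
  rw [← h.I_mul_Dt ht, ← I_smul, sq, Derivation.leibniz, smul_eq_mul, two_smul]

omit h in
/-- The estimates for the differences of the energies and of the dissipated energies. -/
theorem exists_energy_difference_bound (M : Mikado) (hN : 2 ≤ N) (hK : 1 ≤ K) : ∃ C, 0 ≤ C ∧
    ∀ (n : ℕ) (d : Data n) (h : d.Assumptions M N K) (ρin : E3 → ℝ) (ρ r : PF), h.IsOsc ρ →
      h.IsHom r → ρ 0 = ρin → r 0 = ρin →
      (∀ t ∈ Icc 0 d.T, |I t (ρ ^ 2) - I t (r ^ 2)| ≤ C * ((x0 d)⁻¹ * d.D ρin (fun t x => r t x) N)) ∧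
      |(∫ t in (0:ℝ)..d.T, I t (h.Nf ρ ρ)) - ∫ t in (0:ℝ)..d.T, I t (h.Qb r r)| ≤
        C * ((x0 d)⁻¹ * d.D ρin (fun t x => r t x) N) := by
  obtain ⟨C1, hC1, H1⟩ := exists_expansion_bound M hN hK
  obtain ⟨C2, hC2, H2⟩ := exists_energy_density_bound M hN hK
  obtain ⟨CE, hCE, HE⟩ := exists_energy_bounds M (N := N) (by omega) K
  have hK0 : 0 ≤ K := by linarith
  have hG : 0 ≤ cG N K := by rw [cG]; positivity
  refine ⟨2 * (2 * C2 * CE + 18 * cG N K ^ 2 * C1), by positivity, fun n d h ρin ρ r hρ hr hρ0 hr0 => ?_⟩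
  have E1 := (HE n d h ρin r hr hr0).1
  have G1 := (H1 n d h ρin ρ r hρ hr hρ0 hr0).2.2
  have hD0 := h.D_nonneg ρin r
  set D := d.D ρin (fun t x => r t x) N
  have hx := h.x0_pos
  have hx1 := h.one_le_x0
  set v := r + h.W r with hv
  set z := ρ - r - h.W r with hz
  set δ : ℝ → ℝ := fun t => I t (h.Nf ρ ρ) - I t (h.Qb r r) with hδ
  have hc : Continuous δ := (continuous_I _).sub (continuous_I _)
  have cz : Continuous fun t => d.kappa * I t (Gd z) := continuous_const.mul (continuous_I _)
  -- The weight is `x0⁻¹`: the energy of `v` is of order one and is multiplied by `x0⁻¹`; that of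
  -- `z` is of order `x0⁻²` and is multiplied by at most `2 x0`.
  have b1 : ∀ t ∈ Ioo 0 d.T, |δ t| ≤ 2 * C2 * (x0 d)⁻¹ * (d.tau⁻¹ * I t (h.esum r (N + 1))) +
      18 * cG N K ^ 2 * x0 d * (d.kappa * I t (Gd z)) := fun t ht => by
    have ht' := Ioo_subset_Icc_self ht
    obtain ⟨e1, e2⟩ := H2 n d h r hr t ht
    have e3 : ρ = v + z := by rw [hv, hz]; ring
    have e4 : |I t (h.Nf ρ ρ) - I t (h.Nf v v)| ≤
        (x0 d)⁻¹ * I t (h.Nf v v) + (x0 d + 1) * I t (h.Nf z z) := by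
      have f1 : ∀ x, |(h.Nf ρ ρ - h.Nf v v) t x| ≤
          ((x0 d)⁻¹ • h.Nf v v + (x0 d + 1) • h.Nf z z) t x := fun x => by
        have := h.abs_Nf_add_sub_le ht' x v z (inv_pos.2 hx)
        rwa [inv_inv, ← e3] at this
      rw [← I_sub, ← I_smul, ← I_smul, ← I_add, abs_le, ← I_neg]
      exact ⟨I_mono fun x => (abs_le.1 (f1 x)).1, I_mono fun x => (abs_le.1 (f1 x)).2⟩
    have e5 : I t (h.Nf z z) ≤ 9 * cG N K ^ 2 * (d.kappa * I t (Gd z)) := by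
      rw [← I_smul, ← I_smul]
      exact I_mono fun x => h.Nf_le ht' x z
    have e6 : 0 ≤ 9 * cG N K ^ 2 * (d.kappa * I t (Gd z)) :=
      mul_nonneg (by positivity) (mul_nonneg h.kappa_pos.le (I_Gd_nonneg _ _))
    have e7 := mul_le_mul_of_nonneg_left e5 (by linarith : 0 ≤ x0 d + 1)
    have e8 := mul_le_mul_of_nonneg_left e1 (inv_pos.2 hx).le
    have e9 := mul_le_mul_of_nonneg_right hx1 e6
    have e10 := abs_sub_le (I t (h.Nf ρ ρ)) (I t (h.Nf v v)) (I t (h.Qb r r))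
    simp only [hδ]
    linarith
  have b2 : ∫ t in (0:ℝ)..d.T, |δ t| ≤ (2 * C2 * CE + 18 * cG N K ^ 2 * C1) * ((x0 d)⁻¹ * D) := by
    have h1 := intervalIntegral_le_lin hc.abs (h.continuous_tau_inv_I (h.esum r (N + 1))) cz
      h.T_pos.le b1
    rw [intervalIntegral.integral_const_mul d.kappa] at h1
    refine h1.trans ?_
    calc _ ≤ 2 * C2 * (x0 d)⁻¹ * (CE * D) +
          18 * cG N K ^ 2 * x0 d * (C1 * ((x0 d ^ 2)⁻¹ * D)) := by gcongr
      _ = _ := by field_simp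
  have hB : 0 ≤ (2 * C2 * CE + 18 * cG N K ^ 2 * C1) * ((x0 d)⁻¹ * D) := by positivity
  constructor
  · intro t ht
    -- The energies differ in time exactly by the difference of the dissipations, so one bound on `∫
    -- |δ|` serves both claims.
    have hd : ∀ s ∈ Ioo 0 d.T, I s (dt (ρ ^ 2 - r ^ 2)) = -(2 * δ s) := fun s hs => by
      have hs' := Ioo_subset_Icc_self hs
      rw [map_sub, I_sub, h.I_dt_sq hs', h.I_dt_sq hs', hρ s hs', hr.weak hs', Qt_self]
      simp only [hδ]
      ring
    have h0 : I 0 (ρ ^ 2 - r ^ 2) = 0 := by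
      rw [I_sub, sub_eq_zero]
      exact I_congr fun x => by rw [pow_apply, pow_apply, hρ0, hr0]
    have c2 : Continuous fun s => 2 * |δ s| := continuous_const.mul hc.abs
    have h1 := I_sub_le_integral (f := ρ ^ 2 - r ^ 2) c2
      (fun s hs => by rw [hd s hs]; linarith [neg_le_abs (δ s)]) ht
    have h2 := I_sub_le_integral (f := -(ρ ^ 2 - r ^ 2)) c2
      (fun s hs => by rw [map_neg, I_neg, hd s hs]; linarith [le_abs_self (δ s)]) ht
    have h3 := intervalIntegral_mono_right c2 ht fun s _ => by positivity
    simp only [I_neg, h0, intervalIntegral.integral_const_mul] at h1 h2 h3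
    rw [← I_sub, abs_le]
    constructor <;> linarith
  · rw [← intervalIntegral.integral_sub ((continuous_I _).intervalIntegrable _ _)
      ((continuous_I _).intervalIntegrable _ _)]
    have := intervalIntegral.abs_integral_le_integral_abs (μ := volume) (f := δ) h.T_pos.le
    linarith

theorem Qb_add_right (f g g' : PF) : h.Qb f (g + g') = h.Qb f g + h.Qb f g' := by
  simp only [Qb, map_add, mul_add, Finset.sum_add_distrib]

theorem Qb_sub_right (f g g' : PF) : h.Qb f (g - g') = h.Qb f g - h.Qb f g' := by
  rw [eq_sub_iff_add_eq, ← Qb_add_right, sub_add_cancel]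

/-- `Q ≤ Q R = ν ≤ λ`. Bounded `λ` therefore makes `κ̄` comparable to `κ`. -/
theorem Q_le_lam {t : ℝ} (ht : t ∈ Icc 0 d.T) (x : E3) : h.Q t x ≤ d.lam := by
  have h1 := h.one_le_R ht x
  have h2 := h.one_le_Q t x
  refine le_trans ?_ h.nu_le_lam
  rw [← h.Q_mul_R t x]
  nlinarith

theorem abs_Qb_le {t : ℝ} {x : E3} (hg : h.Good t x) (hN : 1 ≤ N) (f g : PF) :
    |h.Qb f g t x| ≤ 9 * cA M N K * (d.kappa * h.Q t x ^ 2 *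
      (Real.sqrt (Gd f t x) * Real.sqrt (Gd g t x))) := by
  have hA := h.cA_nonneg
  have hκ := h.kb_pos t x
  rw [Qb, PF.sum_apply, h.Q_sq]
  refine (abs_sum_fin_le (B := 3 * (cA M N K * h.kb t x * Real.sqrt (Gd f t x) *
    Real.sqrt (Gd g t x))) fun l => ?_).trans_eq (by ring)
  rw [PF.sum_apply]
  refine abs_sum_fin_le fun m => ?_
  rw [mul_apply, mul_apply, abs_mul, abs_mul]
  have h1 := (h.bd_Ab hN hg l m).abs_le
  have h2 := abs_dx_le_sqrt f l t x
  have h3 := abs_dx_le_sqrt g m t x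
  gcongr

theorem abs_Nf_le {t : ℝ} (ht : t ∈ Icc 0 d.T) (x : E3) (f g : PF) :
    |h.Nf f g t x| ≤ 27 * cG N K ^ 2 * (d.kappa *
      (Real.sqrt (Gd f t x) * Real.sqrt (Gd g t x))) := by
  have hG := h.cG_nonneg
  have hκ := h.kappa_pos
  have h1 : ∀ i, |(d.kappa • (h.ηt i * ∑ p, h.di i p f * h.di i p g)) t x| ≤
      h.ηt i t x * (27 * cG N K ^ 2 * (d.kappa *
        (Real.sqrt (Gd f t x) * Real.sqrt (Gd g t x)))) := fun i => by
    have h0 : 0 ≤ h.ηt i t x := h.etat_nonneg i t ht x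
    rw [PF.smul_apply, mul_apply, abs_mul, abs_mul, abs_of_pos hκ, abs_of_nonneg h0]
    by_cases hi : h.ηt i t x = 0
    · rw [hi]; simp
    · have h2 : |(∑ p, h.di i p f * h.di i p g) t x| ≤
          3 * (3 * (cG N K * Real.sqrt (Gd f t x)) * (3 * (cG N K * Real.sqrt (Gd g t x)))) := by
        rw [PF.sum_apply]
        refine abs_sum_fin_le fun p => ?_
        rw [mul_apply, abs_mul]
        exact mul_le_mul (h.abs_di_le ht hi (fun l => abs_dx_le_sqrt f l t x) p)
          (h.abs_di_le ht hi (fun l => abs_dx_le_sqrt g l t x) p) (abs_nonneg _) (by positivity)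
      calc _ ≤ d.kappa * (h.ηt i t x * (3 * (3 * (cG N K * Real.sqrt (Gd f t x)) *
            (3 * (cG N K * Real.sqrt (Gd g t x)))))) := by gcongr
        _ = _ := by ring
  rw [Nf, PF.sum_apply]
  refine (Finset.abs_sum_le_sum_abs _ _).trans ((Finset.sum_le_sum fun i _ => h1 i).trans_eq ?_)
  have h2 : ∑ i, h.ηt i t x = 1 := h.etat_sum t ht x
  rw [← Finset.sum_mul, h2, one_mul]

omit h in
theorem exists_abs_Qt_le (M : Mikado) (hK : 1 ≤ K) : ∃ C, 0 ≤ C ∧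
    ∀ (n : ℕ) (d : Data n) (h : d.Assumptions M N K) (f g : PF) (t : ℝ) (x : E3), h.Good t x →
      |h.Qt f g t x| ≤ C * (d.kappa * h.Q t x *
        (Real.sqrt (Gd f t x) * Real.sqrt (Gd g t x))) := by
  obtain ⟨B, hB0, hB⟩ := M.exists_bound
  have hK0 : 0 ≤ K := by linarith
  have hG : 0 ≤ cG N K := by rw [cG]; positivity
  refine ⟨(9 * cG N K + M.Λ.card * (K * (18 * B ^ 2 * cG N K))) * (3 * cG N K) + 27 * cG N K ^ 2,
    by positivity, fun n d h f g t x hg => ?_⟩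
  have ht := Ioo_subset_Icc_self hg.mem
  have hκ := h.kappa_pos
  have hQ := h.one_le_Q t x
  have hQ0 : 0 ≤ h.Q t x := by linarith
  by_cases hi : ∃ i, h.η i t x ≠ 0
  · obtain ⟨i, hi⟩ := hi
    rw [h.Qt_apply_of_ne hg hi]
    refine (h.abs_bilinear_le hg hi hB0 hB (fun l => abs_dx_le_sqrt f l t x)
      (h.abs_di_le ht (hg.etat_ne hi) fun l => abs_dx_le_sqrt g l t x)).trans ?_
    rw [add_mul]
    have h0 : 0 ≤ 27 * cG N K ^ 2 * (d.kappa * h.Q t x *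
        (Real.sqrt (Gd f t x) * Real.sqrt (Gd g t x))) := by positivity
    linarith
  · push Not at hi
    have h1 : h.Qt f g t x = h.Nf f g t x := by
      rw [Qt_eq, PF.add_apply, add_eq_left, PF.sum_apply]
      refine Finset.sum_eq_zero fun i _ => ?_
      have h2 : d.eta i t x = 0 := hi i
      rw [PF.smul_apply, mul_apply, q_apply, h2]
      simp
    rw [h1, add_mul]
    refine le_trans ((h.abs_Nf_le ht x f g).trans ?_) (le_add_of_nonneg_left (by positivity))
    have := le_mul_of_one_le_right hκ.le hQ
    gcongr

omit h in
/-- When the wave number is bounded, the gradient of the difference of the solutions is controlled by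
the gradient of each of them. -/
theorem exists_comparison (M : Mikado) (hN : 1 ≤ N) (hK : 1 ≤ K) {L : ℝ} (hL : 0 ≤ L) : ∃ C, 0 ≤ C ∧
    ∀ (n : ℕ) (d : Data n) (h : d.Assumptions M N K) (ρin : E3 → ℝ) (ρ r : PF), d.lam ≤ L →
      h.IsOsc ρ → h.IsHom r → ρ 0 = ρin → r 0 = ρin →
      d.kappa * (∫ t in (0:ℝ)..d.T, I t (Gd (ρ - r))) ≤ C * (d.kappa * ∫ t in (0:ℝ)..d.T, I t (Gd r)) ∧
      d.kappa * (∫ t in (0:ℝ)..d.T, I t (Gd (ρ - r))) ≤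
        C * (d.kappa * ∫ t in (0:ℝ)..d.T, I t (Gd ρ)) := by
  obtain ⟨C1, hC1, H1⟩ := exists_abs_Qt_le (N := N) M hK
  have hK0 : 0 ≤ K := by linarith
  set c := C1 * L + 9 * |cA M N K| * L ^ 2 with hc
  have hc0 : 0 ≤ c := by positivity
  set a := 9 * (K * K) with ha
  have ha2 : 2 ≤ a := by nlinarith
  have ha0 : 0 < a := by linarith
  refine ⟨a ^ 2 * c ^ 2, by positivity, fun n d h ρin ρ r hlam hρ hr hρ0 hr0 => ?_⟩
  have hκ := h.kappa_pos
  set f := ρ - r with hf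
  -- The weight `1/(2a)` takes half of the coercivity constant `1/a`, which is valid for both forms
  -- since `a ≥ 2`.
  have hcross : ∀ (X g : PF), (∀ t x, h.Good t x → |X t x| ≤ |h.Qt f g t x| + |h.Qb f g t x|) →
      ∀ t ∈ Ioo 0 d.T, I t X ≤ 1 / (2 * a) * (d.kappa * I t (Gd f)) +
        a / 2 * c ^ 2 * (d.kappa * I t (Gd g)) := fun X g hX t ht => by
    simp only [← I_smul, ← I_add]
    refine h.I_le_of_good (fun t x hg => ?_) ht
    have ht' := Ioo_subset_Icc_self hg.mem
    have hQ := (h.Q_le_lam ht' x).trans hlam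
    have hQ1 := h.one_le_Q t x
    have e1 := Real.sq_sqrt (Gd_nonneg f t x)
    have e2 := Real.sq_sqrt (Gd_nonneg g t x)
    have b1 := H1 n d h f g t x hg
    have b2 := h.abs_Qb_le hg hN f g
    rw [← abs_of_nonneg h.cA_nonneg] at b2
    simp only [PF.add_apply, PF.smul_apply]
    rw [← e1, ← e2]
    set y := Real.sqrt (Gd f t x)
    set w := Real.sqrt (Gd g t x)
    have hyw : 0 ≤ y * w := by positivity
    have b3 : |X t x| ≤ c * (d.kappa * (y * w)) := by
      refine (hX t x hg).trans ?_
      calc _ ≤ C1 * (d.kappa * L * (y * w)) + 9 * |cA M N K| * (d.kappa * L ^ 2 * (y * w)) := by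
            refine add_le_add (b1.trans ?_) (b2.trans ?_) <;> gcongr
        _ = _ := by rw [hc]; ring
    refine (le_abs_self _).trans (b3.trans ?_)
    have b4 : 1 / (2 * a) * (d.kappa * y ^ 2) + a / 2 * c ^ 2 * (d.kappa * w ^ 2) -
        c * (d.kappa * (y * w)) = d.kappa * (1 / (2 * a)) * (y - a * c * w) ^ 2 := by
      field_simp; ring
    have b5 : 0 ≤ d.kappa * (1 / (2 * a)) * (y - a * c * w) ^ 2 := by positivity
    linarith
  have hmain : ∀ g : PF, (∀ t ∈ Ioo 0 d.T, I t (f * h.Dt f) ≤ -(1 / (2 * a) * (d.kappa * I t (Gd f))) +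
      a / 2 * c ^ 2 * (d.kappa * I t (Gd g))) →
      d.kappa * (∫ t in (0:ℝ)..d.T, I t (Gd f)) ≤
        a ^ 2 * c ^ 2 * (d.kappa * ∫ t in (0:ℝ)..d.T, I t (Gd g)) := fun g hg => by
    have cf : Continuous fun t => d.kappa * I t (Gd f) := continuous_const.mul (continuous_I _)
    have cg : Continuous fun t => d.kappa * I t (Gd g) := continuous_const.mul (continuous_I _)
    have h1 := I_sub_le_integral (T := d.T) (f := f ^ 2)
      (φ := fun t => -(1 / a * (d.kappa * I t (Gd f))) + a * c ^ 2 * (d.kappa * I t (Gd g)))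
      (by fun_prop) (fun t ht => by
        rw [h.I_dt_sq (Ioo_subset_Icc_self ht)]
        have := hg t ht
        have e : 1 / (2 * a) = 1 / a / 2 := by field_simp
        rw [e] at this
        linarith) ⟨h.T_pos.le, le_rfl⟩
    rw [intervalIntegral_lin cf cg, intervalIntegral.integral_const_mul,
      intervalIntegral.integral_const_mul] at h1
    have h0 : I 0 (f ^ 2) = 0 := by
      have : I 0 (f ^ 2) = I 0 0 := I_congr fun x => by
        rw [pow_apply, hf, PF.sub_apply, hρ0, hr0, sub_self, PF.zero_apply]; norm_num
      rw [this, I_zero]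
    have h2 := I_sq_nonneg f d.T
    have h3 : 1 / a * (d.kappa * ∫ t in (0:ℝ)..d.T, I t (Gd f)) ≤
        a * c ^ 2 * (d.kappa * ∫ t in (0:ℝ)..d.T, I t (Gd g)) := by linarith
    have h4 := mul_le_mul_of_nonneg_left h3 ha0.le
    rw [← mul_assoc, mul_one_div_cancel ha0.ne', one_mul] at h4
    exact h4.trans_eq (by ring)
  have hDf : ∀ t ∈ Ioo 0 d.T, I t (f * h.Dt f) = -I t (h.Qt f ρ) + I t (h.Qb f r) := fun t ht => by
    have ht' := Ioo_subset_Icc_self ht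
    rw [hf, map_sub, mul_sub, I_sub, ← hf, hρ t ht', hr.weak ht']
    ring
  have half : ∀ X, X / a = 1 / (2 * a) * X + 1 / (2 * a) * X := fun X => by field_simp; ring
  constructor
  · refine hmain r fun t ht => ?_
    have e : ρ = f + r := by rw [hf]; ring
    have b1 := hcross (h.Qb f r - h.Qt f r) r (fun t x _ => by
      rw [PF.sub_apply, add_comm]; exact abs_sub _ _) t ht
    have b2 := h.I_Nf_ge (Ioo_subset_Icc_self ht) f
    rw [half] at b2
    rw [hDf t ht, e, Qt_add_right, I_add, Qt_self]
    rw [I_sub] at b1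
    linarith
  · refine hmain ρ fun t ht => ?_
    have e : r = ρ - f := by rw [hf]; ring
    have b1 := hcross (h.Qb f ρ - h.Qt f ρ) ρ (fun t x _ => by
      rw [PF.sub_apply, add_comm]; exact abs_sub _ _) t ht
    have b2 : d.kappa * I t (Gd f) / a ≤ I t (h.Qb f f) := by
      have h1 : d.kappa * I t (Gd f) * (1 / 2) ≤ I t (h.Qb f f) := by
        rw [mul_comm, ← I_smul, ← I_smul]
        refine I_mono fun x => le_trans ?_ (h.Qb_self (Ioo_subset_Icc_self ht) x f).1
        have := h.kappa_le_kb t x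
        have := Gd_nonneg f t x
        simp only [PF.smul_apply]
        gcongr
      refine le_trans ?_ h1
      rw [div_eq_mul_one_div]
      have := mul_nonneg hκ.le (I_Gd_nonneg f t)
      gcongr
    rw [half] at b2
    have b3 : h.Qb f r = h.Qb f ρ - h.Qb f f := by rw [← Qb_sub_right, ← e]
    rw [hDf t ht, b3, I_sub]
    rw [I_sub] at b1
    linarith

end Data.Assumptions

/-! ### Comparison of the dissipations and conclusion -/

theorem PF.l2sq_eq (f : PF) (t : ℝ) : l2sq (fun x => f t x) = PF.I t (f ^ 2) := by
  refine setIntegral_congr_fun (measurableSet_cube 1 one_pos) fun x _ => ?_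
  simp only [Real.norm_eq_abs, sq_abs]
  rfl

namespace Data.Assumptions

open PF

variable {n : ℕ} {M : Mikado} {N : ℕ} {K : ℝ} {d : Data n} (h : d.Assumptions M N K)
include h

theorem isOsc {ρin : E3 → ℝ} {ρ : ℝ → E3 → ℝ} (hρ : IsSolution d.T d.u (d.Atilde M) ρin ρ) :
    h.IsOsc ⟨ρ, hρ.field⟩ := fun _ ht f => h.weak_rho hρ ht f

theorem dissip_eq {F : ℝ → E3 → ℝ} {f : PF} (hF : ∀ t ∈ Icc 0 d.T, ∀ x, F t x = f t x) :
    d.dissip F = d.kappa * ∫ t in (0:ℝ)..d.T, I t (Gd f) := by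
  rw [Data.dissip]
  congr 1
  refine intervalIntegral.integral_congr fun t ht => ?_
  rw [uIcc_of_le h.T_pos.le] at ht
  have e : F t = f t := funext fun x => hF t ht x
  refine setIntegral_congr_fun (measurableSet_cube 1 one_pos) fun x _ => ?_
  show ‖gradient (F t) x‖ ^ 2 = Gd f t x
  rw [e, Gd_apply]
  exact norm_gradient_sq f t x

theorem inv_x0_le : (x0 d)⁻¹ ≤ d.lam ^ (-(2 * d.gamma)) := by
  have h1 := h.inv_x0_sq_le
  have h2 : d.lam ^ (-(4 * d.gamma)) = (d.lam ^ (-(2 * d.gamma))) ^ 2 := by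
    rw [← Real.rpow_natCast, ← Real.rpow_mul h.lam_pos.le]
    congr 1
    push_cast
    ring
  rw [h2, ← inv_pow] at h1
  exact abs_le_of_sq_le_sq h1 (Real.rpow_nonneg h.lam_pos.le _) |>.trans' (le_abs_self _)

theorem inv_lam_kappa_tau : 1 / (d.lam ^ 2 * d.kappa * d.tau) = (x0 d ^ 2)⁻¹ := by
  rw [h.x0_sq, one_div]
  ring

theorem inv_lam_sqrt_kappa_tau :
    1 / (d.lam * d.kappa ^ (1 / 2 : ℝ) * d.tau ^ (1 / 2 : ℝ)) = (x0 d)⁻¹ := by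
  rw [x0, ← Real.sqrt_eq_rpow, ← Real.sqrt_eq_rpow, Real.sqrt_mul h.tau_pos.le, one_div, mul_assoc,
    mul_comm (Real.sqrt d.kappa)]

/-- The bound on the initial part of the norm of the homogenized solution by the dissipation. -/
theorem D_le {ρin : E3 → ℝ} {r : PF} (hr : r 0 = ρin) {dp : ℝ}
    (hin : ∀ j : ℕ, 1 ≤ j → j ≤ N →
      l2sq (iteratedFDeriv ℝ j ρin) ≤ K * d.lam ^ (2 * (j : ℝ) / d.b) * dp) :
    d.D ρin (fun t x => r t x) N ≤ d.wdissip (fun t x => r t x) + N * K * dp := by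
  have h0 : (0:ℝ) ∈ Icc 0 d.T := ⟨le_rfl, h.T_pos.le⟩
  have hK := h.K_pos
  have hl := h.lam_pos
  refine add_le_add le_rfl ((Finset.sum_le_card_nsmul _ _ (K * dp) fun j hj => ?_).trans_eq (by
    simp [mul_assoc]))
  obtain ⟨hj1, hjN⟩ := Finset.mem_Icc.1 hj
  set l := d.lam ^ (2 / d.b) with hl_def
  have hl0 : 0 < l := Real.rpow_pos_of_pos hl _
  have hlj : d.lam ^ (2 * (j : ℝ) / d.b) = l ^ j := by
    rw [hl_def, ← Real.rpow_natCast, ← Real.rpow_mul hl.le]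
    congr 1
    ring
  have hc : Continuous fun x => ‖iteratedFDeriv ℝ j ρin x‖ ^ 2 := by
    have h2 : Continuous (iteratedFDeriv ℝ j ρin) := by
      rw [← hr]
      exact (r.contDiff_slice 0).continuous_iteratedFDeriv (by exact_mod_cast le_top)
    fun_prop
  have hk : Continuous fun x => d.kbar 0 x ^ j := by
    have h1 : d.kbar 0 = fun x => h.kb 0 x := funext fun x => (h.kb_eq h0 x).symm
    have h3 := (h.kb).continuous_slice 0
    rw [h1]
    fun_prop
  have h1 : d.tau ^ j * ∫ x in cube 1, d.kbar 0 x ^ j * ‖iteratedFDeriv ℝ j ρin x‖ ^ 2 ≤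
      (l ^ j)⁻¹ * l2sq (iteratedFDeriv ℝ j ρin) := by
    rw [l2sq, ← integral_const_mul, ← integral_const_mul]
    refine integral_mono ((integrableOn_cube_of_continuous one_pos (hk.mul hc)).const_mul _)
      ((integrableOn_cube_of_continuous one_pos hc).const_mul _) fun x => ?_
    have h2 := h.tau_kbar_lam 0 h0 x
    have h3 : d.lam ^ (-(2 * d.gamma)) ≤ 1 := Real.rpow_le_one_of_one_le_of_nonpos h.one_le_lam
      (by have := h.gamma_pos; linarith)
    have h4 : 0 ≤ d.tau * d.kbar 0 x := by
      rw [← h.kb_eq h0]; exact (mul_pos h.tau_pos (h.kb_pos 0 x)).le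
    -- By `tau_kbar_lam` the weight `(τ κ̄)^j` compensates the growth `λ^{2j/b}` of the initial
    -- derivatives exactly.
    have h5 : d.tau * d.kbar 0 x ≤ l⁻¹ := by
      rw [← one_div, le_div_iff₀ hl0]; exact h2.trans h3
    simp only
    rw [← mul_assoc, ← mul_pow, ← inv_pow]
    gcongr
  refine h1.trans ?_
  rw [inv_mul_le_iff₀ (by positivity)]
  refine (hin j hj1 hjN).trans_eq ?_
  rw [hlj]
  ring

theorem kappa_integral_Gd_le_wdissip (r : PF) :
    d.kappa * (∫ t in (0:ℝ)..d.T, I t (Gd r)) ≤ d.wdissip (fun t x => r t x) := by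
  rw [wdissip_eq h, ← intervalIntegral.integral_const_mul]
  refine intervalIntegral.integral_mono_on (μ := volume) h.T_pos.le
    ((continuous_const.mul (continuous_I (Gd r))).intervalIntegrable _ _)
    ((continuous_I _).intervalIntegrable _ _) fun t ht => ?_
  rw [← I_smul]
  exact I_mono fun x => mul_le_mul_of_nonneg_right (h.kappa_le_kb t x) (Gd_nonneg _ _ _)

theorem wdissip_le_kappa_integral_Gd (r : PF) {L : ℝ} (hL : d.lam ≤ L) :
    d.wdissip (fun t x => r t x) ≤ L ^ 2 * (d.kappa * ∫ t in (0:ℝ)..d.T, I t (Gd r)) := by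
  rw [wdissip_eq h, ← intervalIntegral.integral_const_mul, ← intervalIntegral.integral_const_mul]
  refine intervalIntegral.integral_mono_on (μ := volume) h.T_pos.le
    ((continuous_I _).intervalIntegrable _ _)
    ((continuous_const.mul (continuous_const.mul (continuous_I (Gd r)))).intervalIntegrable _ _)
    fun t ht => ?_
  rw [← I_smul, ← I_smul]
  refine I_mono fun x => ?_
  have hκ := h.kappa_pos
  have h1 := (h.Q_le_lam ht x).trans hL
  have h2 := h.one_le_Q t x
  have h3 := Gd_nonneg r t x
  rw [PF.smul_apply, PF.smul_apply, mul_apply, ← h.Q_sq]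
  calc _ ≤ d.kappa * L ^ 2 * Gd r t x := by gcongr
    _ = _ := by ring

theorem kappa_integral_Gd_add_le (f g : PF) :
    d.kappa * (∫ t in (0:ℝ)..d.T, I t (Gd (f + g))) ≤
      2 * (d.kappa * ∫ t in (0:ℝ)..d.T, I t (Gd f)) + 2 * (d.kappa * ∫ t in (0:ℝ)..d.T, I t (Gd g)) := by
  have h1 := intervalIntegral_le_lin (continuous_I (Gd (f + g))) (continuous_I (Gd f))
    (continuous_I (Gd g)) h.T_pos.le fun t _ => I_Gd_add_le f g t
  have h2 := mul_le_mul_of_nonneg_left h1 h.kappa_pos.le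
  linarith

omit h in
/-- The dissipations of the two solutions are comparable. -/
theorem exists_dissip_comparison (M : Mikado) (hN : 2 ≤ N) (hK : 1 ≤ K) : ∃ A, 0 ≤ A ∧
    ∀ (n : ℕ) (d : Data n) (h : d.Assumptions M N K) (ρin : E3 → ℝ) (ρ r : PF), h.IsOsc ρ →
      h.IsHom r → ρ 0 = ρin → r 0 = ρin →
      d.D ρin (fun t x => r t x) N ≤ d.wdissip (fun t x => r t x) +
        N * K * (d.kappa * ∫ t in (0:ℝ)..d.T, I t (Gd ρ)) →
      d.kappa * (∫ t in (0:ℝ)..d.T, I t (Gd ρ)) ≤ A * d.wdissip (fun t x => r t x) ∧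
      d.wdissip (fun t x => r t x) ≤ A * (d.kappa * ∫ t in (0:ℝ)..d.T, I t (Gd ρ)) := by
  obtain ⟨C, hC, H⟩ := exists_energy_difference_bound M hN hK
  have hK0 : 0 < K := by linarith
  -- Above this threshold the error terms `C x0⁻¹ D` can be absorbed with a factor one half in both
  -- directions of the comparison.
  set X := 1 + 18 * (K * K) * C * (N * K) + 4 * C with hX
  have hX0 : 0 ≤ X := by positivity
  set L := K * X ^ N with hL
  have hL0 : 0 ≤ L := by positivity
  obtain ⟨c, hc, Hc⟩ := exists_comparison (N := N) M (by omega) hK hL0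
  refine ⟨18 * (K * K) * (2 + C) + 4 * (9 * cG N K ^ 2 + C * (N * K)) + (2 * c + 2) +
    L ^ 2 * (2 * c + 2), by positivity, fun n d h ρin ρ r hρ hr hρ0 hr0 hD => ?_⟩
  have hκ := h.kappa_pos
  have hw0 := h.wdissip_nonneg r
  have hp0 : 0 ≤ d.kappa * ∫ t in (0:ℝ)..d.T, I t (Gd ρ) :=
    mul_nonneg hκ.le (intervalIntegral.integral_nonneg h.T_pos.le fun t _ => I_Gd_nonneg ρ t)
  have hx := h.x0_pos
  set wd := d.wdissip (fun t x => r t x) with hwd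
  set dp := d.kappa * ∫ t in (0:ℝ)..d.T, I t (Gd ρ) with hdp
  have q1 : 0 ≤ 18 * (K * K) * (2 + C) := by positivity
  have q2 : 0 ≤ 4 * (9 * cG N K ^ 2 + C * (N * K)) := by positivity
  have q3 : 0 ≤ 2 * c + 2 := by positivity
  have q4 : 0 ≤ L ^ 2 * (2 * c + 2) := by positivity
  suffices h1 : (dp ≤ (18 * (K * K) * (2 + C)) * wd ∧
      wd ≤ 4 * (9 * cG N K ^ 2 + C * (N * K)) * dp) ∨
      (dp ≤ (2 * c + 2) * wd ∧ wd ≤ L ^ 2 * (2 * c + 2) * dp) by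
    rcases h1 with ⟨h1, h2⟩ | ⟨h1, h2⟩ <;> constructor <;> nlinarith
  rcases le_or_gt X (x0 d) with hXx | hXx
  · left
    have c1 : Continuous fun t => d.kappa * I t (Gd ρ) := continuous_const.mul (continuous_I _)
    have z : Continuous fun _ : ℝ => (0:ℝ) := continuous_const
    have b1 : dp ≤ 9 * (K * K) * ∫ t in (0:ℝ)..d.T, I t (h.Nf ρ ρ) := by
      have := intervalIntegral_le_lin (a := 9 * (K * K)) (b := 0) c1 (continuous_I (h.Nf ρ ρ)) z
        h.T_pos.le fun t ht => by
          rw [mul_zero, add_zero, ← I_smul, ← I_smul]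
          exact I_mono fun x => h.kappa_Gd_le_Nf (Ioo_subset_Icc_self ht) x ρ
      rwa [zero_mul, add_zero, intervalIntegral.integral_const_mul] at this
    have b2 : ∫ t in (0:ℝ)..d.T, I t (h.Nf ρ ρ) ≤ 9 * cG N K ^ 2 * dp := by
      have := intervalIntegral_le_lin (a := 9 * cG N K ^ 2) (b := 0) (continuous_I (h.Nf ρ ρ)) c1 z
        h.T_pos.le fun t ht => by
          rw [mul_zero, add_zero, ← I_smul, ← I_smul]
          exact I_mono fun x => h.Nf_le (Ioo_subset_Icc_self ht) x ρ
      rwa [zero_mul, add_zero, intervalIntegral.integral_const_mul] at this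
    have b3 : ∫ t in (0:ℝ)..d.T, I t (h.Qb r r) ≤ 2 * wd := by
      rw [hwd, wdissip_eq h]
      have := intervalIntegral_le_lin (a := 2) (b := 0) (continuous_I (h.Qb r r))
        (continuous_I (h.kb * Gd r)) z h.T_pos.le fun t ht => by
          rw [mul_zero, add_zero, ← I_smul]
          exact I_mono fun x => (h.Qb_self (Ioo_subset_Icc_self ht) x r).2
      rwa [zero_mul, add_zero] at this
    have b4 : wd ≤ 2 * ∫ t in (0:ℝ)..d.T, I t (h.Qb r r) := by
      rw [hwd, wdissip_eq h]
      have := intervalIntegral_le_lin (a := 2) (b := 0) (continuous_I (h.kb * Gd r))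
        (continuous_I (h.Qb r r)) z h.T_pos.le fun t ht => by
          rw [mul_zero, add_zero, ← I_smul]
          refine I_mono fun x => ?_
          have := (h.Qb_self (Ioo_subset_Icc_self ht) x r).1
          rw [PF.smul_apply, mul_apply]
          linarith
      rwa [zero_mul, add_zero] at this
    have b5 := abs_le.1 (H n d h ρin ρ r hρ hr hρ0 hr0).2
    have b6 : C * ((x0 d)⁻¹ * d.D ρin (fun t x => r t x) N) ≤
        C * (x0 d)⁻¹ * (wd + N * K * dp) := by
      rw [mul_assoc]; gcongr
    have hi : (x0 d)⁻¹ ≤ 1 := inv_le_one_of_one_le₀ h.one_le_x0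
    have hXi : X * (x0 d)⁻¹ ≤ 1 := by
      rw [← div_eq_mul_inv, div_le_one hx]; exact hXx
    have hi0 := inv_pos.2 hx
    have p1 : 0 ≤ 4 * C * (x0 d)⁻¹ := by positivity
    have p2 : 0 ≤ 18 * (K * K) * C * (N * K) * (x0 d)⁻¹ := by positivity
    have r1 : 18 * (K * K) * C * (N * K) * (x0 d)⁻¹ ≤ 1 := by rw [hX] at hXi; linarith
    have r2 : 4 * C * (x0 d)⁻¹ ≤ 1 := by rw [hX] at hXi; linarith
    have s1 := mul_le_mul_of_nonneg_right r1 hp0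
    have s2 := mul_le_mul_of_nonneg_right r2 hw0
    have s3 : C * (x0 d)⁻¹ * wd ≤ C * wd :=
      mul_le_mul_of_nonneg_right (mul_le_of_le_one_right hC hi) hw0
    have s4 : C * (x0 d)⁻¹ * (N * K * dp) ≤ C * (N * K * dp) :=
      mul_le_mul_of_nonneg_right (mul_le_of_le_one_right hC hi) (by positivity)
    constructor
    · have t1 : (∫ t in (0:ℝ)..d.T, I t (h.Nf ρ ρ)) ≤
          (2 + C) * wd + C * (x0 d)⁻¹ * (N * K * dp) := by linarith
      have t2 := mul_le_mul_of_nonneg_left t1 (by positivity : 0 ≤ 9 * (K * K))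
      linarith
    · linarith
  · right
    -- Now `x0 < X`, so `lam_le` bounds `λ` by `K X^N` and the elementary comparison applies.
    have hlam : d.lam ≤ L := h.lam_le.trans (by rw [hL]; gcongr)
    obtain ⟨d1, d2⟩ := Hc n d h ρin ρ r hlam hρ hr hρ0 hr0
    have e1 := h.kappa_integral_Gd_add_le (ρ - r) r
    have e2 := h.kappa_integral_Gd_add_le (-(ρ - r)) ρ
    rw [sub_add_cancel] at e1
    rw [Gd_neg, neg_sub, sub_add_cancel] at e2
    have e3 := h.kappa_integral_Gd_le_wdissip r
    have e4 := h.wdissip_le_kappa_integral_Gd r hlam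
    constructor
    · have := mul_le_mul_of_nonneg_left e3 q3
      linarith
    · refine e4.trans ?_
      rw [mul_assoc]
      refine mul_le_mul_of_nonneg_left ?_ (by positivity)
      linarith

end Data.Assumptions

end MikadoHom

end

theorem proposition5p1 (M : MikadoHom.Mikado) (N : ℕ) (hN : 3 ≤ N) (K : ℝ) (hK : 1 ≤ K) :
    ∃ C : ℝ, 0 < C ∧
      ∀ (n : ℕ) (d : MikadoHom.Data n), d.Assumptions M N K →
      ∀ (ρin : MikadoHom.E3 → ℝ) (ρ ρbar : ℝ → MikadoHom.E3 → ℝ),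
        MikadoHom.IsSolution d.T d.u (d.Atilde M) ρin ρ →
        MikadoHom.IsSolution d.T d.u (d.Abar M) ρin ρbar →
        -- the error of the two-scale expansion
        (∀ t ∈ Set.Icc 0 d.T,
          MikadoHom.l2sq (d.rhoTilde M ρ ρbar t) + d.dissip (d.rhoTilde M ρ ρbar) ≤
            C * (1 / (d.lam ^ 2 * d.kappa * d.tau)) * d.D ρin ρbar N) ∧
        -- closeness of the solutions
        (∀ t ∈ Set.Icc 0 d.T,
          MikadoHom.l2sq (fun x => ρ t x - ρbar t x) ≤
            C * (1 / (d.lam ^ 2 * d.kappa * d.tau)) * d.D ρin ρbar N) ∧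
        -- closeness of the energies
        (∀ t ∈ Set.Icc 0 d.T,
          |MikadoHom.l2sq (ρ t) - MikadoHom.l2sq (ρbar t)| ≤
            C * (1 / (d.lam * d.kappa ^ (1 / 2 : ℝ) * d.tau ^ (1 / 2 : ℝ)) +
              d.lam ^ (-(2 * d.gamma))) * d.D ρin ρbar N) ∧
        -- closeness of the energies for initial data with controlled derivatives
        ((∀ j : ℕ, 1 ≤ j → j ≤ N →
            MikadoHom.l2sq (iteratedFDeriv ℝ j ρin) ≤
              K * d.lam ^ (2 * (j : ℝ) / d.b) * d.dissip ρ) →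
          ∀ t ∈ Set.Icc 0 d.T,
            |MikadoHom.l2sq (ρ t) - MikadoHom.l2sq (ρbar t)| ≤
              C * d.lam ^ (-(2 * d.gamma)) * min (d.wdissip ρbar) (d.dissip ρ)) := by
  open MikadoHom MikadoHom.PF MikadoHom.Data.Assumptions in
  obtain ⟨C1, hC1, H1⟩ := exists_expansion_bound M (N := N) (by omega) hK
  obtain ⟨C3, hC3, H3⟩ := exists_energy_difference_bound M (N := N) (by omega) hK
  obtain ⟨A, hA, HA⟩ := exists_dissip_comparison M (N := N) (by omega) hK
  have hK0 : 0 ≤ K := by linarith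
  -- The first claim adds the norm and the dissipation, hence `2 * C1`; the last two constants
  -- belong to the two entries of the minimum.
  refine ⟨1 + 2 * C1 + C3 + C3 * (1 + N * K * A) + C3 * (A + N * K), by positivity,
    fun n d h ρin ρ ρbar hρ hρbar => ?_⟩
  set r : PF := ⟨ρbar, hρbar.field⟩
  set p : PF := ⟨ρ, hρ.field⟩
  have hosc : h.IsOsc p := h.isOsc hρ
  have hhom : h.IsHom r := h.isHom hρbar
  obtain ⟨G1, G2, G3⟩ := H1 n d h ρin p r hosc hhom hρ.init hρbar.init
  obtain ⟨F1, -⟩ := H3 n d h ρin p r hosc hhom hρ.init hρbar.init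
  have hD : 0 ≤ d.D ρin ρbar N := h.D_nonneg ρin r
  change ∀ t ∈ Set.Icc 0 d.T, I t ((p - r) ^ 2) ≤ C1 * ((x0 d ^ 2)⁻¹ * d.D ρin ρbar N) at G1
  change ∀ t ∈ Set.Icc 0 d.T, I t ((p - r - h.W r) ^ 2) ≤
    C1 * ((x0 d ^ 2)⁻¹ * d.D ρin ρbar N) at G2
  change d.kappa * (∫ t in (0:ℝ)..d.T, I t (Gd (p - r - h.W r))) ≤
    C1 * ((x0 d ^ 2)⁻¹ * d.D ρin ρbar N) at G3
  change ∀ t ∈ Set.Icc 0 d.T, |I t (p ^ 2) - I t (r ^ 2)| ≤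
    C3 * ((x0 d)⁻¹ * d.D ρin ρbar N) at F1
  have hx := h.x0_pos
  have e := h.inv_x0_le
  set ε := d.lam ^ (-(2 * d.gamma))
  have hε : 0 ≤ ε := (inv_pos.2 hx).le.trans e
  have hT : ∀ t ∈ Set.Icc 0 d.T, ∀ x, d.rhoTilde M ρ ρbar t x = (p - r - h.W r) t x :=
    fun t ht x => h.rhoTilde_eq hρ.field hρbar.field ht x
  have hX : 0 ≤ (x0 d ^ 2)⁻¹ * d.D ρin ρbar N := by positivity
  have hY : 0 ≤ (x0 d)⁻¹ * d.D ρin ρbar N := by positivity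
  have n1 : 0 ≤ C3 * (1 + N * K * A) := by positivity
  have n2 : 0 ≤ C3 * (A + N * K) := by positivity
  have hl : ∀ f : PF, ∀ t, l2sq (f t) = I t (f ^ 2) := fun f t => l2sq_eq f t
  rw [h.inv_lam_kappa_tau, h.inv_lam_sqrt_kappa_tau]
  refine ⟨fun t ht => ?_, fun t ht => ?_, fun t ht => ?_, fun hin t ht => ?_⟩
  · have e1 : d.rhoTilde M ρ ρbar t = (p - r - h.W r) t := funext fun x => hT t ht x
    rw [h.dissip_eq hT, e1, hl, mul_assoc]
    refine (add_le_add (G2 t ht) G3).trans ?_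
    rw [← add_mul]
    exact mul_le_mul_of_nonneg_right (by linarith) hX
  · rw [mul_assoc]
    refine ((hl (p - r) t).trans_le (G1 t ht)).trans ?_
    exact mul_le_mul_of_nonneg_right (by linarith) hX
  · refine ((congrArg abs (congrArg₂ (· - ·) (hl p t) (hl r t))).trans_le (F1 t ht)).trans ?_
    rw [mul_assoc]
    refine mul_le_mul (by linarith) ?_ hY (by positivity)
    exact mul_le_mul_of_nonneg_right (le_add_of_nonneg_right hε) hD
  · have ed : d.dissip ρ = d.kappa * ∫ t in (0:ℝ)..d.T, I t (Gd p) :=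
      h.dissip_eq fun t _ x => rfl
    have hDle := h.D_le (r := r) hρbar.init hin
    rw [ed] at hDle ⊢
    obtain ⟨c1, c2⟩ := HA n d h ρin p r hosc hhom hρ.init hρbar.init hDle
    change d.D ρin ρbar N ≤ d.wdissip ρbar + _ at hDle
    change _ ≤ A * d.wdissip ρbar at c1
    change d.wdissip ρbar ≤ _ at c2
    have w0 : 0 ≤ d.wdissip ρbar := h.wdissip_nonneg r
    set wd := d.wdissip ρbar
    set dp := d.kappa * ∫ t in (0:ℝ)..d.T, I t (Gd p)
    have p0 : 0 ≤ dp := mul_nonneg h.kappa_pos.le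
      (intervalIntegral.integral_nonneg h.T_pos.le fun t _ => I_Gd_nonneg p t)
    refine ((congrArg abs (congrArg₂ (· - ·) (hl p t) (hl r t))).trans_le (F1 t ht)).trans ?_
    have b1 : C3 * ((x0 d)⁻¹ * d.D ρin ρbar N) ≤ C3 * (ε * (wd + N * K * dp)) := by gcongr
    have k1 : C3 * (ε * (wd + N * K * dp)) ≤ C3 * (1 + N * K * A) * (ε * wd) := by
      calc _ ≤ C3 * (ε * (wd + N * K * (A * wd))) := by gcongr
        _ = _ := by ring
    have k2 : C3 * (ε * (wd + N * K * dp)) ≤ C3 * (A + N * K) * (ε * dp) := by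
      calc _ ≤ C3 * (ε * (A * dp + N * K * dp)) := by gcongr
        _ = _ := by ring
    have m1 : 0 ≤ (1 + 2 * C1 + C3 + C3 * (A + N * K)) * (ε * wd) := by positivity
    have m2 : 0 ≤ (1 + 2 * C1 + C3 + C3 * (1 + N * K * A)) * (ε * dp) := by positivity
    rw [mul_min_of_nonneg _ _ (by positivity)]
    exact le_min (by linarith) (by linarith)
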